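/- **Setting.** Let $C$ and $\Sigma$ be oriented smooth surfaces, $\Sigma$ connected, and $\pi:\Sigma\to C$ a branched cover of finite degree with simple ramification (locally $w\mapsto w$ or $w\mapsto w^2$, at most one ramification point in each fibre); $C'$ is $C$ minus the branch points. Let $\widetilde\Sigma$ be the bundle of tangent directions of $\Sigma$ and $\widetilde\Gamma=H_1(\widetilde\Sigma;\mathbb Z)/(2H)$, where $H$ is the class of the fibre; it is an extension of $\Gamma=H_1(\Sigma;\mathbb Z)$ by $\mathbb Z/2$. For $\gamma\in\Gamma$ the lift $\widetilde\gamma\in\widetilde\Gamma$ is obtained by writing $\gamma$ as a union of regular closed curves with transverse crossings, adding the classes of their tangent framing lifts, and adding $H$ once for each curve and once for each crossing. $\langle\,,\rangle$ is the intersection pairing on $\Gamma$. Charges of open paths are classes of relative 1-chains on $\widetilde\Sigma$, modulo $2H$. Formal variables $X_a$ satisfy $X_aX_b=X_{a+b}$ and $X_H=-1$, and generating functions are formal series in them with integer coefficients, whose exponents are well-ordered with respect to an additive real weight of the charges, each weight occurring finitely often. **Spectral networks.** A spectral network subordinate to $\pi$ consists of embedded streets on $C$ that end at branch points or at joints (or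 run off); a street of type $ij$ is lifted to the sheets $i$ and $j$ of $\pi$. A street may carry both a constituent one-way street of type $ij$ and, with the opposite orientation, one of type $ji$; it is two-way if both are present in the network. Each constituent of type $ij$ carries a generating function of charges of solitons that start on sheet $i$ and end on sheet $j$ over the given point of the street; it is parallel along the street. Write $\Upsilon(p)$ and $\Delta(p)$ for the generating functions of the constituents that agree and disagree with the orientation of $p$. At a joint, at which the streets lie on three sheets $1,2,3$ and the directions of the possible outgoing legs are, counterclockwise, $12,13,23,21,31,32$, let $\tau_{ij}$ and $\nu_{ij}$ be the generating functions of the constituents of type $ij$ running out of and into the joint. They satisfy $$\begin{aligned}\tau_{12}&=\nu_{12}+\eta\,\tau_{13}\nu_{32},&\tau_{21}&=\nu_{21}+\eta^{-1}\nu_{23}\tau_{31},\\ \tau_{23}&=\nu_{23}+\eta\,\tau_{21}\nu_{13},&\tau_{32}&=\nu_{32}+\eta^{-1}\nu_{31}\tau_{12},\\ \tau_{31}&=\nu_{31}+\eta\,\tau_{32}\nu_{21},&\tau_{13}&=\nu_{13}+\eta^{-1}\nu_{12}\tau_{23},\end{aligned}$$ where $\eta$ inserts a half-twist along the fibre of $\widetilde\Sigma\to\Sigma$,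 and a constituent running out of a joint is present exactly if one of the constituents, or pairs of constituents, on the right of its equation is. At most one two-way street emanates from a branch point, and on it the outgoing generating function is $X_a$ with $a$ the charge of the simpleton, the lift of the street through the ramification point. The street factor is $Q(p)=1+\Upsilon(p)\Delta(p)$, with the base point of the resulting closed charges forgotten. **Horses.** The standard picture in the plane $\mathbb C$ has four joints $\mathrm{bot}=-i$, $\mathrm{right}=1$, $\mathrm{left}=-1$, $\mathrm{top}=i$ and thirteen streets, all oriented upwards. Those of type 12 lie on lines of slope $1$: $a_1$ (a ray ending at bot), $a_2$ (bot to right), $a_3$ (a ray from right), $\overline{a_3}$ (a ray ending at left), $\overline{a_2}$ (left to top), $\overline{a_1}$ (a ray from top). Those of type 23 lie on lines of slope $-1$: $b_1$ (a ray ending at bot), $b_2$ (bot to left), $b_3$ (a ray from left), $\overline{b_3}$ (a ray ending at right), $\overline{b_2}$ (right to top), $\overline{b_1}$ (a ray from top). The street $c$, of type 13, is the segment from bot to top. A horse is the part of a spectral network in an open disk $U\subset C'$ together with an orientation preserving identification of $U$ with the plane that identifies some of its streets, with their joints and types, with the standard picture, such that every two-way street that meets $U$ is one of the thirteen horse streets,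 and $c$ is two-way. One-way background streets may be present; at joints with them horse streets continue straight. **Herds.** Let $m\ge 1$. An $m$-herd is a spectral network with open disks $U_1,\dots,U_m\subset C'$ that cover its two-way streets, with $U_l\cap U_k\neq\emptyset$ for $l\ne k$ iff $|l-k|=1$, such that each $U_l$ carries a horse (with streets $p^{(l)}$), and: * (sources) $a_1^{(1)},b_1^{(1)}$ start at, and $\overline{a_1}^{(m)},\overline{b_1}^{(m)}$ end at, four distinct branch points; no constituent of $\overline{a_3}^{(1)},\overline{b_3}^{(1)}$ runs upwards and none of $a_3^{(m)},b_3^{(m)}$ runs downwards; * (gluing) for $1\le l<m$: $a_1^{(l+1)}=a_3^{(l)}$, $b_1^{(l+1)}=b_3^{(l)}$, $\overline{a_1}^{(l)}=\overline{a_3}^{(l+1)}$, $\overline{b_1}^{(l)}=\overline{b_3}^{(l+1)}$; * (no holes) for $1\le l<m$ the loops formed by $\overline{a_2}^{(l)},\overline{b_1}^{(l)},a_2^{(l+1)},b_3^{(l)}$ and by $\overline{b_2}^{(l)},\overline{a_1}^{(l)},b_2^{(l+1)},a_3^{(l)}$ bound closed disks on $C'$ with disjoint interiors. **Proposition.** For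 every $m$-herd there is a formal series $P_m$ in the variables $X_\alpha$, $\alpha\in\widetilde\Gamma$, such that $Q(p)$ is a power of $P_m$ for every two-way street $p$. It satisfies $$P_m=1+z\,(P_m)^{(m-1)^2},\qquad z=(-1)^m X_{\widetilde{\gamma+\gamma'}},$$ for some $\gamma,\gamma'\in H_1(\Sigma;\mathbb Z)$ with $\langle\gamma,\gamma'\rangle=m$. More precisely, writing $Q(p,l)=Q(p^{(l)})$, for $l=1,\dots,m$: $$\begin{aligned}Q(c,l)&=P_m,\\ Q(a_2,l)=Q(b_2,l)=Q(a_3,l)=Q(b_3,l)&=P_m^{\,m-l},\\ Q(\overline{a_2},l)=Q(\overline{b_2},l)=Q(\overline{a_3},l)=Q(\overline{b_3},l)&=P_m^{\,l-1},\\ Q(a_1,l)=Q(b_1,l)&=P_m^{\,m-l+1},\\ Q(\overline{a_1},l)=Q(\overline{b_1},l)&=P_m^{\,l}.\end{aligned}$$ -/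

import Mathlib

open scoped Manifold ContDiff Topology
open Set

noncomputable section

namespace HerdNetwork

/-! ## Oriented surfaces

A surface is a smooth real 2-manifold, modelled on `ℂ` seen as a real plane.  The tangent space
at `x` is then a copy of `ℂ`, through the preferred chart at `x`. -/

/-- The derivative of a map of surfaces, as an endomorphism of the plane. -/
def der {M M' : Type*} [TopologicalSpace M] [ChartedSpace ℂ M] [TopologicalSpace M']
    [ChartedSpace ℂ M'] (f : M → M') (x : M) : ℂ →L[ℝ] ℂ :=
  mfderiv 𝓘(ℝ, ℂ) 𝓘(ℝ, ℂ) f x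

/-- Jacobian determinant of a plane-valued map on a surface. -/
def jac {M : Type*} [TopologicalSpace M] [ChartedSpace ℂ M] (f : M → ℂ) (x : M) : ℝ :=
  LinearMap.det (der f x : ℂ →ₗ[ℝ] ℂ)

/-- The given atlas is an oriented one: all its coordinate changes have positive Jacobian. -/
class OrientedAtlas (M : Type*) [TopologicalSpace M] [ChartedSpace ℂ M] : Prop where
  pos : ∀ e ∈ atlas ℂ M, ∀ x ∈ e.source, 0 < jac e x

/-- All orientation preserving smooth charts of an oriented surface. -/
def orientedCharts (M : Type*) [TopologicalSpace M] [ChartedSpace ℂ M] :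
    Set (OpenPartialHomeomorph M ℂ) :=
  {e | e ∈ IsManifold.maximalAtlas 𝓘(ℝ, ℂ) ∞ M ∧ ∀ x ∈ e.source, 0 < jac e x}

/-- The oriented area `v ∧ w` in an oriented plane. -/
def wedge (v w : ℂ) : ℝ := ((starRingEnd ℂ) v * w).im

/-- Tangent vectors with their base points. -/
abbrev Tan (M : Type*) [TopologicalSpace M] [ChartedSpace ℂ M] : Type _ :=
  TangentBundle 𝓘(ℝ, ℂ) M

/-- The tangent vector `v` at the point `x`. -/
def tan {M : Type*} [TopologicalSpace M] [ChartedSpace ℂ M] (x : M) (v : ℂ) : Tan M := ⟨x, v⟩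

/-- The vector part of a tangent vector. -/
def vec {M : Type*} [TopologicalSpace M] [ChartedSpace ℂ M] (w : Tan M) : ℂ := w.2

/-- The tangent vector pointing in the opposite direction. -/
def opp {M : Type*} [TopologicalSpace M] [ChartedSpace ℂ M] (w : Tan M) : Tan M :=
  tan w.1 (-vec w)

/-- The bundle of directions of a surface: nonzero tangent vectors.  The unit tangent bundle of
any Riemannian metric is a deformation retract of it; no metric has to be chosen. -/
abbrev Dir (M : Type*) [TopologicalSpace M] [ChartedSpace ℂ M] : Type _ :=
  {w : Tan M // vec w ≠ 0}

/-- The velocity vector of a curve. -/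
def velocity {M : Type*} [TopologicalSpace M] [ChartedSpace ℂ M] (γ : ℝ → M) (t : ℝ) : Tan M :=
  tan (γ t) (mfderiv 𝓘(ℝ, ℝ) 𝓘(ℝ, ℂ) γ t (1 : ℝ))

/-! ## Singular 1-chains modulo boundaries -/

/-- Singular 1-chains. -/
abbrev Chain1 (X : Type*) [TopologicalSpace X] : Type _ := FreeAbelianGroup C(unitInterval, X)

/-- The edge from the `i`th to the `j`th vertex of the standard 2-simplex. -/
def edge (i j : Fin 3) : C(unitInterval, stdSimplex ℝ (Fin 3)) where
  toFun t := ⟨(1 - (t : ℝ)) • Pi.single i 1 + (t : ℝ) • Pi.single j 1,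
    convex_stdSimplex ℝ (Fin 3) (single_mem_stdSimplex ℝ i) (single_mem_stdSimplex ℝ j)
      (sub_nonneg.2 t.2.2) t.2.1 (by ring)⟩
  continuous_toFun := by fun_prop

/-- The boundary of a singular 2-simplex. -/
def bdry2 {X : Type*} [TopologicalSpace X] (f : C(stdSimplex ℝ (Fin 3), X)) : Chain1 X :=
  FreeAbelianGroup.of (f.comp (edge 1 2)) - FreeAbelianGroup.of (f.comp (edge 0 2))
    + FreeAbelianGroup.of (f.comp (edge 0 1))

/-- The boundary of a singular 1-chain. -/
def bdry1 (X : Type*) [TopologicalSpace X] : Chain1 X →+ FreeAbelianGroup X :=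
  FreeAbelianGroup.lift fun p => FreeAbelianGroup.of (p 1) - FreeAbelianGroup.of (p 0)

/-- The 1-boundaries. -/
def boundaries (X : Type*) [TopologicalSpace X] : AddSubgroup (Chain1 X) :=
  AddSubgroup.closure (range bdry2)

/-- 1-chains modulo 1-boundaries. -/
abbrev ChainMod (X : Type*) [TopologicalSpace X] : Type _ := Chain1 X ⧸ boundaries X

/-- `H₁(X; ℤ)`: cycles modulo boundaries. -/
def H1 (X : Type*) [TopologicalSpace X] : AddSubgroup (ChainMod X) :=
  (bdry1 X).ker.map (QuotientAddGroup.mk' (boundaries X))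

/-- The 1-chain given by the part of a curve from parameter `a` to parameter `b`. -/
def arc {X : Type*} [TopologicalSpace X] (f : ℝ → X) (a b : ℝ) : Chain1 X :=
  open Classical in
  if h : Continuous (fun r : unitInterval => f (a + r * (b - a))) then
    FreeAbelianGroup.of ⟨_, h⟩ else 0

section Surface

variable {M : Type*} [TopologicalSpace M] [ChartedSpace ℂ M] [IsManifold 𝓘(ℝ, ℂ) ∞ M]

/-- The 1-chain on the bundle of directions given by a curve of nonzero tangent vectors. -/
def dirArc (f : ℝ → Tan M) (a b : ℝ) : Chain1 (Dir M) :=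
  open Classical in
  if h : Continuous (fun r : unitInterval => f (a + r * (b - a))) ∧
      ∀ r : unitInterval, vec (f (a + r * (b - a))) ≠ 0 then
    FreeAbelianGroup.of ⟨fun r => ⟨f (a + r * (b - a)), h.2 r⟩, h.1.subtype_mk _⟩ else 0

/-- The loop winding once, counterclockwise, around the fibre of the bundle of directions. -/
def fibreLoop (w : Tan M) : Chain1 (Dir M) :=
  dirArc (fun t => tan w.1 (Complex.exp (2 * Real.pi * t * Complex.I) * vec w)) 0 1

/-- The straight path of tangent vectors at `x` from `v` to `v'`; it is only used for vectors that
are not opposite, and is then the short rotation from the direction `v` to the direction `v'`. -/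
def turnArc (x : M) (v v' : ℂ) : Chain1 (Dir M) :=
  dirArc (fun r => tan x ((1 - r) * v + r * v')) 0 1

variable (M) in
/-- Boundaries on the bundle of directions, together with twice the fibre class. -/
def extRel : AddSubgroup (Chain1 (Dir M)) :=
  boundaries (Dir M) ⊔ AddSubgroup.closure {c | ∃ w : Tan M, vec w ≠ 0 ∧ c = 2 • fibreLoop w}

variable (M) in
/-- 1-chains on the bundle of directions modulo boundaries and modulo `2H`.  All extended
charges (those of closed cycles and the relative ones) live here, and concatenation of charges is
addition here. -/
abbrev ExtChain : Type _ := Chain1 (Dir M) ⧸ extRel M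

/-- The class of a chain. -/
def cls (c : Chain1 (Dir M)) : ExtChain M := QuotientAddGroup.mk c

/-- The charges running from the tangent vector `w` to the tangent vector `w'`: classes of chains
with boundary `w' - w`. -/
def charges (w w' : Tan M) : Set (ExtChain M) :=
  {a | ∃ c : Chain1 (Dir M), cls c = a ∧
    FreeAbelianGroup.map (fun d : Dir M => d.1) (bdry1 (Dir M) c)
      = FreeAbelianGroup.of w' - FreeAbelianGroup.of w}

variable (M) in
/-- The extension of `H₁(M; ℤ)` by the fibre class `H` of order two. -/
def extH1 : AddSubgroup (ExtChain M) :=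
  (bdry1 (Dir M)).ker.map (QuotientAddGroup.mk' (extRel M))

/-! ## Formal series -/

/-- The relations `X_H = -1`. -/
def twistIdeal (M : Type*) [TopologicalSpace M] [ChartedSpace ℂ M] [IsManifold 𝓘(ℝ, ℂ) ∞ M] :
    Ideal (AddMonoidAlgebra ℤ (ExtChain M)) :=
  Ideal.span {x | ∃ w : Tan M, vec w ≠ 0 ∧
    x = AddMonoidAlgebra.single (cls (fibreLoop w)) 1 + 1}

variable (M) in
/-- Finite integral combinations of the symbols `X_a`, with `X_a X_b = X_{a+b}`, `X_H = -1`. -/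
abbrev Coeff : Type _ := AddMonoidAlgebra ℤ (ExtChain M) ⧸ twistIdeal M

/-- The symbol `X_a`, as a finite combination. -/
def sym (a : ExtChain M) : Coeff M :=
  Ideal.Quotient.mk (twistIdeal M) (AddMonoidAlgebra.single a 1)

variable (M) in
/-- Formal series in the symbols `X_a`, graded by a weight `Z`: for every real `r` there is a
finite combination of the `X_a` of weight `r`, and the weights that occur are well-ordered. -/
abbrev Series : Type _ := HahnSeries ℝ (Coeff M)

/-- The formal variable `X_a`. -/
def X (Z : ExtChain M →+ ℝ) (a : ExtChain M) : Series M := HahnSeries.single (Z a) (sym a)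

/-- The series `f` is a formal series in the variables `X_a`, `a ∈ A`, with integer
coefficients. -/
def SeriesIn (Z : ExtChain M →+ ℝ) (A : Set (ExtChain M)) (f : Series M) : Prop :=
  ∀ r : ℝ, f.coeff r ∈ AddSubgroup.closure {x | ∃ a ∈ A, Z a = r ∧ x = sym a}

/-! ## Closed curves, the intersection pairing and the lift of homology classes -/

variable (M) in
/-- A regular closed curve, parametrised with period one. -/
structure Loop where
  curve : ℝ → M
  smooth : ContMDiff 𝓘(ℝ, ℝ) 𝓘(ℝ, ℂ) 1 curve
  periodic : ∀ t, curve (t + 1) = curve t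
  regular : ∀ t, vec (velocity curve t) ≠ 0

/-- The homology class of a closed curve. -/
def Loop.homology (β : Loop M) : ChainMod M := QuotientAddGroup.mk (arc β.curve 0 1)

/-- The class of the tangent framing lift of a closed curve. -/
def Loop.framing (β : Loop M) : ExtChain M := cls (dirArc (velocity β.curve) 0 1)

/-- The crossings of a finite family of closed curves, self-crossings included; each is listed
once. -/
def crossings {k : ℕ} (β : Fin k → Loop M) : Set ((Fin k × ℝ) × (Fin k × ℝ)) :=
  {x | x.1.2 ∈ Ico 0 1 ∧ x.2.2 ∈ Ico 0 1 ∧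
    (x.1.1 < x.2.1 ∨ (x.1.1 = x.2.1 ∧ x.1.2 < x.2.2)) ∧
    (β x.1.1).curve x.1.2 = (β x.2.1).curve x.2.2}

/-- `g` is the lift `γ~` of `γ`: write `γ` as a union of regular closed curves with
transverse crossings, add up their tangent framing lifts, and add `H` once for every curve and once
for every crossing. -/
def IsTildeLift (γ : ChainMod M) (g : ExtChain M) : Prop :=
  ∃ (k : ℕ) (β : Fin k → Loop M),
    (crossings β).Finite ∧
    (∀ x ∈ crossings β, wedge (vec (velocity (β x.1.1).curve x.1.2))
      (vec (velocity (β x.2.1).curve x.2.2)) ≠ 0) ∧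
    ∑ i, (β i).homology = γ ∧
    ∃ w : Tan M, vec w ≠ 0 ∧
      g = ∑ i, (β i).framing + (k + (crossings β).ncard) • cls (fibreLoop w)

/-- Common points of two finite families of closed curves. -/
def meetings {k k' : ℕ} (β : Fin k → Loop M) (β' : Fin k' → Loop M) :
    Set ((Fin k × ℝ) × (Fin k' × ℝ)) :=
  {x | x.1.2 ∈ Ico 0 1 ∧ x.2.2 ∈ Ico 0 1 ∧ (β x.1.1).curve x.1.2 = (β' x.2.1).curve x.2.2}

/-- `⟨γ, γ'⟩ = n`: the signed number of meetings of transverse representatives is `n`. -/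
def HasIntersection (γ γ' : ChainMod M) (n : ℤ) : Prop :=
  ∃ (k k' : ℕ) (β : Fin k → Loop M) (β' : Fin k' → Loop M),
    ∑ i, (β i).homology = γ ∧ ∑ i, (β' i).homology = γ' ∧
    (meetings β β').Finite ∧
    (∀ x ∈ meetings β β', wedge (vec (velocity (β x.1.1).curve x.1.2))
      (vec (velocity (β' x.2.1).curve x.2.2)) ≠ 0) ∧
    n = ∑ᶠ x ∈ meetings β β', if 0 < wedge (vec (velocity (β x.1.1).curve x.1.2))
      (vec (velocity (β' x.2.1).curve x.2.2)) then (1 : ℤ) else -1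

end Surface

/-! ## Branched covers -/

section Cover

variable {S C : Type*} [TopologicalSpace S] [ChartedSpace ℂ S] [IsManifold 𝓘(ℝ, ℂ) ∞ S]
  [TopologicalSpace C] [ChartedSpace ℂ C]

/-- `x` is a ramification point of `π`. -/
def Ramified (π : S → C) (x : S) : Prop := ¬ ∃ U ∈ 𝓝 x, InjOn π U

/-- The branch points. -/
def branchPoints (π : S → C) : Set C := π '' {x | Ramified π x}

/-- `π` is a branched cover of degree `K` with simple ramification: proper, in oriented local
coordinates either `w ↦ w` or `w ↦ w ^ 2`, with at most one ramification point over each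
point, and with `K` points over each point that is not a branch point. -/
structure IsSimpleBranchedCover (π : S → C) (K : ℕ) : Prop where
  degree_pos : 0 < K
  proper : IsProperMap π
  local_form : ∀ x, ∃ n : ℕ, (n = 1 ∨ n = 2) ∧
    ∃ e ∈ orientedCharts S, ∃ e' ∈ orientedCharts C, x ∈ e.source ∧ e x = 0 ∧ e' (π x) = 0 ∧
      ∀ y ∈ e.source, π y ∈ e'.source ∧ e' (π y) = e y ^ n
  simple : ∀ x y, Ramified π x → Ramified π y → π x = π y → x = y
  card_fibre : ∀ z, z ∉ branchPoints π → (π ⁻¹' {z}).ncard = K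

/-- The lift to `T_x S` of a tangent vector of the base at `π x`, for `x` unramified. -/
def liftVec (π : S → C) (x : S) (v : ℂ) : ℂ :=
  (der π x).inverse v

/-! ## Streets -/

/-- An oriented street of type `ij` away from the branch points: an immersed curve on the base,
given by its lifts `src` to sheet `i` and `tgt` to sheet `j`.  Only parameters in `[0,1]`
count. -/
structure Street (π : S → C) where
  src : ℝ → S
  tgt : ℝ → S
  src_smooth : ContMDiff 𝓘(ℝ, ℝ) 𝓘(ℝ, ℂ) 1 src
  tgt_smooth : ContMDiff 𝓘(ℝ, ℝ) 𝓘(ℝ, ℂ) 1 tgt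
  same_base : ∀ t ∈ Icc (0 : ℝ) 1, π (src t) = π (tgt t)
  distinct : ∀ t ∈ Icc (0 : ℝ) 1, src t ≠ tgt t
  unbranched : ∀ t ∈ Icc (0 : ℝ) 1, π (src t) ∉ branchPoints π
  src_regular : ∀ t ∈ Icc (0 : ℝ) 1, vec (velocity src t) ≠ 0
  tgt_regular : ∀ t ∈ Icc (0 : ℝ) 1, vec (velocity tgt t) ≠ 0

/-- The first piece of a street that emanates from a branch point, through its lift to the
cover: a regular curve through the ramification point, symmetric under exchange of the two sheets
that collide there.  Run from parameter `-1` to parameter `1` it is a simpleton. -/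
structure Cap (π : S → C) where
  path : ℝ → S
  smooth : ContMDiff 𝓘(ℝ, ℝ) 𝓘(ℝ, ℂ) 1 path
  regular : ∀ t ∈ Icc (-1 : ℝ) 1, vec (velocity path t) ≠ 0
  ramified : Ramified π (path 0)
  symmetric : ∀ t ∈ Icc (0 : ℝ) 1, π (path (-t)) = π (path t)
  injective : InjOn path (Icc (-1) 1)
  unbranched : ∀ t ∈ Ioc (0 : ℝ) 1, π (path t) ∉ branchPoints π

/-- The branch point at which a cap starts. -/
def Cap.branchPoint {π : S → C} (σ : Cap π) : C := π (σ.path 0)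

/-- The charge of the simpleton given by a cap (class of its tangent framing lift). -/
def Cap.simpleton {π : S → C} (σ : Cap π) : ExtChain S := cls (dirArc (velocity σ.path) (-1) 1)

/-- The charges of solitons of type `ij` at the parameter `t` of a street of type `ij`: they
start on sheet `i` against the street and end on sheet `j` along it, as simpletons do. -/
def Street.solitonCharges {π : S → C} (p : Street π) (t : ℝ) : Set (ExtChain S) :=
  charges (opp (velocity p.src t)) (velocity p.tgt t)

/-- Parallel transport of soliton charges along a street, from parameter `t` to parameter `t'`,
is the addition of this class: the lift to sheet `j` minus the lift to sheet `i`. -/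
def Street.transport {π : S → C} (p : Street π) (t t' : ℝ) : ExtChain S :=
  cls (dirArc (velocity p.tgt) t t') - cls (dirArc (fun r => opp (velocity p.src r)) t t')

end Cover

/-! ## Spectral networks -/

/-- A spectral network with its soliton generating functions, subordinate to the branched cover
`π : S → C`.

A (two-way capable) street is split at the joints.  Each piece occurs in `St` with both
orientations, exchanged by `rev`; the oriented piece `s` of type `ij` is the carrier of the
solitons of type `ij`, and `present s` says that this constituent one-way street belongs to the
network.  `gen s t` is the generating function of the solitons of type `ij` at the
parameter `t`.  So for a street `p` oriented as `s` one has `Υ(p) = gen s` and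
`Δ(p) = gen (rev s)`.

`Jt` indexes the joints at which streets on three sheets meet.  The sheets at a joint are numbered
so that the directions of the six possible legs are, counterclockwise,
`01, 02, 12, 10, 20, 21`; `leg v i j` is the street of type `ij` running out of `v` (if
there is one), and the street of type `ji` running into `v` is its reverse. -/
structure SpectralNetwork {S C : Type*} [TopologicalSpace S] [ChartedSpace ℂ S]
    [IsManifold 𝓘(ℝ, ℂ) ∞ S] [TopologicalSpace C] [ChartedSpace ℂ C]
    (π : S → C) (Z : ExtChain S →+ ℝ)
    (St Jt : Type*) where
  street : St → Street π
  rev : St → St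
  rev_rev : ∀ s, rev (rev s) = s
  rev_ne : ∀ s, rev s ≠ s
  src_rev : ∀ s t, (street (rev s)).src t = (street s).tgt (1 - t)
  -- the pieces adjacent to branch points
  cap : St → Option (Cap π)
  cap_tgt : ∀ s σ, cap s = some σ → velocity σ.path 1 = velocity (street s).tgt 0
  cap_src : ∀ s σ, cap s = some σ → velocity σ.path (-1) = opp (velocity (street s).src 0)
  -- the joints
  sheet : Jt → Fin 3 → S
  sheet_injective : ∀ v, Function.Injective (sheet v)
  sheet_base : ∀ v i, π (sheet v i) = π (sheet v 0)
  joint_unbranched : ∀ v, π (sheet v 0) ∉ branchPoints π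
  dir : Jt → Fin 3 → Fin 3 → ℂ
  dir_swap : ∀ v i j, dir v j i = -dir v i j
  dir_cyclic : ∀ v, 0 < wedge (dir v 0 1) (dir v 0 2) ∧ 0 < wedge (dir v 0 2) (dir v 1 2) ∧
    0 < wedge (dir v 0 1) (dir v 1 2)
  leg : Jt → Fin 3 → Fin 3 → Option St
  leg_diag : ∀ v i, leg v i i = none
  leg_src : ∀ v i j s, leg v i j = some s →
    velocity (street s).src 0 = tan (sheet v i) (liftVec π (sheet v i) (dir v i j))
  leg_tgt : ∀ v i j s, leg v i j = some s →
    velocity (street s).tgt 0 = tan (sheet v j) (liftVec π (sheet v j) (dir v i j))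
  leg_unique : ∀ v i j v' i' j' s, leg v i j = some s → leg v' i' j' = some s →
    v = v' ∧ i = i' ∧ j = j'
  leg_cap : ∀ v i j s, leg v i j = some s → cap s = none
  -- the one-way constituents that belong to the network
  present : St → Prop
  present_or : ∀ s, present s ∨ present (rev s)
  present_cap : ∀ s, cap s ≠ none → present s
  -- the generating functions
  gen : St → ℝ → Series S
  gen_mem : ∀ s, ∀ t ∈ Icc (0 : ℝ) 1, SeriesIn Z ((street s).solitonCharges t) (gen s t)
  gen_transport : ∀ s, ∀ t ∈ Icc (0 : ℝ) 1, ∀ t' ∈ Icc (0 : ℝ) 1,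
    gen s t' = X Z ((street s).transport t t') * gen s t
  gen_absent : ∀ s, ¬ present s → ∀ t, gen s t = 0

namespace SpectralNetwork

variable {S C : Type*} [TopologicalSpace S] [ChartedSpace ℂ S] [IsManifold 𝓘(ℝ, ℂ) ∞ S]
  [TopologicalSpace C] [ChartedSpace ℂ C] {π : S → C} {Z : ExtChain S →+ ℝ}
  {St Jt : Type*} (N : SpectralNetwork π Z St Jt)

/-- A street is two-way if both of its one-way constituents belong to the network. -/
def TwoWay (s : St) : Prop := N.present s ∧ N.present (N.rev s)

/-- The street factor `Q(p) = cl [1 + Υ(p) Δ(p)]`, evaluated at the parameter `t`.  The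
closure map is the identity on chains. -/
def Q (s : St) (t : ℝ) : Series S := 1 + N.gen s t * N.gen (N.rev s) (1 - t)

/-- The position of a joint. -/
def pt (v : Jt) : C := π (N.sheet v 0)

/-- The generating function of solitons of type `ij` running out of a joint. -/
def τ (v : Jt) (i j : Fin 3) : Series S := (N.leg v i j).elim 0 fun s => N.gen s 0

/-- The generating function of solitons of type `ij` running into a joint. -/
def ν (v : Jt) (i j : Fin 3) : Series S := (N.leg v j i).elim 0 fun s => N.gen (N.rev s) 1

/-- There is a street of type `ij` running out of the joint. -/
def outAt (v : Jt) (i j : Fin 3) : Prop := ∃ s, N.leg v i j = some s ∧ N.present s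

/-- There is a street of type `ij` running into the joint. -/
def inAt (v : Jt) (i j : Fin 3) : Prop := ∃ s, N.leg v j i = some s ∧ N.present (N.rev s)

/-- The turns needed to concatenate, at a joint, a soliton of type `ik` with one of type `kj`
to one of type `ij`.  They add up to a half-twist: counterclockwise if `j = i + 1`
(this is `η`) and clockwise if `j = i + 2` (this is `η⁻¹`). -/
def turn (v : Jt) (i k j : Fin 3) : ExtChain S :=
  cls (turnArc (N.sheet v i) (liftVec π (N.sheet v i) (-N.dir v i j))
    (liftVec π (N.sheet v i) (-N.dir v i k)))
  + cls (turnArc (N.sheet v k) (liftVec π (N.sheet v k) (N.dir v i k))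
    (liftVec π (N.sheet v k) (-N.dir v k j)))
  + cls (turnArc (N.sheet v j) (liftVec π (N.sheet v j) (N.dir v k j))
    (liftVec π (N.sheet v j) (N.dir v i j)))

/-- The six-way junction equations. -/
def SixWay : Prop :=
  ∀ (v : Jt) (i : Fin 3),
    N.τ v i (i + 1) = N.ν v i (i + 1)
      + X Z (N.turn v i (i + 2) (i + 1)) * (N.τ v i (i + 2) * N.ν v (i + 2) (i + 1)) ∧
    N.τ v i (i + 2) = N.ν v i (i + 2)
      + X Z (N.turn v i (i + 1) (i + 2)) * (N.ν v i (i + 1) * N.τ v (i + 1) (i + 2))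

/-- A street runs out of a joint exactly if it has a source there, according to the six-way
junction equations. -/
def SixWayStreets : Prop :=
  ∀ (v : Jt) (i : Fin 3),
    (N.outAt v i (i + 1) ↔ N.inAt v i (i + 1) ∨
      (N.outAt v i (i + 2) ∧ N.inAt v (i + 2) (i + 1))) ∧
    (N.outAt v i (i + 2) ↔ N.inAt v i (i + 2) ∨
      (N.inAt v i (i + 1) ∧ N.outAt v (i + 1) (i + 2)))

/-- At most one two-way street emanates from a branch point, and on it (or, if there is none, on
each street that emanates from the branch point) the outgoing solitons are the simpletons. -/
def BranchRule : Prop :=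
  (∀ s s' σ σ', N.cap s = some σ → N.cap s' = some σ' → σ.branchPoint = σ'.branchPoint →
    N.TwoWay s → N.TwoWay s' → s = s') ∧
  ∀ s σ, N.cap s = some σ →
    (∀ s' σ', N.cap s' = some σ' → σ'.branchPoint = σ.branchPoint → s' ≠ s → ¬ N.TwoWay s') →
    N.gen s 0 = X Z σ.simpleton

/-- The parameters of a street without its ends: `(0,1)`, extended by `(-1,0]` and by
`[1,2)` for the caps at its start and at its end. -/
def params (s : St) : Set ℝ :=
  {t | (0 < t ∧ t < 1) ∨ (N.cap s ≠ none ∧ -1 < t ∧ t ≤ 0) ∨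
    (N.cap (N.rev s) ≠ none ∧ 1 ≤ t ∧ t < 2)}

/-- The two lifts of a point of a street, caps included. -/
def strand (s : St) (t : ℝ) : S × S :=
  if t ≤ 0 then
    (N.cap s).elim ((N.street s).src t, (N.street s).tgt t)
      fun σ => (σ.path (-(1 + t)), σ.path (1 + t))
  else if 1 ≤ t then
    (N.cap (N.rev s)).elim ((N.street s).src t, (N.street s).tgt t)
      fun σ => (σ.path (2 - t), σ.path (-(2 - t)))
  else ((N.street s).src t, (N.street s).tgt t)

/-- Streets do not meet each other or themselves, nor a joint, except at their ends or where no
sheet is shared. -/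
def Embedded : Prop :=
  (∀ s s', ∀ t ∈ N.params s, ∀ t' ∈ N.params s',
    π (N.strand s t).1 = π (N.strand s' t').1 →
      (s' = s ∧ t' = t) ∨ (s' = N.rev s ∧ t' = 1 - t) ∨
      Disjoint ({(N.strand s t).1, (N.strand s t).2} : Set S)
        {(N.strand s' t').1, (N.strand s' t').2}) ∧
  (∀ s v, ∀ t ∈ N.params s, π (N.strand s t).1 = N.pt v →
    Disjoint ({(N.strand s t).1, (N.strand s t).2} : Set S) (range (N.sheet v))) ∧
  ∀ v v', N.pt v = N.pt v' → v = v' ∨ Disjoint (range (N.sheet v)) (range (N.sheet v'))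

/-- The set of points of the base on a street; branch points are not included. -/
def trace (s : St) : Set C :=
  (fun t => π ((N.street s).src t)) '' Icc 0 1 ∪ (fun t => π (N.strand s t).1) '' N.params s

/-- The set of points on a list of streets. -/
def listTrace (L : List St) : Set C := {z | ∃ s ∈ L, z ∈ N.trace s}

/-- `s'` continues `s` straight through a joint. -/
def Continues (s s' : St) : Prop :=
  ∃ v i j, N.leg v j i = some (N.rev s) ∧ N.leg v i j = some s'

/-- The laws of a spectral network. -/
structure Lawful : Prop where
  sixWay : N.SixWay
  sixWayStreets : N.SixWayStreets
  branchRule : N.BranchRule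
  embedded : N.Embedded

end SpectralNetwork

/-! ## Horses and herds -/

/-- The thirteen horse streets; `a1'` stands for `a₁` with an overline, and so on. -/
inductive HorseStreet
  | a1 | a2 | a3 | b1 | b2 | b3 | c | a1' | a2' | a3' | b1' | b2' | b3'

/-- The four joints of a horse: `bot` between `a₁, b₁` and `a₂, b₂, c`; `right` between
`a₂, b₃'` and `a₃, b₂'`; `left` between `b₂, a₃'` and `b₃, a₂'`; `top` between
`a₂', b₂', c` and `a₁', b₁'`. -/
inductive HorseJoint
  | bot | right | left | top

/-- The ray from `z` in the direction `d`. -/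
def ray (z d : ℂ) : Set ℂ := {w | ∃ r : ℝ, 0 ≤ r ∧ w = z + r * d}

/-- The positions of the joints in the standard picture of a horse in the plane. -/
def HorseJoint.pos : HorseJoint → ℂ
  | bot => -Complex.I
  | right => 1
  | left => -1
  | top => Complex.I

/-- The streets in the standard picture of a horse in the plane.  Streets of type 12 have slope
`1`, streets of type 23 have slope `-1`, and `c`, of type 13, is vertical; all run up. -/
def HorseStreet.fig : HorseStreet → Set ℂ
  | a1 => ray (-Complex.I) (-(1 + Complex.I))
  | a2 => segment ℝ (-Complex.I) 1
  | a3 => ray 1 (1 + Complex.I)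
  | b1 => ray (-Complex.I) (1 - Complex.I)
  | b2 => segment ℝ (-Complex.I) (-1)
  | b3 => ray (-1) (-1 + Complex.I)
  | c => segment ℝ (-Complex.I) Complex.I
  | a3' => ray (-1) (-(1 + Complex.I))
  | a2' => segment ℝ (-1) Complex.I
  | a1' => ray Complex.I (1 + Complex.I)
  | b3' => ray 1 (1 - Complex.I)
  | b2' => segment ℝ 1 Complex.I
  | b1' => ray Complex.I (-1 + Complex.I)

/-- The exponent of `P_m` in `Q(p, l)`. -/
def HorseStreet.exponent (m l : ℕ) : HorseStreet → ℕ
  | c => 1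
  | a2 | b2 | a3 | b3 => m - l
  | a2' | b2' | a3' | b3' => l - 1
  | a1 | b1 => m - l + 1
  | a1' | b1' => l

section Herd

variable {S C : Type*} [TopologicalSpace S] [ChartedSpace ℂ S] [IsManifold 𝓘(ℝ, ℂ) ∞ S]
  [TopologicalSpace C] [ChartedSpace ℂ C] {π : S → C} {Z : ExtChain S →+ ℝ}
  {St Jt : Type*}

/-- A horse in the network `N` on the disk `U` (the domain of the chart `φ`).  A horse street is
a list of pieces running up and continuing each other straight through background joints;
background streets (not listed) are one-way.  In the coordinate `φ`, which identifies `U` with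
the plane, the horse streets are those of the standard picture.  The sheets 1, 2, 3 are numbered
0, 1, 2. -/
structure IsHorse (N : SpectralNetwork π Z St Jt) (φ : OpenPartialHomeomorph C ℂ)
    (joint : HorseJoint → Jt) (street : HorseStreet → List St) : Prop where
  chart : φ ∈ orientedCharts C
  disk : φ.target = univ
  unbranched : Disjoint φ.source (branchPoints π)
  ne_nil : ∀ p, street p ≠ []
  chain : ∀ p, (street p).IsChain N.Continues
  bot_a : N.leg (joint .bot) 0 1 = (street .a2).head? ∧
    N.leg (joint .bot) 1 0 = (street .a1).getLast?.map N.rev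
  bot_b : N.leg (joint .bot) 1 2 = (street .b2).head? ∧
    N.leg (joint .bot) 2 1 = (street .b1).getLast?.map N.rev
  bot_c : N.leg (joint .bot) 0 2 = (street .c).head?
  right_a : N.leg (joint .right) 0 1 = (street .a3).head? ∧
    N.leg (joint .right) 1 0 = (street .a2).getLast?.map N.rev
  right_b : N.leg (joint .right) 1 2 = (street .b2').head? ∧
    N.leg (joint .right) 2 1 = (street .b3').getLast?.map N.rev
  left_a : N.leg (joint .left) 0 1 = (street .a2').head? ∧
    N.leg (joint .left) 1 0 = (street .a3').getLast?.map N.rev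
  left_b : N.leg (joint .left) 1 2 = (street .b3).head? ∧
    N.leg (joint .left) 2 1 = (street .b2).getLast?.map N.rev
  top_a : N.leg (joint .top) 0 1 = (street .a1').head? ∧
    N.leg (joint .top) 1 0 = (street .a2').getLast?.map N.rev
  top_b : N.leg (joint .top) 1 2 = (street .b1').head? ∧
    N.leg (joint .top) 2 1 = (street .b2').getLast?.map N.rev
  top_c : N.leg (joint .top) 2 0 = (street .c).getLast?.map N.rev
  joint_mem : ∀ q, N.pt (joint q) ∈ φ.source
  joint_pos : ∀ q, φ (N.pt (joint q)) = q.pos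
  fig : ∀ p, φ '' (N.listTrace (street p) ∩ φ.source) = p.fig
  twoWay_horse : ∀ s, N.TwoWay s → (N.trace s ∩ φ.source).Nonempty →
    ∃ p, s ∈ street p ∨ N.rev s ∈ street p
  twoWay_c : ∀ s ∈ street .c, N.TwoWay s

/-- An `m`-herd structure on the network `N`: horses numbered by `l = 1, …, m` (other values of
`l` are ignored). -/
structure Herd (N : SpectralNetwork π Z St Jt) (m : ℕ) where
  chart : ℕ → OpenPartialHomeomorph C ℂ
  joint : ℕ → HorseJoint → Jt
  street : ℕ → HorseStreet → List St
  -- horses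
  horse : ∀ l ∈ Icc 1 m, IsHorse N (chart l) (joint l) (street l)
  cover : ∀ s, N.TwoWay s → N.trace s ⊆ ⋃ l ∈ Icc 1 m, (chart l).source
  overlap : ∀ l ∈ Icc 1 m, ∀ k ∈ Icc 1 m, l ≠ k →
    (((chart l).source ∩ (chart k).source).Nonempty ↔ (l = k + 1 ∨ k = l + 1))
  -- four distinct branch points, at the lower ends of `a₁`, `b₁` of the first horse and at the
  -- upper ends of `a₁'`, `b₁'` of the last horse
  source : Fin 4 → Cap π
  source_a : (street 1 .a1).head?.bind N.cap = some (source 0)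
  source_b : (street 1 .b1).head?.bind N.cap = some (source 1)
  source_a' : (street m .a1').getLast?.bind (fun s => N.cap (N.rev s)) = some (source 2)
  source_b' : (street m .b1').getLast?.bind (fun s => N.cap (N.rev s)) = some (source 3)
  source_distinct : Function.Injective fun i => (source i).branchPoint
  -- nothing else flows into the first horse from below or into the last one from above
  lower_a : ∀ s, (street 1 .a3').getLast? = some s → ¬ N.present s
  lower_b : ∀ s, (street 1 .b3').getLast? = some s → ¬ N.present s
  upper_a : ∀ s, (street m .a3).head? = some s → ¬ N.present (N.rev s)
  upper_b : ∀ s, (street m .b3).head? = some s → ¬ N.present (N.rev s)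
  -- gluing
  glue : ∀ l, 1 ≤ l → l < m →
    street (l + 1) .a1 = street l .a3 ∧ street (l + 1) .b1 = street l .b3 ∧
    street l .a1' = street (l + 1) .a3' ∧ street l .b1' = street (l + 1) .b3'
  -- no holes
  noHoles : ∀ l, 1 ≤ l → l < m → ∃ F G : ℂ → C,
    (ContinuousOn F (Metric.closedBall 0 1) ∧ InjOn F (Metric.closedBall 0 1) ∧
      MapsTo F (Metric.closedBall 0 1) (branchPoints π)ᶜ ∧
      F '' Metric.sphere 0 1 = N.listTrace (street l .a2') ∪ N.listTrace (street l .b1') ∪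
        N.listTrace (street (l + 1) .a2) ∪ N.listTrace (street l .b3)) ∧
    (ContinuousOn G (Metric.closedBall 0 1) ∧ InjOn G (Metric.closedBall 0 1) ∧
      MapsTo G (Metric.closedBall 0 1) (branchPoints π)ᶜ ∧
      G '' Metric.sphere 0 1 = N.listTrace (street l .b2') ∪ N.listTrace (street l .a1') ∪
        N.listTrace (street (l + 1) .b2) ∪ N.listTrace (street l .a3)) ∧
    Disjoint (F '' Metric.ball 0 1) (G '' Metric.ball 0 1)

end Herd

end HerdNetwork

end

open scoped Manifold ContDiff Topology
open Set
noncomputable section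
namespace HerdNetwork

/-- The model with corners of a surface. -/
local notation "𝓒" => 𝓘(ℝ, ℂ)

/-- The model with corners of the line. -/
local notation "𝓡" => 𝓘(ℝ, ℝ)

/-- The parameter interval of streets and pieces. -/
local notation "𝕀" => Icc (0 : ℝ) 1
set_option linter.unusedSectionVars false

section Chains

variable {X : Type*} [TopologicalSpace X]

theorem edge_apply (i j : Fin 3) (t : unitInterval) (k : Fin 3) :
    (edge i j t).1 k
      = (1 - (t : ℝ)) * (Pi.single i (1 : ℝ) : Fin 3 → ℝ) k
        + t * (Pi.single j (1 : ℝ) : Fin 3 → ℝ) k := rfl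

/-- The affine map from the standard simplex to the unit square given by two sums of barycentric
coordinates. -/
def simplexToSquare (A B : Finset (Fin 3)) : C(stdSimplex ℝ (Fin 3), unitInterval × unitInterval) where
  toFun x := (⟨∑ i ∈ A, x.1 i, Finset.sum_nonneg fun i _ => x.2.1 i, by
      rw [← x.2.2]; exact Finset.sum_le_univ_sum_of_nonneg x.2.1⟩,
    ⟨∑ i ∈ B, x.1 i, Finset.sum_nonneg fun i _ => x.2.1 i, by
      rw [← x.2.2]; exact Finset.sum_le_univ_sum_of_nonneg x.2.1⟩)
  continuous_toFun := by fun_prop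

theorem boundary_square_mem (H : C(unitInterval × unitInterval, X)) :
    FreeAbelianGroup.of (H.comp ⟨fun t => (t, 0), by fun_prop⟩)
      + FreeAbelianGroup.of (H.comp ⟨fun t => (1, t), by fun_prop⟩)
      - FreeAbelianGroup.of (H.comp ⟨fun t => (t, 1), by fun_prop⟩)
      - FreeAbelianGroup.of (H.comp ⟨fun t => (0, t), by fun_prop⟩) ∈ boundaries X := by
  have h1 : bdry2 (H.comp (simplexToSquare {1, 2} {2})) ∈ boundaries X :=
    AddSubgroup.subset_closure ⟨_, rfl⟩
  have h2 : bdry2 (H.comp (simplexToSquare {2} {1, 2})) ∈ boundaries X :=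
    AddSubgroup.subset_closure ⟨_, rfl⟩
  have key : ∀ (A B : Finset (Fin 3)) (i j : Fin 3) (g : C(unitInterval, unitInterval × unitInterval)),
      (∀ t, simplexToSquare A B (edge i j t) = g t) →
      (H.comp (simplexToSquare A B)).comp (edge i j) = H.comp g := by
    intro A B i j g h
    ext t
    simp only [ContinuousMap.comp_apply, h]
  have h := sub_mem h1 h2
  rw [bdry2, bdry2,
    key _ _ 1 2 ⟨fun t => (1, t), by fun_prop⟩, key _ _ 0 2 ⟨fun t => (t, t), by fun_prop⟩,
    key _ _ 0 1 ⟨fun t => (t, 0), by fun_prop⟩, key _ _ 1 2 ⟨fun t => (t, 1), by fun_prop⟩,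
    key _ _ 0 2 ⟨fun t => (t, t), by fun_prop⟩, key _ _ 0 1 ⟨fun t => (0, t), by fun_prop⟩] at h
  · convert h using 1
    abel
  all_goals
    intro t
    refine Prod.ext (Subtype.ext ?_) (Subtype.ext ?_) <;>
    simp [simplexToSquare, edge_apply]

theorem const_mem_boundaries (x : X) :
    FreeAbelianGroup.of (ContinuousMap.const unitInterval x) ∈ boundaries X := by
  have h : bdry2 (ContinuousMap.const (stdSimplex ℝ (Fin 3)) x) ∈ boundaries X :=
    AddSubgroup.subset_closure ⟨_, rfl⟩
  simpa [bdry2, ContinuousMap.const_comp] using h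

end Chains

open SpectralNetwork

variable {M : Type*} [TopologicalSpace M] [ChartedSpace ℂ M] [IsManifold 𝓒 ∞ M]
  {S C : Type*} [TopologicalSpace S] [ChartedSpace ℂ S] [IsManifold 𝓒 ∞ S]
  [TopologicalSpace C] [ChartedSpace ℂ C] [IsManifold 𝓒 ∞ C] {π : S → C} {K : ℕ}
  {Z : ExtChain S →+ ℝ} {St Jt : Type*} {N : SpectralNetwork π Z St Jt}
  {φ : OpenPartialHomeomorph C ℂ} {J : HorseJoint → Jt} {L : HorseStreet → List St}
  {p : HorseStreet} {v : Jt} {s s' : St} {k l : ℕ}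

local instance : AddZero (ExtChain M) := inferInstance
local instance : AddZeroClass (ExtChain M) := inferInstance
local instance : Sub (ExtChain M) := inferInstance

theorem cls_add (c d : Chain1 (Dir M)) : cls (c + d) = cls c + cls d := rfl
theorem cls_sub (c d : Chain1 (Dir M)) : cls (c - d) = cls c - cls d := rfl

theorem cls_eq_zero {c : Chain1 (Dir M)} (h : c ∈ boundaries (Dir M)) : cls c = 0 :=
  (QuotientAddGroup.eq_zero_iff c).2 (AddSubgroup.mem_sup_left h)

theorem segment_mem_uIcc {a b r : ℝ} (h0 : 0 ≤ r) (h1 : r ≤ 1) : a + r * (b - a) ∈ uIcc a b := by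
  rcases le_total a b with h | h
  · rw [uIcc_of_le h]
    constructor <;> nlinarith
  · rw [uIcc_of_ge h]
    constructor <;> nlinarith

theorem dirArc_of {f : ℝ → Tan M} {a b : ℝ} (hf : ContinuousOn f (uIcc a b))
    (hne : ∀ t ∈ uIcc a b, vec (f t) ≠ 0) :
    ∃ g : C(unitInterval, Dir M), (∀ r, (g r).1 = f (a + r * (b - a))) ∧
      dirArc f a b = FreeAbelianGroup.of g := by
  have h1 : Continuous (fun r : unitInterval => f (a + r * (b - a))) :=
    hf.comp_continuous (by fun_prop) fun r => segment_mem_uIcc r.2.1 r.2.2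
  have h2 : ∀ r : unitInterval, vec (f (a + r * (b - a))) ≠ 0 :=
    fun r => hne _ (segment_mem_uIcc r.2.1 r.2.2)
  refine ⟨⟨fun r => ⟨f (a + r * (b - a)), h2 r⟩, h1.subtype_mk _⟩, fun r => rfl, ?_⟩
  rw [dirArc, dif_pos ⟨h1, h2⟩]

theorem dirArc_congr {f g : ℝ → Tan M} {a b : ℝ} (h : ∀ t ∈ uIcc a b, f t = g t) :
    dirArc f a b = dirArc g a b := by
  have e : (fun r : unitInterval => f (a + r * (b - a)))
      = fun r : unitInterval => g (a + r * (b - a)) := by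
    funext r
    exact h _ (segment_mem_uIcc r.2.1 r.2.2)
  have e' : ∀ r : unitInterval, f (a + r * (b - a)) = g (a + r * (b - a)) := fun r => congrFun e r
  unfold dirArc
  by_cases h1 : Continuous (fun r : unitInterval => f (a + r * (b - a))) ∧
      ∀ r : unitInterval, vec (f (a + r * (b - a))) ≠ 0
  · have h2 : Continuous (fun r : unitInterval => g (a + r * (b - a))) ∧
        ∀ r : unitInterval, vec (g (a + r * (b - a))) ≠ 0 :=
      ⟨e ▸ h1.1, fun r => e' r ▸ h1.2 r⟩
    rw [dif_pos h1, dif_pos h2]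
    congr 1
    ext1 r
    exact Subtype.ext (e' r)
  · have h2 : ¬ (Continuous (fun r : unitInterval => g (a + r * (b - a))) ∧
        ∀ r : unitInterval, vec (g (a + r * (b - a))) ≠ 0) :=
      fun h2 => h1 ⟨e ▸ h2.1, fun r => (e' r).symm ▸ h2.2 r⟩
    rw [dif_neg h1, dif_neg h2]

/-- Paths of directions in a star-shaped region are determined up to boundaries by their ends. -/
theorem exists_potential {E : Type*} [NormedAddCommGroup E] [NormedSpace ℝ E] {K : Set E} {x₀ : E}
    (hK : StarConvex ℝ x₀ K) {D : E → Tan M} (hD : ContinuousOn D K)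
    (hne : ∀ w ∈ K, vec (D w) ≠ 0) :
    ∃ k : E → ExtChain M, ∀ (p : ℝ → E) (a b : ℝ), ContinuousOn p (uIcc a b) →
      MapsTo p (uIcc a b) K → cls (dirArc (fun t => D (p t)) a b) = k (p b) - k (p a) := by
  refine ⟨fun w => cls (dirArc (fun r => D (x₀ + r • (w - x₀))) 0 1), fun p a b hp hpK => ?_⟩
  have hst : ∀ w ∈ K, ∀ r : ℝ, 0 ≤ r → r ≤ 1 → x₀ + r • (w - x₀) ∈ K := by
    intro w hw r h0 h1
    have := hK hw (sub_nonneg.2 h1) h0 (by ring)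
    convert this using 1
    module
  have hq : Continuous fun r : unitInterval => p (a + r * (b - a)) :=
    hp.comp_continuous (by fun_prop) fun r => segment_mem_uIcc r.2.1 r.2.2
  have hqK : ∀ r : unitInterval, p (a + r * (b - a)) ∈ K :=
    fun r => hpK (segment_mem_uIcc r.2.1 r.2.2)
  have hHK : ∀ x : unitInterval × unitInterval,
      x₀ + (x.2 : ℝ) • (p (a + x.1 * (b - a)) - x₀) ∈ K :=
    fun x => hst _ (hqK x.1) _ x.2.2.1 x.2.2.2
  let H : C(unitInterval × unitInterval, Dir M) :=
    ⟨fun x => ⟨D (x₀ + (x.2 : ℝ) • (p (a + x.1 * (b - a)) - x₀)), hne _ (hHK x)⟩, by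
      refine Continuous.subtype_mk (hD.comp_continuous ?_ hHK) _
      exact continuous_const.add ((continuous_subtype_val.comp continuous_snd).smul
        ((hq.comp continuous_fst).sub continuous_const))⟩
  have hsq := cls_eq_zero (boundary_square_mem H)
  have hray : ∀ w ∈ K, ContinuousOn (fun r : ℝ => D (x₀ + r • (w - x₀))) (uIcc 0 1) := by
    intro w hw
    refine hD.comp (by fun_prop) fun r hr => ?_
    rw [uIcc_of_le zero_le_one] at hr
    exact hst w hw r hr.1 hr.2
  have hray' : ∀ w ∈ K, ∀ r ∈ uIcc (0 : ℝ) 1, vec (D (x₀ + r • (w - x₀))) ≠ 0 := by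
    intro w hw r hr
    rw [uIcc_of_le zero_le_one] at hr
    exact hne _ (hst w hw r hr.1 hr.2)
  obtain ⟨g, hg, hg'⟩ := dirArc_of (f := fun t => D (p t)) (a := a) (b := b)
    (hD.comp hp hpK) (fun t ht => hne _ (hpK ht))
  have hpa : p a ∈ K := hpK left_mem_uIcc
  have hpb : p b ∈ K := hpK right_mem_uIcc
  obtain ⟨ga, hga, hga'⟩ := dirArc_of (hray _ hpa) (hray' _ hpa)
  obtain ⟨gb, hgb, hgb'⟩ := dirArc_of (hray _ hpb) (hray' _ hpb)
  have e1 : H.comp ⟨fun t => (t, 0), by fun_prop⟩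
      = ContinuousMap.const _ (H (0, 0)) := by
    ext1 t
    exact Subtype.ext (by simp [H])
  have e2 : H.comp ⟨fun t => (1, t), by fun_prop⟩ = gb := by
    ext1 t
    refine Subtype.ext ?_
    rw [hgb]
    simp [H]
  have e3 : H.comp ⟨fun t => (t, 1), by fun_prop⟩ = g := by
    ext1 t
    refine Subtype.ext ?_
    rw [hg]
    simp [H]
  have e4 : H.comp ⟨fun t => (0, t), by fun_prop⟩ = ga := by
    ext1 t
    refine Subtype.ext ?_
    rw [hga]
    simp [H]
  rw [e1, e2, e3, e4, cls_sub, cls_sub, cls_add, cls_eq_zero (const_mem_boundaries _)] at hsq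
  simp only []
  rw [hg', hga', hgb']
  rw [zero_add] at hsq
  have : cls (FreeAbelianGroup.of gb) - cls (FreeAbelianGroup.of ga) - cls (FreeAbelianGroup.of g) = 0 := by
    rw [← hsq]; abel
  exact (sub_eq_zero.1 this).symm

/-- The class of an arc depends on its ends through a function on the parameter interval. -/
theorem exists_primitive {f : ℝ → Tan M} {s : Set ℝ} (hs : s.OrdConnected)
    (hf : ContinuousOn f s) (hne : ∀ t ∈ s, vec (f t) ≠ 0) :
    ∃ k : ℝ → ExtChain M, ∀ (h : ℝ → ℝ) (a b : ℝ), ContinuousOn h (uIcc a b) →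
      MapsTo h (uIcc a b) s → cls (dirArc (fun t => f (h t)) a b) = k (h b) - k (h a) := by
  rcases s.eq_empty_or_nonempty with rfl | ⟨x, hx⟩
  · exact ⟨0, fun h a b _ hm => (hm left_mem_uIcc).elim⟩
  · exact exists_potential (hs.convex.starConvex hx) hf hne

theorem cls_dirArc_comp {f : ℝ → Tan M} {h : ℝ → ℝ} {a b : ℝ} {s : Set ℝ} (hs : s.OrdConnected)
    (hf : ContinuousOn f s) (hne : ∀ t ∈ s, vec (f t) ≠ 0) (hh : ContinuousOn h (uIcc a b))
    (hm : MapsTo h (uIcc a b) s) :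
    cls (dirArc (fun t => f (h t)) a b) = cls (dirArc f (h a) (h b)) := by
  obtain ⟨k, hk⟩ := exists_primitive hs hf hne
  rw [hk h a b hh hm]
  have hsub : uIcc (h a) (h b) ⊆ s := hs.uIcc_subset (hm left_mem_uIcc) (hm right_mem_uIcc)
  exact (hk id _ _ continuousOn_id hsub).symm

theorem cls_dirArc_add {f : ℝ → Tan M} {a b c : ℝ} {s : Set ℝ} (hs : s.OrdConnected)
    (hf : ContinuousOn f s) (hne : ∀ t ∈ s, vec (f t) ≠ 0) (ha : a ∈ s) (hb : b ∈ s) (hc : c ∈ s) :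
    cls (dirArc f a b) + cls (dirArc f b c) = cls (dirArc f a c) := by
  obtain ⟨k, hk⟩ := exists_primitive hs hf hne
  have e := fun x (hx : x ∈ s) y (hy : y ∈ s) =>
    hk id x y continuousOn_id (hs.uIcc_subset hx hy)
  simp only [id] at e
  rw [e a ha b hb, e b hb c hc, e a ha c hc]
  abel

theorem cls_dirArc_self {f : ℝ → Tan M} {a : ℝ} (hne : vec (f a) ≠ 0) :
    cls (dirArc f a a) = 0 := by
  have := cls_dirArc_add (f := f) (a := a) (b := a) (c := a) (s := {a}) ordConnected_singleton
    (continuousOn_singleton f a) (by simpa using hne) rfl rfl rfl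
  simpa using this

theorem cls_dirArc_symm {f : ℝ → Tan M} {a b : ℝ} (hf : ContinuousOn f (uIcc a b))
    (hne : ∀ t ∈ uIcc a b, vec (f t) ≠ 0) :
    cls (dirArc f b a) = -cls (dirArc f a b) := by
  have := cls_dirArc_add ordConnected_uIcc hf hne left_mem_uIcc right_mem_uIcc left_mem_uIcc
  rw [cls_dirArc_self (hne _ left_mem_uIcc)] at this
  exact eq_neg_of_add_eq_zero_right this

section Series

variable (Z : ExtChain M →+ ℝ)

theorem sym_zero : sym (0 : ExtChain M) = 1 := rfl

theorem sym_add (a b : ExtChain M) : sym (a + b) = sym a * sym b := by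
  rw [sym, sym, sym, ← map_mul, AddMonoidAlgebra.single_mul_single, mul_one]

theorem sym_fibre {w : Tan M} (hw : vec w ≠ 0) : sym (cls (fibreLoop w)) = -1 := by
  have : Ideal.Quotient.mk (twistIdeal M)
      (AddMonoidAlgebra.single (cls (fibreLoop w)) 1 + 1) = 0 :=
    Ideal.Quotient.eq_zero_iff_mem.2 (Ideal.subset_span ⟨w, hw, rfl⟩)
  rw [map_add, map_one] at this
  exact eq_neg_of_add_eq_zero_left this

theorem two_nsmul_fibre {w : Tan M} (hw : vec w ≠ 0) : 2 • cls (fibreLoop w) = 0 :=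
  (QuotientAddGroup.eq_zero_iff _).2
    (AddSubgroup.mem_sup_right (AddSubgroup.subset_closure ⟨w, hw, rfl⟩))

theorem weight_fibre {w : Tan M} (hw : vec w ≠ 0) : Z (cls (fibreLoop w)) = 0 := by
  have : Z (2 • cls (fibreLoop w)) = 0 := by rw [two_nsmul_fibre hw, map_zero]
  rw [map_nsmul] at this
  simpa using this

theorem X_zero : X Z (0 : ExtChain M) = 1 := by
  rw [X, map_zero, sym_zero]
  rfl

theorem X_add (a b : ExtChain M) : X Z (a + b) = X Z a * X Z b := by
  rw [X, X, X, HahnSeries.single_mul_single, map_add, sym_add]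

theorem X_fibre {w : Tan M} (hw : vec w ≠ 0) : X Z (cls (fibreLoop w)) = -1 := by
  rw [X, weight_fibre Z hw, sym_fibre hw, HahnSeries.single_neg]
  rfl

theorem X_nsmul_fibre {w : Tan M} (hw : vec w ≠ 0) (n : ℕ) :
    X Z (n • cls (fibreLoop w)) = (-1) ^ n := by
  induction n with
  | zero => rw [zero_nsmul, X_zero, pow_zero]
  | succ n ih => rw [succ_nsmul, X_add, ih, X_fibre Z hw, pow_succ]

theorem X_mul_X_of_add_eq_zero {a b : ExtChain M} (h : a + b = 0) : X Z a * X Z b = 1 := by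
  rw [← X_add, h, X_zero]

variable {Z}

theorem SeriesIn.add {A : Set (ExtChain M)} {f g : Series M} (hf : SeriesIn Z A f)
    (hg : SeriesIn Z A g) : SeriesIn Z A (f + g) := fun r => by
  rw [HahnSeries.coeff_add]
  exact add_mem (hf r) (hg r)

theorem seriesIn_one {A : Set (ExtChain M)} (h : (0 : ExtChain M) ∈ A) : SeriesIn Z A 1 := by
  intro r
  rw [HahnSeries.coeff_one]
  split_ifs with hr
  · exact AddSubgroup.subset_closure ⟨0, h, by rw [map_zero, hr], sym_zero.symm⟩
  · exact zero_mem _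

theorem SeriesIn.mul {A B D : Set (ExtChain M)} {f g : Series M} (hf : SeriesIn Z A f)
    (hg : SeriesIn Z B g) (h : ∀ a ∈ A, ∀ b ∈ B, a + b ∈ D) : SeriesIn Z D (f * g) := by
  intro r
  rw [HahnSeries.coeff_mul]
  refine sum_mem fun ij hij => ?_
  have hr : ij.1 + ij.2 = r := (Finset.mem_antidiagonal.1 hij).2.2
  have h1 := hf ij.1
  have h2 := hg ij.2
  generalize f.coeff ij.1 = x at h1
  generalize g.coeff ij.2 = y at h2
  induction h1 using AddSubgroup.closure_induction with
  | zero => rw [zero_mul]; exact zero_mem _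
  | add _ _ _ _ hx hy => rw [add_mul]; exact add_mem hx hy
  | neg x _ hx => exact (neg_mul x y : -x * y = -(x * y)) ▸ neg_mem hx
  | mem x hx =>
    obtain ⟨a, ha, hZa, rfl⟩ := hx
    induction h2 using AddSubgroup.closure_induction with
    | zero => rw [mul_zero]; exact zero_mem _
    | add x y _ _ hx hy => rw [mul_add]; exact add_mem hx hy
    | neg x _ hx => exact (mul_neg (sym a) x : sym a * -x = -(sym a * x)) ▸ neg_mem hx
    | mem x hx =>
      obtain ⟨b, hb, hZb, rfl⟩ := hx
      exact AddSubgroup.subset_closure ⟨a + b, h a ha b hb, by rw [map_add, hZa, hZb, hr],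
        (sym_add a b).symm⟩

theorem charges_add_mem_extH1 {w w' : Tan M} {a b : ExtChain M} (ha : a ∈ charges w w')
    (hb : b ∈ charges w' w) : a + b ∈ extH1 M := by
  obtain ⟨c, rfl, hc⟩ := ha
  obtain ⟨d, rfl, hd⟩ := hb
  refine ⟨c + d, ?_, rfl⟩
  have h0 : FreeAbelianGroup.map (fun d : Dir M => d.1) (bdry1 (Dir M) (c + d)) = 0 := by
    rw [map_add, map_add, hc, hd]
    abel
  let r : FreeAbelianGroup (Tan M) →+ FreeAbelianGroup (Dir M) :=
    open Classical in
    FreeAbelianGroup.lift fun w => if h : vec w ≠ 0 then FreeAbelianGroup.of ⟨w, h⟩ else 0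
  have hr : ∀ x, r (FreeAbelianGroup.map (fun d : Dir M => d.1) x) = x := by
    intro x
    induction x using FreeAbelianGroup.induction_on with
    | zero => simp
    | of x => simp [r, x.2]
    | neg x hx => rw [map_neg, map_neg, hx]
    | add x y hx hy => rw [map_add, map_add, hx, hy]
  have := hr (bdry1 (Dir M) (c + d))
  rw [h0, map_zero] at this
  exact this.symm

end Series

@[simp] theorem vec_tan (x : M) (v : ℂ) : vec (tan x v) = v := rfl
@[simp] theorem tan_fst (x : M) (v : ℂ) : (tan x v).1 = x := rfl
@[simp] theorem velocity_fst (γ : ℝ → M) (t : ℝ) : (velocity γ t).1 = γ t := rfl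
@[simp] theorem opp_fst (w : Tan M) : (opp w).1 = w.1 := rfl
@[simp] theorem vec_opp (w : Tan M) : vec (opp w) = -vec w := rfl
@[simp] theorem opp_tan (x : M) (v : ℂ) : opp (tan x v) = tan x (-v) := rfl
@[simp] theorem opp_opp (w : Tan M) : opp (opp w) = w := by
  rw [opp, opp_fst, vec_opp, neg_neg]
  rfl

theorem tan_vec (w : Tan M) : tan w.1 (vec w) = w := rfl

theorem continuous_tan (x : M) : Continuous (tan x : ℂ → Tan M) :=
  FiberBundle.continuous_totalSpaceMk ℂ (TangentSpace 𝓒 : M → Type) x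

/-- Multiplication of tangent vectors by a scalar is continuous. -/
theorem continuousOn_smul {Y : Type*} [TopologicalSpace Y] {s : Set Y} {f : Y → Tan M} {c : Y → ℝ}
    (hf : ContinuousOn f s) (hc : ContinuousOn c s) :
    ContinuousOn (fun y => tan (f y).1 (c y • vec (f y))) s := by
  intro y hy
  have h := (FiberBundle.continuousWithinAt_totalSpace ℂ f).1 (hf y hy)
  refine (FiberBundle.continuousWithinAt_totalSpace ℂ _).2 ⟨h.1, ?_⟩
  refine ((hc y hy).smul h.2).congr_of_eventuallyEq ?_ ?_
  · have hb := (trivializationAt ℂ (TangentSpace 𝓒 : M → Type) (f y).1).open_baseSet.mem_nhds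
      (FiberBundle.mem_baseSet_trivializationAt' (f y).1)
    filter_upwards [h.1 hb] with z hz
    exact ((trivializationAt ℂ (TangentSpace 𝓒 : M → Type) (f y).1).linear ℝ hz).map_smul
      (c z) (f z).2
  · exact ((trivializationAt ℂ (TangentSpace 𝓒 : M → Type) (f y).1).linear ℝ
      (FiberBundle.mem_baseSet_trivializationAt' (f y).1)).map_smul (c y) (f y).2

theorem continuousOn_opp {Y : Type*} [TopologicalSpace Y] {s : Set Y} {f : Y → Tan M}
    (hf : ContinuousOn f s) : ContinuousOn (fun y => opp (f y)) s := by
  have := continuousOn_smul hf (c := fun _ => -1) continuousOn_const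
  refine this.congr fun y _ => ?_
  simp [opp]

theorem continuous_tan_model : Continuous (fun p : ℂ × ℂ => (tan p.1 p.2 : Tan ℂ)) :=
  (tangentBundleModelSpaceHomeomorph 𝓒).symm.continuous

theorem continuous_vec_model : Continuous (vec : Tan ℂ → ℂ) :=
  continuous_snd.comp (tangentBundleModelSpaceHomeomorph 𝓒).continuous

/-- The action of a map of surfaces on tangent vectors. -/
def push {M' : Type*} [TopologicalSpace M'] [ChartedSpace ℂ M'] (f : M → M') (w : Tan M) : Tan M' :=
  tan (f w.1) (der f w.1 (vec w))

theorem continuousOn_tangentMap_of_contMDiffAt {E H N : Type*} [NormedAddCommGroup E]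
    [NormedSpace ℝ E] [TopologicalSpace H] {I : ModelWithCorners ℝ E H} [TopologicalSpace N]
    [ChartedSpace H N] [IsManifold I 1 N] {f : N → M} {s : Set N}
    (hf : ∀ x ∈ s, ContMDiffAt I 𝓒 1 f x) {Y : Type*} [TopologicalSpace Y] {t : Set Y}
    {g : Y → TangentBundle I N} (hg : ContinuousOn g t) (hgs : ∀ y ∈ t, (g y).1 ∈ s) :
    ContinuousOn (fun y => tangentMap I 𝓒 f (g y)) t := by
  have : IsManifold 𝓒 1 M := IsManifold.of_le (n := ∞) (by simp)
  intro y hy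
  obtain ⟨u, hu, hfu⟩ := (contMDiffAt_iff_contMDiffOn_nhds (by simp)).1 (hf _ (hgs y hy))
  obtain ⟨v, hvu, hvo, hv⟩ := mem_nhds_iff.1 hu
  have hfv := (hfu.mono hvu).continuousOn_tangentMapWithin le_rfl hvo.uniqueMDiffOn
  have hbase : ContinuousWithinAt (fun y => (g y).1) t y :=
    (FiberBundle.continuous_proj E (TangentSpace I : N → Type _)).continuousAt.comp_continuousWithinAt
      (hg y hy)
  have h1 : ContinuousAt (tangentMap I 𝓒 f) (g y) := by
    have hn : Bundle.TotalSpace.proj ⁻¹' v ∈ 𝓝 (g y) :=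
      (hvo.preimage (FiberBundle.continuous_proj E (TangentSpace I : N → Type _))).mem_nhds hv
    refine (hfv.continuousAt hn).congr ?_
    filter_upwards [hn] with w hw
    simp only [tangentMap, tangentMapWithin, mfderivWithin_of_isOpen hvo hw]
  exact h1.comp_continuousWithinAt (hg y hy)

theorem continuousOn_push {M' : Type*} [TopologicalSpace M'] [ChartedSpace ℂ M']
    [IsManifold 𝓒 ∞ M'] {f : M → M'} {Y : Type*} [TopologicalSpace Y] {t : Set Y}
    {g : Y → Tan M} (hg : ContinuousOn g t)
    (hf : ∀ y ∈ t, ContMDiffAt 𝓒 𝓒 1 f (g y).1) :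
    ContinuousOn (fun y => push f (g y)) t :=
  have : IsManifold 𝓒 1 M := IsManifold.of_le (n := ∞) (by simp)
  continuousOn_tangentMap_of_contMDiffAt (s := {x | ContMDiffAt 𝓒 𝓒 1 f x})
    (fun _ hx => hx) hg hf

theorem continuousOn_velocity {γ : ℝ → M} {s : Set ℝ}
    (h : ∀ t ∈ s, ContMDiffAt 𝓡 𝓒 1 γ t) : ContinuousOn (velocity γ) s := by
  have : Continuous (fun t : ℝ => (⟨t, 1⟩ : TangentBundle 𝓡 ℝ)) :=
    (tangentBundleModelSpaceHomeomorph 𝓡).symm.continuous.comp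
      (continuous_id.prodMk continuous_const)
  exact continuousOn_tangentMap_of_contMDiffAt h this.continuousOn fun _ hy => hy

theorem velocity_comp {γ : ℝ → M} {h : ℝ → ℝ} {t d : ℝ}
    (hγ : MDifferentiableAt 𝓡 𝓒 γ (h t)) (hh : HasDerivAt h d t) :
    velocity (fun t => γ (h t)) t = tan (γ (h t)) (d • vec (velocity γ (h t))) := by
  have e := HasMFDerivAt.comp t hγ.hasMFDerivAt hh.hasFDerivAt.hasMFDerivAt
  have e' : mfderiv 𝓡 𝓒 (fun t => γ (h t)) t = _ := e.mfderiv
  simp only [velocity, tan]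
  congr 1
  rw [e']
  have : (ContinuousLinearMap.toSpanSingleton ℝ d : ℝ →L[ℝ] ℝ) (1 : ℝ) = d • (1 : ℝ) := by simp
  refine Eq.trans ?_ (map_smul (mfderiv 𝓡 𝓒 γ (h t)) d (1 : ℝ))
  exact congrArg (mfderiv 𝓡 𝓒 γ (h t)) this

theorem velocity_push {M' : Type*} [TopologicalSpace M'] [ChartedSpace ℂ M'] {f : M → M'}
    {γ : ℝ → M} {t : ℝ} (hf : MDifferentiableAt 𝓒 𝓒 f (γ t))
    (hγ : MDifferentiableAt 𝓡 𝓒 γ t) :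
    velocity (fun t => f (γ t)) t = push f (velocity γ t) := by
  have e' : mfderiv 𝓡 𝓒 (fun t => f (γ t)) t = _ :=
    (HasMFDerivAt.comp t hf.hasMFDerivAt hγ.hasMFDerivAt).mfderiv
  simp only [velocity, push, tan]
  congr 1
  rw [e']
  rfl

theorem push_opp {M' : Type*} [TopologicalSpace M'] [ChartedSpace ℂ M']
    [IsManifold 𝓒 ∞ M'] (f : M → M') (w : Tan M) :
    push f (opp w) = opp (push f w) := by
  simp only [push, opp_fst, vec_opp, map_neg, opp_tan]

theorem velocity_congr {γ γ' : ℝ → M} {t : ℝ} (h : γ =ᶠ[𝓝 t] γ') :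
    velocity γ t = velocity γ' t := by
  simp only [velocity, tan]
  rw [h.eq_of_nhds, h.mfderiv_eq]

theorem velocity_reverse (γ : ℝ → M) (hγ : ContMDiff 𝓡 𝓒 1 γ) (t : ℝ) :
    velocity (fun t => γ (1 - t)) t = opp (velocity γ (1 - t)) := by
  rw [velocity_comp (h := fun t => 1 - t) (d := -1)
    ((hγ.mdifferentiable (by simp)) _) (by simpa using (hasDerivAt_id t).const_sub 1)]
  simp [opp]

/-- A smooth local inverse of a branched cover near an unramified point. -/
structure LocalSection (π : S → C) (x : S) where
  source : Set S
  inv : C → S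
  isOpen_source : IsOpen source
  mem : x ∈ source
  left_inv : ∀ y ∈ source, inv (π y) = y
  smooth : ∀ y ∈ source, ContMDiffAt 𝓒 𝓒 ∞ π y
  inv_smooth : ∀ y ∈ source, ContMDiffAt 𝓒 𝓒 ∞ inv (π y)
  right_inv : ∀ y ∈ source, ∀ᶠ z in 𝓝 (π y), π (inv z) = z ∧ inv z ∈ source
  det_pos : ∀ y ∈ source, 0 < LinearMap.det (der π y : ℂ →ₗ[ℝ] ℂ)

theorem IsSimpleBranchedCover.exists_charts (hπ : IsSimpleBranchedCover π K) {x : S}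
    (hx : π x ∉ branchPoints π) : ∃ e ∈ orientedCharts S, ∃ e' ∈ orientedCharts C, x ∈ e.source ∧
      ∀ y ∈ e.source, π y ∈ e'.source ∧ e' (π y) = e y := by
  obtain ⟨n, hn, e, he, e', he', hxe, h0, -, h⟩ := hπ.local_form x
  rcases hn with rfl | rfl
  · exact ⟨e, he, e', he', hxe, fun y hy => by simpa using h y hy⟩
  · refine (hx ⟨x, ?_, rfl⟩).elim
    rintro ⟨U, hU, hinj⟩
    have h1 : ∀ᶠ z in 𝓝 (0 : ℂ), e.symm z ∈ U ∧ z ∈ e.target := by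
      refine Filter.Eventually.and ?_ ?_
      · have := e.continuousAt_symm (x := 0) (h0 ▸ e.map_source hxe)
        refine this.eventually_mem ?_
        rwa [← h0, e.left_inv hxe]
      · exact e.open_target.mem_nhds (h0 ▸ e.map_source hxe)
    have h2 : ∀ᶠ z in 𝓝 (0 : ℂ), e.symm (-z) ∈ U ∧ -z ∈ e.target := by
      have : Filter.Tendsto (fun z : ℂ => -z) (𝓝 0) (𝓝 0) := by
        simpa using (continuous_neg (G := ℂ)).tendsto 0
      exact this.eventually h1
    have h3 : ∀ᶠ z in 𝓝[≠] (0 : ℂ), z ≠ 0 ∧ (e.symm z ∈ U ∧ z ∈ e.target) ∧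
        (e.symm (-z) ∈ U ∧ -z ∈ e.target) :=
      (eventually_mem_nhdsWithin (a := (0 : ℂ)) (s := {0}ᶜ)).and
        ((h1.and h2).filter_mono nhdsWithin_le_nhds)
    obtain ⟨z, hz, ⟨hzU, hzt⟩, hzU', hzt'⟩ := h3.exists
    have a := h _ (e.map_target hzt)
    have b := h _ (e.map_target hzt')
    have hπe : π (e.symm z) = π (e.symm (-z)) := by
      refine e'.injOn a.1 b.1 ?_
      rw [a.2, b.2, e.right_inv hzt, e.right_inv hzt', neg_sq]
    have := congrArg e (hinj hzU hzU' hπe)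
    rw [e.right_inv hzt, e.right_inv hzt'] at this
    exact hz (self_eq_neg.1 this)

theorem IsSimpleBranchedCover.nonempty_localSection (hπ : IsSimpleBranchedCover π K) {x : S}
    (hx : π x ∉ branchPoints π) : Nonempty (LocalSection π x) := by
  obtain ⟨e, he, e', he', hxe, h⟩ := hπ.exists_charts hx
  have hev : ∀ y ∈ e.source, ∀ᶠ z in 𝓝 (π y), z ∈ e'.source ∧ e' z ∈ e.target := by
    intro y hy
    refine Filter.Eventually.and (e'.open_source.mem_nhds (h y hy).1) ?_
    refine (e'.continuousAt (h y hy).1).eventually_mem (e.open_target.mem_nhds ?_)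
    rw [(h y hy).2]
    exact e.map_source hy
  have hsm : ∀ y ∈ e.source, ContMDiffAt 𝓒 𝓒 ∞ π y := by
    intro y hy
    have h1 : ContMDiffAt 𝓒 𝓒 ∞ e y :=
      (contMDiffOn_of_mem_maximalAtlas he.1).contMDiffAt (e.open_source.mem_nhds hy)
    have ht : e y ∈ e'.target := (h y hy).2 ▸ e'.map_source (h y hy).1
    have h2 : ContMDiffAt 𝓒 𝓒 ∞ e'.symm (e y) :=
      (contMDiffOn_symm_of_mem_maximalAtlas he'.1).contMDiffAt (e'.open_target.mem_nhds ht)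
    refine (h2.comp y h1).congr_of_eventuallyEq ?_
    filter_upwards [e.open_source.mem_nhds hy] with z hz
    rw [Function.comp_apply, ← (h z hz).2, e'.left_inv (h z hz).1]
  refine ⟨⟨e.source, fun z => e.symm (e' z), e.open_source, hxe, fun y hy => ?_, hsm,
    fun y hy => ?_, fun y hy => ?_, fun y hy => ?_⟩⟩
  · rw [(h y hy).2, e.left_inv hy]
  · have h1 : ContMDiffAt 𝓒 𝓒 ∞ e' (π y) :=
      (contMDiffOn_of_mem_maximalAtlas he'.1).contMDiffAt (e'.open_source.mem_nhds (h y hy).1)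
    have ht : e' (π y) ∈ e.target := (h y hy).2 ▸ e.map_source hy
    have h2 : ContMDiffAt 𝓒 𝓒 ∞ e.symm (e' (π y)) :=
      (contMDiffOn_symm_of_mem_maximalAtlas he.1).contMDiffAt (e.open_target.mem_nhds ht)
    exact h2.comp _ h1
  · filter_upwards [hev y hy] with z hz
    have := h _ (e.map_target hz.2)
    refine ⟨?_, e.map_target hz.2⟩
    refine e'.injOn this.1 hz.1 ?_
    rw [this.2, e.right_inv hz.2]
  · have h1 : MDifferentiableAt 𝓒 𝓒 e' (π y) :=
      ((contMDiffOn_of_mem_maximalAtlas he'.1).contMDiffAt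
        (e'.open_source.mem_nhds (h y hy).1)).mdifferentiableAt (by simp)
    have h2 := (hsm y hy).mdifferentiableAt (by simp)
    have h3 : mfderiv 𝓒 𝓒 e y
        = (mfderiv 𝓒 𝓒 e' (π y)).comp (mfderiv 𝓒 𝓒 π y) := by
      rw [← mfderiv_comp y h1 h2]
      refine Filter.EventuallyEq.mfderiv_eq ?_
      filter_upwards [e.open_source.mem_nhds hy] with z hz
      exact (h z hz).2.symm
    have h4 : jac e y = jac e' (π y) * LinearMap.det (der π y : ℂ →ₗ[ℝ] ℂ) := by
      rw [jac, jac, ← LinearMap.det_comp]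
      exact congrArg (fun f : ℂ →L[ℝ] ℂ => LinearMap.det (f : ℂ →ₗ[ℝ] ℂ)) h3
    have h5 := he.2 y hy
    rw [h4] at h5
    exact (pos_iff_pos_of_mul_pos h5).1 (he'.2 _ (h y hy).1)

theorem LocalSection.der_comp {x : S} (L : LocalSection π x) {y : S} (hy : y ∈ L.source) :
    (der π y).comp (der L.inv (π y)) = ContinuousLinearMap.id ℝ ℂ ∧
      (der L.inv (π y)).comp (der π y) = ContinuousLinearMap.id ℝ ℂ := by
  have h1 := (L.smooth y hy).mdifferentiableAt (by simp)
  have h2 := (L.inv_smooth y hy).mdifferentiableAt (by simp)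
  constructor
  · have h1' : MDifferentiableAt 𝓒 𝓒 π (L.inv (π y)) := by rwa [L.left_inv y hy]
    have e := mfderiv_comp (π y) h1' h2
    rw [L.left_inv y hy] at e
    refine Eq.trans e.symm ?_
    refine Eq.trans (Filter.EventuallyEq.mfderiv_eq (f := id) ?_) mfderiv_id
    filter_upwards [L.right_inv y hy] with z hz
    exact hz.1
  · have e := mfderiv_comp y h2 h1
    refine Eq.trans e.symm ?_
    refine Eq.trans (Filter.EventuallyEq.mfderiv_eq (f := id) ?_) mfderiv_id
    filter_upwards [L.isOpen_source.mem_nhds hy] with z hz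
    exact L.left_inv z hz

theorem LocalSection.liftVec_eq {x : S} (L : LocalSection π x) {y : S} (hy : y ∈ L.source) (v : ℂ) :
    liftVec π y v = der L.inv (π y) v := by
  obtain ⟨h1, h2⟩ := L.der_comp hy
  let e : ℂ ≃L[ℝ] ℂ := ContinuousLinearEquiv.equivOfInverse (der π y) (der L.inv (π y))
    (fun v => congrArg (fun f : ℂ →L[ℝ] ℂ => f v) h2)
    (fun v => congrArg (fun f : ℂ →L[ℝ] ℂ => f v) h1)
  have he : der π y = (e : ℂ →L[ℝ] ℂ) := rfl
  rw [liftVec, he, ContinuousLinearMap.inverse_equiv]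
  rfl

section

variable (hπ : IsSimpleBranchedCover π K) {x : S} (hx : π x ∉ branchPoints π)

include hπ hx

theorem IsSimpleBranchedCover.der_liftVec (v : ℂ) : der π x (liftVec π x v) = v := by
  obtain ⟨L⟩ := hπ.nonempty_localSection hx
  rw [L.liftVec_eq L.mem]
  exact congrArg (fun f : ℂ →L[ℝ] ℂ => f v) (L.der_comp L.mem).1

theorem IsSimpleBranchedCover.liftVec_der (v : ℂ) : liftVec π x (der π x v) = v := by
  obtain ⟨L⟩ := hπ.nonempty_localSection hx
  rw [L.liftVec_eq L.mem]
  exact congrArg (fun f : ℂ →L[ℝ] ℂ => f v) (L.der_comp L.mem).2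

theorem IsSimpleBranchedCover.der_ne_zero {v : ℂ} (hv : v ≠ 0) : der π x v ≠ 0 := by
  intro h
  apply hv
  rw [← hπ.liftVec_der hx v, h]
  exact map_zero (der π x).inverse

theorem IsSimpleBranchedCover.mdifferentiableAt : MDifferentiableAt 𝓒 𝓒 π x := by
  obtain ⟨L⟩ := hπ.nonempty_localSection hx
  exact (L.smooth x L.mem).mdifferentiableAt (by simp)

theorem IsSimpleBranchedCover.contMDiffAt : ContMDiffAt 𝓒 𝓒 1 π x := by
  obtain ⟨L⟩ := hπ.nonempty_localSection hx
  exact (L.smooth x L.mem).of_le (by simp)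

end

theorem liftVec_neg (x : S) (v : ℂ) : liftVec π x (-v) = -liftVec π x v :=
  map_neg (der π x).inverse v

theorem liftVec_smul (x : S) (c : ℝ) (v : ℂ) : liftVec π x (c • v) = c • liftVec π x v :=
  map_smul (der π x).inverse c v

theorem liftVec_add (x : S) (v w : ℂ) : liftVec π x (v + w) = liftVec π x v + liftVec π x w :=
  map_add (der π x).inverse v w

theorem wedge_map (A : ℂ →L[ℝ] ℂ) (v w : ℂ) :
    wedge (A v) (A w) = LinearMap.det (A : ℂ →ₗ[ℝ] ℂ) * wedge v w := by
  have hA : ∀ z : ℂ, A z = z.re • A 1 + z.im • A Complex.I := by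
    intro z
    rw [← map_smul, ← map_smul, ← map_add]
    congr 1
    apply Complex.ext <;> simp
  have hdet : LinearMap.det (A : ℂ →ₗ[ℝ] ℂ) = (A 1).re * (A Complex.I).im
      - (A Complex.I).re * (A 1).im := by
    rw [← LinearMap.det_toMatrix Complex.basisOneI, Matrix.det_fin_two]
    simp [LinearMap.toMatrix_apply, Complex.coe_basisOneI_repr, Complex.coe_basisOneI]
  rw [hdet, hA v, hA w]
  simp [wedge, Complex.add_re, Complex.add_im]
  ring

/-- The lift to a point of the cover of a tangent vector of the base. -/
def liftTan (π : S → C) (x : S) (v : ℂ) : Tan S := tan x (liftVec π x v)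

theorem continuousOn_liftTan (hπ : IsSimpleBranchedCover π K) {Y : Type*} [TopologicalSpace Y]
    {s : Set Y} {g : Y → Tan C} {c : Y → S} (hg : ContinuousOn g s) (hc : ContinuousOn c s)
    (hgc : ∀ y ∈ s, π (c y) = (g y).1) (hbr : ∀ y ∈ s, π (c y) ∉ branchPoints π) :
    ContinuousOn (fun y => liftTan π (c y) (vec (g y))) s := by
  intro y hy
  obtain ⟨L⟩ := hπ.nonempty_localSection (hbr y hy)
  have h1 : ∀ᶠ z in 𝓝[s] y, c z ∈ L.source :=
    (hc y hy).eventually_mem (L.isOpen_source.mem_nhds L.mem)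
  have h2 : ∀ z ∈ s ∩ c ⁻¹' L.source, push L.inv (g z) = liftTan π (c z) (vec (g z)) := by
    intro z hz
    rw [liftTan, L.liftVec_eq hz.2, push, hgc z hz.1, ← hgc z hz.1, L.left_inv _ hz.2]
  have h3 : ContinuousOn (fun z => push L.inv (g z)) (s ∩ c ⁻¹' L.source) := by
    refine continuousOn_push (hg.mono inter_subset_left) fun z hz => ?_
    rw [← hgc z hz.1]
    exact (L.inv_smooth _ hz.2).of_le (by simp)
  have h4 := (h3.congr fun z hz => (h2 z hz).symm) y ⟨hy, L.mem⟩
  exact h4.mono_of_mem_nhdsWithin (Filter.inter_mem self_mem_nhdsWithin h1)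

theorem IsSimpleBranchedCover.isCoveringMapOn [T2Space S] (hπ : IsSimpleBranchedCover π K) :
    IsCoveringMapOn π (branchPoints π)ᶜ := by
  refine hπ.proper.isClosedMap.isCoveringMapOn_of_isLocalHomeomorphOn (fun z hz => ?_) ?_
  · exact Set.finite_of_ncard_pos (by rw [hπ.card_fibre z hz]; exact hπ.degree_pos)
  · refine IsLocalHomeomorphOn.mk _ _ fun x hx => ?_
    obtain ⟨e, he, e', he', hxe, h⟩ := hπ.exists_charts hx
    have ht : ∀ y ∈ e.source, e y ∈ e'.target := fun y hy => by
      rw [← (h y hy).2]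
      exact e'.map_source (h y hy).1
    refine ⟨e.trans e'.symm, ?_, fun y hy => ?_⟩
    · rw [OpenPartialHomeomorph.trans_source]
      exact ⟨hxe, ht x hxe⟩
    · rw [OpenPartialHomeomorph.trans_source] at hy
      rw [OpenPartialHomeomorph.trans_apply, ← (h y hy.1).2, e'.left_inv (h y hy.1).1]

theorem IsSimpleBranchedCover.exists_lift [T2Space S] (hπ : IsSimpleBranchedCover π K) {F : ℂ → C}
    (hF : Continuous F) (hbr : ∀ w, F w ∉ branchPoints π) {w₀ : ℂ} {x₀ : S} (h : π x₀ = F w₀) :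
    ∃ G : ℂ → S, Continuous G ∧ (∀ w, π (G w) = F w) ∧ G w₀ = x₀ := by
  obtain ⟨G, ⟨h1, h2⟩, -⟩ := hπ.isCoveringMapOn.existsUnique_continuousMap_lifts ⟨F, hF⟩ h hbr
  exact ⟨G, G.continuous, fun w => congrFun h2 w, h1⟩

theorem IsSimpleBranchedCover.lift_unique [T2Space S] (hπ : IsSimpleBranchedCover π K) {Y : Type*}
    [TopologicalSpace Y] {s : Set Y} (hs : IsPreconnected s) {c c' : Y → S} (hc : ContinuousOn c s)
    (hc' : ContinuousOn c' s) (h : ∀ y ∈ s, π (c y) = π (c' y))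
    (hbr : ∀ y ∈ s, π (c y) ∉ branchPoints π) {y₀ : Y} (hy₀ : y₀ ∈ s) (h₀ : c y₀ = c' y₀) :
    ∀ y ∈ s, c y = c' y := by
  have hcov := hπ.isCoveringMapOn.isCoveringMap_restrictPreimage
  have : PreconnectedSpace s := Subtype.preconnectedSpace hs
  let g : s → π ⁻¹' (branchPoints π)ᶜ := fun y => ⟨c y, hbr y y.2⟩
  let g' : s → π ⁻¹' (branchPoints π)ᶜ := fun y => ⟨c' y, by
    rw [mem_preimage, ← h y y.2]
    exact hbr y y.2⟩
  have hg : Continuous g := (continuousOn_iff_continuous_domRestrict.1 hc).subtype_mk _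
  have hg' : Continuous g' := (continuousOn_iff_continuous_domRestrict.1 hc').subtype_mk _
  have := hcov.eq_of_comp_eq hg hg' (funext fun y => Subtype.ext (h y y.2)) ⟨y₀, hy₀⟩
    (Subtype.ext h₀)
  exact fun y hy => congrArg Subtype.val (congrFun this ⟨y, hy⟩)

/-- A continuous lift of a smooth map is smooth, and acts on tangent vectors by lifting them. -/
theorem IsSimpleBranchedCover.lift_smooth (hπ : IsSimpleBranchedCover π K) {F : ℂ → C} {G : ℂ → S}
    (hG : Continuous G) (h : ∀ w, π (G w) = F w) {w : ℂ} (hbr : F w ∉ branchPoints π)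
    (hF : ContMDiffAt 𝓒 𝓒 1 F w) :
    ContMDiffAt 𝓒 𝓒 1 G w ∧
      ∀ v, push G (tan w v) = liftTan π (G w) (vec (push F (tan w v))) := by
  rw [← h] at hbr
  obtain ⟨L⟩ := hπ.nonempty_localSection hbr
  have he : G =ᶠ[𝓝 w] fun z => L.inv (F z) := by
    filter_upwards [hG.continuousAt.eventually_mem (L.isOpen_source.mem_nhds L.mem)] with z hz
    rw [← h, L.left_inv _ hz]
  have h1 : ContMDiffAt 𝓒 𝓒 1 L.inv (F w) := by
    rw [← h]
    exact (L.inv_smooth _ L.mem).of_le (by simp)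
  refine ⟨(h1.comp w hF).congr_of_eventuallyEq he, fun v => ?_⟩
  have e' : mfderiv 𝓒 𝓒 G w = _ := he.mfderiv_eq.trans
    (mfderiv_comp w (h1.mdifferentiableAt (by simp)) (hF.mdifferentiableAt (by simp)))
  simp only [liftTan, push, tan]
  congr 1
  rw [L.liftVec_eq L.mem, h]
  exact congrArg (fun f : ℂ →L[ℝ] ℂ => f v) e'

section Street

variable (p : Street π)

theorem Street.continuous_velocity_tgt : Continuous (velocity p.tgt) :=
  continuousOn_univ.1 (continuousOn_velocity fun t _ => p.tgt_smooth t)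

theorem Street.continuous_velocity_src : Continuous (velocity p.src) :=
  continuousOn_univ.1 (continuousOn_velocity fun t _ => p.src_smooth t)

theorem Street.continuous_opp_velocity_src : Continuous fun t => opp (velocity p.src t) :=
  continuousOn_univ.1 (continuousOn_opp p.continuous_velocity_src.continuousOn)

theorem Street.opp_src_regular : ∀ t ∈ 𝕀, vec (opp (velocity p.src t)) ≠ 0 :=
  fun t ht => by simpa using p.src_regular t ht

theorem Street.transport_add {a b c : ℝ} (ha : a ∈ 𝕀) (hb : b ∈ 𝕀)
    (hc : c ∈ 𝕀) : p.transport a b + p.transport b c = p.transport a c := by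
  have h1 := cls_dirArc_add ordConnected_Icc p.continuous_velocity_tgt.continuousOn p.tgt_regular
    ha hb hc
  have h2 := cls_dirArc_add ordConnected_Icc p.continuous_opp_velocity_src.continuousOn
    p.opp_src_regular ha hb hc
  simp only [Street.transport]
  rw [← h1, ← h2]
  abel

theorem Street.transport_self {a : ℝ} (ha : a ∈ 𝕀) : p.transport a a = 0 := by
  simpa using p.transport_add ha ha ha

theorem Street.transport_symm {a b : ℝ} (ha : a ∈ 𝕀) (hb : b ∈ 𝕀) :
    p.transport b a = -p.transport a b := by
  have := p.transport_add ha hb ha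
  rw [p.transport_self ha] at this
  exact eq_neg_of_add_eq_zero_right this

end Street

theorem wedge_swap (v w : ℂ) : wedge w v = -wedge v w := by
  simp [wedge]; ring

theorem wedge_neg_left (v w : ℂ) : wedge (-v) w = -wedge v w := by simp [wedge]
theorem wedge_neg_right (v w : ℂ) : wedge v (-w) = -wedge v w := by simp [wedge]

theorem wedge_self (v : ℂ) : wedge v v = 0 := by simp [wedge]; ring

theorem wedge_smul_left (c : ℝ) (v w : ℂ) : wedge (c • v) w = c * wedge v w := by
  simp [wedge]; ring

theorem wedge_smul_right (c : ℝ) (v w : ℂ) : wedge v (c • w) = c * wedge v w := by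
  simp [wedge]; ring

theorem wedge_add_right (v w w' : ℂ) : wedge v (w + w') = wedge v w + wedge v w' := by
  simp [wedge]; ring

theorem turn_ne_zero {v w : ℂ} (h : wedge v w ≠ 0) (r : ℝ) : (1 - r) * v + r * w ≠ (0 : ℂ) := by
  intro h0
  have h1 : wedge v ((1 - r : ℝ) • v + r • w) = 0 := by
    have : ((1 - r : ℝ) • v + r • w : ℂ) = 0 := by
      rw [← h0]; simp
    rw [this]; simp [wedge]
  have h2 : wedge w ((1 - r : ℝ) • v + r • w) = 0 := by
    have : ((1 - r : ℝ) • v + r • w : ℂ) = 0 := by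
      rw [← h0]; simp
    rw [this]; simp [wedge]
  rw [wedge_add_right, wedge_smul_right, wedge_smul_right, wedge_self] at h1 h2
  rw [wedge_swap v w] at h2
  have h3 : r = 0 := by
    rcases mul_eq_zero.1 (show r * wedge v w = 0 by linarith) with h | h'
    · exact h
    · exact absurd h' h
  rw [h3] at h2
  apply h
  linarith

theorem continuous_turn (x : M) (v w : ℂ) :
    Continuous fun r : ℝ => (tan x ((1 - r) * v + r * w) : Tan M) :=
  (continuous_tan x).comp (by fun_prop)

/-- The opposite turn is the reversed turn. -/
theorem cls_turnArc_symm (x : M) {v w : ℂ} (h : wedge v w ≠ 0) :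
    cls (turnArc x v w) + cls (turnArc x w v) = 0 := by
  have hne : ∀ r ∈ (univ : Set ℝ), vec (tan x ((1 - r) * v + r * w) : Tan M) ≠ 0 :=
    fun r _ => turn_ne_zero h r
  have h1 := cls_dirArc_comp (f := fun r : ℝ => (tan x ((1 - r) * v + r * w) : Tan M))
    (h := fun t => 1 - t) (a := 0) (b := 1) (s := univ) ordConnected_univ
    (continuous_turn x v w).continuousOn hne (by fun_prop) (fun _ _ => mem_univ _)
  have h2 := cls_dirArc_symm (f := fun r : ℝ => (tan x ((1 - r) * v + r * w) : Tan M))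
    (a := 0) (b := 1) (continuous_turn x v w).continuousOn fun r _ => hne r (mem_univ r)
  have h3 : turnArc x w v
      = dirArc (fun t : ℝ => (tan x ((1 - (1 - t : ℝ) : ℂ) * v + (1 - t : ℝ) * w) : Tan M)) 0 1 := by
    rw [turnArc]
    refine dirArc_congr fun t _ => ?_
    congr 1
    push_cast
    ring
  rw [h3, turnArc]
  simp only [sub_zero, sub_self] at h1
  have h1' := h1.trans h2
  push_cast at h1' ⊢
  rw [h1']
  abel

namespace SpectralNetwork

variable (N)

theorem tgt_rev (s : St) (t : ℝ) : (N.street (N.rev s)).tgt t = (N.street s).src (1 - t) := by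
  have := N.src_rev (N.rev s) (1 - t)
  rw [N.rev_rev, sub_sub_cancel] at this
  exact this.symm

theorem velocity_src_rev (s : St) (t : ℝ) :
    velocity (N.street (N.rev s)).src t = opp (velocity (N.street s).tgt (1 - t)) := by
  rw [show (N.street (N.rev s)).src = fun t => (N.street s).tgt (1 - t) from
    funext (N.src_rev s), velocity_reverse _ (N.street s).tgt_smooth]

theorem velocity_tgt_rev (s : St) (t : ℝ) :
    velocity (N.street (N.rev s)).tgt t = opp (velocity (N.street s).src (1 - t)) := by
  rw [show (N.street (N.rev s)).tgt = fun t => (N.street s).src (1 - t) from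
    funext (N.tgt_rev s), velocity_reverse _ (N.street s).src_smooth]

theorem one_sub_mem {t : ℝ} (ht : t ∈ 𝕀) : 1 - t ∈ 𝕀 :=
  ⟨by linarith [ht.2], by linarith [ht.1]⟩

theorem transport_rev (s : St) {a b : ℝ} (ha : a ∈ 𝕀) (hb : b ∈ 𝕀) :
    (N.street (N.rev s)).transport a b = (N.street s).transport (1 - b) (1 - a) := by
  have hm : MapsTo (fun t : ℝ => 1 - t) (uIcc a b) (Icc 0 1) := fun t ht =>
    one_sub_mem (ordConnected_Icc.uIcc_subset ha hb ht)
  have h1 := cls_dirArc_comp (h := fun t => 1 - t) ordConnected_Icc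
    (N.street s).continuous_velocity_tgt.continuousOn (N.street s).tgt_regular
    (a := a) (b := b) (by fun_prop) hm
  have h2 := cls_dirArc_comp (h := fun t => 1 - t) ordConnected_Icc
    (N.street s).continuous_opp_velocity_src.continuousOn (N.street s).opp_src_regular
    (a := a) (b := b) (by fun_prop) hm
  rw [(N.street s).transport_symm (one_sub_mem ha) (one_sub_mem hb)]
  simp only [Street.transport]
  rw [← h1, ← h2]
  simp only [velocity_src_rev, opp_opp]
  change cls (dirArc (velocity (N.street (N.rev s)).tgt) a b) - _ = _
  rw [show velocity (N.street (N.rev s)).tgt = fun t => opp (velocity (N.street s).src (1 - t)) from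
    funext (N.velocity_tgt_rev s)]
  abel

/-- The street factor at the start of a street. -/
def factor (s : St) : Series S := 1 + N.gen s 0 * N.gen (N.rev s) 1

theorem zero_mem_I : (0 : ℝ) ∈ 𝕀 := ⟨le_rfl, zero_le_one⟩
theorem one_mem_I : (1 : ℝ) ∈ 𝕀 := ⟨zero_le_one, le_rfl⟩

theorem Q_eq_factor (s : St) {t : ℝ} (ht : t ∈ 𝕀) : N.Q s t = N.factor s := by
  rw [Q, factor, N.gen_transport s 0 zero_mem_I t ht,
    N.gen_transport (N.rev s) 1 one_mem_I (1 - t) (one_sub_mem ht),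
    N.transport_rev s one_mem_I (one_sub_mem ht), sub_sub_cancel, sub_self,
    (N.street s).transport_symm zero_mem_I ht]
  have := X_mul_X_of_add_eq_zero Z (add_neg_cancel ((N.street s).transport 0 t))
  linear_combination (N.gen s 0 * N.gen (N.rev s) 1) * this

theorem factor_rev (s : St) : N.factor (N.rev s) = N.factor s := by
  rw [← N.Q_eq_factor s one_mem_I, factor, Q, N.rev_rev, sub_self]
  exact congrArg (fun x => 1 + x) (mul_comm (N.gen (N.rev s) 0) (N.gen s 1))

theorem factor_of_not_twoWay (h : ¬ N.TwoWay s) : N.factor s = 1 := by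
  rw [factor]
  by_cases h1 : N.present s
  · rw [N.gen_absent (N.rev s) fun h2 => h ⟨h1, h2⟩]
    exact (congrArg (fun x => 1 + x) (mul_zero (N.gen s 0))).trans (add_zero _)
  · rw [N.gen_absent s h1]
    exact (congrArg (fun x => 1 + x) (zero_mul (N.gen (N.rev s) 1))).trans (add_zero _)

/-- The charge of the parallel transport along a street. -/
def T (s : St) : ExtChain S := (N.street s).transport 0 1

theorem T_rev (s : St) : N.T (N.rev s) = N.T s := by
  rw [T, T, N.transport_rev s zero_mem_I one_mem_I, sub_self, sub_zero]

theorem gen_one (s : St) : N.gen s 1 = X Z (N.T s) * N.gen s 0 :=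
  N.gen_transport s 0 zero_mem_I 1 one_mem_I

theorem twoWay_rev : N.TwoWay (N.rev s) ↔ N.TwoWay s := by
  rw [TwoWay, TwoWay, N.rev_rev, and_comm]

section Legs

variable {N} {v : Jt} {i j : Fin 3} {s : St}

theorem τ_eq (h : N.leg v i j = some s) : N.τ v i j = N.gen s 0 := by simp [τ, h]

theorem ν_eq (h : N.leg v i j = some s) : N.ν v j i = N.gen (N.rev s) 1 := by simp [ν, h]

theorem outAt_iff (h : N.leg v i j = some s) : N.outAt v i j ↔ N.present s := by simp [outAt, h]

theorem inAt_iff (h : N.leg v i j = some s) : N.inAt v j i ↔ N.present (N.rev s) := by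
  simp [inAt, h]

theorem ν_eq_zero (h : ¬ N.inAt v i j) : N.ν v i j = 0 := by
  rw [ν]
  rcases e : N.leg v j i with _ | s
  · rfl
  · exact N.gen_absent _ (fun h' => h ⟨s, e, h'⟩) 1

theorem τ_eq_zero (h : ¬ N.outAt v i j) : N.τ v i j = 0 := by
  rw [τ]
  rcases e : N.leg v i j with _ | s
  · rfl
  · exact N.gen_absent _ (fun h' => h ⟨s, e, h'⟩) 0

theorem velocity_tgt_one (h : N.leg v i j = some s) :
    velocity (N.street (N.rev s)).tgt 1 = tan (N.sheet v i) (liftVec π (N.sheet v i) (N.dir v j i)) := by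
  rw [velocity_tgt_rev, sub_self, N.leg_src v i j s h, opp_tan, ← liftVec_neg, N.dir_swap v j i,
    neg_neg]

theorem velocity_src_one (h : N.leg v i j = some s) :
    velocity (N.street (N.rev s)).src 1 = tan (N.sheet v j) (liftVec π (N.sheet v j) (N.dir v j i)) := by
  rw [velocity_src_rev, sub_self, N.leg_tgt v i j s h, opp_tan, ← liftVec_neg, N.dir_swap v i j]

theorem src_zero (h : N.leg v i j = some s) : (N.street s).src 0 = N.sheet v i :=
  congrArg (fun w => w.1) (N.leg_src v i j s h)

theorem tgt_zero (h : N.leg v i j = some s) : (N.street s).tgt 0 = N.sheet v j :=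
  congrArg (fun w => w.1) (N.leg_tgt v i j s h)

theorem leg_ne (h : N.leg v i j = some s) : i ≠ j := by
  rintro rfl
  rw [N.leg_diag] at h
  exact absurd h (by simp)

end Legs

section Continues

variable {N}

theorem Continues.rev (h : N.Continues s s') : N.Continues (N.rev s') (N.rev s) := by
  obtain ⟨v, i, j, h1, h2⟩ := h
  exact ⟨v, j, i, by rw [N.rev_rev]; exact h2, h1⟩

theorem Continues.right_unique {s s' s'' : St} (h : N.Continues s s') (h' : N.Continues s s'') :
    s' = s'' := by
  obtain ⟨v, i, j, h1, h2⟩ := h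
  obtain ⟨v', i', j', h1', h2'⟩ := h'
  obtain ⟨rfl, rfl, rfl⟩ := N.leg_unique _ _ _ _ _ _ _ h1 h1'
  exact Option.some.inj (h2.symm.trans h2')

theorem Continues.left_unique {s s' s'' : St} (h : N.Continues s s'') (h' : N.Continues s' s'') :
    s = s' := by
  have := h.rev.right_unique h'.rev
  rw [← N.rev_rev s, this, N.rev_rev]

theorem Continues.cap_eq_none (h : N.Continues s s') : N.cap s' = none := by
  obtain ⟨v, i, j, h1, h2⟩ := h
  exact N.leg_cap _ _ _ _ h2

theorem Continues.velocity_tgt (h : N.Continues s s') :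
    velocity (N.street s).tgt 1 = velocity (N.street s').tgt 0 := by
  obtain ⟨v, i, j, h1, h2⟩ := h
  rw [N.leg_tgt _ _ _ _ h2]
  simpa [N.rev_rev] using velocity_tgt_one h1

theorem Continues.velocity_src (h : N.Continues s s') :
    velocity (N.street s).src 1 = velocity (N.street s').src 0 := by
  obtain ⟨v, i, j, h1, h2⟩ := h
  rw [N.leg_src _ _ _ _ h2]
  simpa [N.rev_rev] using velocity_src_one h1

end Continues

section Turns

variable (v : Jt)

theorem wedge_dir_ne_zero {i j k : Fin 3} (hij : i ≠ j) (hik : i ≠ k) (hjk : j ≠ k) :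
    wedge (N.dir v i j) (N.dir v i k) ≠ 0 ∧ wedge (N.dir v i k) (N.dir v j k) ≠ 0 := by
  obtain ⟨h1, h2, h3⟩ := N.dir_cyclic v
  have e1 : N.dir v 1 0 = -N.dir v 0 1 := N.dir_swap v 0 1
  have e2 : N.dir v 2 0 = -N.dir v 0 2 := N.dir_swap v 0 2
  have e3 : N.dir v 2 1 = -N.dir v 1 2 := N.dir_swap v 1 2
  have w1 := wedge_swap (N.dir v 0 1) (N.dir v 0 2)
  have w2 := wedge_swap (N.dir v 0 1) (N.dir v 1 2)
  have w3 := wedge_swap (N.dir v 0 2) (N.dir v 1 2)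
  fin_cases i <;> fin_cases j <;> first | exact (hij rfl).elim | skip
  all_goals fin_cases k <;> first | exact (hik rfl).elim | exact (hjk rfl).elim | skip
  all_goals
    simp only [Fin.mk_one, Fin.zero_eta, Fin.reduceFinMk, e1, e2, e3, wedge_neg_left,
      wedge_neg_right]
    constructor <;> intro h <;> linarith

theorem turn_cyclic (i k j : Fin 3) : N.turn v i k j = N.turn v k j i := by
  rw [turn, turn, N.dir_swap v i k, N.dir_swap v i j, N.dir_swap v j k]
  simp only [neg_neg]
  abel

theorem turn_add_turn (hπ : ∀ i, ∃ A : ℂ →L[ℝ] ℂ, (∀ w, liftVec π (N.sheet v i) w = A w) ∧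
    LinearMap.det (A : ℂ →ₗ[ℝ] ℂ) ≠ 0) {i k j : Fin 3} (hij : i ≠ j) (hik : i ≠ k) (hjk : j ≠ k) :
    N.turn v i k j + N.turn v i j k = 0 := by
  have hw : ∀ (n : Fin 3) (a b : ℂ), wedge a b ≠ 0 →
      wedge (liftVec π (N.sheet v n) a) (liftVec π (N.sheet v n) b) ≠ 0 := by
    intro n a b hab
    obtain ⟨A, hA, hdet⟩ := hπ n
    rw [hA, hA, wedge_map]
    exact mul_ne_zero hdet hab
  obtain ⟨w1, w2⟩ := N.wedge_dir_ne_zero v hij hik hjk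
  obtain ⟨-, w3⟩ := N.wedge_dir_ne_zero v hik hij hjk.symm
  have c1 := cls_turnArc_symm (N.sheet v i) (hw i (-N.dir v i j) (-N.dir v i k)
    (by rwa [wedge_neg_left, wedge_neg_right, neg_neg]))
  have c2 := cls_turnArc_symm (N.sheet v k) (hw k (N.dir v i k) (N.dir v j k) w2)
  have c3 := cls_turnArc_symm (N.sheet v j) (hw j (N.dir v i j) (N.dir v k j) w3)
  rw [turn, turn]
  have e1 : N.dir v j k = -N.dir v k j := N.dir_swap v k j
  rw [e1] at c2 ⊢
  rw [neg_neg]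
  have : ∀ a b c d e f : ExtChain S, a + b = 0 → c + d = 0 → e + f = 0 →
      a + c + f + (b + e + d) = 0 := by
    intro a b c d e f h1 h2 h3
    calc _ = (a + b) + (c + d) + (e + f) := by abel
      _ = 0 := by rw [h1, h2, h3]; simp
  exact this _ _ _ _ _ _ c1 c2 c3

end Turns

end SpectralNetwork

section Joint

variable {o n : Fin 3 → Fin 3 → Prop}

/-- The presence rules at a joint with sheets `i, j, k` in cyclic order. -/
def PresenceRules (o n : Fin 3 → Fin 3 → Prop) (i j k : Fin 3) : Prop :=
  (o i j ↔ n i j ∨ (o i k ∧ n k j)) ∧ (o i k ↔ n i k ∨ (n i j ∧ o j k)) ∧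
  (o j k ↔ n j k ∨ (o j i ∧ n i k)) ∧ (o j i ↔ n j i ∨ (n j k ∧ o k i)) ∧
  (o k i ↔ n k i ∨ (o k j ∧ n j i)) ∧ (o k j ↔ n k j ∨ (n k i ∧ o i j))

theorem presenceRules
    (h : ∀ i, (o i (i + 1) ↔ n i (i + 1) ∨ (o i (i + 2) ∧ n (i + 2) (i + 1))) ∧
      (o i (i + 2) ↔ n i (i + 2) ∨ (n i (i + 1) ∧ o (i + 1) (i + 2)))) (i : Fin 3) :
    PresenceRules o n i (i + 1) (i + 2) := by
  fin_cases i
  · exact ⟨(h 0).1, (h 0).2, (h 1).1, (h 1).2, (h 2).1, (h 2).2⟩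
  · exact ⟨(h 1).1, (h 1).2, (h 2).1, (h 2).2, (h 0).1, (h 0).2⟩
  · exact ⟨(h 2).1, (h 2).2, (h 0).1, (h 0).2, (h 1).1, (h 1).2⟩

/-- Either `j` or `i` is the cyclic successor of the other. -/
theorem cyclic_cases : ∀ {i j : Fin 3}, i ≠ j →
    ∃ k, (j = i + 1 ∧ k = i + 2 ∨ i = j + 1 ∧ k = j + 2) ∧ i ≠ k ∧ j ≠ k := by
  decide

theorem add_one_add_two : ∀ j : Fin 3, j + 1 + 2 = j := by decide
theorem add_one_add_one : ∀ j : Fin 3, j + 1 + 1 = j + 2 := by decide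

variable {i j k : Fin 3} (h : PresenceRules o n i j k)
  (t1 : ¬ (o j k ∧ n k j)) (t2 : ¬ (o k j ∧ n j k)) (t3 : ¬ (o i k ∧ n k i)) (t4 : ¬ (o k i ∧ n i k))

include h t1 t2 t3 t4

theorem PresenceRules.no_third (a : n i j) (b : n j i) :
    ¬ (o i k ∧ n k j) ∧ ¬ (n j k ∧ o k i) := by
  obtain ⟨h1, h2, h3, h4, h5, h6⟩ := h
  have oij := h1.2 (Or.inl a)
  have oji := h4.2 (Or.inl b)
  constructor
  · rintro ⟨oik, nkj⟩
    rcases h2.1 oik with nik | ⟨-, ojk⟩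
    · exact t1 ⟨h3.2 (Or.inr ⟨oji, nik⟩), nkj⟩
    · exact t1 ⟨ojk, nkj⟩
  · rintro ⟨njk, oki⟩
    rcases h5.1 oki with nki | ⟨okj, -⟩
    · exact t2 ⟨h6.2 (Or.inr ⟨nki, oij⟩), njk⟩
    · exact t2 ⟨okj, njk⟩

theorem PresenceRules.not_out (a : n j i) (b : ¬ n i j) : ¬ o i j := by
  obtain ⟨h1, h2, h3, h4, h5, h6⟩ := h
  intro oij
  rcases h1.1 oij with nij | ⟨oik, nkj⟩
  · exact b nij
  · rcases h2.1 oik with nik | ⟨nij, -⟩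
    · exact t4 ⟨h5.2 (Or.inr ⟨h6.2 (Or.inl nkj), a⟩), nik⟩
    · exact b nij

theorem PresenceRules.not_out' (a : n i j) (b : ¬ n j i) : ¬ o j i := by
  obtain ⟨h1, h2, h3, h4, h5, h6⟩ := h
  intro oji
  rcases h4.1 oji with nji | ⟨njk, oki⟩
  · exact b nji
  · rcases h5.1 oki with nki | ⟨-, nji⟩
    · exact t3 ⟨h2.2 (Or.inr ⟨a, h3.2 (Or.inl njk)⟩), nki⟩
    · exact b nji

end Joint

namespace SpectralNetwork

variable {v : Jt} {i j k : Fin 3} {s s' : St}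

theorem SixWayStreets.rules (h : N.SixWayStreets) (v : Jt) (i : Fin 3) :
    PresenceRules (N.outAt v) (N.inAt v) i (i + 1) (i + 2) :=
  presenceRules (h v) i

theorem SixWayStreets.out_of_in (h : N.SixWayStreets) (hij : i ≠ j) (hn : N.inAt v i j) :
    N.outAt v i j := by
  obtain ⟨k, ⟨rfl, rfl⟩ | ⟨rfl, rfl⟩, -, -⟩ := cyclic_cases hij
  · exact (h.rules v i).1.2 (Or.inl hn)
  · exact (h.rules v j).2.2.2.1.2 (Or.inl hn)

theorem SixWay.eqs (h : N.SixWay) (v : Jt) :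
    N.τ v 0 1 = N.ν v 0 1 + X Z (N.turn v 0 2 1) * (N.τ v 0 2 * N.ν v 2 1) ∧
    N.τ v 0 2 = N.ν v 0 2 + X Z (N.turn v 0 1 2) * (N.ν v 0 1 * N.τ v 1 2) ∧
    N.τ v 1 2 = N.ν v 1 2 + X Z (N.turn v 0 2 1) * (N.τ v 1 0 * N.ν v 0 2) ∧
    N.τ v 1 0 = N.ν v 1 0 + X Z (N.turn v 0 1 2) * (N.ν v 1 2 * N.τ v 2 0) ∧
    N.τ v 2 0 = N.ν v 2 0 + X Z (N.turn v 0 2 1) * (N.τ v 2 1 * N.ν v 1 0) ∧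
    N.τ v 2 1 = N.ν v 2 1 + X Z (N.turn v 0 1 2) * (N.ν v 2 0 * N.τ v 0 1) := by
  have e1 : N.turn v 0 2 1 = N.turn v 2 1 0 := N.turn_cyclic v 0 2 1
  have e2 : N.turn v 0 1 2 = N.turn v 1 2 0 := N.turn_cyclic v 0 1 2
  have e3 : N.turn v 2 1 0 = N.turn v 1 0 2 := N.turn_cyclic v 2 1 0
  have e4 : N.turn v 1 2 0 = N.turn v 2 0 1 := N.turn_cyclic v 1 2 0
  refine ⟨(h v 0).1, (h v 0).2, ?_, ?_, ?_, ?_⟩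
  · rw [e1, e3]; exact (h v 1).1
  · rw [e2]; exact (h v 1).2
  · rw [e1]; exact (h v 2).1
  · rw [e2, e4]; exact (h v 2).2

theorem exists_twoWay_leg (h : N.outAt v i j) (h' : N.inAt v j i) :
    ∃ s, N.leg v i j = some s ∧ N.TwoWay s := by
  obtain ⟨s, hs, hp⟩ := h
  exact ⟨s, hs, hp, (inAt_iff hs).1 h'⟩

theorem not_out_and_in (htw : ∀ i' j', N.outAt v i' j' → N.inAt v j' i' →
      (i' = i ∧ j' = j) ∨ (i' = j ∧ j' = i)) {a b : Fin 3} (ha : a = k ∨ b = k) (hik : i ≠ k)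
      (hjk : j ≠ k) : ¬ (N.outAt v a b ∧ N.inAt v b a) := by
  rintro ⟨ho, hn⟩
  rcases htw a b ho hn with ⟨rfl, rfl⟩ | ⟨rfl, rfl⟩ <;> rcases ha with h | h <;> tauto

variable (N) in
/-- `s'` continues `s` straight through a joint at which no other street is two-way. -/
def Straight (s s' : St) : Prop :=
  ∃ v i j, N.leg v j i = some (N.rev s) ∧ N.leg v i j = some s' ∧
    ∀ i' j' s'', N.leg v i' j' = some s'' → N.TwoWay s'' → (i' = i ∧ j' = j) ∨ (i' = j ∧ j' = i)

theorem Continues.present (h : N.Continues s s') (hN : N.SixWayStreets) (hs : N.present s) :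
    N.present s' := by
  obtain ⟨v, i, j, h1, h2⟩ := h
  rw [← outAt_iff h2]
  refine hN.out_of_in (leg_ne h2) ?_
  rwa [inAt_iff h1, N.rev_rev]

theorem Straight.not_present (h : N.Straight s s') (hN : N.SixWayStreets) (hs : N.present s)
    (hs' : ¬ N.present (N.rev s')) : ¬ N.present (N.rev s) := by
  obtain ⟨v, i, j, h1, h2, h3⟩ := h
  rw [← outAt_iff h1]
  have htw : ∀ i' j', N.outAt v i' j' → N.inAt v j' i' →
      (i' = i ∧ j' = j) ∨ (i' = j ∧ j' = i) := fun i' j' ho hn => by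
    obtain ⟨s'', hs'', ht⟩ := exists_twoWay_leg ho hn
    exact h3 i' j' s'' hs'' ht
  have a : N.inAt v i j := by rwa [inAt_iff h1, N.rev_rev]
  have b : ¬ N.inAt v j i := by rwa [inAt_iff h2]
  obtain ⟨k, ⟨rfl, rfl⟩ | ⟨rfl, rfl⟩, hik, hjk⟩ := cyclic_cases (leg_ne h2)
  · exact (hN.rules v i).not_out' (not_out_and_in htw (by simp) hik hjk)
      (not_out_and_in htw (by simp) hik hjk) (not_out_and_in htw (by simp) hik hjk)
      (not_out_and_in htw (by simp) hik hjk) a b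
  · exact (hN.rules v j).not_out (not_out_and_in htw (by simp) hik hjk)
      (not_out_and_in htw (by simp) hik hjk) (not_out_and_in htw (by simp) hik hjk)
      (not_out_and_in htw (by simp) hik hjk) a b

theorem τ_eq_ν (hN : N.SixWay) (hS : N.SixWayStreets) (hij : i ≠ j)
    (htw : ∀ i' j', N.outAt v i' j' → N.inAt v j' i' → (i' = i ∧ j' = j) ∨ (i' = j ∧ j' = i))
    (h : N.inAt v j i) (h' : N.inAt v i j) : N.τ v i j = N.ν v i j := by
  have hz : ∀ (x y : Series S) (p q : Prop), (¬ p → x = 0) → (¬ q → y = 0) → ¬ (p ∧ q) →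
      ∀ e n : Series S, n + e * (x * y) = n := by
    intro x y p q hp hq hpq e n
    rcases not_and_or.1 hpq with h | h
    · rw [hp h]; ring
    · rw [hq h]; ring
  obtain ⟨k, ⟨rfl, rfl⟩ | ⟨rfl, rfl⟩, hik, hjk⟩ := cyclic_cases hij
  · obtain ⟨n1, -⟩ := (hS.rules v i).no_third (not_out_and_in htw (by simp) hik hjk)
      (not_out_and_in htw (by simp) hik hjk) (not_out_and_in htw (by simp) hik hjk)
      (not_out_and_in htw (by simp) hik hjk) h' h
    rw [(hN v i).1]
    exact hz _ _ _ _ τ_eq_zero ν_eq_zero n1 _ _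
  · obtain ⟨-, n2⟩ := (hS.rules v j).no_third (not_out_and_in htw (by simp) hik hjk)
      (not_out_and_in htw (by simp) hik hjk) (not_out_and_in htw (by simp) hik hjk)
      (not_out_and_in htw (by simp) hik hjk) h h'
    have := (hN v (j + 1)).2
    rw [add_one_add_two, add_one_add_one] at this
    rw [this]
    exact hz _ _ _ _ ν_eq_zero τ_eq_zero n2 _ _

theorem Straight.gen_eq (h : N.Straight s s') (hN : N.SixWay) (hS : N.SixWayStreets)
    (hs : N.TwoWay s) (hs' : N.TwoWay s') :
    N.gen s' 0 = N.gen s 1 ∧ N.gen (N.rev s) 0 = N.gen (N.rev s') 1 := by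
  obtain ⟨v, i, j, h1, h2, h3⟩ := h
  have htw : ∀ i' j', N.outAt v i' j' → N.inAt v j' i' →
      (i' = i ∧ j' = j) ∨ (i' = j ∧ j' = i) := fun i' j' ho hn => by
    obtain ⟨s'', hs'', ht⟩ := exists_twoWay_leg ho hn
    exact h3 i' j' s'' hs'' ht
  have a : N.inAt v i j := by
    rw [inAt_iff h1, N.rev_rev]
    exact hs.1
  have b : N.inAt v j i := by
    rw [inAt_iff h2]
    exact hs'.2
  constructor
  · have := τ_eq_ν hN hS (leg_ne h2) htw b a
    rwa [τ_eq h2, ν_eq h1, N.rev_rev] at this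
  · have := τ_eq_ν hN hS (leg_ne h1) (fun i' j' ho hn => (htw i' j' ho hn).symm) a b
    rwa [τ_eq h1, ν_eq h2] at this

/-! ### Straight lists of streets -/

variable (N) in
/-- The transport along a list of streets. -/
def listT (L : List St) : ExtChain S := (L.map N.T).sum

theorem straight_list_gen (hN : N.SixWay) (hS : N.SixWayStreets) :
    ∀ (L : List St), L.IsChain N.Straight → (∀ s ∈ L, N.TwoWay s) → ∀ (x y : St),
      L.head? = some x → L.getLast? = some y →
      N.gen y 1 = X Z (N.listT L) * N.gen x 0 ∧
      N.gen (N.rev x) 1 = X Z (N.listT L) * N.gen (N.rev y) 0 ∧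
      ∀ s ∈ L, N.factor s = N.factor x
  | [], _, _, x, y, hx, _ => by simp at hx
  | [s], _, _, x, y, hx, hy => by
    simp only [List.head?_cons, Option.some.injEq, List.getLast?_singleton] at hx hy
    subst hx hy
    refine ⟨?_, ?_, by simp⟩
    · simpa [listT] using N.gen_one s
    · simpa [listT, T_rev] using N.gen_one (N.rev s)
  | s :: s' :: L, hL, htw, x, y, hx, hy => by
    simp only [List.head?_cons, Option.some.injEq] at hx
    subst hx
    rw [List.isChain_cons_cons] at hL
    rw [List.getLast?_cons_cons] at hy
    have ih := straight_list_gen hN hS (s' :: L) hL.2 (fun r hr => htw r (List.mem_cons_of_mem _ hr))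
      s' y rfl hy
    obtain ⟨g1, g2⟩ := hL.1.gen_eq hN hS (htw s (by simp)) (htw s' (by simp))
    have hT : N.listT (s :: s' :: L) = N.T s + N.listT (s' :: L) := by simp [listT]
    have hf : N.factor s' = N.factor s := by
      rw [← N.Q_eq_factor s one_mem_I, factor, Q, sub_self, g1, ← g2]
    rw [hT, X_add]
    refine ⟨?_, ?_, ?_⟩
    · rw [ih.1, g1, N.gen_one s]
      ring
    · rw [N.gen_one (N.rev s), T_rev, g2, ih.2.1]
      ring
    · intro r hr
      rcases List.mem_cons.1 hr with rfl | hr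
      · rfl
      · rw [ih.2.2 r hr, hf]

theorem present_of_chain (hS : N.SixWayStreets) :
    ∀ {L : List St}, L.IsChain N.Continues → ∀ x, L.head? = some x → N.present x →
      ∀ s ∈ L, N.present s
  | [], _, x, hx, _ => by simp at hx
  | [s], _, x, hx, hp => by simp_all
  | s :: s' :: L, hL, x, hx, hp => by
    simp only [List.head?_cons, Option.some.injEq] at hx
    subst hx
    rw [List.isChain_cons_cons] at hL
    intro r hr
    rcases List.mem_cons.1 hr with rfl | hr
    · exact hp
    · exact present_of_chain hS hL.2 s' rfl (hL.1.present hS hp) r hr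

/-- The reversed list of reversed streets. -/
def revList (N : SpectralNetwork π Z St Jt) (L : List St) :
    List St := (L.map N.rev).reverse

theorem mem_revList {L : List St} : s ∈ N.revList L ↔ N.rev s ∈ L := by
  simp only [revList, List.mem_reverse, List.mem_map]
  constructor
  · rintro ⟨a, ha, rfl⟩
    rwa [N.rev_rev]
  · intro h
    exact ⟨_, h, N.rev_rev s⟩

theorem chain_revList {L : List St} (h : L.IsChain N.Continues) :
    (N.revList L).IsChain N.Continues := by
  rw [revList, List.isChain_reverse, List.isChain_map]
  exact h.imp fun _ _ h => h.rev

theorem head?_revList (L : List St) : (N.revList L).head? = L.getLast?.map N.rev := by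
  simp [revList, List.head?_reverse, List.getLast?_map]

theorem getLast?_revList (L : List St) : (N.revList L).getLast? = L.head?.map N.rev := by
  simp [revList, List.getLast?_reverse, List.head?_map]

theorem not_present_of_straight_list (hS : N.SixWayStreets) :
    ∀ {L : List St}, L.IsChain N.Straight → (∀ s ∈ L, N.present s) → ∀ y,
      L.getLast? = some y → ¬ N.present (N.rev y) → ∀ s ∈ L, ¬ N.present (N.rev s)
  | [], _, _, x, hx, _ => by simp at hx
  | [s], _, _, x, hx, hp => by simp_all
  | s :: s' :: L, hL, hs, y, hy, hp => by
    rw [List.isChain_cons_cons] at hL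
    rw [List.getLast?_cons_cons] at hy
    have ih := not_present_of_straight_list hS hL.2
      (fun r hr => hs r (List.mem_cons_of_mem _ hr)) y hy hp
    intro r hr
    rcases List.mem_cons.1 hr with rfl | hr
    · exact hL.1.not_present hS (hs r (by simp)) (ih s' (by simp))
    · exact ih r hr

end SpectralNetwork

/-! ## The standard picture -/

namespace HorseStreet

/-- The end of a horse street from which `param` measures its points. -/
def base : HorseStreet → ℂ
  | a1 | a2 | b1 | b2 | c => -Complex.I
  | a3 | b3' | b2' => 1
  | b3 | a3' | a2' => -1
  | a1' | b1' => Complex.I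

/-- The upward direction of a horse street. -/
def d : HorseStreet → ℂ
  | a1 | a2 | a3 | a1' | a2' | a3' => 1 + Complex.I
  | b1 | b2 | b3 | b1' | b2' | b3' => -1 + Complex.I
  | c => 2 * Complex.I

/-- The range of parameters of a horse street. -/
def R : HorseStreet → Set ℝ
  | a1 | b1 | a3' | b3' => Iic 0
  | a2 | b2 | a2' | b2' | c => Icc 0 1
  | a3 | b3 | a1' | b1' => Ici 0

/-- The sheet at which the solitons of the upward constituent start. -/
def i : HorseStreet → Fin 3
  | b1 | b2 | b3 | b1' | b2' | b3' => 1
  | _ => 0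

/-- The sheet at which the solitons of the upward constituent end. -/
def j : HorseStreet → Fin 3
  | a1 | a2 | a3 | a1' | a2' | a3' => 1
  | _ => 2

theorem d_ne_zero (p : HorseStreet) : p.d ≠ 0 := by
  intro h
  have := congrArg Complex.im h
  cases p <;> simp [d] at this

theorem d_im_pos (p : HorseStreet) : 0 < p.d.im := by
  cases p <;> simp [d]

theorem mem_ray {z d w : ℂ} : w ∈ ray z d ↔ ∃ r : ℝ, r ∈ Ici (0 : ℝ) ∧ w = z + r * d := Iff.rfl

theorem mem_ray_neg {z d w : ℂ} : w ∈ ray z (-d) ↔ ∃ r : ℝ, r ∈ Iic (0 : ℝ) ∧ w = z + r * d := by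
  constructor
  · rintro ⟨r, hr, rfl⟩
    exact ⟨-r, by simpa using hr, by push_cast; ring⟩
  · rintro ⟨r, hr, rfl⟩
    exact ⟨-r, by simpa using hr, by push_cast; ring⟩

theorem mem_segment' {z d w : ℂ} :
    w ∈ segment ℝ z (z + d) ↔ ∃ r : ℝ, r ∈ 𝕀 ∧ w = z + r * d := by
  rw [segment_eq_image']
  constructor
  · rintro ⟨r, hr, rfl⟩
    exact ⟨r, hr, by simp⟩
  · rintro ⟨r, hr, rfl⟩
    exact ⟨r, hr, by simp⟩

theorem mem_fig {w : ℂ} : w ∈ p.fig ↔ ∃ r ∈ p.R, w = p.base + r * p.d := by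
  have e1 : (1 : ℂ) - Complex.I = -(-1 + Complex.I) := by ring
  have e2 : (1 : ℂ) = -Complex.I + (1 + Complex.I) := by ring
  have e3 : (-1 : ℂ) = -Complex.I + (-1 + Complex.I) := by ring
  have e4 : Complex.I = -Complex.I + (2 * Complex.I) := by ring
  have e5 : Complex.I = -1 + (1 + Complex.I) := by ring
  have e6 : Complex.I = 1 + (-1 + Complex.I) := by ring
  cases p <;> simp only [fig, base, d, R]
  case a1 => exact mem_ray_neg
  case a2 =>
    have := mem_segment' (z := -Complex.I) (d := 1 + Complex.I) (w := w)
    rwa [← e2] at this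
  case a3 => exact mem_ray
  case b1 => rw [e1]; exact mem_ray_neg
  case b2 =>
    have := mem_segment' (z := -Complex.I) (d := -1 + Complex.I) (w := w)
    rwa [← e3] at this
  case b3 => exact mem_ray
  case c =>
    have := mem_segment' (z := -Complex.I) (d := 2 * Complex.I) (w := w)
    rwa [← e4] at this
  case a1' => exact mem_ray
  case a2' =>
    have := mem_segment' (z := -1) (d := 1 + Complex.I) (w := w)
    rwa [← e5] at this
  case a3' => exact mem_ray_neg
  case b1' => exact mem_ray
  case b2' =>
    have := mem_segment' (z := 1) (d := -1 + Complex.I) (w := w)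
    rwa [← e6] at this
  case b3' => rw [e1]; exact mem_ray_neg

/-- Streets of different types meet only in joints. -/
theorem exists_joint {p p' : HorseStreet} {z : ℂ} (hz : z ∈ p.fig) (hz' : z ∈ p'.fig)
    (h : wedge p.d p'.d ≠ 0) : ∃ q : HorseJoint, z = q.pos := by
  have key : ∀ p : HorseStreet, z ∈ p.fig →
      (p.d = 1 + Complex.I ∧ (z.im = z.re - 1 ∨ z.im = z.re + 1)) ∨
      (p.d = -1 + Complex.I ∧ (z.im = -z.re - 1 ∨ z.im = -z.re + 1)) ∨
      (p.d = 2 * Complex.I ∧ z.re = 0) := by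
    intro p hz
    obtain ⟨r, -, rfl⟩ := mem_fig.1 hz
    cases p <;> simp [d, base, Complex.ext_iff] <;> norm_num <;>
      first | (left; ring1) | (right; ring1)
  have fin : ∀ q : HorseJoint, z.re = q.pos.re → z.im = q.pos.im → ∃ q : HorseJoint, z = q.pos :=
    fun q h h' => ⟨q, Complex.ext h h'⟩
  rcases key p hz with ⟨e, h1⟩ | ⟨e, h1⟩ | ⟨e, h1⟩ <;>
    rcases key p' hz' with ⟨e', h2⟩ | ⟨e', h2⟩ | ⟨e', h2⟩ <;>
    first
      | exact (h (by rw [e, e', wedge_self])).elim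
      | (rcases h1 with h1 | h1 <;> rcases h2 with h2 | h2)
      | (rcases h1 with h1 | h1)
      | (rcases h2 with h2 | h2)
  all_goals first
    | exact fin .bot (by simp [HorseJoint.pos]; linarith) (by simp [HorseJoint.pos]; linarith)
    | exact fin .right (by simp [HorseJoint.pos]; linarith) (by simp [HorseJoint.pos]; linarith)
    | exact fin .left (by simp [HorseJoint.pos]; linarith) (by simp [HorseJoint.pos]; linarith)
    | exact fin .top (by simp [HorseJoint.pos]; linarith) (by simp [HorseJoint.pos]; linarith)

/-- A joint on a horse street is an end of it. -/
theorem end_of_joint {q : HorseJoint} {r : ℝ} (hr : r ∈ p.R)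
    (h : q.pos = p.base + r * p.d) : IsLeast p.R r ∨ IsGreatest p.R r := by
  have h1 := congrArg Complex.re h
  have h2 := congrArg Complex.im h
  have hr' : r = 0 ∨ (r = 1 ∧ p.R = Icc 0 1) := by
    cases p <;> cases q <;> simp [HorseJoint.pos, base, d, R] at h1 h2 hr ⊢ <;>
      first
        | (left; linarith)
        | (right; linarith)
  rcases hr' with rfl | ⟨rfl, hR⟩
  · have h01 : p.R = Iic 0 ∨ p.R = Ici 0 ∨ p.R = Icc 0 1 := by cases p <;> simp [R]
    rcases h01 with h | h | h <;> rw [h]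
    · exact Or.inr isGreatest_Iic
    · exact Or.inl isLeast_Ici
    · exact Or.inl (isLeast_Icc zero_le_one)
  · rw [hR]
    exact Or.inr (isGreatest_Icc zero_le_one)

end HorseStreet

/-! ## Curves in the coordinate of a horse -/

section LineCurves

variable {f : ℝ → ℂ} {u b d : ℂ} {R : Set ℝ} {t : ℝ}

theorem deriv_mem_line (ht : t ∈ 𝕀) (hf : HasDerivAt f u t) (hd : d ≠ 0)
    (hev : ∀ᶠ r in 𝓝[Icc 0 1] t, ∃ ρ ∈ R, f r = b + (ρ : ℝ) * d) : ∃ c : ℝ, u = c * d := by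
  have h1 : HasDerivAt (fun r => ((f r - b) / d).im) (u / d).im t := by
    have := (Complex.imCLM.hasFDerivAt.comp_hasDerivAt t ((hf.sub_const b).div_const d))
    exact this
  have h2 : HasDerivWithinAt (fun r => ((f r - b) / d).im) 0 (Icc 0 1) t := by
    refine (hasDerivWithinAt_const t 𝕀 (0 : ℝ)).congr_of_eventuallyEq_of_mem ?_ ht
    filter_upwards [hev] with r ⟨ρ, _, hr⟩
    simp [hr, hd]
  have h3 := (uniqueDiffOn_Icc_zero_one t ht).eq_deriv _ h1.hasDerivWithinAt h2
  refine ⟨(u / d).re, ?_⟩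
  have : ((u / d).re : ℂ) = u / d := Complex.ext (by simp) (by simp [h3])
  rw [this, div_mul_cancel₀ _ hd]

theorem deriv_nonneg_of_isLeast (hf : HasDerivAt f u 0) (hd : d ≠ 0) {c ρ₀ : ℝ} (hu : u = c * d)
    (h0 : f 0 = b + ρ₀ * d) (hρ : ρ₀ ∈ lowerBounds R)
    (hev : ∀ᶠ r in 𝓝[Icc 0 1] (0 : ℝ), ∃ ρ ∈ R, f r = b + (ρ : ℝ) * d) : 0 ≤ c := by
  have h1 : HasDerivAt (fun r => ((f r - b) / d).re) (u / d).re 0 :=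
    (Complex.reCLM.hasFDerivAt.comp_hasDerivAt 0 ((hf.sub_const b).div_const d))
  have hc : (u / d).re = c := by rw [hu, mul_div_cancel_right₀ _ hd, Complex.ofReal_re]
  rw [hc] at h1
  have h2 := (hasDerivWithinAt_iff_tendsto_slope' (s := Ioi 0) (by simp)).1
    (h1.hasDerivWithinAt (s := Ioi 0))
  refine ge_of_tendsto h2 ?_
  have hle : 𝓝[>] (0 : ℝ) ≤ 𝓝[Icc 0 1] 0 := by
    rw [← nhdsWithin_Ioc_eq_nhdsGT (zero_lt_one' ℝ)]
    exact nhdsWithin_mono _ Ioc_subset_Icc_self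
  filter_upwards [hle hev, self_mem_nhdsWithin] with r ⟨ρ, hρR, hr⟩ hr0
  have e0 : ((f 0 - b) / d).re = ρ₀ := by rw [h0]; simp [hd]
  have e1 : ((f r - b) / d).re = ρ := by rw [hr]; simp [hd]
  rw [slope_def_field, e0, e1]
  exact div_nonneg (sub_nonneg.2 (hρ hρR)) (by simpa using le_of_lt hr0)

theorem deriv_nonpos_of_isGreatest (hf : HasDerivAt f u 0) (hd : d ≠ 0) {c ρ₀ : ℝ} (hu : u = c * d)
    (h0 : f 0 = b + ρ₀ * d) (hρ : ρ₀ ∈ upperBounds R)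
    (hev : ∀ᶠ r in 𝓝[Icc 0 1] (0 : ℝ), ∃ ρ ∈ R, f r = b + (ρ : ℝ) * d) : c ≤ 0 := by
  have := deriv_nonneg_of_isLeast (R := -R) (c := -c) (ρ₀ := -ρ₀) (d := -d) hf (neg_ne_zero.2 hd)
    (by rw [hu]; push_cast; ring) (by rw [h0]; push_cast; ring)
    (fun x hx => by simpa using neg_le_neg (hρ hx)) (by
      filter_upwards [hev] with r ⟨ρ, hρ, hr⟩
      exact ⟨-ρ, by simpa using hρ, by rw [hr]; push_cast; ring⟩)
  linarith

end LineCurves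

theorem mem_uIcc_zero_one {t : ℝ} : t ∈ uIcc (0 : ℝ) 1 ↔ t ∈ 𝕀 := by
  rw [uIcc_of_le zero_le_one]

/-- The coordinate vector of the projection of a tangent vector. -/
def cvec (φ : OpenPartialHomeomorph C ℂ) (π : S → C) (w : Tan S) : ℂ :=
  der φ (π w.1) (der π w.1 (vec w))

theorem cvec_opp (w : Tan S) : cvec φ π (opp w) = -cvec φ π w := by
  simp [cvec]

theorem orientedCharts.contMDiffAt (hφ : φ ∈ orientedCharts C) {z : C} (hz : z ∈ φ.source) :
    ContMDiffAt 𝓒 𝓒 ∞ φ z :=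
  (contMDiffOn_of_mem_maximalAtlas hφ.1).contMDiffAt (φ.open_source.mem_nhds hz)

theorem orientedCharts.contMDiffAt_symm (hφ : φ ∈ orientedCharts C) {z : ℂ} (hz : z ∈ φ.target) :
    ContMDiffAt 𝓒 𝓒 ∞ φ.symm z :=
  (contMDiffOn_symm_of_mem_maximalAtlas hφ.1).contMDiffAt (φ.open_target.mem_nhds hz)

theorem hasDerivAt_of_velocity {f : ℝ → ℂ} {t : ℝ}
    (hf : MDifferentiableAt 𝓡 𝓒 f t) : HasDerivAt f (vec (velocity f t)) t := by
  have key : ∀ A : ℝ →L[ℝ] ℂ, HasFDerivAt f A t → HasDerivAt f (A 1) t := fun A h => h.hasDerivAt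
  exact key _ hf.hasMFDerivAt.hasFDerivAt

theorem hasDerivAt_coord (hπ : IsSimpleBranchedCover π K) (hφ : φ ∈ orientedCharts C)
    {γ : ℝ → S} {t : ℝ} (hγ : ContMDiffAt 𝓡 𝓒 1 γ t) (hU : π (γ t) ∈ φ.source)
    (hb : π (γ t) ∉ branchPoints π) :
    HasDerivAt (fun r => φ (π (γ r))) (cvec φ π (velocity γ t)) t := by
  have h1 := hγ.mdifferentiableAt (by simp)
  have h2 := hπ.mdifferentiableAt hb
  have h3 := (orientedCharts.contMDiffAt hφ hU).mdifferentiableAt (by simp)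
  have h4 := velocity_push (f := π) (γ := γ) h2 h1
  have h5 := velocity_push (f := φ) (γ := fun r => π (γ r)) h3 (h2.comp t h1)
  have := hasDerivAt_of_velocity (f := fun r => φ (π (γ r))) (h3.comp t (h2.comp t h1))
  rw [h5, h4] at this
  exact this

theorem det_der_pos (hφ : φ ∈ orientedCharts C) {z : C} (hz : z ∈ φ.source) :
    0 < LinearMap.det (der φ z : ℂ →ₗ[ℝ] ℂ) := hφ.2 z hz

theorem det_ne_zero_iff_injective {A : ℂ →L[ℝ] ℂ} (h : LinearMap.det (A : ℂ →ₗ[ℝ] ℂ) ≠ 0) {v : ℂ}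
    (hv : v ≠ 0) : A v ≠ 0 := by
  intro h0
  have := wedge_map A v (Complex.I * v)
  rw [h0] at this
  have h1 : wedge v (Complex.I * v) = v.re ^ 2 + v.im ^ 2 := by simp [wedge]; ring
  have h2 : wedge (0 : ℂ) (A (Complex.I * v)) = 0 := by simp [wedge]
  rw [h1, h2] at this
  have h3 : v.re ^ 2 + v.im ^ 2 = 0 := (mul_eq_zero.1 this.symm).resolve_left h
  apply hv
  apply Complex.ext <;> simp <;> nlinarith [sq_nonneg v.re, sq_nonneg v.im]

theorem cvec_ne_zero (hπ : IsSimpleBranchedCover π K) (hφ : φ ∈ orientedCharts C) {w : Tan S}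
    (hU : π w.1 ∈ φ.source) (hb : π w.1 ∉ branchPoints π) (hw : vec w ≠ 0) : cvec φ π w ≠ 0 :=
  det_ne_zero_iff_injective (det_der_pos hφ hU).ne' (hπ.der_ne_zero hb hw)

theorem cvec_liftVec (hπ : IsSimpleBranchedCover π K) {x : S} (hb : π x ∉ branchPoints π) (v : ℂ) :
    cvec φ π (tan x (liftVec π x v)) = der φ (π x) v := by
  rw [cvec, tan_fst, vec_tan, hπ.der_liftVec hb]

theorem Street.cvec_tgt (hπ : IsSimpleBranchedCover π K) (hφ : φ ∈ orientedCharts C) (p : Street π)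
    {t : ℝ} (ht : t ∈ 𝕀) (hU : π (p.src t) ∈ φ.source) :
    cvec φ π (velocity p.tgt t) = cvec φ π (velocity p.src t) := by
  have h1 := (hasDerivAt_coord hπ hφ p.src_smooth.contMDiffAt hU
    (p.unbranched t ht)).hasDerivWithinAt (s := Icc 0 1)
  have h2 := (hasDerivAt_coord hπ hφ (p.tgt_smooth.contMDiffAt (x := t))
    (p.same_base t ht ▸ hU) (p.same_base t ht ▸ p.unbranched t ht)).hasDerivWithinAt (s := Icc 0 1)
  refine (uniqueDiffOn_Icc_zero_one t ht).eq_deriv _ h2 (h1.congr (fun r hr => ?_) ?_)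
  · rw [p.same_base r hr]
  · rw [p.same_base t ht]

namespace SpectralNetwork

variable (N)

/-- The coordinates of the directions at a joint. -/
def dirCoord (φ : OpenPartialHomeomorph C ℂ) (v : Jt) (i j : Fin 3) : ℂ :=
  der φ (N.pt v) (N.dir v i j)

theorem dirCoord_swap (φ : OpenPartialHomeomorph C ℂ) (v : Jt) (i j : Fin 3) :
    N.dirCoord φ v j i = -N.dirCoord φ v i j := by
  rw [dirCoord, dirCoord, N.dir_swap v i j, map_neg]

theorem dirCoord_cyclic (hφ : φ ∈ orientedCharts C)
    (hv : N.pt v ∈ φ.source) : 0 < wedge (N.dirCoord φ v 0 1) (N.dirCoord φ v 0 2) ∧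
      0 < wedge (N.dirCoord φ v 0 2) (N.dirCoord φ v 1 2) ∧
      0 < wedge (N.dirCoord φ v 0 1) (N.dirCoord φ v 1 2) := by
  obtain ⟨h1, h2, h3⟩ := N.dir_cyclic v
  have hd := det_der_pos hφ hv
  simp only [dirCoord, wedge_map]
  exact ⟨mul_pos hd h1, mul_pos hd h2, mul_pos hd h3⟩

theorem wedge_dirCoord_ne_zero (hφ : φ ∈ orientedCharts C)
    (hv : N.pt v ∈ φ.source) {i j i' j' : Fin 3} (hij : i ≠ j) (hij' : i' ≠ j')
    (h : ¬ ((i' = i ∧ j' = j) ∨ (i' = j ∧ j' = i))) :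
    wedge (N.dirCoord φ v i j) (N.dirCoord φ v i' j') ≠ 0 := by
  obtain ⟨h1, h2, h3⟩ := N.dirCoord_cyclic hφ hv
  have e1 : N.dirCoord φ v 1 0 = -N.dirCoord φ v 0 1 := N.dirCoord_swap φ v 0 1
  have e2 : N.dirCoord φ v 2 0 = -N.dirCoord φ v 0 2 := N.dirCoord_swap φ v 0 2
  have e3 : N.dirCoord φ v 2 1 = -N.dirCoord φ v 1 2 := N.dirCoord_swap φ v 1 2
  have w1 := wedge_swap (N.dirCoord φ v 0 1) (N.dirCoord φ v 0 2)
  have w2 := wedge_swap (N.dirCoord φ v 0 1) (N.dirCoord φ v 1 2)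
  have w3 := wedge_swap (N.dirCoord φ v 0 2) (N.dirCoord φ v 1 2)
  fin_cases i <;> fin_cases j <;> first | exact (hij rfl).elim | skip
  all_goals fin_cases i' <;> fin_cases j' <;>
    first | exact (hij' rfl).elim | exact (h (Or.inl ⟨rfl, rfl⟩)).elim |
      exact (h (Or.inr ⟨rfl, rfl⟩)).elim | skip
  all_goals
    simp only [Fin.mk_one, Fin.zero_eta, Fin.reduceFinMk, e1, e2, e3, wedge_neg_left,
      wedge_neg_right]
    intro h
    linarith

theorem sheet_unbranched (v : Jt) (i : Fin 3) : π (N.sheet v i) ∉ branchPoints π := by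
  rw [N.sheet_base]
  exact N.joint_unbranched v

theorem cvec_leg (hπ : IsSimpleBranchedCover π K)
    {i j : Fin 3} (h : N.leg v i j = some s) :
    cvec φ π (velocity (N.street s).src 0) = N.dirCoord φ v i j := by
  rw [N.leg_src v i j s h, cvec_liftVec hπ (N.sheet_unbranched v i), N.sheet_base]
  rfl

theorem base_leg {i j : Fin 3} (h : N.leg v i j = some s) :
    π ((N.street s).src 0) = N.pt v := by
  rw [src_zero h, N.sheet_base]
  rfl

/-- The piece `s` is part of the list `L`, with one of its orientations. -/
def On (L : List St) (s : St) : Prop := s ∈ L ∨ N.rev s ∈ L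

theorem on_rev {L : List St} : N.On L (N.rev s) ↔ N.On L s := by
  rw [On, On, N.rev_rev, or_comm]

theorem On.mem_listTrace {L : List St} (h : N.On L s) {t : ℝ} (ht : t ∈ 𝕀) :
    π ((N.street s).src t) ∈ N.listTrace L := by
  rcases h with h | h
  · exact ⟨s, h, Or.inl ⟨t, ht, rfl⟩⟩
  · refine ⟨_, h, Or.inl ⟨1 - t, one_sub_mem ht, ?_⟩⟩
    simp only []
    rw [N.src_rev, sub_sub_cancel, (N.street s).same_base t ht]

theorem mem_trace {t : ℝ} (ht : t ∈ 𝕀) :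
    π ((N.street s).src t) ∈ N.trace s := Or.inl ⟨t, ht, rfl⟩

end SpectralNetwork

namespace HorseJoint

/-- The street of type `01` running into a joint of a horse. -/
def inA : HorseJoint → HorseStreet
  | bot => .a1 | right => .a2 | left => .a3' | top => .a2'

/-- The street of type `01` running out of a joint of a horse. -/
def outA : HorseJoint → HorseStreet
  | bot => .a2 | right => .a3 | left => .a2' | top => .a1'

/-- The street of type `12` running into a joint of a horse. -/
def inB : HorseJoint → HorseStreet
  | bot => .b1 | right => .b3' | left => .b2 | top => .b2'

/-- The street of type `12` running out of a joint of a horse. -/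
def outB : HorseJoint → HorseStreet
  | bot => .b2 | right => .b2' | left => .b3 | top => .b1'

end HorseJoint

theorem head_or_pred {α : Type*} {R : α → α → Prop} : ∀ {l : List α}, l.IsChain R → ∀ s ∈ l,
    l.head? = some s ∨ ∃ s₀ ∈ l, R s₀ s
  | [], _, s, hs => by simp at hs
  | [a], _, s, hs => by simp at hs; simp [hs]
  | a :: b :: l, h, s, hs => by
    rw [List.isChain_cons_cons] at h
    rcases List.mem_cons.1 hs with rfl | hs
    · exact Or.inl rfl
    · rcases head_or_pred h.2 s hs with h' | ⟨s₀, h₀, h'⟩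
      · simp only [List.head?_cons, Option.some.injEq] at h'
        subst h'
        exact Or.inr ⟨a, by simp, h.1⟩
      · exact Or.inr ⟨s₀, List.mem_cons_of_mem _ h₀, h'⟩

theorem last_or_succ {α : Type*} {R : α → α → Prop} : ∀ {l : List α}, l.IsChain R → ∀ s ∈ l,
    l.getLast? = some s ∨ ∃ s₁ ∈ l, R s s₁
  | [], _, s, hs => by simp at hs
  | [a], _, s, hs => by simp at hs; simp [hs]
  | a :: b :: l, h, s, hs => by
    rw [List.isChain_cons_cons] at h
    rw [List.getLast?_cons_cons]
    rcases List.mem_cons.1 hs with rfl | hs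
    · exact Or.inr ⟨b, by simp, h.1⟩
    · rcases last_or_succ h.2 s hs with h' | ⟨s₀, h₀, h'⟩
      · exact Or.inl h'
      · exact Or.inr ⟨s₀, List.mem_cons_of_mem _ h₀, h'⟩

namespace IsHorse

variable (h : IsHorse N φ J L)

include h

theorem legs_a (q : HorseJoint) : N.leg (J q) 0 1 = (L q.outA).head? ∧
    N.leg (J q) 1 0 = (L q.inA).getLast?.map N.rev := by
  cases q
  exacts [h.bot_a, h.right_a, h.left_a, h.top_a]

theorem legs_b (q : HorseJoint) : N.leg (J q) 1 2 = (L q.outB).head? ∧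
    N.leg (J q) 2 1 = (L q.inB).getLast?.map N.rev := by
  cases q
  exacts [h.bot_b, h.right_b, h.left_b, h.top_b]

theorem exists_head (p : HorseStreet) : ∃ s, (L p).head? = some s := by
  rcases e : L p with _ | ⟨s, l⟩
  · exact (h.ne_nil p e).elim
  · exact ⟨s, rfl⟩

theorem exists_last (p : HorseStreet) : ∃ s, (L p).getLast? = some s :=
  ⟨_, List.getLast?_eq_some_getLast (h.ne_nil p)⟩

theorem coord_mem_fig (hs : N.On (L p) s) {t : ℝ}
    (ht : t ∈ 𝕀) (hU : π ((N.street s).src t) ∈ φ.source) :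
    φ (π ((N.street s).src t)) ∈ p.fig := by
  rw [← h.fig p]
  exact mem_image_of_mem φ ⟨SpectralNetwork.On.mem_listTrace N hs ht, hU⟩

variable (hπ : IsSimpleBranchedCover π K)

include hπ

theorem eventually_coord (hs : N.On (L p) s) {t : ℝ}
    (hU : π ((N.street s).src t) ∈ φ.source) : ∀ᶠ r in 𝓝[Icc 0 1] t,
      ∃ ρ ∈ p.R, φ (π ((N.street s).src r)) = p.base + (ρ : ℝ) * p.d := by
  have hc : Continuous fun r => π ((N.street s).src r) :=
    hπ.proper.continuous.comp (N.street s).src_smooth.continuous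
  have h1 := hc.continuousAt.eventually_mem (φ.open_source.mem_nhds hU)
  filter_upwards [nhdsWithin_le_nhds h1, self_mem_nhdsWithin] with r hr hr'
  exact HorseStreet.mem_fig.1 (h.coord_mem_fig hs hr' hr)

theorem hasDerivAt {t : ℝ} (ht : t ∈ 𝕀)
    (hU : π ((N.street s).src t) ∈ φ.source) :
    HasDerivAt (fun r => φ (π ((N.street s).src r))) (cvec φ π (velocity (N.street s).src t)) t :=
  hasDerivAt_coord hπ h.chart (N.street s).src_smooth.contMDiffAt hU ((N.street s).unbranched t ht)

/-- The pieces of a horse street run along it in the coordinate. -/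
theorem exists_cvec (hs : N.On (L p) s) {t : ℝ}
    (ht : t ∈ 𝕀) (hU : π ((N.street s).src t) ∈ φ.source) :
    ∃ c : ℝ, c ≠ 0 ∧ cvec φ π (velocity (N.street s).src t) = c * p.d := by
  obtain ⟨c, hc⟩ := deriv_mem_line ht (h.hasDerivAt hπ ht hU) p.d_ne_zero
    (h.eventually_coord hπ hs hU)
  refine ⟨c, ?_, hc⟩
  rintro rfl
  refine cvec_ne_zero hπ h.chart (w := velocity (N.street s).src t) hU
    ((N.street s).unbranched t ht) ((N.street s).src_regular t ht) ?_
  rw [hc]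
  simp

theorem exists_dirCoord {i j : Fin 3}
    (hleg : N.leg v i j = some s) (hs : N.On (L p) s) (hv : N.pt v ∈ φ.source) :
    ∃ c : ℝ, c ≠ 0 ∧ N.dirCoord φ v i j = c * p.d ∧ ∃ ρ ∈ p.R, φ (N.pt v) = p.base + ρ * p.d ∧
      (IsLeast p.R ρ → 0 < c) ∧ (IsGreatest p.R ρ → c < 0) := by
  have hU : π ((N.street s).src 0) ∈ φ.source := by rwa [N.base_leg hleg]
  obtain ⟨c, hc0, hc⟩ := h.exists_cvec hπ hs zero_mem_I hU
  obtain ⟨ρ, hρ, hρ'⟩ := HorseStreet.mem_fig.1 (h.coord_mem_fig hs zero_mem_I hU)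
  have hev := h.eventually_coord hπ hs hU
  have hd := h.hasDerivAt hπ zero_mem_I hU
  refine ⟨c, hc0, by rw [← N.cvec_leg hπ hleg, hc], ρ, hρ, by rw [← N.base_leg hleg, hρ'],
    fun hl => ?_, fun hg => ?_⟩
  · exact lt_of_le_of_ne (deriv_nonneg_of_isLeast hd p.d_ne_zero hc hρ' hl.2 hev) hc0.symm
  · exact lt_of_le_of_ne (deriv_nonpos_of_isGreatest hd p.d_ne_zero hc hρ' hg.2 hev) hc0

/-- A street that runs straight through a joint does not end there. -/
theorem not_end {i j : Fin 3} (hleg : N.leg v i j = some s)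
    (hleg' : N.leg v j i = some s') (hs : N.On (L p) s) (hs' : N.On (L p) s')
    (hv : N.pt v ∈ φ.source) : ∃ ρ ∈ p.R, φ (N.pt v) = p.base + ρ * p.d ∧
      ¬ IsLeast p.R ρ ∧ ¬ IsGreatest p.R ρ := by
  obtain ⟨c, hc0, hc, ρ, hρ, e, hl, hg⟩ := h.exists_dirCoord hπ hleg hs hv
  obtain ⟨c', hc0', hc', ρ', hρ', e', hl', hg'⟩ := h.exists_dirCoord hπ hleg' hs' hv
  have e1 : ρ' = ρ := by
    have := e.symm.trans e'
    have h1 : (ρ : ℂ) = ρ' := mul_right_cancel₀ p.d_ne_zero (add_left_cancel this)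
    exact (Complex.ofReal_inj.1 h1).symm
  subst e1
  have e2 : c' = -c := by
    have h1 : (c' : ℂ) * p.d = ((-c : ℝ) : ℂ) * p.d := by
      rw [← hc', N.dirCoord_swap φ v i j, hc]
      push_cast
      ring
    exact_mod_cast mul_right_cancel₀ p.d_ne_zero h1
  refine ⟨ρ', hρ, e, fun hh => ?_, fun hh => ?_⟩
  · have := hl hh; have := hl' hh; linarith
  · have := hg hh; have := hg' hh; linarith

theorem not_joint {i j : Fin 3}
    (hleg : N.leg v i j = some s) (hleg' : N.leg v j i = some s') (hs : N.On (L p) s)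
    (hs' : N.On (L p) s') (hv : N.pt v ∈ φ.source) (q : HorseJoint) : φ (N.pt v) ≠ q.pos := by
  intro hq
  obtain ⟨ρ, hρ, e, h1, h2⟩ := h.not_end hπ hleg hleg' hs hs' hv
  rcases HorseStreet.end_of_joint hρ (hq.symm.trans e) with h3 | h3
  exacts [h1 h3, h2 h3]

theorem exists_on {i j : Fin 3} (hleg : N.leg v i j = some s) (hs : N.TwoWay s)
    (hv : N.pt v ∈ φ.source) : ∃ p, N.On (L p) s :=
  h.twoWay_horse s hs ⟨N.pt v, by rw [← N.base_leg hleg]; exact N.mem_trace zero_mem_I, hv⟩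

/-- Two streets of a horse that meet at a joint and are not parallel meet in a joint of the
horse. -/
theorem exists_joint {p p' : HorseStreet} {i j i' j' : Fin 3}
    (hleg : N.leg v i j = some s) (hleg' : N.leg v i' j' = some s') (hs : N.On (L p) s)
    (hs' : N.On (L p') s') (hv : N.pt v ∈ φ.source)
    (hn : ¬ ((i' = i ∧ j' = j) ∨ (i' = j ∧ j' = i))) :
    ∃ q : HorseJoint, φ (N.pt v) = q.pos := by
  obtain ⟨c, hc0, hc, ρ, hρ, e, -⟩ := h.exists_dirCoord hπ hleg hs hv
  obtain ⟨c', hc0', hc', ρ', hρ', e', -⟩ := h.exists_dirCoord hπ hleg' hs' hv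
  have hw := N.wedge_dirCoord_ne_zero h.chart hv (leg_ne hleg) (leg_ne hleg') hn
  have e1 : (c : ℂ) * p.d = c • p.d := rfl
  have e2 : (c' : ℂ) * p'.d = c' • p'.d := rfl
  rw [hc, hc', e1, e2, wedge_smul_left, wedge_smul_right] at hw
  have hw' : wedge p.d p'.d ≠ 0 := fun h0 => hw (by rw [h0]; ring)
  exact HorseStreet.exists_joint (HorseStreet.mem_fig.2 ⟨ρ, hρ, e⟩)
    (HorseStreet.mem_fig.2 ⟨ρ', hρ', e'⟩) hw'

/-- Consecutive pieces of a horse street continue each other straight. -/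
theorem straight (hs : s ∈ L p) (hs' : s' ∈ L p)
    (hc : N.Continues s s') (hU : π ((N.street s').src 0) ∈ φ.source) : N.Straight s s' := by
  obtain ⟨v, i, j, h1, h2⟩ := hc
  refine ⟨v, i, j, h1, h2, fun i' j' s'' h3 ht => ?_⟩
  have hv : N.pt v ∈ φ.source := by rwa [← N.base_leg h2]
  by_contra hn
  obtain ⟨p', hp'⟩ := h.exists_on hπ h3 ht hv
  obtain ⟨q, hq⟩ := h.exists_joint hπ h2 h3 (Or.inl hs') hp' hv hn
  exact h.not_joint hπ h2 h1 (Or.inl hs') (Or.inr (by rwa [N.rev_rev])) hv q hq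

theorem src_mem_aux [T2Space C] (hp : p.R = Icc 0 1) (hs : s ∈ L p)
    (h0 : π ((N.street s).src 0) ∈ φ.source) :
    ∀ t ∈ 𝕀, π ((N.street s).src t) ∈ φ.source := by
  have hc : Continuous fun r => π ((N.street s).src r) :=
    hπ.proper.continuous.comp (N.street s).src_smooth.continuous
  have hfig : IsCompact p.fig := by
    have : p.fig = (fun r : ℝ => p.base + (r : ℂ) * p.d) '' Icc 0 1 := by
      ext w
      rw [HorseStreet.mem_fig, hp]
      simp only [mem_image, eq_comm]
    rw [this]
    exact isCompact_Icc.image (by fun_prop)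
  have himg : IsClosed (φ.symm '' p.fig) := by
    refine (hfig.image_of_continuousOn (φ.continuousOn_symm.mono ?_)).isClosed
    rw [h.disk]
    exact subset_univ _
  have key : {t | π ((N.street s).src t) ∈ φ.source} ∩ Icc 0 1
      = (fun r => π ((N.street s).src r)) ⁻¹' (φ.symm '' p.fig) ∩ Icc 0 1 := by
    ext t
    constructor
    · rintro ⟨h1, h2⟩
      exact ⟨⟨_, h.coord_mem_fig (Or.inl hs) h2 h1, φ.left_inv h1⟩, h2⟩
    · rintro ⟨⟨w, hw, hw'⟩, h2⟩
      refine ⟨?_, h2⟩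
      have : φ.symm w ∈ φ.source := φ.map_target (by rw [h.disk]; trivial)
      rwa [hw'] at this
  refine IsClosed.Icc_subset_of_forall_mem_nhdsWithin (s := {t | π ((N.street s).src t) ∈ φ.source})
    ?_ h0 fun t ht => ?_
  · rw [key]
    exact (himg.preimage hc).inter isClosed_Icc
  · exact nhdsWithin_le_nhds (hc.continuousAt.eventually_mem (φ.open_source.mem_nhds ht.1))

/-- The bounded horse streets lie in the disk of the horse. -/
theorem src_mem [T2Space C] (hp : p.R = Icc 0 1) (hs : s ∈ L p) :
    ∀ t ∈ 𝕀, π ((N.street s).src t) ∈ φ.source := by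
  have key : ∀ l : List St, (∀ s ∈ l, s ∈ L p) → l.IsChain N.Continues →
      (∀ x, l.head? = some x → π ((N.street x).src 0) ∈ φ.source) →
      ∀ s ∈ l, ∀ t ∈ 𝕀, π ((N.street s).src t) ∈ φ.source := by
    intro l
    induction l with
    | nil => simp
    | cons a l ih =>
      intro hl hch hx s hs
      have ha := h.src_mem_aux hπ hp (hl a (by simp)) (hx a rfl)
      rcases List.mem_cons.1 hs with rfl | hs
      · exact ha
      · refine ih (fun s hs => hl s (List.mem_cons_of_mem _ hs)) hch.tail (fun x hx' => ?_) s hs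
        rcases l with _ | ⟨b, l⟩
        · simp at hx'
        · simp only [List.head?_cons, Option.some.injEq] at hx'
          subst hx'
          rw [List.isChain_cons_cons] at hch
          have := congrArg (fun w => w.1) hch.1.velocity_src
          simp only [velocity_fst] at this
          rw [← this]
          exact ha 1 one_mem_I
  refine key _ (fun s hs => hs) (h.chain p) (fun x hx => ?_) s hs
  have hleg : ∃ q i j, N.leg (J q) i j = (L p).head? := by
    cases p <;> simp [HorseStreet.R, Set.ext_iff] at hp
    case a2 => exact ⟨_, _, _, h.bot_a.1⟩
    case b2 => exact ⟨_, _, _, h.bot_b.1⟩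
    case c => exact ⟨_, _, _, h.bot_c⟩
    case a2' => exact ⟨_, _, _, h.left_a.1⟩
    case b2' => exact ⟨_, _, _, h.right_b.1⟩
    all_goals
      first
        | (have := hp (-1); norm_num at this; done)
        | (have := hp 2; norm_num at this)
  obtain ⟨q, i, j, hq⟩ := hleg
  rw [hx] at hq
  rw [N.base_leg hq]
  exact h.joint_mem q

theorem straight_chain [T2Space C] (hp : p.R = Icc 0 1) :
    (L p).IsChain N.Straight :=
  (h.chain p).imp_of_mem_imp fun _ _ ha hb hab =>
    h.straight hπ ha hb hab (h.src_mem hπ hp hb 0 zero_mem_I)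

end IsHorse

namespace IsHorse

variable (h : IsHorse N φ J L) (hπ : IsSimpleBranchedCover π K)

include h hπ

theorem exists_dirCoord_of_head {q : HorseJoint} {i j : Fin 3}
    (hleg : N.leg (J q) i j = (L p).head?) (hq : q.pos = p.base) (hp : IsLeast p.R 0) :
    ∃ c : ℝ, 0 < c ∧ N.dirCoord φ (J q) i j = c * p.d := by
  obtain ⟨s, hs⟩ := h.exists_head p
  obtain ⟨c, hc0, hc, ρ, hρ, e, hl, -⟩ := h.exists_dirCoord hπ (hleg.trans hs)
    (Or.inl (List.mem_of_head? hs)) (h.joint_mem q)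
  rw [h.joint_pos, hq] at e
  have : (ρ : ℂ) * p.d = 0 := by linear_combination -e
  have : ρ = 0 := by exact_mod_cast (mul_eq_zero.1 this).resolve_right p.d_ne_zero
  subst this
  exact ⟨c, hl hp, hc⟩

theorem dirCoord_a (q : HorseJoint) :
    ∃ c : ℝ, 0 < c ∧ N.dirCoord φ (J q) 0 1 = c * (1 + Complex.I) := by
  have hd : q.outA.d = 1 + Complex.I := by cases q <;> rfl
  rw [← hd]
  refine h.exists_dirCoord_of_head hπ (h.legs_a q).1 (by cases q <;> rfl) ?_
  cases q
  exacts [isLeast_Icc zero_le_one, isLeast_Ici, isLeast_Icc zero_le_one, isLeast_Ici]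

theorem dirCoord_b (q : HorseJoint) :
    ∃ c : ℝ, 0 < c ∧ N.dirCoord φ (J q) 1 2 = c * (-1 + Complex.I) := by
  have hd : q.outB.d = -1 + Complex.I := by cases q <;> rfl
  rw [← hd]
  refine h.exists_dirCoord_of_head hπ (h.legs_b q).1 (by cases q <;> rfl) ?_
  cases q
  exacts [isLeast_Icc zero_le_one, isLeast_Icc zero_le_one, isLeast_Ici, isLeast_Ici]

theorem dirCoord_c_bot : ∃ c : ℝ, 0 < c ∧ N.dirCoord φ (J .bot) 0 2 = c * (2 * Complex.I) :=
  h.exists_dirCoord_of_head hπ (p := .c) h.bot_c rfl (isLeast_Icc zero_le_one)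

theorem dirCoord_c_top : ∃ c : ℝ, 0 < c ∧ N.dirCoord φ (J .top) 0 2 = c * (2 * Complex.I) := by
  obtain ⟨s, hs⟩ := h.exists_last .c
  have hleg : N.leg (J .top) 2 0 = some (N.rev s) := by rw [h.top_c, hs]; rfl
  obtain ⟨c, hc0, hc, ρ, hρ, e, -, hg⟩ := h.exists_dirCoord hπ hleg
    ((N.on_rev).2 (Or.inl (List.mem_of_getLast? hs))) (h.joint_mem .top)
  rw [h.joint_pos] at e
  have : ρ = 1 := by
    have := congrArg Complex.im e
    simp [HorseJoint.pos, HorseStreet.base, HorseStreet.d] at this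
    linarith
  subst this
  refine ⟨-c, by linarith [hg (isGreatest_Icc zero_le_one)], ?_⟩
  rw [N.dirCoord_swap φ _ 2 0, hc]
  simp [HorseStreet.d]

theorem eq_c_of_dirCoord {q : HorseJoint} {k : ℝ}
    (hk : N.dirCoord φ (J q) 0 2 = k * p.d) : p = .c := by
  obtain ⟨α, -, ha⟩ := h.dirCoord_a hπ q
  obtain ⟨β, -, hb⟩ := h.dirCoord_b hπ q
  obtain ⟨h1, h2, -⟩ := N.dirCoord_cyclic h.chart (h.joint_mem q)
  rw [ha, hk] at h1
  rw [hb, hk] at h2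
  have e : ∀ (c : ℝ) (z : ℂ), (c : ℂ) * z = c • z := fun c z => rfl
  rw [e, e, wedge_smul_left, wedge_smul_right] at h1 h2
  by_contra hp
  have : p.d = 1 + Complex.I ∨ p.d = -1 + Complex.I := by
    cases p <;> first | exact Or.inl rfl | exact Or.inr rfl | exact (hp rfl).elim
  rcases this with hd | hd
  · rw [hd, wedge_self] at h1
    simp at h1
  · rw [hd, wedge_self] at h2
    simp at h2

/-- Which streets lie in the third direction at a joint of a horse. -/
theorem twoWay_third {q : HorseJoint} {i j : Fin 3} (hij : (i = 0 ∧ j = 2) ∨ (i = 2 ∧ j = 0))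
    (hleg : N.leg (J q) i j = some s) (hs : N.TwoWay s) :
    (q = .bot ∧ i = 0 ∧ j = 2) ∨ (q = .top ∧ i = 2 ∧ j = 0) := by
  obtain ⟨p, hp⟩ := h.exists_on hπ hleg hs (h.joint_mem q)
  obtain ⟨c, hc0, hc, ρ, hρ, e, hl, hg⟩ := h.exists_dirCoord hπ hleg hp (h.joint_mem q)
  have hpc : p = .c := by
    rcases hij with ⟨rfl, rfl⟩ | ⟨rfl, rfl⟩
    · exact h.eq_c_of_dirCoord hπ hc
    · refine h.eq_c_of_dirCoord hπ (q := q) (k := -c) ?_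
      rw [N.dirCoord_swap φ _ 2 0, hc]
      push_cast
      ring
  subst hpc
  rw [h.joint_pos] at e
  have e1 := congrArg Complex.re e
  have e2 := congrArg Complex.im e
  have e' : ∀ x y : ℝ, (x : ℂ) * (2 * Complex.I) = y * (2 * Complex.I) → x = y := by
    intro x y hxy
    exact_mod_cast mul_right_cancel₀ (by simp) hxy
  cases q <;> simp [HorseJoint.pos, HorseStreet.base, HorseStreet.d] at e1 e2
  · subst e2
    left
    refine ⟨rfl, ?_⟩
    rcases hij with hij | ⟨rfl, rfl⟩
    · exact hij
    · obtain ⟨γ, hγ, h3⟩ := h.dirCoord_c_bot hπ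
      rw [N.dirCoord_swap φ _ 2 0, hc] at h3
      have h4 := e' (-c) γ (by rw [← h3]; simp [HorseStreet.d])
      have := hl (isLeast_Icc zero_le_one)
      linarith
  · have : ρ = 1 := by linarith
    subst this
    right
    refine ⟨rfl, ?_⟩
    rcases hij with ⟨rfl, rfl⟩ | hij
    · obtain ⟨γ, hγ, h3⟩ := h.dirCoord_c_top hπ
      rw [hc] at h3
      have h4 := e' c γ (by rw [← h3]; simp [HorseStreet.d])
      have := hg (isGreatest_Icc zero_le_one)
      linarith
    · exact hij

end IsHorse

namespace SpectralNetwork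

theorem not_present_of_chain (hS : N.SixWayStreets) :
    ∀ {L : List St}, L.IsChain N.Continues → ∀ x, L.head? = some x → ¬ N.present (N.rev x) →
      ∀ s ∈ L, ¬ N.present (N.rev s)
  | [], _, x, hx, _ => by simp at hx
  | [s], _, x, hx, hp => by simp_all
  | s :: s' :: L, hL, x, hx, hp => by
    simp only [List.head?_cons, Option.some.injEq] at hx
    subst hx
    rw [List.isChain_cons_cons] at hL
    intro r hr
    rcases List.mem_cons.1 hr with rfl | hr
    · exact hp
    · exact not_present_of_chain hS hL.2 s' rfl (fun h => hp (hL.1.rev.present hS h)) r hr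

theorem straight_revList {L : List St} (h : L.IsChain N.Straight) :
    (N.revList L).IsChain N.Straight := by
  rw [revList, List.isChain_reverse, List.isChain_map]
  refine h.imp fun a b h => ?_
  obtain ⟨v, i, j, h1, h2, h3⟩ := h
  exact ⟨v, j, i, by rw [N.rev_rev]; exact h2, h1, fun i' j' s hs ht => (h3 i' j' s hs ht).symm⟩

variable (N) in
/-- The upward constituents of a list of streets are present. -/
def Up (L : List St) : Prop := ∀ s ∈ L, N.present s

variable (N) in
/-- The downward constituents of a list of streets are present. -/
def Down (L : List St) : Prop := ∀ s ∈ L, N.present (N.rev s)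

end SpectralNetwork

namespace IsHorse

variable (h : IsHorse N φ J L) (hS : N.SixWayStreets)

include h

theorem outA (q : HorseJoint) : ∃ s, (L q.outA).head? = some s ∧ N.leg (J q) 0 1 = some s := by
  obtain ⟨s, hs⟩ := h.exists_head q.outA
  exact ⟨s, hs, by rw [(h.legs_a q).1, hs]⟩

theorem inA (q : HorseJoint) :
    ∃ s, (L q.inA).getLast? = some s ∧ N.leg (J q) 1 0 = some (N.rev s) := by
  obtain ⟨s, hs⟩ := h.exists_last q.inA
  exact ⟨s, hs, by rw [(h.legs_a q).2, hs]; rfl⟩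

theorem outB (q : HorseJoint) : ∃ s, (L q.outB).head? = some s ∧ N.leg (J q) 1 2 = some s := by
  obtain ⟨s, hs⟩ := h.exists_head q.outB
  exact ⟨s, hs, by rw [(h.legs_b q).1, hs]⟩

theorem inB (q : HorseJoint) :
    ∃ s, (L q.inB).getLast? = some s ∧ N.leg (J q) 2 1 = some (N.rev s) := by
  obtain ⟨s, hs⟩ := h.exists_last q.inB
  exact ⟨s, hs, by rw [(h.legs_b q).2, hs]; rfl⟩

theorem inAt_of_up_a {q : HorseJoint} (hu : N.Up (L q.inA)) : N.inAt (J q) 0 1 := by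
  obtain ⟨s, hs, hl⟩ := h.inA q
  rw [inAt_iff hl, N.rev_rev]
  exact hu s (List.mem_of_getLast? hs)

theorem inAt_of_up_b {q : HorseJoint} (hu : N.Up (L q.inB)) : N.inAt (J q) 1 2 := by
  obtain ⟨s, hs, hl⟩ := h.inB q
  rw [inAt_iff hl, N.rev_rev]
  exact hu s (List.mem_of_getLast? hs)

theorem inAt_of_down_a {q : HorseJoint} (hu : N.Down (L q.outA)) : N.inAt (J q) 1 0 := by
  obtain ⟨s, hs, hl⟩ := h.outA q
  rw [inAt_iff hl]
  exact hu s (List.mem_of_head? hs)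

theorem inAt_of_down_b {q : HorseJoint} (hu : N.Down (L q.outB)) : N.inAt (J q) 2 1 := by
  obtain ⟨s, hs, hl⟩ := h.outB q
  rw [inAt_iff hl]
  exact hu s (List.mem_of_head? hs)

include hS

theorem up_of_head (hs : (L p).head? = some s) (hp : N.present s) :
    N.Up (L p) := present_of_chain hS (h.chain p) s hs hp

theorem down_of_last (hs : (L p).getLast? = some s)
    (hp : N.present (N.rev s)) : N.Down (L p) := fun r hr =>
  present_of_chain hS (chain_revList (h.chain p)) (N.rev s) (by rw [head?_revList, hs]; rfl) hp
    (N.rev r) (mem_revList.2 (by rwa [N.rev_rev]))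

theorem up_a {q : HorseJoint} (ho : N.outAt (J q) 0 1) : N.Up (L q.outA) := by
  obtain ⟨s, hs, hl⟩ := h.outA q
  exact h.up_of_head hS hs ((outAt_iff hl).1 ho)

theorem up_b {q : HorseJoint} (ho : N.outAt (J q) 1 2) : N.Up (L q.outB) := by
  obtain ⟨s, hs, hl⟩ := h.outB q
  exact h.up_of_head hS hs ((outAt_iff hl).1 ho)

theorem down_a {q : HorseJoint} (ho : N.outAt (J q) 1 0) : N.Down (L q.inA) := by
  obtain ⟨s, hs, hl⟩ := h.inA q
  exact h.down_of_last hS hs ((outAt_iff hl).1 ho)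

theorem down_b {q : HorseJoint} (ho : N.outAt (J q) 2 1) : N.Down (L q.inB) := by
  obtain ⟨s, hs, hl⟩ := h.inB q
  exact h.down_of_last hS hs ((outAt_iff hl).1 ho)

theorem up_outA {q : HorseJoint} (hu : N.Up (L q.inA)) : N.Up (L q.outA) :=
  h.up_a hS (hS.out_of_in (by decide) (h.inAt_of_up_a hu))

theorem up_outB {q : HorseJoint} (hu : N.Up (L q.inB)) : N.Up (L q.outB) :=
  h.up_b hS (hS.out_of_in (by decide) (h.inAt_of_up_b hu))

theorem down_inA {q : HorseJoint} (hu : N.Down (L q.outA)) : N.Down (L q.inA) :=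
  h.down_a hS (hS.out_of_in (by decide) (h.inAt_of_down_a hu))

theorem down_inB {q : HorseJoint} (hu : N.Down (L q.outB)) : N.Down (L q.inB) :=
  h.down_b hS (hS.out_of_in (by decide) (h.inAt_of_down_b hu))

theorem inAt_c_bot : N.inAt (J .bot) 2 0 := by
  obtain ⟨s, hs⟩ := h.exists_head .c
  rw [inAt_iff (h.bot_c.trans hs)]
  exact (h.twoWay_c s (List.mem_of_head? hs)).2

theorem inAt_c_top : N.inAt (J .top) 0 2 := by
  obtain ⟨s, hs⟩ := h.exists_last .c
  have hleg : N.leg (J .top) 2 0 = some (N.rev s) := by rw [h.top_c, hs]; rfl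
  rw [inAt_iff hleg, N.rev_rev]
  exact (h.twoWay_c s (List.mem_of_getLast? hs)).1

theorem rules (q : HorseJoint) : PresenceRules (N.outAt (J q)) (N.inAt (J q)) 0 1 2 := hS.rules (J q) 0

/-- The lower legs of a horse are two-way. -/
theorem down_lower (ha : N.Up (L .a1)) (hb : N.Up (L .b1)) :
    N.Down (L .a1) ∧ N.Down (L .b1) := by
  obtain ⟨r1, r2, r3, r4, r5, r6⟩ := h.rules hS .bot
  have i20 := h.inAt_c_bot hS
  have o20 : N.outAt (J .bot) 2 0 := r5.2 (Or.inl i20)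
  have o01 : N.outAt (J .bot) 0 1 := r1.2 (Or.inl (h.inAt_of_up_a (q := .bot) ha))
  exact ⟨h.down_a hS (q := .bot) (r4.2 (Or.inr ⟨h.inAt_of_up_b (q := .bot) hb, o20⟩)),
    h.down_b hS (q := .bot) (r6.2 (Or.inr ⟨i20, o01⟩))⟩

/-- The upper legs of a horse are two-way. -/
theorem up_upper (ha : N.Down (L .a1')) (hb : N.Down (L .b1')) :
    N.Up (L .a1') ∧ N.Up (L .b1') := by
  obtain ⟨r1, r2, r3, r4, r5, r6⟩ := h.rules hS .top
  have i02 := h.inAt_c_top hS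
  have o02 : N.outAt (J .top) 0 2 := r2.2 (Or.inl i02)
  have o10 : N.outAt (J .top) 1 0 := r4.2 (Or.inl (h.inAt_of_down_a (q := .top) ha))
  exact ⟨h.up_a hS (q := .top) (r1.2 (Or.inr ⟨o02, h.inAt_of_down_b (q := .top) hb⟩)),
    h.up_b hS (q := .top) (r3.2 (Or.inr ⟨o10, i02⟩))⟩

variable (hπ : IsSimpleBranchedCover π K) 

include hπ

theorem side_third {q : HorseJoint} (hq : q = .right ∨ q = .left) {i j : Fin 3}
    (hij : (i = 0 ∧ j = 2) ∨ (i = 2 ∧ j = 0)) (ho : N.outAt (J q) i j) : ¬ N.inAt (J q) j i := by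
  intro hi
  obtain ⟨s, hs, ht⟩ := exists_twoWay_leg ho hi
  rcases h.twoWay_third hπ hij hs ht with ⟨rfl, -⟩ | ⟨rfl, -⟩ <;> simp at hq

theorem not_down_of_head (hs : (L p).head? = some s)
    (hp : ¬ N.present (N.rev s)) : ∀ r ∈ L p, ¬ N.present (N.rev r) :=
  not_present_of_chain hS (h.chain p) s hs hp

theorem not_up_of_last (hs : (L p).getLast? = some s)
    (hp : ¬ N.present s) : ∀ r ∈ L p, ¬ N.present r := fun r hr => by
  have := not_present_of_chain hS (chain_revList (h.chain p)) (N.rev s)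
    (by rw [head?_revList, hs]; rfl) (by rwa [N.rev_rev]) (N.rev r)
    (mem_revList.2 (by rwa [N.rev_rev]))
  rwa [N.rev_rev] at this

theorem not_down_of_last [T2Space C] (hp : p.R = Icc 0 1) (hu : N.Up (L p))
    (hs : (L p).getLast? = some s) (hs' : ¬ N.present (N.rev s)) :
    ∀ r ∈ L p, ¬ N.present (N.rev r) :=
  not_present_of_straight_list hS (h.straight_chain hπ hp) hu s hs hs'

theorem not_up_of_head [T2Space C] (hp : p.R = Icc 0 1) (hu : N.Down (L p))
    (hs : (L p).head? = some s) (hs' : ¬ N.present s) : ∀ r ∈ L p, ¬ N.present r := fun r hr => by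
  have := not_present_of_straight_list hS (straight_revList (h.straight_chain hπ hp))
    (fun r hr => by
      have := hu (N.rev r) (mem_revList.1 hr)
      rwa [N.rev_rev] at this)
    (N.rev s) (by rw [getLast?_revList, hs]; rfl) (by rwa [N.rev_rev]) (N.rev r)
    (mem_revList.2 (by rwa [N.rev_rev]))
  rwa [N.rev_rev] at this

theorem not_down_a2 [T2Space C] (hu : N.Up (L .a2)) (h0 : ∀ s ∈ L .a3, ¬ N.present (N.rev s)) :
    ∀ r ∈ L .a2, ¬ N.present (N.rev r) := by
  obtain ⟨s, hs, hl⟩ := h.inA .right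
  refine h.not_down_of_last hS hπ rfl hu hs ?_
  rw [← outAt_iff hl]
  obtain ⟨r1, r2, r3, r4, r5, r6⟩ := h.rules hS .right
  have n10 : ¬ N.inAt (J .right) 1 0 := by
    obtain ⟨s', hs', hl'⟩ := h.outA .right
    rw [inAt_iff hl']
    exact h0 s' (List.mem_of_head? hs')
  have i01 := h.inAt_of_up_a (q := .right) hu
  intro o10
  obtain ⟨i12, o20⟩ := (r4.1 o10).resolve_left n10
  have i20 := (r5.1 o20).resolve_right fun hh => n10 hh.2
  exact h.side_third hS hπ (Or.inl rfl) (Or.inl ⟨rfl, rfl⟩)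
    (r2.2 (Or.inr ⟨i01, r3.2 (Or.inl i12)⟩)) i20

theorem not_down_b2 [T2Space C] (hu : N.Up (L .b2)) (h0 : ∀ s ∈ L .b3, ¬ N.present (N.rev s)) :
    ∀ r ∈ L .b2, ¬ N.present (N.rev r) := by
  obtain ⟨s, hs, hl⟩ := h.inB .left
  refine h.not_down_of_last hS hπ rfl hu hs ?_
  rw [← outAt_iff hl]
  obtain ⟨r1, r2, r3, r4, r5, r6⟩ := h.rules hS .left
  have n21 : ¬ N.inAt (J .left) 2 1 := by
    obtain ⟨s', hs', hl'⟩ := h.outB .left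
    rw [inAt_iff hl']
    exact h0 s' (List.mem_of_head? hs')
  have i12 := h.inAt_of_up_b (q := .left) hu
  intro o21
  obtain ⟨i20, o01⟩ := (r6.1 o21).resolve_left n21
  have i01 := (r1.1 o01).resolve_right fun hh => n21 hh.2
  exact h.side_third hS hπ (Or.inr rfl) (Or.inl ⟨rfl, rfl⟩)
    (r2.2 (Or.inr ⟨i01, r3.2 (Or.inl i12)⟩)) i20

theorem not_up_a2' [T2Space C] (hu : N.Down (L .a2')) (h0 : ∀ s ∈ L .a3', ¬ N.present s) :
    ∀ r ∈ L .a2', ¬ N.present r := by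
  obtain ⟨s, hs, hl⟩ := h.outA .left
  refine h.not_up_of_head hS hπ rfl hu hs ?_
  rw [← outAt_iff hl]
  obtain ⟨r1, r2, r3, r4, r5, r6⟩ := h.rules hS .left
  have n01 : ¬ N.inAt (J .left) 0 1 := by
    obtain ⟨s', hs', hl'⟩ := h.inA .left
    rw [inAt_iff hl', N.rev_rev]
    exact h0 s' (List.mem_of_getLast? hs')
  have i10 := h.inAt_of_down_a (q := .left) hu
  intro o01
  obtain ⟨o02, i21⟩ := (r1.1 o01).resolve_left n01
  have i02 := (r2.1 o02).resolve_right fun hh => n01 hh.1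
  exact h.side_third hS hπ (Or.inr rfl) (Or.inr ⟨rfl, rfl⟩)
    (r5.2 (Or.inr ⟨r6.2 (Or.inl i21), i10⟩)) i02

theorem not_up_b2' [T2Space C] (hu : N.Down (L .b2')) (h0 : ∀ s ∈ L .b3', ¬ N.present s) :
    ∀ r ∈ L .b2', ¬ N.present r := by
  obtain ⟨s, hs, hl⟩ := h.outB .right
  refine h.not_up_of_head hS hπ rfl hu hs ?_
  rw [← outAt_iff hl]
  obtain ⟨r1, r2, r3, r4, r5, r6⟩ := h.rules hS .right
  have n12 : ¬ N.inAt (J .right) 1 2 := by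
    obtain ⟨s', hs', hl'⟩ := h.inB .right
    rw [inAt_iff hl', N.rev_rev]
    exact h0 s' (List.mem_of_getLast? hs')
  have i21 := h.inAt_of_down_b (q := .right) hu
  intro o12
  obtain ⟨o10, i02⟩ := (r3.1 o12).resolve_left n12
  have i10 := (r4.1 o10).resolve_right fun hh => n12 hh.1
  exact h.side_third hS hπ (Or.inl rfl) (Or.inr ⟨rfl, rfl⟩)
    (r5.2 (Or.inr ⟨r6.2 (Or.inl i21), i10⟩)) i02

end IsHorse

/-- The horse streets that are two-way in the `l`th horse of an `m`-herd. -/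
def HorseStreet.Active (m l : ℕ) : HorseStreet → Prop
  | a2 | b2 | a3 | b3 => l < m
  | a2' | b2' | a3' | b3' => 1 < l
  | _ => True

namespace Herd

variable {m : ℕ} (H : Herd N m)

theorem exists_source_a : ∃ s, (H.street 1 .a1).head? = some s ∧ N.cap s = some (H.source 0) := by
  have := H.source_a
  rcases e : (H.street 1 .a1).head? with _ | s
  · rw [e] at this; simp at this
  · rw [e] at this; exact ⟨s, rfl, this⟩

theorem exists_source_b : ∃ s, (H.street 1 .b1).head? = some s ∧ N.cap s = some (H.source 1) := by
  have := H.source_b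
  rcases e : (H.street 1 .b1).head? with _ | s
  · rw [e] at this; simp at this
  · rw [e] at this; exact ⟨s, rfl, this⟩

theorem exists_source_a' :
    ∃ s, (H.street m .a1').getLast? = some s ∧ N.cap (N.rev s) = some (H.source 2) := by
  have := H.source_a'
  rcases e : (H.street m .a1').getLast? with _ | s
  · rw [e] at this; simp at this
  · rw [e] at this; exact ⟨s, rfl, this⟩

theorem exists_source_b' :
    ∃ s, (H.street m .b1').getLast? = some s ∧ N.cap (N.rev s) = some (H.source 3) := by
  have := H.source_b'
  rcases e : (H.street m .b1').getLast? with _ | s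
  · rw [e] at this; simp at this
  · rw [e] at this; exact ⟨s, rfl, this⟩

variable (hS : N.SixWayStreets)

include hS

theorem up_lower : ∀ l ∈ Icc 1 m, N.Up (H.street l .a1) ∧ N.Up (H.street l .b1) ∧
    N.Up (H.street l .a2) ∧ N.Up (H.street l .b2) ∧ N.Up (H.street l .a3) ∧ N.Up (H.street l .b3) := by
  have step : ∀ l ∈ Icc 1 m, N.Up (H.street l .a1) → N.Up (H.street l .b1) →
      N.Up (H.street l .a1) ∧ N.Up (H.street l .b1) ∧ N.Up (H.street l .a2) ∧ N.Up (H.street l .b2) ∧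
      N.Up (H.street l .a3) ∧ N.Up (H.street l .b3) := by
    intro l hl ha hb
    have h := H.horse l hl
    have ha2 := h.up_outA hS (q := .bot) ha
    have hb2 := h.up_outB hS (q := .bot) hb
    exact ⟨ha, hb, ha2, hb2, h.up_outA hS (q := .right) ha2, h.up_outB hS (q := .left) hb2⟩
  intro l hl
  obtain ⟨h1, h2⟩ := hl
  induction l, h1 using Nat.le_induction with
  | base =>
    have h := H.horse 1 ⟨le_rfl, h2⟩
    obtain ⟨s, hs, hc⟩ := H.exists_source_a
    obtain ⟨s', hs', hc'⟩ := H.exists_source_b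
    exact step 1 ⟨le_rfl, h2⟩ (h.up_of_head hS hs (N.present_cap s (by simp [hc])))
      (h.up_of_head hS hs' (N.present_cap s' (by simp [hc'])))
  | succ l h1 ih =>
    obtain ⟨-, -, -, -, ha, hb⟩ := ih (by omega)
    obtain ⟨g1, g2, -, -⟩ := H.glue l h1 h2
    exact step (l + 1) ⟨by omega, h2⟩ (g1 ▸ ha) (g2 ▸ hb)

theorem down_upper : ∀ l ∈ Icc 1 m, N.Down (H.street l .a1') ∧ N.Down (H.street l .b1') ∧
    N.Down (H.street l .a2') ∧ N.Down (H.street l .b2') ∧ N.Down (H.street l .a3') ∧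
    N.Down (H.street l .b3') := by
  have step : ∀ l ∈ Icc 1 m, N.Down (H.street l .a1') → N.Down (H.street l .b1') →
      N.Down (H.street l .a1') ∧ N.Down (H.street l .b1') ∧ N.Down (H.street l .a2') ∧
      N.Down (H.street l .b2') ∧ N.Down (H.street l .a3') ∧ N.Down (H.street l .b3') := by
    intro l hl ha hb
    have h := H.horse l hl
    have ha2 := h.down_inA hS (q := .top) ha
    have hb2 := h.down_inB hS (q := .top) hb
    exact ⟨ha, hb, ha2, hb2, h.down_inA hS (q := .left) ha2, h.down_inB hS (q := .right) hb2⟩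
  intro l hl
  obtain ⟨h1, h2⟩ := hl
  induction h2 using Nat.decreasingInduction with
  | self =>
    have h := H.horse m ⟨h1, le_rfl⟩
    obtain ⟨s, hs, hc⟩ := H.exists_source_a'
    obtain ⟨s', hs', hc'⟩ := H.exists_source_b'
    exact step m ⟨h1, le_rfl⟩ (h.down_of_last hS hs (N.present_cap _ (by simp [hc])))
      (h.down_of_last hS hs' (N.present_cap _ (by simp [hc'])))
  | of_succ l h2 ih =>
    obtain ⟨-, -, -, -, ha, hb⟩ := ih (by omega)
    obtain ⟨-, -, g1, g2⟩ := H.glue l h1 h2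
    exact step l ⟨by omega, by omega⟩ (g1 ▸ ha) (g2 ▸ hb)

theorem twoWay_outer (hl : l ∈ Icc 1 m) : N.Down (H.street l .a1) ∧
    N.Down (H.street l .b1) ∧ N.Up (H.street l .a1') ∧ N.Up (H.street l .b1') := by
  obtain ⟨h1, h2, -⟩ := H.up_lower hS l hl
  obtain ⟨g1, g2, -⟩ := H.down_upper hS l hl
  have h := H.horse l hl
  exact ⟨(h.down_lower hS h1 h2).1, (h.down_lower hS h1 h2).2, h.up_upper hS g1 g2⟩

theorem down_inner (hl : l ∈ Icc 1 m) (hm : l < m) : N.Down (H.street l .a2) ∧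
    N.Down (H.street l .b2) ∧ N.Down (H.street l .a3) ∧ N.Down (H.street l .b3) := by
  obtain ⟨h1, h2, -⟩ := H.twoWay_outer hS (l := l + 1) ⟨by omega, hm⟩
  obtain ⟨g1, g2, -, -⟩ := H.glue l hl.1 hm
  rw [g1] at h1
  rw [g2] at h2
  have h := H.horse l hl
  exact ⟨h.down_inA hS (q := .right) h1, h.down_inB hS (q := .left) h2, h1, h2⟩

theorem up_inner (hl : l ∈ Icc 1 m) (hm : 1 < l) : N.Up (H.street l .a2') ∧
    N.Up (H.street l .b2') ∧ N.Up (H.street l .a3') ∧ N.Up (H.street l .b3') := by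
  obtain ⟨k, rfl⟩ : ∃ k, l = k + 1 := ⟨l - 1, by omega⟩
  obtain ⟨-, -, h1, h2⟩ := H.twoWay_outer hS (l := k) ⟨by omega, by have := hl.2; omega⟩
  obtain ⟨-, -, g1, g2⟩ := H.glue k (by omega) hl.2
  rw [g1] at h1
  rw [g2] at h2
  have h := H.horse (k + 1) hl
  exact ⟨h.up_outA hS (q := .left) h1, h.up_outB hS (q := .right) h2, h1, h2⟩

theorem twoWay_of_active (hl : l ∈ Icc 1 m) (hp : p.Active m l) :
    ∀ s ∈ H.street l p, N.TwoWay s := by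
  obtain ⟨a1, a2, a3, a4, a5, a6⟩ := H.up_lower hS l hl
  obtain ⟨b1, b2, b3, b4, b5, b6⟩ := H.down_upper hS l hl
  obtain ⟨c1, c2, c3, c4⟩ := H.twoWay_outer hS hl
  intro s hs
  cases p
  case a1 => exact ⟨a1 s hs, c1 s hs⟩
  case a2 => exact ⟨a3 s hs, (H.down_inner hS hl hp).1 s hs⟩
  case a3 => exact ⟨a5 s hs, (H.down_inner hS hl hp).2.2.1 s hs⟩
  case b1 => exact ⟨a2 s hs, c2 s hs⟩
  case b2 => exact ⟨a4 s hs, (H.down_inner hS hl hp).2.1 s hs⟩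
  case b3 => exact ⟨a6 s hs, (H.down_inner hS hl hp).2.2.2 s hs⟩
  case c => exact (H.horse l hl).twoWay_c s hs
  case a1' => exact ⟨c3 s hs, b1 s hs⟩
  case a2' => exact ⟨(H.up_inner hS hl hp).1 s hs, b3 s hs⟩
  case a3' => exact ⟨(H.up_inner hS hl hp).2.2.1 s hs, b5 s hs⟩
  case b1' => exact ⟨c4 s hs, b2 s hs⟩
  case b2' => exact ⟨(H.up_inner hS hl hp).2.1 s hs, b4 s hs⟩
  case b3' => exact ⟨(H.up_inner hS hl hp).2.2.2 s hs, b6 s hs⟩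

theorem not_twoWay_of_not_active [T2Space C] (hπ : IsSimpleBranchedCover π K)
    (hl : l ∈ Icc 1 m) (hp : ¬ p.Active m l) :
    ∀ s ∈ H.street l p, ¬ N.TwoWay s := by
  obtain ⟨u1, u2, u3, u4, u5, u6⟩ := H.up_lower hS l hl
  obtain ⟨d1, d2, d3, d4, d5, d6⟩ := H.down_upper hS l hl
  have h := H.horse l hl
  have hcase : (l = m ∧ (p = .a2 ∨ p = .b2 ∨ p = .a3 ∨ p = .b3)) ∨
      (l = 1 ∧ (p = .a2' ∨ p = .b2' ∨ p = .a3' ∨ p = .b3')) := by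
    have h1 := hl.1
    have h2 := hl.2
    cases p <;> simp [HorseStreet.Active] at hp ⊢ <;> omega
  rcases hcase with ⟨rfl, hp'⟩ | ⟨rfl, hp'⟩
  · have k3 : ∀ s ∈ H.street l .a3, ¬ N.present (N.rev s) := by
      obtain ⟨s, hs⟩ := h.exists_head .a3
      exact h.not_down_of_head hS hπ hs (H.upper_a s hs)
    have k3' : ∀ s ∈ H.street l .b3, ¬ N.present (N.rev s) := by
      obtain ⟨s, hs⟩ := h.exists_head .b3
      exact h.not_down_of_head hS hπ hs (H.upper_b s hs)
    rcases hp' with rfl | rfl | rfl | rfl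
    · exact fun s hs ht => h.not_down_a2 hS hπ u3 k3 s hs ht.2
    · exact fun s hs ht => h.not_down_b2 hS hπ u4 k3' s hs ht.2
    · exact fun s hs ht => k3 s hs ht.2
    · exact fun s hs ht => k3' s hs ht.2
  · have k3 : ∀ s ∈ H.street 1 .a3', ¬ N.present s := by
      obtain ⟨s, hs⟩ := h.exists_last .a3'
      exact h.not_up_of_last hS hπ hs (H.lower_a s hs)
    have k3' : ∀ s ∈ H.street 1 .b3', ¬ N.present s := by
      obtain ⟨s, hs⟩ := h.exists_last .b3'
      exact h.not_up_of_last hS hπ hs (H.lower_b s hs)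
    rcases hp' with rfl | rfl | rfl | rfl
    · exact fun s hs ht => h.not_up_a2' hS hπ d3 k3 s hs ht.1
    · exact fun s hs ht => h.not_up_b2' hS hπ d4 k3' s hs ht.1
    · exact fun s hs ht => k3 s hs ht.1
    · exact fun s hs ht => k3' s hs ht.1

end Herd

section Lists

variable {α : Type*} {R : α → α → Prop}

theorem eq_of_getElem_eq {L L' : List α} (hR : ∀ a b c, R a c → R b c → a = b)
    (hL : L.IsChain R) (hL' : L'.IsChain R) (h0 : ∀ x a, L.head? = some x → ¬ R a x)
    (h0' : ∀ x a, L'.head? = some x → ¬ R a x) :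
    ∀ (i j : ℕ) (hi : i < L.length) (hj : j < L'.length), L[i] = L'[j] →
      i = j ∧ L.head? = L'.head? := by
  rw [List.isChain_iff_getElem] at hL hL'
  intro i
  induction i with
  | zero =>
    intro j hi hj e
    rcases j with _ | j
    · refine ⟨rfl, ?_⟩
      rw [List.head?_eq_getElem?, List.head?_eq_getElem?, List.getElem?_eq_getElem hi,
        List.getElem?_eq_getElem hj, e]
    · refine (h0 L[0] L'[j] (by rw [List.head?_eq_getElem?, List.getElem?_eq_getElem hi]) ?_).elim
      rw [e]
      exact hL' j hj
  | succ i ih =>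
    intro j hi hj e
    rcases j with _ | j
    · refine (h0' L'[0] L[i] (by rw [List.head?_eq_getElem?, List.getElem?_eq_getElem hj]) ?_).elim
      rw [← e]
      exact hL i hi
    · obtain ⟨h1, h2⟩ := ih j (by omega) (by omega) (hR _ _ _ (hL i hi) (e ▸ hL' j hj))
      exact ⟨by rw [h1], h2⟩

theorem nodup_of_chain {L : List α} (hR : ∀ a b c, R a c → R b c → a = b)
    (hL : L.IsChain R) (h0 : ∀ x a, L.head? = some x → ¬ R a x) : L.Nodup := by
  rw [List.nodup_iff_injective_get]
  intro i j e
  exact Fin.ext (eq_of_getElem_eq hR hL hL h0 h0 i j i.2 j.2 e).1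

theorem head_eq_of_mem {L L' : List α} (hR : ∀ a b c, R a c → R b c → a = b)
    (hL : L.IsChain R) (hL' : L'.IsChain R) (h0 : ∀ x a, L.head? = some x → ¬ R a x)
    (h0' : ∀ x a, L'.head? = some x → ¬ R a x) {s : α} (hs : s ∈ L) (hs' : s ∈ L') :
    L.head? = L'.head? := by
  obtain ⟨i, hi, rfl⟩ := List.getElem_of_mem hs
  obtain ⟨j, hj, e⟩ := List.getElem_of_mem hs'
  exact (eq_of_getElem_eq hR hL hL' h0 h0' i j hi hj e.symm).2

theorem flatMap_range_succ (f : ℕ → List α) (n : ℕ) :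
    (List.range (n + 1)).flatMap f = (List.range n).flatMap f ++ f n := by
  rw [List.range_succ, List.flatMap_append]
  simp

theorem getLast?_flatMap_range (f : ℕ → List α) (n : ℕ) (hf : f n ≠ []) :
    ((List.range (n + 1)).flatMap f).getLast? = (f n).getLast? := by
  rw [flatMap_range_succ, List.getLast?_append_of_ne_nil _ hf]

theorem head?_flatMap_range (f : ℕ → List α) (n : ℕ) (hf : f 0 ≠ []) :
    ((List.range (n + 1)).flatMap f).head? = (f 0).head? := by
  rw [List.range_succ_eq_map, List.flatMap_cons]
  obtain ⟨x, l, e⟩ := List.exists_cons_of_ne_nil hf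
  rw [e]
  rfl

theorem isChain_flatMap_range (f : ℕ → List α) : ∀ n : ℕ, (∀ b < n, f b ≠ []) →
    (∀ b < n, (f b).IsChain R) →
    (∀ b, b + 1 < n → ∀ x y, (f b).getLast? = some x → (f (b + 1)).head? = some y → R x y) →
    ((List.range n).flatMap f).IsChain R
  | 0, _, _, _ => by simp
  | 1, _, h, _ => by simpa [flatMap_range_succ] using h 0 (by simp)
  | n + 2, h1, h2, h3 => by
    rw [flatMap_range_succ, List.isChain_append]
    refine ⟨isChain_flatMap_range f (n + 1) (fun b hb => h1 b (by omega)) (fun b hb => h2 b (by omega))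
      (fun b hb => h3 b (by omega)), h2 _ (by omega), ?_⟩
    intro x hx y hy
    rw [getLast?_flatMap_range f n (h1 n (by omega))] at hx
    exact h3 n (by omega) x y hx hy

end Lists

/-- The four lines of two-way streets of a herd, each starting at one of the branch points. -/
inductive Arm
  | a | b | a' | b'

namespace Arm

/-- The street of a horse that comes first on an arm. -/
def outer : Arm → HorseStreet
  | a => .a1 | b => .b1 | a' => .a1' | b' => .b1'

/-- The street of a horse that comes second on an arm. -/
def inner : Arm → HorseStreet
  | a => .a2 | b => .b2 | a' => .a2' | b' => .b2'

/-- The number of the horse that is reached as number `n` on an arm. -/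
def level (m n : ℕ) : Arm → ℕ
  | a | b => n + 1
  | a' | b' => m - n

/-- The number of the branch point at which an arm starts. -/
def index : Arm → Fin 4
  | a => 0 | b => 1 | a' => 2 | b' => 3

theorem index_injective : Function.Injective index := by
  intro x y h
  cases x <;> cases y <;> simp [index] at h ⊢

theorem level_mem {m n : ℕ} (h : n < m) (x : Arm) : x.level m n ∈ Icc 1 m := by
  cases x <;> simp only [level, mem_Icc] <;> omega

theorem outer_active (m l : ℕ) (x : Arm) : x.outer.Active m l := by
  cases x <;> trivial

theorem inner_active {m n : ℕ} (h : n < m) (x : Arm) :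
    x.inner.Active m (x.level m n) ↔ n + 1 < m := by
  cases x <;> simp only [level, inner, HorseStreet.Active] <;> omega

end Arm

namespace IsHorse

variable (h : IsHorse N φ J L)

include h

theorem continues_a (q : HorseJoint) {x y : St} (hx : (L q.inA).getLast? = some x)
    (hy : (L q.outA).head? = some y) : N.Continues x y :=
  ⟨J q, 0, 1, by rw [(h.legs_a q).2, hx]; rfl, by rw [(h.legs_a q).1, hy]⟩

theorem continues_b (q : HorseJoint) {x y : St} (hx : (L q.inB).getLast? = some x)
    (hy : (L q.outB).head? = some y) : N.Continues x y :=
  ⟨J q, 1, 2, by rw [(h.legs_b q).2, hx]; rfl, by rw [(h.legs_b q).1, hy]⟩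

end IsHorse

variable (N) in
/-- A list of streets, or the reversed list, in the direction in which an arm runs through it. -/
def Arm.orient (L : List St) : Arm → List St
  | a | b => L
  | a' | b' => N.revList L

theorem Arm.mem_orient {x : Arm} {L : List St} (h : s ∈ x.orient N L) : N.On L s := by
  cases x
  exacts [Or.inl h, Or.inl h, Or.inr (mem_revList.1 h), Or.inr (mem_revList.1 h)]

theorem Arm.on_orient {x : Arm} {L : List St} : N.On (x.orient N L) s ↔ N.On L s := by
  cases x <;> simp only [orient, On, mem_revList, N.rev_rev]
  · tauto
  · tauto

theorem Arm.orient_ne_nil {x : Arm} {L : List St} (h : L ≠ []) : x.orient N L ≠ [] := by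
  cases x <;> simpa [orient, revList] using h

theorem Arm.chain_orient {x : Arm} {L : List St} (h : L.IsChain N.Continues) :
    (x.orient N L).IsChain N.Continues := by
  cases x
  exacts [h, h, chain_revList h, chain_revList h]

namespace Herd

variable {m : ℕ} (H : Herd N m)

/-- The blocks of an arm: outer and inner streets in turn. -/
def block (x : Arm) (b : ℕ) : List St :=
  x.orient N (H.street (x.level m (b / 2)) (if b % 2 = 0 then x.outer else x.inner))

theorem block_ne_nil (x : Arm) {b : ℕ} (hb : b < 2 * m) : H.block x b ≠ [] :=
  Arm.orient_ne_nil ((H.horse _ (x.level_mem (by omega))).ne_nil _)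

theorem block_chain (x : Arm) {b : ℕ} (hb : b < 2 * m) : (H.block x b).IsChain N.Continues :=
  Arm.chain_orient ((H.horse _ (x.level_mem (by omega))).chain _)

theorem block_even (x : Arm) (n : ℕ) :
    H.block x (2 * n) = x.orient N (H.street (x.level m n) x.outer) := by
  rw [block, show 2 * n / 2 = n by omega, if_pos (by omega)]

theorem block_odd (x : Arm) (n : ℕ) :
    H.block x (2 * n + 1) = x.orient N (H.street (x.level m n) x.inner) := by
  rw [block, show (2 * n + 1) / 2 = n by omega, if_neg (by omega)]

theorem continues_outer_inner (x : Arm) {n : ℕ} (hn : n < m)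
    (hs : (H.block x (2 * n)).getLast? = some s) (hs' : (H.block x (2 * n + 1)).head? = some s') :
    N.Continues s s' := by
  have h := H.horse _ (x.level_mem hn)
  rw [block_even] at hs
  rw [block_odd] at hs'
  cases x <;> simp only [Arm.orient, getLast?_revList, head?_revList, Option.map_eq_some_iff] at hs hs'
  · exact h.continues_a .bot hs hs'
  · exact h.continues_b .bot hs hs'
  · obtain ⟨t, ht, rfl⟩ := hs
    obtain ⟨t', ht', rfl⟩ := hs'
    exact (h.continues_a .top ht' ht).rev
  · obtain ⟨t, ht, rfl⟩ := hs
    obtain ⟨t', ht', rfl⟩ := hs'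
    exact (h.continues_b .top ht' ht).rev

theorem continues_inner_outer (x : Arm) {n : ℕ} (hn : n + 1 < m)
    (hs : (H.block x (2 * n + 1)).getLast? = some s)
    (hs' : (H.block x (2 * (n + 1))).head? = some s') : N.Continues s s' := by
  have h := H.horse _ (x.level_mem (show n < m by omega))
  rw [block_odd] at hs
  rw [block_even] at hs'
  cases x <;> simp only [Arm.orient, getLast?_revList, head?_revList, Option.map_eq_some_iff] at hs hs'
  · refine h.continues_a .right hs ?_
    rw [← hs']
    exact congrArg List.head? (H.glue (n + 1) (by omega) hn).1.symm
  · refine h.continues_b .left hs ?_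
    rw [← hs']
    exact congrArg List.head? (H.glue (n + 1) (by omega) hn).2.1.symm
  · obtain ⟨t, ht, rfl⟩ := hs
    obtain ⟨t', ht', rfl⟩ := hs'
    refine (h.continues_a .left ?_ ht).rev
    rw [← ht']
    have := (H.glue (m - (n + 1)) (by omega) (by omega)).2.2.1
    rw [show m - (n + 1) + 1 = m - n by omega] at this
    exact congrArg List.getLast? this.symm
  · obtain ⟨t, ht, rfl⟩ := hs
    obtain ⟨t', ht', rfl⟩ := hs'
    refine (h.continues_b .right ?_ ht).rev
    rw [← ht']
    have := (H.glue (m - (n + 1)) (by omega) (by omega)).2.2.2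
    rw [show m - (n + 1) + 1 = m - n by omega] at this
    exact congrArg List.getLast? this.symm

theorem block_continues (x : Arm) {b : ℕ} (hb : b + 1 < 2 * m)
    (hs : (H.block x b).getLast? = some s) (hs' : (H.block x (b + 1)).head? = some s') :
    N.Continues s s' := by
  rcases Nat.even_or_odd' b with ⟨n, rfl | rfl⟩
  · exact H.continues_outer_inner x (by omega) hs hs'
  · exact H.continues_inner_outer x (n := n) (by omega) hs hs'

/-- All two-way streets on an arm. -/
def line (x : Arm) : List St := (List.range (2 * m - 1)).flatMap (H.block x)

theorem mem_line {x : Arm} : s ∈ H.line x ↔ ∃ b < 2 * m - 1, s ∈ H.block x b := by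
  simp [line]

theorem line_chain (x : Arm) : (H.line x).IsChain N.Continues :=
  isChain_flatMap_range _ _ (fun _ hb => H.block_ne_nil x (by omega))
    (fun _ hb => H.block_chain x (by omega))
    fun _ hb _ _ hs hs' => H.block_continues x (by omega) hs hs'

theorem block_head (x : Arm) : ∃ s, (H.block x 0).head? = some s ∧
    N.cap s = some (H.source x.index) := by
  rw [show (0 : ℕ) = 2 * 0 from rfl, block_even]
  cases x
  · exact H.exists_source_a
  · exact H.exists_source_b
  · obtain ⟨s, hs, h⟩ := H.exists_source_a'
    exact ⟨N.rev s, by simp [Arm.orient, head?_revList, Arm.level, Arm.outer, hs], h⟩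
  · obtain ⟨s, hs, h⟩ := H.exists_source_b'
    exact ⟨N.rev s, by simp [Arm.orient, head?_revList, Arm.level, Arm.outer, hs], h⟩

theorem line_head? (hm : 1 ≤ m) (x : Arm) : (H.line x).head? = (H.block x 0).head? := by
  rw [line, show 2 * m - 1 = (2 * m - 2) + 1 by omega]
  exact head?_flatMap_range _ _ (H.block_ne_nil x (by omega))

theorem line_head (hm : 1 ≤ m) (x : Arm) : ∃ s, (H.line x).head? = some s ∧
    N.cap s = some (H.source x.index) := by
  rw [H.line_head? hm]
  exact H.block_head x

theorem line_no_pred (hm : 1 ≤ m) (x : Arm) : ∀ s t, (H.line x).head? = some s → ¬ N.Continues t s := by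
  intro s t hs hc
  obtain ⟨s', hs', hcap⟩ := H.line_head hm x
  rw [hs] at hs'
  obtain rfl := Option.some.inj hs'
  rw [hc.cap_eq_none] at hcap
  exact absurd hcap (by simp)

theorem continues_left_unique (a b c : St) (h : N.Continues a c) (h' : N.Continues b c) : a = b :=
  h.left_unique h'

theorem line_nodup (hm : 1 ≤ m) (x : Arm) : (H.line x).Nodup :=
  nodup_of_chain continues_left_unique (H.line_chain x) (H.line_no_pred hm x)

theorem arm_eq_of_mem_line (hm : 1 ≤ m) {x y : Arm} (hx : s ∈ H.line x)
    (hy : s ∈ H.line y) : x = y := by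
  have := head_eq_of_mem continues_left_unique (H.line_chain x) (H.line_chain y)
    (H.line_no_pred hm x) (H.line_no_pred hm y) hx hy
  obtain ⟨s, hs, hc⟩ := H.line_head hm x
  obtain ⟨s', hs', hc'⟩ := H.line_head hm y
  rw [hs, hs'] at this
  obtain rfl := Option.some.inj this
  rw [hc] at hc'
  refine Arm.index_injective (H.source_distinct ?_)
  simp only []
  rw [Option.some.inj hc']

theorem block_eq_of_mem (hm : 1 ≤ m) {x : Arm} {b b' : ℕ} (hb : b < 2 * m - 1) (hb' : b' < 2 * m - 1)
    (hs : s ∈ H.block x b) (hs' : s ∈ H.block x b') : b = b' := by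
  have hp := (List.nodup_flatMap.1 (H.line_nodup hm x)).2
  by_contra hne
  have key : ∀ b b', b < b' → b' < 2 * m - 1 → s ∈ H.block x b → s ∉ H.block x b' := by
    intro b b' h h' h1 h2
    rw [List.pairwise_iff_getElem] at hp
    have := hp b b' (by simp; omega) (by simpa using h') h
    simp only [List.getElem_range, Function.onFun] at this
    exact this h1 h2
  rcases lt_or_gt_of_ne hne with h | h
  · exact key b b' h hb' hs hs'
  · exact key b' b h hb hs' hs

variable (hS : N.SixWayStreets)

include hS

theorem twoWay_of_on_active (hl : l ∈ Icc 1 m) (hp : p.Active m l)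
    (hs : N.On (H.street l p) s) : N.TwoWay s := by
  rcases hs with hs | hs
  · exact H.twoWay_of_active hS hl hp s hs
  · exact N.twoWay_rev.1 (H.twoWay_of_active hS hl hp _ hs)

theorem block_twoWay (x : Arm) {b : ℕ} (hb : b < 2 * m - 1) : ∀ s ∈ H.block x b, N.TwoWay s := by
  intro s hs
  refine H.twoWay_of_on_active hS (x.level_mem (show b / 2 < m by omega)) ?_ (Arm.mem_orient hs)
  split_ifs with h
  · exact x.outer_active _ _
  · rw [x.inner_active (by omega)]
    omega

theorem line_twoWay (x : Arm) : ∀ s ∈ H.line x, N.TwoWay s := by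
  intro s hs
  obtain ⟨b, hb, hs⟩ := H.mem_line.1 hs
  exact H.block_twoWay hS x hb s hs

variable [T2Space C] (hπ : IsSimpleBranchedCover π K)

include hπ

theorem line_succ (hm : 1 ≤ m) (x : Arm) (hs : s ∈ H.line x) :
    ∃ s', N.Continues s s' ∧ (s' ∈ H.line x ∨ ¬ N.TwoWay s') := by
  rcases last_or_succ (H.line_chain x) s hs with h | ⟨s', hs', hc⟩
  · rw [line, show 2 * m - 1 = (2 * m - 2) + 1 by omega,
      getLast?_flatMap_range _ _ (H.block_ne_nil x (by omega))] at h
    obtain ⟨s', l, e⟩ := List.exists_cons_of_ne_nil (H.block_ne_nil x (show 2 * m - 1 < 2 * m by omega))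
    have hs' : (H.block x (2 * m - 1)).head? = some s' := by rw [e]; rfl
    refine ⟨s', H.block_continues x (b := 2 * m - 2) (by omega) h
      (by rwa [show 2 * m - 2 + 1 = 2 * m - 1 by omega]), Or.inr fun ht => ?_⟩
    have hmem := List.mem_of_head? hs'
    rw [show 2 * m - 1 = 2 * (m - 1) + 1 by omega, block_odd] at hmem
    have hna : ¬ x.inner.Active m (x.level m (m - 1)) := by
      rw [x.inner_active (by omega)]
      omega
    rcases Arm.mem_orient hmem with h1 | h1
    · exact H.not_twoWay_of_not_active hS hπ (x.level_mem (by omega)) hna _ h1 ht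
    · exact H.not_twoWay_of_not_active hS hπ (x.level_mem (by omega)) hna _ h1 (N.twoWay_rev.2 ht)
  · exact ⟨s', hc, Or.inl hs'⟩

theorem rev_notMem_line (hm : 1 ≤ m) (x y : Arm) : ∀ s ∈ H.line y, N.rev s ∉ H.line x := by
  have key : ∀ i (hi : i < (H.line y).length), N.rev (H.line y)[i] ∉ H.line x := by
    intro i
    induction i with
    | zero =>
      intro hi hmem
      obtain ⟨s', hc, -⟩ := H.line_succ hS hπ hm x hmem
      have h1 := hc.rev.cap_eq_none
      rw [N.rev_rev] at h1
      obtain ⟨s, hs, hcap⟩ := H.line_head hm y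
      rw [List.head?_eq_getElem?, List.getElem?_eq_getElem hi] at hs
      rw [← Option.some.inj hs, h1] at hcap
      exact absurd hcap (by simp)
    | succ i ih =>
      intro hi hmem
      obtain ⟨s', hc, h⟩ := H.line_succ hS hπ hm x hmem
      have hch := (List.isChain_iff_getElem.1 (H.line_chain y)) i hi
      obtain rfl := hc.right_unique hch.rev
      rcases h with h | h
      · exact ih (by omega) h
      · exact h (N.twoWay_rev.2 (H.line_twoWay hS y _ (List.getElem_mem _)))
  intro s hs
  obtain ⟨i, hi, rfl⟩ := List.getElem_of_mem hs
  exact key i hi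

/-- Different blocks of the lines of a herd have no streets in common. -/
theorem block_unique (hm : 1 ≤ m) {x y : Arm} {b b' : ℕ} (hb : b < 2 * m - 1) (hb' : b' < 2 * m - 1)
    (hs : N.On (H.block x b) s) (hs' : N.On (H.block y b') s) : x = y ∧ b = b' := by
  have key : ∀ s, s ∈ H.block x b → N.On (H.block y b') s → x = y ∧ b = b' := by
    intro s hs hs'
    have h1 : s ∈ H.line x := H.mem_line.2 ⟨b, hb, hs⟩
    rcases hs' with hs' | hs'
    · obtain rfl := H.arm_eq_of_mem_line hm h1 (H.mem_line.2 ⟨b', hb', hs'⟩)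
      exact ⟨rfl, H.block_eq_of_mem hm hb hb' hs hs'⟩
    · exact (H.rev_notMem_line hS hπ hm y x s h1 (H.mem_line.2 ⟨b', hb', hs'⟩)).elim
  rcases hs with hs | hs
  · exact key s hs hs'
  · exact key _ hs (N.on_rev.2 hs')

end Herd

/-- The number on an arm of the `l`th horse. -/
def Arm.num (m l : ℕ) : Arm → ℕ
  | a | b => l - 1
  | a' | b' => m - l

theorem Arm.num_lt {m l : ℕ} (hl : l ∈ Icc 1 m) (x : Arm) : x.num m l < m := by
  have h1 := hl.1
  have h2 := hl.2
  cases x <;> simp only [num] <;> omega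

theorem Arm.level_num {m l : ℕ} (hl : l ∈ Icc 1 m) (x : Arm) : x.level m (x.num m l) = l := by
  have h1 := hl.1
  have h2 := hl.2
  cases x <;> simp only [num, level] <;> omega

namespace Herd

variable {m : ℕ} (H : Herd N m)

theorem on_outer_iff (hl : l ∈ Icc 1 m) (x : Arm) :
    N.On (H.block x (2 * x.num m l)) s ↔ N.On (H.street l x.outer) s := by
  rw [block_even, Arm.on_orient, x.level_num hl]

theorem on_inner_iff (hl : l ∈ Icc 1 m) (x : Arm) :
    N.On (H.block x (2 * x.num m l + 1)) s ↔ N.On (H.street l x.inner) s := by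
  rw [block_odd, Arm.on_orient, x.level_num hl]

/-- Each two-way horse street, except `c`, is the first or the second street of an arm. -/
theorem exists_outer_or_inner (hl : l ∈ Icc 1 m) (hp : p.Active m l)
    (hc : p ≠ .c) : (∃ x : Arm, ∃ k ∈ Icc 1 m, H.street l p = H.street k x.outer) ∨
      ∃ x : Arm, p = x.inner := by
  have h1 := hl.1
  have h2 := hl.2
  have e : 1 < l → l - 1 + 1 = l := fun h => by omega
  cases p
  case a1 => exact Or.inl ⟨.a, l, hl, rfl⟩
  case b1 => exact Or.inl ⟨.b, l, hl, rfl⟩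
  case a1' => exact Or.inl ⟨.a', l, hl, rfl⟩
  case b1' => exact Or.inl ⟨.b', l, hl, rfl⟩
  case c => exact (hc rfl).elim
  case a2 => exact Or.inr ⟨.a, rfl⟩
  case b2 => exact Or.inr ⟨.b, rfl⟩
  case a2' => exact Or.inr ⟨.a', rfl⟩
  case b2' => exact Or.inr ⟨.b', rfl⟩
  case a3 => exact Or.inl ⟨.a, l + 1, ⟨by omega, hp⟩, (H.glue l h1 hp).1.symm⟩
  case b3 => exact Or.inl ⟨.b, l + 1, ⟨by omega, hp⟩, (H.glue l h1 hp).2.1.symm⟩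
  case a3' =>
    have hp' : 1 < l := hp
    have := (H.glue (l - 1) (by omega) (by omega)).2.2.1
    rw [e hp'] at this
    exact Or.inl ⟨.a', l - 1, ⟨by omega, by omega⟩, this.symm⟩
  case b3' =>
    have hp' : 1 < l := hp
    have := (H.glue (l - 1) (by omega) (by omega)).2.2.2
    rw [e hp'] at this
    exact Or.inl ⟨.b', l - 1, ⟨by omega, by omega⟩, this.symm⟩

theorem inner_num_lt (hl : l ∈ Icc 1 m) {x : Arm} (hp : x.inner.Active m l) :
    2 * x.num m l + 1 < 2 * m - 1 := by
  have := (x.inner_active (x.num_lt hl)).1 (by rwa [x.level_num hl])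
  omega

theorem outer_num_lt (hl : l ∈ Icc 1 m) (x : Arm) : 2 * x.num m l < 2 * m - 1 := by
  have := x.num_lt hl
  omega

/-- A two-way horse street starts at a joint of some horse, or at a branch point. -/
theorem head_leg (hl : l ∈ Icc 1 m) (hp : p.Active m l)
    (hs : (H.street l p).head? = some s) :
    N.cap s ≠ none ∨ ∃ k ∈ Icc 1 m, ∃ q i j, N.leg (H.joint k q) i j = some s := by
  have h1 := hl.1
  have h2 := hl.2
  have h := H.horse l hl
  have hA : ∀ k ∈ Icc 1 m, ∀ q, H.street l p = H.street k (HorseJoint.outA q) →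
      ∃ k ∈ Icc 1 m, ∃ q i j, N.leg (H.joint k q) i j = some s := fun k hk q e =>
    ⟨k, hk, q, 0, 1, by rw [((H.horse k hk).legs_a q).1, ← e, hs]⟩
  have hB : ∀ k ∈ Icc 1 m, ∀ q, H.street l p = H.street k (HorseJoint.outB q) →
      ∃ k ∈ Icc 1 m, ∃ q i j, N.leg (H.joint k q) i j = some s := fun k hk q e =>
    ⟨k, hk, q, 1, 2, by rw [((H.horse k hk).legs_b q).1, ← e, hs]⟩
  cases p
  case a2 => exact Or.inr (hA l hl .bot rfl)
  case b2 => exact Or.inr (hB l hl .bot rfl)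
  case c => exact Or.inr ⟨l, hl, .bot, 0, 2, h.bot_c.trans hs⟩
  case a2' => exact Or.inr (hA l hl .left rfl)
  case b2' => exact Or.inr (hB l hl .right rfl)
  case a3 => exact Or.inr (hA l hl .right rfl)
  case b3 => exact Or.inr (hB l hl .left rfl)
  case a1' => exact Or.inr (hA l hl .top rfl)
  case b1' => exact Or.inr (hB l hl .top rfl)
  case a1 =>
    rcases h1.lt_or_eq with hlt | rfl
    · have := (H.glue (l - 1) (by omega) (by omega)).1
      rw [show l - 1 + 1 = l by omega] at this
      exact Or.inr (hA (l - 1) ⟨by omega, by omega⟩ .right this)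
    · obtain ⟨s', hs', hc⟩ := H.exists_source_a
      rw [hs] at hs'
      rw [Option.some.inj hs', hc]
      exact Or.inl (by simp)
  case b1 =>
    rcases h1.lt_or_eq with hlt | rfl
    · have := (H.glue (l - 1) (by omega) (by omega)).2.1
      rw [show l - 1 + 1 = l by omega] at this
      exact Or.inr (hB (l - 1) ⟨by omega, by omega⟩ .left this)
    · obtain ⟨s', hs', hc⟩ := H.exists_source_b
      rw [hs] at hs'
      rw [Option.some.inj hs', hc]
      exact Or.inl (by simp)
  case a3' =>
    have hp' : 1 < l := hp
    have := (H.glue (l - 1) (by omega) (by omega)).2.2.1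
    rw [show l - 1 + 1 = l by omega] at this
    exact Or.inr (hA (l - 1) ⟨by omega, by omega⟩ .top this.symm)
  case b3' =>
    have hp' : 1 < l := hp
    have := (H.glue (l - 1) (by omega) (by omega)).2.2.2
    rw [show l - 1 + 1 = l by omega] at this
    exact Or.inr (hB (l - 1) ⟨by omega, by omega⟩ .top this.symm)

/-- A two-way horse street ends at a joint of some horse, or at a branch point. -/
theorem last_leg (hl : l ∈ Icc 1 m) (hp : p.Active m l)
    (hs : (H.street l p).getLast? = some s) :
    N.cap (N.rev s) ≠ none ∨ ∃ k ∈ Icc 1 m, ∃ q i j, N.leg (H.joint k q) i j = some (N.rev s) := by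
  have h1 := hl.1
  have h2 := hl.2
  have h := H.horse l hl
  have hA : ∀ k ∈ Icc 1 m, ∀ q, H.street l p = H.street k (HorseJoint.inA q) →
      ∃ k ∈ Icc 1 m, ∃ q i j, N.leg (H.joint k q) i j = some (N.rev s) := fun k hk q e =>
    ⟨k, hk, q, 1, 0, by rw [((H.horse k hk).legs_a q).2, ← e, hs]; rfl⟩
  have hB : ∀ k ∈ Icc 1 m, ∀ q, H.street l p = H.street k (HorseJoint.inB q) →
      ∃ k ∈ Icc 1 m, ∃ q i j, N.leg (H.joint k q) i j = some (N.rev s) := fun k hk q e =>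
    ⟨k, hk, q, 2, 1, by rw [((H.horse k hk).legs_b q).2, ← e, hs]; rfl⟩
  cases p
  case a1 => exact Or.inr (hA l hl .bot rfl)
  case b1 => exact Or.inr (hB l hl .bot rfl)
  case a2 => exact Or.inr (hA l hl .right rfl)
  case b2 => exact Or.inr (hB l hl .left rfl)
  case c => exact Or.inr ⟨l, hl, .top, 2, 0, by rw [h.top_c, hs]; rfl⟩
  case a2' => exact Or.inr (hA l hl .top rfl)
  case b2' => exact Or.inr (hB l hl .top rfl)
  case a3' => exact Or.inr (hA l hl .left rfl)
  case b3' => exact Or.inr (hB l hl .right rfl)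
  case a3 =>
    exact Or.inr (hA (l + 1) ⟨by omega, hp⟩ .bot (H.glue l h1 hp).1.symm)
  case b3 =>
    exact Or.inr (hB (l + 1) ⟨by omega, hp⟩ .bot (H.glue l h1 hp).2.1.symm)
  case a1' =>
    rcases h2.lt_or_eq with hlt | rfl
    · exact Or.inr (hA (l + 1) ⟨by omega, hlt⟩ .left (H.glue l h1 hlt).2.2.1)
    · obtain ⟨s', hs', hc⟩ := H.exists_source_a'
      rw [hs] at hs'
      rw [Option.some.inj hs', hc]
      exact Or.inl (by simp)
  case b1' =>
    rcases h2.lt_or_eq with hlt | rfl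
    · exact Or.inr (hB (l + 1) ⟨by omega, hlt⟩ .right (H.glue l h1 hlt).2.2.2)
    · obtain ⟨s', hs', hc⟩ := H.exists_source_b'
      rw [hs] at hs'
      rw [Option.some.inj hs', hc]
      exact Or.inl (by simp)

variable (hS : N.SixWayStreets) [T2Space C] (hπ : IsSimpleBranchedCover π K)

include hS hπ

theorem active_of_twoWay (hl : l ∈ Icc 1 m)
    (hs : N.On (H.street l p) s) (ht : N.TwoWay s) : p.Active m l := by
  by_contra hn
  rcases hs with hs | hs
  · exact H.not_twoWay_of_not_active hS hπ hl hn s hs ht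
  · exact H.not_twoWay_of_not_active hS hπ hl hn _ hs (N.twoWay_rev.2 ht)

/-- A two-way street that meets a joint of the standard picture starts at a joint of a horse. -/
theorem exists_eq_joint (hk : k ∈ Icc 1 m) {i j : Fin 3}
    (hleg : N.leg v i j = some s) (hs : N.On (H.street k p) s) (ht : N.TwoWay s)
    (hv : N.pt v ∈ (H.chart k).source) {q : HorseJoint} (hq : H.chart k (N.pt v) = q.pos) :
    ∃ k' ∈ Icc 1 m, ∃ q', v = H.joint k' q' := by
  have h := H.horse k hk
  have hp := H.active_of_twoWay hS hπ hk hs ht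
  have hcap := N.leg_cap v i j s hleg
  have fin : (∃ k ∈ Icc 1 m, ∃ q i j, N.leg (H.joint k q) i j = some s) →
      ∃ k' ∈ Icc 1 m, ∃ q', v = H.joint k' q' := by
    rintro ⟨k, hk, q, i', j', hl⟩
    exact ⟨k, hk, q, (N.leg_unique _ _ _ _ _ _ _ hleg hl).1⟩
  rcases hs with hs | hs
  · rcases head_or_pred (h.chain p) s hs with h1 | ⟨s₀, h0, v', i', j', h2, h3⟩
    · rcases H.head_leg hk hp h1 with h2 | h2
      · exact (h2 hcap).elim
      · exact fin h2
    · obtain ⟨rfl, rfl, rfl⟩ := N.leg_unique _ _ _ _ _ _ _ hleg h3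
      exact (h.not_joint hπ h3 h2 (Or.inl hs) (Or.inr (by rwa [N.rev_rev])) hv q hq).elim
  · rcases last_or_succ (h.chain p) _ hs with h1 | ⟨s₁, h0, v', i', j', h2, h3⟩
    · rcases H.last_leg hk hp h1 with h2 | h2
      · rw [N.rev_rev] at h2
        exact (h2 hcap).elim
      · rw [N.rev_rev] at h2
        exact fin h2
    · rw [N.rev_rev] at h2
      obtain ⟨rfl, rfl, rfl⟩ := N.leg_unique _ _ _ _ _ _ _ hleg h2
      exact (h.not_joint hπ h2 h3 (Or.inr hs) (Or.inl h0) hv q hq).elim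

/-- Where a two-way street runs straight through a joint of a horse, one side of it is the second
street of an arm. -/
theorem inner_of_through (hk : k ∈ Icc 1 m) {q : HorseJoint} {i j : Fin 3}
    (h1 : N.leg (H.joint k q) i j = some s) (h2 : N.leg (H.joint k q) j i = some s')
    (ht : N.TwoWay s) (ht' : N.TwoWay s') :
    ∃ x : Arm, N.On (H.street k x.inner) s ∨ N.On (H.street k x.inner) s' := by
  have h := H.horse k hk
  obtain ⟨oA, hoA, loA⟩ := h.outA q
  obtain ⟨iA, hiA, liA⟩ := h.inA q
  obtain ⟨oB, hoB, loB⟩ := h.outB q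
  obtain ⟨iB, hiB, liB⟩ := h.inB q
  have moA : N.On (H.street k q.outA) oA := Or.inl (List.mem_of_head? hoA)
  have miA : N.On (H.street k q.inA) (N.rev iA) := N.on_rev.2 (Or.inl (List.mem_of_getLast? hiA))
  have moB : N.On (H.street k q.outB) oB := Or.inl (List.mem_of_head? hoB)
  have miB : N.On (H.street k q.inB) (N.rev iB) := N.on_rev.2 (Or.inl (List.mem_of_getLast? hiB))
  have hA : ∃ x : Arm, x.inner = q.outA ∨ x.inner = q.inA := by
    cases q
    exacts [⟨.a, Or.inl rfl⟩, ⟨.a, Or.inr rfl⟩, ⟨.a', Or.inl rfl⟩, ⟨.a', Or.inr rfl⟩]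
  have hB : ∃ x : Arm, x.inner = q.outB ∨ x.inner = q.inB := by
    cases q
    exacts [⟨.b, Or.inl rfl⟩, ⟨.b', Or.inl rfl⟩, ⟨.b, Or.inr rfl⟩, ⟨.b', Or.inr rfl⟩]
  have third : ∀ s s', N.leg (H.joint k q) 0 2 = some s → N.leg (H.joint k q) 2 0 = some s' →
      N.TwoWay s → N.TwoWay s' → False := by
    intro s s' g1 g2 t1 t2
    rcases h.twoWay_third hπ (Or.inl ⟨rfl, rfl⟩) g1 t1 with ⟨rfl, -⟩ | ⟨-, h0, -⟩
    · rcases h.twoWay_third hπ (Or.inr ⟨rfl, rfl⟩) g2 t2 with ⟨-, h0, -⟩ | ⟨h0, -⟩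
      · exact absurd h0 (by decide)
      · exact HorseJoint.noConfusion h0
    · exact absurd h0 (by decide)
  have hij := leg_ne h1
  obtain ⟨x, hx⟩ := hA
  obtain ⟨y, hy⟩ := hB
  fin_cases i <;> fin_cases j <;> first | exact (hij rfl).elim | skip
  · obtain rfl := Option.some.inj (h1.symm.trans loA)
    obtain rfl := Option.some.inj (h2.symm.trans liA)
    rcases hx with hx | hx
    · exact ⟨x, Or.inl (hx ▸ moA)⟩
    · exact ⟨x, Or.inr (hx ▸ miA)⟩
  · exact (third _ _ h1 h2 ht ht').elim
  · obtain rfl := Option.some.inj (h1.symm.trans liA)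
    obtain rfl := Option.some.inj (h2.symm.trans loA)
    rcases hx with hx | hx
    · exact ⟨x, Or.inr (hx ▸ moA)⟩
    · exact ⟨x, Or.inl (hx ▸ miA)⟩
  · obtain rfl := Option.some.inj (h1.symm.trans loB)
    obtain rfl := Option.some.inj (h2.symm.trans liB)
    rcases hy with hy | hy
    · exact ⟨y, Or.inl (hy ▸ moB)⟩
    · exact ⟨y, Or.inr (hy ▸ miB)⟩
  · exact (third _ _ h2 h1 ht' ht).elim
  · obtain rfl := Option.some.inj (h1.symm.trans liB)
    obtain rfl := Option.some.inj (h2.symm.trans loB)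
    rcases hy with hy | hy
    · exact ⟨y, Or.inr (hy ▸ moB)⟩
    · exact ⟨y, Or.inl (hy ▸ miB)⟩

theorem outer_not_inner {l k : ℕ} (hl : l ∈ Icc 1 m) (hk : k ∈ Icc 1 m) {x y : Arm}
    (hs : N.On (H.street l x.outer) s) : ¬ N.On (H.street k y.inner) s := by
  intro hs'
  have hm : 1 ≤ m := hl.1.trans hl.2
  have ht := H.twoWay_of_on_active hS hl (x.outer_active m l) hs
  have hp := H.active_of_twoWay hS hπ hk hs' ht
  have := (H.block_unique hS hπ hm (outer_num_lt hl x) (inner_num_lt hk hp)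
    ((H.on_outer_iff hl x).2 hs) ((H.on_inner_iff hk y).2 hs')).2
  omega

/-- Through the joints on the first street of an arm, no other two-way street runs. -/
theorem straight_outer (hl : l ∈ Icc 1 m) (x : Arm) :
    (H.street l x.outer).IsChain N.Straight := by
  refine ((H.horse l hl).chain _).imp_of_mem_imp fun s₀ s hs₀ hs hc => ?_
  obtain ⟨v, i, j, h1, h2⟩ := hc
  refine ⟨v, i, j, h1, h2, fun i' j' s'' h3 ht => ?_⟩
  by_contra hn
  have ts := H.twoWay_of_active hS hl (x.outer_active m l) s hs
  have ts₀ := H.twoWay_of_active hS hl (x.outer_active m l) s₀ hs₀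
  have hcov := H.cover s ts (N.mem_trace zero_mem_I)
  rw [N.base_leg h2] at hcov
  simp only [mem_iUnion] at hcov
  obtain ⟨k, hk, hv⟩ := hcov
  have h := H.horse k hk
  obtain ⟨p, hp⟩ := h.exists_on hπ h2 ts hv
  obtain ⟨p', hp'⟩ := h.exists_on hπ h3 ht hv
  obtain ⟨q, hq⟩ := h.exists_joint hπ h2 h3 hp hp' hv hn
  obtain ⟨k', hk', q', rfl⟩ := H.exists_eq_joint hS hπ hk h2 hp ts hv hq
  obtain ⟨y, hy | hy⟩ := H.inner_of_through hS hπ hk' h2 h1 ts (N.twoWay_rev.2 ts₀)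
  · exact H.outer_not_inner hS hπ hl hk' (Or.inl hs) hy
  · exact H.outer_not_inner hS hπ hl hk' (Or.inl hs₀) (N.on_rev.1 hy)

theorem straight_of_active (hl : l ∈ Icc 1 m) (hp : p.Active m l) :
    (H.street l p).IsChain N.Straight := by
  by_cases hc : p = .c
  · subst hc
    exact (H.horse l hl).straight_chain hπ rfl
  rcases H.exists_outer_or_inner hl hp hc with ⟨x, k, hk, e⟩ | ⟨x, rfl⟩
  · rw [e]
    exact H.straight_outer hS hπ hk x
  · exact (H.horse l hl).straight_chain hπ (by cases x <;> rfl)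

end Herd

theorem IsSimpleBranchedCover.exists_liftVec_map (hπ : IsSimpleBranchedCover π K) {x : S}
    (hx : π x ∉ branchPoints π) : ∃ A : ℂ →L[ℝ] ℂ, (∀ w, liftVec π x w = A w) ∧
      LinearMap.det (A : ℂ →ₗ[ℝ] ℂ) ≠ 0 := by
  obtain ⟨L⟩ := hπ.nonempty_localSection hx
  refine ⟨der L.inv (π x), L.liftVec_eq L.mem, fun h0 => ?_⟩
  have h1 := (L.der_comp L.mem).1
  have h2 : LinearMap.det (der π x : ℂ →ₗ[ℝ] ℂ) * LinearMap.det (der L.inv (π x) : ℂ →ₗ[ℝ] ℂ) =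
      LinearMap.det ((ContinuousLinearMap.id ℝ ℂ : ℂ →L[ℝ] ℂ) : ℂ →ₗ[ℝ] ℂ) := by
    rw [← h1, ← LinearMap.det_comp]
    rfl
  rw [h0, mul_zero] at h2
  exact zero_ne_one (h2.trans LinearMap.det_id)

namespace SpectralNetwork

theorem turn_inverse (hπ : IsSimpleBranchedCover π K) (v : Jt) :
    X Z (N.turn v 0 1 2) * X Z (N.turn v 0 2 1) = 1 :=
  X_mul_X_of_add_eq_zero Z (N.turn_add_turn v
    (fun i => hπ.exists_liftVec_map (N.sheet_unbranched v i)) (by decide) (by decide) (by decide))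

variable (N)

/-- The outgoing series at the start of a list of streets. -/
def u0 (L : List St) : Series S := L.head?.elim 0 fun s => N.gen s 0

/-- The outgoing series at the end of a list of streets. -/
def u1 (L : List St) : Series S := L.getLast?.elim 0 fun s => N.gen s 1

/-- The incoming series at the end of a list of streets. -/
def d0 (L : List St) : Series S := L.getLast?.elim 0 fun s => N.gen (N.rev s) 0

/-- The incoming series at the start of a list of streets. -/
def d1 (L : List St) : Series S := L.head?.elim 0 fun s => N.gen (N.rev s) 1

/-- The street factor of a list of streets. -/
def fac (L : List St) : Series S := 1 + N.u0 L * N.d1 L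

theorem u0_revList (L : List St) : N.u0 (N.revList L) = N.d0 L := by
  rw [u0, head?_revList, d0]
  cases L.getLast? <;> rfl

theorem u1_revList (L : List St) : N.u1 (N.revList L) = N.d1 L := by
  rw [u1, getLast?_revList, d1]
  cases L.head? <;> rfl

theorem listT_revList (L : List St) : N.listT (N.revList L) = N.listT L := by
  rw [listT, revList, List.map_reverse, List.sum_reverse, List.map_map, listT]
  congr 1
  exact List.map_congr_left fun s _ => N.T_rev s

variable {N}

theorem straight_list (hN : N.SixWay) (hS : N.SixWayStreets) {L : List St}
    (hL : L.IsChain N.Straight) (ht : ∀ s ∈ L, N.TwoWay s) (hne : L ≠ []) :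
    N.u1 L = X Z (N.listT L) * N.u0 L ∧ N.d1 L = X Z (N.listT L) * N.d0 L ∧
      (∀ s ∈ L, N.factor s = N.fac L) ∧ 1 + N.u1 L * N.d0 L = N.fac L := by
  obtain ⟨x, l, e⟩ := List.exists_cons_of_ne_nil hne
  have hx : L.head? = some x := by rw [e]; rfl
  have hy : L.getLast? = some (L.getLast hne) := List.getLast?_eq_some_getLast hne
  obtain ⟨h1, h2, h3⟩ := straight_list_gen hN hS L hL ht x _ hx hy
  have e1 : N.u0 L = N.gen x 0 := by rw [u0, hx]; rfl
  have e2 : N.d1 L = N.gen (N.rev x) 1 := by rw [d1, hx]; rfl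
  have e3 : N.u1 L = N.gen (L.getLast hne) 1 := by rw [u1, hy]; rfl
  have e4 : N.d0 L = N.gen (N.rev (L.getLast hne)) 0 := by rw [d0, hy]; rfl
  refine ⟨by rw [e3, e1, h1], by rw [e2, e4, h2], fun s hs => ?_, ?_⟩
  · rw [h3 s hs, fac, e1, e2, factor]
  · rw [fac, e3, e4, e1, e2, h1, h2]
    ring

theorem inactive_list {L : List St} (ht : ∀ s ∈ L, ¬ N.TwoWay s) (hne : L ≠ []) :
    (∀ s ∈ L, N.factor s = 1) ∧ N.fac L = 1 ∧ 1 + N.u1 L * N.d0 L = 1 := by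
  obtain ⟨x, l, e⟩ := List.exists_cons_of_ne_nil hne
  have hx : L.head? = some x := by rw [e]; rfl
  have hy : L.getLast? = some (L.getLast hne) := List.getLast?_eq_some_getLast hne
  have e1 : N.u0 L = N.gen x 0 := by rw [u0, hx]; rfl
  have e2 : N.d1 L = N.gen (N.rev x) 1 := by rw [d1, hx]; rfl
  have e3 : N.u1 L = N.gen (L.getLast hne) 1 := by rw [u1, hy]; rfl
  have e4 : N.d0 L = N.gen (N.rev (L.getLast hne)) 0 := by rw [d0, hy]; rfl
  have hf := fun s hs => N.factor_of_not_twoWay (ht s hs)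
  refine ⟨hf, ?_, ?_⟩
  · rw [fac, e1, e2]
    exact hf x (List.mem_of_head? hx)
  · have := hf _ (List.getLast_mem hne)
    rw [← N.Q_eq_factor _ one_mem_I, Q, sub_self] at this
    rw [e3, e4]
    exact this

end SpectralNetwork

section JointAlgebra

variable {A : Type*} [CommRing A] {E E' t01 t02 t12 t10 t20 t21 n01 n02 n12 n10 n20 n21 : A}

/-- Solving the junction equations when nothing of type `02` runs in. -/
theorem solve_joint_02 (hE : E' * E = 1)
    (e1 : t01 = n01 + E * (t02 * n21)) (e2 : t02 = n02 + E' * (n01 * t12))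
    (e3 : t12 = n12 + E * (t10 * n02)) (e4 : t10 = n10 + E' * (n12 * t20))
    (e5 : t20 = n20 + E * (t21 * n10)) (e6 : t21 = n21 + E' * (n20 * t01)) (h : n02 = 0) :
    t12 = n12 ∧ t02 = E' * (n01 * n12) ∧ t01 = n01 * (1 + t12 * n21) ∧
      1 + n01 * t10 = (1 + t02 * n20) * (1 + t01 * n10) ∧
      1 + n12 * t21 = (1 + t02 * n20) * (1 + t12 * n21) := by
  subst h
  have a : t12 = n12 := by rw [e3]; ring
  subst a
  have b : t02 = E' * (n01 * t12) := by rw [e2]; ring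
  have c : t01 = n01 * (1 + t12 * n21) := by rw [e1, b]; linear_combination n01 * t12 * n21 * hE
  refine ⟨rfl, b, c, ?_, ?_⟩
  · rw [e4, e5, e6, c, b]
    linear_combination (t12 * n10 * n01 * (n21 + E' * (n20 * (n01 * (1 + t12 * n21))))) * hE
  · rw [e6, c, b]
    ring

/-- Solving the junction equations when nothing of type `20` runs in. -/
theorem solve_joint_20 (hE : E' * E = 1)
    (e1 : t01 = n01 + E * (t02 * n21)) (e2 : t02 = n02 + E' * (n01 * t12))
    (e3 : t12 = n12 + E * (t10 * n02)) (e4 : t10 = n10 + E' * (n12 * t20))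
    (e5 : t20 = n20 + E * (t21 * n10)) (e6 : t21 = n21 + E' * (n20 * t01)) (h : n20 = 0) :
    t21 = n21 ∧ t20 = E * (n21 * n10) ∧ t10 = n10 * (1 + t21 * n12) ∧
      1 + t01 * n10 = (1 + t20 * n02) * (1 + t10 * n01) ∧
      1 + t12 * n21 = (1 + t20 * n02) * (1 + t21 * n12) := by
  subst h
  have a : t21 = n21 := by rw [e6]; ring
  subst a
  have b : t20 = E * (t21 * n10) := by rw [e5]; ring
  have c : t10 = n10 * (1 + t21 * n12) := by rw [e4, b]; linear_combination n10 * t21 * n12 * hE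
  refine ⟨rfl, b, c, ?_, ?_⟩
  · rw [e1, e2, e3, c, b]
    linear_combination (t21 * n10 * n01 * (n12 + E * (n10 * (1 + t21 * n12) * n02))) * hE
  · rw [e3, c, b]
    ring

/-- Solving the junction equations when `02` does not run against `21` or `10`, nor `20` against
`01`. -/
theorem solve_joint_left (hE : E' * E = 1)
    (e1 : t01 = n01 + E * (t02 * n21)) (e2 : t02 = n02 + E' * (n01 * t12))
    (e3 : t12 = n12 + E * (t10 * n02)) (e4 : t10 = n10 + E' * (n12 * t20))
    (e5 : t20 = n20 + E * (t21 * n10)) (e6 : t21 = n21 + E' * (n20 * t01))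
    (h1 : n02 * n21 = 0) (h2 : n01 * n20 = 0) :
    t21 = n21 ∧ 1 + n01 * t10 = 1 + t01 * n10 ∧ 1 + n12 * t21 = 1 + t12 * n21 ∧
      (n02 = 0 → t12 = n12) ∧ (n20 = 0 → t10 = n10 * (1 + n12 * t21)) := by
  have a : t21 = n21 := by
    rw [e6, e1, e2]
    linear_combination (E' + E' * n21 * E * E' * t12) * h2 + E' * n20 * E * h1
  have b : t12 * n21 = n12 * n21 := by
    rw [e3]
    linear_combination E * t10 * h1
  have c : t01 = n01 * (1 + n12 * n21) := by
    rw [e1, e2]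
    linear_combination E * h1 + n01 * t12 * n21 * hE + n01 * b
  have d : n01 * t10 = n01 * (n10 * (1 + n12 * n21)) := by
    rw [e4, e5, a]
    linear_combination E' * n12 * h2 + n01 * n12 * n21 * n10 * hE
  refine ⟨a, ?_, ?_, fun h => ?_, fun h => ?_⟩
  · rw [d, c]
    ring
  · rw [a, b]
  · rw [e3, h]
    ring
  · rw [e4, e5, h, a]
    linear_combination n12 * n21 * n10 * hE

/-- Solving the junction equations when `02` does not run against `10`, nor `20` against `12`. -/
theorem solve_joint_right (hE : E' * E = 1)
    (e1 : t01 = n01 + E * (t02 * n21)) (e2 : t02 = n02 + E' * (n01 * t12))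
    (e3 : t12 = n12 + E * (t10 * n02)) (e4 : t10 = n10 + E' * (n12 * t20))
    (e5 : t20 = n20 + E * (t21 * n10)) (e6 : t21 = n21 + E' * (n20 * t01))
    (h1 : n10 * n02 = 0) (h2 : n12 * n20 = 0) :
    t12 = n12 ∧ 1 + n01 * t10 = 1 + t01 * n10 ∧ 1 + n12 * t21 = 1 + t12 * n21 ∧
      (n02 = 0 → t01 = n01 * (1 + t12 * n21)) ∧ (n20 = 0 → t21 = n21) := by
  have a : t12 = n12 := by
    rw [e3, e4, e5]
    linear_combination (E + E * E' * E * n12 * t21) * h1 + E * E' * n02 * h2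
  have b : n12 * t21 = n12 * n21 := by
    rw [e6]
    linear_combination E' * t01 * h2
  have c : t10 = n10 * (1 + n12 * n21) := by
    rw [e4, e5]
    linear_combination E' * h2 + n10 * n12 * t21 * hE + n10 * b
  have d : t01 * n10 = n01 * (n10 * (1 + n12 * n21)) := by
    rw [e1, e2, a]
    linear_combination E * n21 * h1 + n01 * n12 * n21 * n10 * hE
  refine ⟨a, ?_, ?_, fun h => ?_, fun h => ?_⟩
  · rw [d, c]
  · rw [b, a]
  · rw [e1, e2, h, a]
    linear_combination n12 * n21 * n01 * hE
  · rw [e6, h]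
    ring

end JointAlgebra

namespace IsHorse

variable (h : IsHorse N φ J L)

include h

theorem series_a (q : HorseJoint) : N.τ (J q) 0 1 = N.u0 (L q.outA) ∧
    N.ν (J q) 1 0 = N.d1 (L q.outA) ∧ N.τ (J q) 1 0 = N.d0 (L q.inA) ∧
    N.ν (J q) 0 1 = N.u1 (L q.inA) := by
  obtain ⟨o, ho, lo⟩ := h.outA q
  obtain ⟨i, hi, li⟩ := h.inA q
  refine ⟨?_, ?_, ?_, ?_⟩
  · rw [τ_eq lo, u0, ho]; rfl
  · rw [ν_eq lo, d1, ho]; rfl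
  · rw [τ_eq li, d0, hi]; rfl
  · rw [ν_eq li, u1, hi, N.rev_rev]; rfl

theorem series_b (q : HorseJoint) : N.τ (J q) 1 2 = N.u0 (L q.outB) ∧
    N.ν (J q) 2 1 = N.d1 (L q.outB) ∧ N.τ (J q) 2 1 = N.d0 (L q.inB) ∧
    N.ν (J q) 1 2 = N.u1 (L q.inB) := by
  obtain ⟨o, ho, lo⟩ := h.outB q
  obtain ⟨i, hi, li⟩ := h.inB q
  refine ⟨?_, ?_, ?_, ?_⟩
  · rw [τ_eq lo, u0, ho]; rfl
  · rw [ν_eq lo, d1, ho]; rfl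
  · rw [τ_eq li, d0, hi]; rfl
  · rw [ν_eq li, u1, hi, N.rev_rev]; rfl

theorem series_c : N.τ (J .bot) 0 2 = N.u0 (L .c) ∧ N.ν (J .bot) 2 0 = N.d1 (L .c) ∧
    N.τ (J .top) 2 0 = N.d0 (L .c) ∧ N.ν (J .top) 0 2 = N.u1 (L .c) := by
  obtain ⟨o, ho⟩ := h.exists_head .c
  obtain ⟨i, hi⟩ := h.exists_last .c
  have lo : N.leg (J .bot) 0 2 = some o := h.bot_c.trans ho
  have li : N.leg (J .top) 2 0 = some (N.rev i) := by rw [h.top_c, hi]; rfl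
  refine ⟨?_, ?_, ?_, ?_⟩
  · rw [τ_eq lo, u0, ho]; rfl
  · rw [ν_eq lo, d1, ho]; rfl
  · rw [τ_eq li, d0, hi]; rfl
  · rw [ν_eq li, u1, hi, N.rev_rev]; rfl

variable (hπ : IsSimpleBranchedCover π K) (hN : N.SixWay) (hS : N.SixWayStreets)

include hπ hS

theorem ν_bot : N.ν (J .bot) 0 2 = 0 := by
  refine ν_eq_zero fun hi => ?_
  have ho : N.outAt (J .bot) 2 0 := hS.out_of_in (by decide) (h.inAt_c_bot hS)
  obtain ⟨s, hs, ht⟩ := exists_twoWay_leg ho hi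
  rcases h.twoWay_third hπ (Or.inr ⟨rfl, rfl⟩) hs ht with ⟨-, h0, -⟩ | ⟨h0, -⟩
  · exact absurd h0 (by decide)
  · exact HorseJoint.noConfusion h0

theorem ν_top : N.ν (J .top) 2 0 = 0 := by
  refine ν_eq_zero fun hi => ?_
  have ho : N.outAt (J .top) 0 2 := hS.out_of_in (by decide) (h.inAt_c_top hS)
  obtain ⟨s, hs, ht⟩ := exists_twoWay_leg ho hi
  rcases h.twoWay_third hπ (Or.inl ⟨rfl, rfl⟩) hs ht with ⟨h0, -⟩ | ⟨-, h0, -⟩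
  · exact HorseJoint.noConfusion h0
  · exact absurd h0 (by decide)

theorem ν_side_20 {q : HorseJoint} (hq : q = .right ∨ q = .left) (h01 : N.inAt (J q) 0 1)
    (h12 : N.inAt (J q) 1 2) : N.ν (J q) 2 0 = 0 := by
  refine ν_eq_zero fun hi => ?_
  obtain ⟨r1, r2, r3, r4, r5, r6⟩ := h.rules hS q
  exact h.side_third hS hπ hq (Or.inl ⟨rfl, rfl⟩) (r2.2 (Or.inr ⟨h01, r3.2 (Or.inl h12)⟩)) hi

theorem ν_side_02 {q : HorseJoint} (hq : q = .right ∨ q = .left) (h10 : N.inAt (J q) 1 0)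
    (h21 : N.inAt (J q) 2 1) : N.ν (J q) 0 2 = 0 := by
  refine ν_eq_zero fun hi => ?_
  obtain ⟨r1, r2, r3, r4, r5, r6⟩ := h.rules hS q
  exact h.side_third hS hπ hq (Or.inr ⟨rfl, rfl⟩) (r5.2 (Or.inr ⟨r6.2 (Or.inl h21), h10⟩)) hi

include hN

theorem bot_series : N.u0 (L .b2) = N.u1 (L .b1) ∧
    N.u0 (L .c) = X Z (N.turn (J .bot) 0 1 2) * (N.u1 (L .a1) * N.u1 (L .b1)) ∧
    N.u0 (L .a2) = N.u1 (L .a1) * N.fac (L .b2) ∧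
    1 + N.u1 (L .a1) * N.d0 (L .a1) = N.fac (L .c) * N.fac (L .a2) ∧
    1 + N.u1 (L .b1) * N.d0 (L .b1) = N.fac (L .c) * N.fac (L .b2) := by
  obtain ⟨e1, e2, e3, e4, e5, e6⟩ := hN.eqs (J .bot)
  obtain ⟨a1, a2, a3, a4⟩ := h.series_a .bot
  obtain ⟨b1, b2, b3, b4⟩ := h.series_b .bot
  obtain ⟨c1, c2, c3, c4⟩ := h.series_c
  have := solve_joint_02 (A := Series S) (turn_inverse (N := N) hπ (J .bot)) e1 e2 e3 e4 e5 e6 (h.ν_bot hπ hS)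
  rw [a1, a2, a3, a4, b1, b2, b3, b4, c1, c2] at this
  exact this

theorem top_series : N.d0 (L .b2') = N.d1 (L .b1') ∧
    N.d0 (L .c) = X Z (N.turn (J .top) 0 2 1) * (N.d1 (L .b1') * N.d1 (L .a1')) ∧
    N.d0 (L .a2') = N.d1 (L .a1') * (1 + N.d0 (L .b2') * N.u1 (L .b2')) ∧
    N.fac (L .a1') = (1 + N.d0 (L .c) * N.u1 (L .c)) * (1 + N.d0 (L .a2') * N.u1 (L .a2')) ∧
    N.fac (L .b1') = (1 + N.d0 (L .c) * N.u1 (L .c)) * (1 + N.d0 (L .b2') * N.u1 (L .b2')) := by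
  obtain ⟨e1, e2, e3, e4, e5, e6⟩ := hN.eqs (J .top)
  obtain ⟨a1, a2, a3, a4⟩ := h.series_a .top
  obtain ⟨b1, b2, b3, b4⟩ := h.series_b .top
  obtain ⟨c1, c2, c3, c4⟩ := h.series_c
  have := solve_joint_20 (A := Series S) (turn_inverse (N := N) hπ (J .top)) e1 e2 e3 e4 e5 e6 (h.ν_top hπ hS)
  rw [a1, a2, a3, a4, b1, b2, b3, b4, c3, c4] at this
  exact this

end IsHorse

theorem Series.mul_comm (a b : Series S) : a * b = b * a := by ring

theorem Series.mul_eq_zero_left {a : Series S} (h : a = 0) (b : Series S) : a * b = 0 :=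
  (congrArg (fun x : Series S => x * b) h).trans (MulZeroClass.zero_mul b)

theorem Series.mul_eq_zero_right (a : Series S) {b : Series S} (h : b = 0) : a * b = 0 :=
  (congrArg (fun x : Series S => a * x) h).trans (MulZeroClass.mul_zero a)

namespace SpectralNetwork

theorem d1_eq_zero {L : List St} (hu : N.Up L) (ht : ∀ s ∈ L, ¬ N.TwoWay s) : N.d1 L = 0 := by
  rw [d1]
  cases e : L.head? with
  | none => rfl
  | some s =>
    have hs := List.mem_of_head? e
    exact N.gen_absent _ (fun h => ht s hs ⟨hu s hs, h⟩) 1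

theorem u1_eq_zero {L : List St} (hd : N.Down L) (ht : ∀ s ∈ L, ¬ N.TwoWay s) : N.u1 L = 0 := by
  rw [u1]
  cases e : L.getLast? with
  | none => rfl
  | some s =>
    have hs := List.mem_of_getLast? e
    exact N.gen_absent _ (fun h => ht s hs ⟨h, hd s hs⟩) 1

end SpectralNetwork

namespace Herd

variable {m : ℕ} (H : Herd N m)

/-- The street factor of a horse street. -/
def q (l : ℕ) (p : HorseStreet) : Series S := N.fac (H.street l p)

variable [T2Space C] (hπ : IsSimpleBranchedCover π K) (hN : N.SixWay) (hS : N.SixWayStreets)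

include hπ hN hS

theorem q_spec (hl : l ∈ Icc 1 m) (p : HorseStreet) :
    (∀ s ∈ H.street l p, N.factor s = H.q l p) ∧
      1 + N.u1 (H.street l p) * N.d0 (H.street l p) = H.q l p := by
  have hne := (H.horse l hl).ne_nil p
  by_cases hp : p.Active m l
  · have := straight_list hN hS (H.straight_of_active hS hπ hl hp) (H.twoWay_of_active hS hl hp) hne
    exact ⟨this.2.2.1, this.2.2.2⟩
  · have := inactive_list (H.not_twoWay_of_not_active hS hπ hl hp) hne
    exact ⟨fun s hs => (this.1 s hs).trans this.2.1.symm, this.2.2.trans this.2.1.symm⟩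

theorem q_of_not_active (hl : l ∈ Icc 1 m) (hp : ¬ p.Active m l) :
    H.q l p = 1 :=
  (inactive_list (H.not_twoWay_of_not_active hS hπ hl hp) ((H.horse l hl).ne_nil p)).2.1

theorem transport (hl : l ∈ Icc 1 m) (hp : p.Active m l) :
    N.u1 (H.street l p) = X Z (N.listT (H.street l p)) * N.u0 (H.street l p) ∧
      N.d1 (H.street l p) = X Z (N.listT (H.street l p)) * N.d0 (H.street l p) := by
  have := straight_list hN hS (H.straight_of_active hS hπ hl hp) (H.twoWay_of_active hS hl hp)
    ((H.horse l hl).ne_nil p)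
  exact ⟨this.1, this.2.1⟩

theorem q_bot (hl : l ∈ Icc 1 m) :
    H.q l .a1 = H.q l .c * H.q l .a2 ∧ H.q l .b1 = H.q l .c * H.q l .b2 := by
  obtain ⟨-, -, -, h1, h2⟩ := (H.horse l hl).bot_series hπ hN hS
  rw [(H.q_spec hπ hN hS hl .a1).2] at h1
  rw [(H.q_spec hπ hN hS hl .b1).2] at h2
  exact ⟨h1, h2⟩

theorem q_spec' (hl : l ∈ Icc 1 m) (p : HorseStreet) :
    1 + N.d0 (H.street l p) * N.u1 (H.street l p) = H.q l p := by
  rw [← (H.q_spec hπ hN hS hl p).2]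
  exact congrArg (fun x : Series S => 1 + x) (Series.mul_comm _ _)

theorem q_top (hl : l ∈ Icc 1 m) :
    H.q l .a1' = H.q l .c * H.q l .a2' ∧ H.q l .b1' = H.q l .c * H.q l .b2' := by
  obtain ⟨-, -, -, h1, h2⟩ := (H.horse l hl).top_series hπ hN hS
  rw [H.q_spec' hπ hN hS hl, H.q_spec' hπ hN hS hl] at h1 h2
  exact ⟨h1, h2⟩

theorem right_series (hl : l ∈ Icc 1 m) :
    H.q l .a2 = H.q l .a3 ∧ H.q l .b3' = H.q l .b2' ∧
      (l < m → N.u0 (H.street l .a3) = N.u1 (H.street l .a2) * H.q l .b2') ∧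
      (1 < l → N.d0 (H.street l .b3') = N.d1 (H.street l .b2')) := by
  have h := H.horse l hl
  obtain ⟨e1, e2, e3, e4, e5, e6⟩ := hN.eqs (H.joint l .right)
  obtain ⟨a1, a2, a3, a4⟩ := h.series_a .right
  obtain ⟨b1, b2, b3, b4⟩ := h.series_b .right
  obtain ⟨u1, u2, u3, u4, u5, u6⟩ := H.up_lower hS l hl
  obtain ⟨d1, d2, d3, d4, d5, d6⟩ := H.down_upper hS l hl
  have z02 : l < m → N.ν (H.joint l .right) 0 2 = 0 := fun hlt =>
    h.ν_side_02 hπ hS (Or.inl rfl) (h.inAt_of_down_a (q := .right) (H.down_inner hS hl hlt).2.2.1)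
      (h.inAt_of_down_b (q := .right) d4)
  have z20 : 1 < l → N.ν (H.joint l .right) 2 0 = 0 := fun hlt =>
    h.ν_side_20 hπ hS (Or.inl rfl) (h.inAt_of_up_a (q := .right) u3)
      (h.inAt_of_up_b (q := .right) (H.up_inner hS hl hlt).2.2.2)
  have g1 : N.ν (H.joint l .right) 1 0 * N.ν (H.joint l .right) 0 2 = 0 := by
    rcases hl.2.lt_or_eq with hlt | rfl
    · exact Series.mul_eq_zero_right _ (z02 hlt)
    · exact Series.mul_eq_zero_left (a2.trans (d1_eq_zero u5
        (H.not_twoWay_of_not_active hS hπ hl (p := .a3) (by simp [HorseStreet.Active])))) _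
  have g2 : N.ν (H.joint l .right) 1 2 * N.ν (H.joint l .right) 2 0 = 0 := by
    rcases hl.1.lt_or_eq with hlt | rfl
    · exact Series.mul_eq_zero_right _ (z20 hlt)
    · exact Series.mul_eq_zero_left (b4.trans (u1_eq_zero d6
        (H.not_twoWay_of_not_active hS hπ hl (p := .b3') (by simp [HorseStreet.Active])))) _
  have := solve_joint_right (A := Series S) (turn_inverse (N := N) hπ (H.joint l .right))
    e1 e2 e3 e4 e5 e6 g1 g2
  rw [a1, a2, a3, a4, b1, b2, b3, b4] at this
  obtain ⟨-, k1, k2, k3, k4⟩ := this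
  refine ⟨(H.q_spec hπ hN hS hl .a2).2.symm.trans k1, (H.q_spec hπ hN hS hl .b3').2.symm.trans k2,
    fun hlt => k3 (z02 hlt), fun hlt => k4 (z20 hlt)⟩

theorem left_series (hl : l ∈ Icc 1 m) :
    H.q l .a3' = H.q l .a2' ∧ H.q l .b2 = H.q l .b3 ∧
      (l < m → N.u0 (H.street l .b3) = N.u1 (H.street l .b2)) ∧
      (1 < l → N.d0 (H.street l .a3') = N.d1 (H.street l .a2') * H.q l .b2) := by
  have h := H.horse l hl
  obtain ⟨e1, e2, e3, e4, e5, e6⟩ := hN.eqs (H.joint l .left)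
  obtain ⟨a1, a2, a3, a4⟩ := h.series_a .left
  obtain ⟨b1, b2, b3, b4⟩ := h.series_b .left
  obtain ⟨u1, u2, u3, u4, u5, u6⟩ := H.up_lower hS l hl
  obtain ⟨d1, d2, d3, d4, d5, d6⟩ := H.down_upper hS l hl
  have z02 : l < m → N.ν (H.joint l .left) 0 2 = 0 := fun hlt =>
    h.ν_side_02 hπ hS (Or.inr rfl) (h.inAt_of_down_a (q := .left) d3)
      (h.inAt_of_down_b (q := .left) (H.down_inner hS hl hlt).2.2.2)
  have z20 : 1 < l → N.ν (H.joint l .left) 2 0 = 0 := fun hlt =>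
    h.ν_side_20 hπ hS (Or.inr rfl) (h.inAt_of_up_a (q := .left) (H.up_inner hS hl hlt).2.2.1)
      (h.inAt_of_up_b (q := .left) u4)
  have g1 : N.ν (H.joint l .left) 0 2 * N.ν (H.joint l .left) 2 1 = 0 := by
    rcases hl.2.lt_or_eq with hlt | rfl
    · exact Series.mul_eq_zero_left (z02 hlt) _
    · exact Series.mul_eq_zero_right _ (b2.trans (d1_eq_zero u6
        (H.not_twoWay_of_not_active hS hπ hl (p := .b3) (by simp [HorseStreet.Active]))))
  have g2 : N.ν (H.joint l .left) 0 1 * N.ν (H.joint l .left) 2 0 = 0 := by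
    rcases hl.1.lt_or_eq with hlt | rfl
    · exact Series.mul_eq_zero_right _ (z20 hlt)
    · exact Series.mul_eq_zero_left (a4.trans (u1_eq_zero d5
        (H.not_twoWay_of_not_active hS hπ hl (p := .a3') (by simp [HorseStreet.Active])))) _
  have := solve_joint_left (A := Series S) (turn_inverse (N := N) hπ (H.joint l .left))
    e1 e2 e3 e4 e5 e6 g1 g2
  rw [a1, a2, a3, a4, b1, b2, b3, b4] at this
  obtain ⟨-, k1, k2, k3, k4⟩ := this
  refine ⟨(H.q_spec hπ hN hS hl .a3').2.symm.trans k1, (H.q_spec hπ hN hS hl .b2).2.symm.trans k2,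
    fun hlt => k3 (z02 hlt), fun hlt => ?_⟩
  rw [← (H.q_spec hπ hN hS hl .b2).2]
  exact k4 (z20 hlt)

/-- The street factors of the second streets of the arms, through those of the streets `c`. -/
theorem q_inner_lower (hl : l ∈ Icc 1 m) (p : HorseStreet)
    (hp : p = .a2 ∨ p = .b2) :
    H.q l p = ∏ i ∈ Finset.Ioc l m, H.q i .c := by
  obtain ⟨h1, h2⟩ := hl
  induction h2 using Nat.decreasingInduction with
  | self =>
    rw [Finset.Ioc_self, Finset.prod_empty]
    refine H.q_of_not_active hπ hN hS ⟨h1, le_rfl⟩ ?_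
    rcases hp with rfl | rfl <;> simp [HorseStreet.Active]
  | of_succ l h2 ih =>
    have hl : l ∈ Icc 1 m := ⟨h1, by omega⟩
    have hl' : l + 1 ∈ Icc 1 m := ⟨by omega, h2⟩
    have e : Finset.Ioc l m = insert (l + 1) (Finset.Ioc (l + 1) m) := by
      ext x; simp only [Finset.mem_Ioc, Finset.mem_insert]; omega
    rw [e, Finset.prod_insert (by simp), ← ih (by omega)]
    obtain ⟨g1, g2, -, -⟩ := H.glue l h1 h2
    rcases hp with rfl | rfl
    · rw [(H.right_series hπ hN hS hl).1, ← (H.q_bot hπ hN hS hl').1, q, q, g1]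
    · rw [(H.left_series hπ hN hS hl).2.1, ← (H.q_bot hπ hN hS hl').2, q, q, g2]

theorem q_inner_upper (hl : l ∈ Icc 1 m) (p : HorseStreet)
    (hp : p = .a2' ∨ p = .b2') :
    H.q l p = ∏ i ∈ Finset.Ico 1 l, H.q i .c := by
  obtain ⟨h1, h2⟩ := hl
  induction l, h1 using Nat.le_induction with
  | base =>
    rw [Finset.Ico_self, Finset.prod_empty]
    refine H.q_of_not_active hπ hN hS ⟨le_rfl, h2⟩ ?_
    rcases hp with rfl | rfl <;> simp [HorseStreet.Active]
  | succ l h1 ih =>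
    have hl : l ∈ Icc 1 m := ⟨h1, by omega⟩
    have hl' : l + 1 ∈ Icc 1 m := ⟨by omega, h2⟩
    have e : Finset.Ico 1 (l + 1) = insert l (Finset.Ico 1 l) := by
      ext x; simp only [Finset.mem_Ico, Finset.mem_insert]; omega
    rw [e, Finset.prod_insert (by simp), ← ih (by omega)]
    obtain ⟨-, -, g1, g2⟩ := H.glue l h1 h2
    rcases hp with rfl | rfl
    · rw [← (H.left_series hπ hN hS hl').1, ← (H.q_top hπ hN hS hl).1, q, q, g1]
    · rw [← (H.right_series hπ hN hS hl').2.1, ← (H.q_top hπ hN hS hl).2, q, q, g2]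

omit hπ hN hS in
/-- The factor that the solitons running out along the streets of type 12 collect at a horse. -/
def r (l : ℕ) : Series S := H.q l .b2 * H.q l .b2'

theorem r_eq (hl : l ∈ Icc 1 m) :
    H.r l = ∏ i ∈ (Finset.Icc 1 m).erase l, H.q i .c := by
  have h1 := hl.1
  have h2 := hl.2
  rw [r, H.q_inner_lower hπ hN hS hl _ (Or.inr rfl), H.q_inner_upper hπ hN hS hl _ (Or.inr rfl)]
  have e : (Finset.Icc 1 m).erase l = Finset.disjUnion (Finset.Ioc l m) (Finset.Ico 1 l)
      (Finset.disjoint_left.2 fun x => by simp only [Finset.mem_Ioc, Finset.mem_Ico]; omega) := by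
    ext x
    simp only [Finset.mem_erase, Finset.mem_Icc, Finset.mem_disjUnion, Finset.mem_Ioc,
      Finset.mem_Ico]
    omega
  rw [e]
  exact (Finset.prod_disjUnion (M := Series S) _).symm

omit hπ hN hS in
/-- The charge collected along an arm from the branch point up to the `n`th joint of type `bot`
or `top`. -/
def ch (x : Arm) (n : ℕ) : ExtChain S :=
  (H.source x.index).simpleton + ∑ b ∈ Finset.range (2 * n + 1), N.listT (H.block x b)

omit hπ hN hS in
theorem listT_block_even (x : Arm) (n : ℕ) :
    N.listT (H.block x (2 * n)) = N.listT (H.street (x.level m n) x.outer) := by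
  rw [block_even]
  cases x <;> simp only [Arm.orient, listT_revList]

omit hπ hN hS in
theorem listT_block_odd (x : Arm) (n : ℕ) :
    N.listT (H.block x (2 * n + 1)) = N.listT (H.street (x.level m n) x.inner) := by
  rw [block_odd]
  cases x <;> simp only [Arm.orient, listT_revList]

omit hπ hN hS in
theorem ch_zero (x : Arm) : H.ch x 0 = N.listT (H.block x 0) + (H.source x.index).simpleton := by
  simp [ch, add_comm]

omit hπ hN hS in
theorem ch_succ (x : Arm) (n : ℕ) : H.ch x (n + 1) =
    N.listT (H.street (x.level m (n + 1)) x.outer) +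
      (N.listT (H.street (x.level m n) x.inner) + H.ch x n) := by
  rw [ch, ch, show 2 * (n + 1) + 1 = (2 * n + 1) + 1 + 1 by ring, Finset.sum_range_succ,
    Finset.sum_range_succ, show 2 * n + 1 + 1 = 2 * (n + 1) by ring, listT_block_even,
    listT_block_odd]
  abel

theorem gen_source (hB : N.BranchRule) (hm : 1 ≤ m) (x : Arm)
    (hs : (H.block x 0).head? = some s) : N.gen s 0 = X Z (H.source x.index).simpleton := by
  obtain ⟨s', hs', hc⟩ := H.block_head x
  obtain rfl := Option.some.inj (hs.symm.trans hs')
  refine hB.2 s _ hc fun s' σ' hc' e hne ht => hne ?_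
  exact (hB.1 s s' _ _ hc hc' e.symm (H.block_twoWay hS x (by omega) s (List.mem_of_head? hs)) ht).symm

theorem u1_zero (hB : N.BranchRule) (hm : 1 ≤ m) (x : Arm) :
    N.u1 (H.block x 0) = X Z (H.ch x 0) := by
  obtain ⟨s, hs, -⟩ := H.block_head x
  have h0 : N.u0 (H.block x 0) = X Z (H.source x.index).simpleton := by
    rw [u0, hs]
    exact H.gen_source hπ hN hS hB hm x hs
  have hl : x.level m 0 ∈ Icc 1 m := x.level_mem (by omega)
  have key := H.transport hπ hN hS hl (x.outer_active m _)
  rw [ch_zero, X_add, ← h0, show (0 : ℕ) = 2 * 0 from rfl, listT_block_even, block_even]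
  cases x
  · exact key.1
  · exact key.1
  · simp only [Arm.orient, u1_revList, u0_revList]
    exact key.2
  · simp only [Arm.orient, u1_revList, u0_revList]
    exact key.2

end Herd

section Algebra

variable {A : Type*} [CommRing A] {ι : Type*} [DecidableEq ι]

/-- The algebraic system satisfied by the street factors of a herd has only symmetric solutions. -/
theorem solve_herd {s : Finset ι} {q r : ι → A} {x : A}
    (hq : ∀ l ∈ s, q l = 1 + x * ∏ i ∈ s.erase l, r i)
    (hr : ∀ l ∈ s, r l = ∏ i ∈ s.erase l, q i) {k : ι} (hk : k ∈ s) :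
    (∀ l ∈ s, q l = q k) ∧ q k = 1 + x * q k ^ ((s.card - 1) ^ 2) := by
  have h1 : ∀ l ∈ s, r l = ∏ i ∈ s, q i - x * ∏ i ∈ s, r i := by
    intro l hl
    rw [← Finset.mul_prod_erase s q hl, ← Finset.mul_prod_erase s r hl, ← hr l hl]
    linear_combination - r l * hq l hl
  have h2 : ∀ l ∈ s, r l = r k := fun l hl => (h1 l hl).trans (h1 k hk).symm
  have h3 : ∀ l ∈ s, q l = 1 + x * r k ^ (s.card - 1) := by
    intro l hl
    rw [hq l hl, Finset.prod_congr rfl fun i hi => h2 i (Finset.mem_of_mem_erase hi),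
      Finset.prod_const, Finset.card_erase_of_mem hl]
  have h4 : ∀ l ∈ s, q l = q k := fun l hl => (h3 l hl).trans (h3 k hk).symm
  refine ⟨h4, ?_⟩
  have h5 : r k = q k ^ (s.card - 1) := by
    rw [hr k hk, Finset.prod_congr rfl fun i hi => h4 i (Finset.mem_of_mem_erase hi),
      Finset.prod_const, Finset.card_erase_of_mem hk]
  have h6 := h3 k hk
  rwa [h5, ← pow_mul, ← sq] at h6

end Algebra

namespace Herd

variable {m : ℕ} (H : Herd N m)

variable (N) in
/-- The charge of the closed solitons on the streets `c`. -/
def z (l : ℕ) : ExtChain S :=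
  N.turn (H.joint l .bot) 0 1 2 + N.turn (H.joint l .top) 0 2 1 + N.listT (H.street l .c) +
    (H.ch .a (l - 1) + H.ch .b (l - 1) + H.ch .a' (m - l) + H.ch .b' (m - l))

variable [T2Space C] (hπ : IsSimpleBranchedCover π K) (hN : N.SixWay) (hS : N.SixWayStreets)
  (hB : N.BranchRule)

include hπ hN hS hB

theorem u1_a {n : ℕ} (hn : n < m) : N.u1 (H.street (n + 1) .a1) =
    X Z (H.ch .a n) * ∏ i ∈ Finset.Ico 1 (n + 1), H.r i := by
  induction n with
  | zero =>
    have := H.u1_zero hπ hN hS hB hn .a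
    rw [Finset.Ico_self, Finset.prod_empty, ← this]
    exact (mul_one (M := Series S) _).symm
  | succ n ih =>
    have hl : n + 1 ∈ Icc 1 m := ⟨by omega, by omega⟩
    have hl' : n + 1 + 1 ∈ Icc 1 m := ⟨by omega, by omega⟩
    have t1 := (H.transport hπ hN hS hl' (p := .a1) trivial).1
    have t2 := (H.transport hπ hN hS hl (p := .a2) hn).1
    have t3 := (H.right_series hπ hN hS hl).2.2.1 hn
    have t4 := ((H.horse _ hl).bot_series hπ hN hS).2.2.1
    rw [← (H.glue (n + 1) hl.1 hn).1, t2, t4, ih (by omega)] at t3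
    have e : Finset.Ico 1 (n + 1 + 1) = insert (n + 1) (Finset.Ico 1 (n + 1)) := by
      ext x; simp only [Finset.mem_Ico, Finset.mem_insert]; omega
    have e2 : ∏ i ∈ Finset.Ico 1 (n + 1 + 1), H.r i = H.q (n + 1) .b2 * H.q (n + 1) .b2' *
        ∏ i ∈ Finset.Ico 1 (n + 1), H.r i := by
      rw [e]
      exact Finset.prod_insert (M := Series S) (by simp)
    rw [t1, t3, e2, ch_succ, X_add, X_add]
    change X Z (N.listT (H.street (n + 1 + 1) .a1)) * (X Z (N.listT (H.street (n + 1) .a2)) *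
      (X Z (H.ch .a n) * _ * H.q (n + 1) .b2) * H.q (n + 1) .b2') =
      X Z (N.listT (H.street (n + 1 + 1) .a1)) * (X Z (N.listT (H.street (n + 1) .a2)) * _) * _
    ring

theorem u1_b {n : ℕ} (hn : n < m) : N.u1 (H.street (n + 1) .b1) = X Z (H.ch .b n) := by
  induction n with
  | zero => exact H.u1_zero hπ hN hS hB hn .b
  | succ n ih =>
    have hl : n + 1 ∈ Icc 1 m := ⟨by omega, by omega⟩
    have hl' : n + 1 + 1 ∈ Icc 1 m := ⟨by omega, by omega⟩
    have t1 := (H.transport hπ hN hS hl' (p := .b1) trivial).1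
    have t2 := (H.transport hπ hN hS hl (p := .b2) hn).1
    have t3 := (H.left_series hπ hN hS hl).2.2.1 hn
    have t4 := ((H.horse _ hl).bot_series hπ hN hS).1
    rw [← (H.glue (n + 1) hl.1 hn).2.1, t2, t4, ih (by omega)] at t3
    rw [t1, t3, ch_succ, X_add, X_add]
    rfl

theorem d1_a {n : ℕ} (hn : n < m) : N.d1 (H.street (m - n) .a1') =
    X Z (H.ch .a' n) * ∏ i ∈ Finset.Ioc (m - n) m, H.r i := by
  induction n with
  | zero =>
    have := H.u1_zero hπ hN hS hB hn .a'
    rw [show H.block .a' 0 = N.revList (H.street (m - 0) .a1') from rfl, u1_revList] at this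
    rw [Nat.sub_zero, Finset.Ioc_self, Finset.prod_empty, ← this]
    exact (mul_one (M := Series S) _).symm
  | succ n ih =>
    obtain ⟨l, hl0⟩ : ∃ l, l = m - (n + 1) := ⟨_, rfl⟩
    have hl1 : m - n = l + 1 := by omega
    rw [← hl0]
    rw [hl1] at ih
    have hl : l ∈ Icc 1 m := ⟨by omega, by omega⟩
    have hl' : l + 1 ∈ Icc 1 m := ⟨by omega, by omega⟩
    have t1 := (H.transport hπ hN hS hl (p := .a1') trivial).2
    have t2 := (H.transport hπ hN hS hl' (p := .a2') (show 1 < l + 1 by omega)).2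
    have t3 := (H.left_series hπ hN hS hl').2.2.2 (by omega)
    have t4 := ((H.horse _ hl').top_series hπ hN hS).2.2.1
    rw [← (H.glue l hl.1 (by omega)).2.2.1, t2, t4, ih (by omega), H.q_spec' hπ hN hS hl'] at t3
    have e : Finset.Ioc l m = insert (l + 1) (Finset.Ioc (l + 1) m) := by
      ext x; simp only [Finset.mem_Ioc, Finset.mem_insert]; omega
    have e2 : ∏ i ∈ Finset.Ioc l m, H.r i = H.q (l + 1) .b2 * H.q (l + 1) .b2' *
        ∏ i ∈ Finset.Ioc (l + 1) m, H.r i := by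
      rw [e]
      exact Finset.prod_insert (M := Series S) (by simp)
    rw [t1, t3, e2, ch_succ, X_add, X_add]
    simp only [Arm.level, Arm.outer, Arm.inner, ← hl0, hl1]
    change _ * (X Z (N.listT (H.street (l + 1) .a2')) *
      (X Z (H.ch .a' n) * _ * H.q (l + 1) .b2') * H.q (l + 1) .b2) = _
    ring

theorem d1_b {n : ℕ} (hn : n < m) : N.d1 (H.street (m - n) .b1') = X Z (H.ch .b' n) := by
  induction n with
  | zero =>
    have := H.u1_zero hπ hN hS hB hn .b'
    rwa [show H.block .b' 0 = N.revList (H.street (m - 0) .b1') from rfl, u1_revList] at this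
  | succ n ih =>
    obtain ⟨l, hl0⟩ : ∃ l, l = m - (n + 1) := ⟨_, rfl⟩
    have hl1 : m - n = l + 1 := by omega
    rw [← hl0]
    rw [hl1] at ih
    have hl : l ∈ Icc 1 m := ⟨by omega, by omega⟩
    have hl' : l + 1 ∈ Icc 1 m := ⟨by omega, by omega⟩
    have t1 := (H.transport hπ hN hS hl (p := .b1') trivial).2
    have t2 := (H.transport hπ hN hS hl' (p := .b2') (show 1 < l + 1 by omega)).2
    have t3 := (H.right_series hπ hN hS hl').2.2.2 (by omega)
    have t4 := ((H.horse _ hl').top_series hπ hN hS).1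
    rw [← (H.glue l hl.1 (by omega)).2.2.2, t2, t4, ih (by omega)] at t3
    rw [t1, t3, ch_succ, X_add, X_add]
    simp only [Arm.level, Arm.outer, Arm.inner, ← hl0, hl1]

theorem q_c (hl : l ∈ Icc 1 m) :
    H.q l .c = 1 + X Z (z N H l) * ∏ i ∈ (Finset.Icc 1 m).erase l, H.r i := by
  have h := H.horse l hl
  obtain ⟨h1, h2⟩ := hl
  obtain ⟨-, t1, -⟩ := h.bot_series hπ hN hS
  obtain ⟨-, t2, -⟩ := h.top_series hπ hN hS
  have t3 := (H.transport hπ hN hS ⟨h1, h2⟩ (p := .c) trivial).2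
  have s1 := H.u1_a hπ hN hS hB (n := l - 1) (by omega)
  have s2 := H.u1_b hπ hN hS hB (n := l - 1) (by omega)
  have s3 := H.d1_a hπ hN hS hB (n := m - l) (by omega)
  have s4 := H.d1_b hπ hN hS hB (n := m - l) (by omega)
  rw [show l - 1 + 1 = l by omega] at s1 s2
  rw [show m - (m - l) = l by omega] at s3 s4
  have e : (Finset.Icc 1 m).erase l = Finset.disjUnion (Finset.Ico 1 l) (Finset.Ioc l m)
      (Finset.disjoint_left.2 fun x => by simp only [Finset.mem_Ioc, Finset.mem_Ico]; omega) := by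
    ext x
    simp only [Finset.mem_erase, Finset.mem_Icc, Finset.mem_disjUnion, Finset.mem_Ioc,
      Finset.mem_Ico]
    omega
  have e2 : ∏ i ∈ (Finset.Icc 1 m).erase l, H.r i =
      (∏ i ∈ Finset.Ico 1 l, H.r i) * ∏ i ∈ Finset.Ioc l m, H.r i := by
    rw [e]
    exact Finset.prod_disjUnion (M := Series S) _
  rw [q, fac, t1, t3, t2, s1, s2, s3, s4, e2, z]
  simp only [X_add]
  ring

/-- The street factors of a herd are powers of a single series. -/
theorem q_eq_pow (hm : 1 ≤ m) {x : ExtChain S} (hz : ∀ l ∈ Icc 1 m, z N H l = x) :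
    H.q m .c = 1 + X Z x * H.q m .c ^ ((m - 1) ^ 2) ∧
      ∀ l ∈ Icc 1 m, ∀ p : HorseStreet, H.q l p = H.q m .c ^ p.exponent m l := by
  have key := solve_herd (A := Series S) (s := Finset.Icc 1 m) (q := fun l => H.q l .c)
    (r := fun l => H.r l) (x := X Z x)
    (fun l hl => by
      have hl' : l ∈ Icc 1 m := by simpa using hl
      rw [← hz l hl']
      exact H.q_c hπ hN hS hB hl')
    (fun l hl => H.r_eq hπ hN hS (by simpa using hl)) (k := m) (by simp [hm])
  obtain ⟨k1, k2⟩ := key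
  rw [Nat.card_Icc, show m + 1 - 1 = m by omega] at k2
  refine ⟨k2, ?_⟩
  have k1' : ∀ l ∈ Icc 1 m, H.q l .c = H.q m .c := fun l hl => k1 l (by simpa using hl)
  intro l hl p
  have h1 := hl.1
  have h2 := hl.2
  have lo : ∀ p, p = .a2 ∨ p = .b2 → H.q l p = H.q m .c ^ (m - l) := by
    intro p hp
    rw [H.q_inner_lower hπ hN hS hl p hp, Finset.prod_congr rfl (g := fun _ => H.q m .c) fun i hi => by
      simp only [Finset.mem_Ioc] at hi
      exact k1' i ⟨by omega, hi.2⟩, Finset.prod_const, Nat.card_Ioc]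
  have up : ∀ p, p = .a2' ∨ p = .b2' → H.q l p = H.q m .c ^ (l - 1) := by
    intro p hp
    rw [H.q_inner_upper hπ hN hS hl p hp, Finset.prod_congr rfl (g := fun _ => H.q m .c) fun i hi => by
      simp only [Finset.mem_Ico] at hi
      exact k1' i ⟨by omega, by omega⟩, Finset.prod_const, Nat.card_Ico]
  obtain ⟨r1, r2, -, -⟩ := H.right_series hπ hN hS hl
  obtain ⟨l1, l2, -, -⟩ := H.left_series hπ hN hS hl
  obtain ⟨b1, b2⟩ := H.q_bot hπ hN hS hl
  obtain ⟨t1, t2⟩ := H.q_top hπ hN hS hl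
  have su : ∀ {n k : ℕ}, n + 1 = k → H.q m .c * H.q m .c ^ n = H.q m .c ^ k := by
    rintro n _ rfl
    ring
  cases p
  case a1 => rw [b1, k1' l hl, lo _ (Or.inl rfl)]; exact su rfl
  case b1 => rw [b2, k1' l hl, lo _ (Or.inr rfl)]; exact su rfl
  case a1' => rw [t1, k1' l hl, up _ (Or.inl rfl)]; exact su (by simp only [HorseStreet.exponent]; omega)
  case b1' => rw [t2, k1' l hl, up _ (Or.inr rfl)]; exact su (by simp only [HorseStreet.exponent]; omega)
  case c => rw [k1' l hl]; exact (pow_one (M := Series S) _).symm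
  case a2 => exact lo _ (Or.inl rfl)
  case b2 => exact lo _ (Or.inr rfl)
  case a3 => rw [← r1]; exact lo _ (Or.inl rfl)
  case b3 => rw [← l2]; exact lo _ (Or.inr rfl)
  case a2' => exact up _ (Or.inl rfl)
  case b2' => exact up _ (Or.inr rfl)
  case a3' => rw [l1]; exact up _ (Or.inl rfl)
  case b3' => rw [r2]; exact up _ (Or.inr rfl)

end Herd

/-- Functions on the plane that differ locally by constants can be glued up to local constants. -/
theorem exists_glue {G : Type*} [AddCommGroup G] (O : ℂ → Set ℂ) (hO : ∀ i, IsOpen (O i))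
    (hmem : ∀ i, i ∈ O i) (κ : ℂ → ℂ → G)
    (h : ∀ i j, ∀ b ∈ O i ∩ O j, ∀ᶠ b' in 𝓝 b, κ j b' - κ i b' = κ j b - κ i b) :
    ∃ k : ℂ → G, ∀ i, ∀ b ∈ O i, ∀ᶠ b' in 𝓝 b, k b' - κ i b' = k b - κ i b := by
  let : TopologicalSpace G := ⊥
  have : DiscreteTopology G := ⟨rfl⟩
  let Z : FiberBundleCore ℂ ℂ G :=
    { baseSet := O
      isOpen_baseSet := hO
      indexAt := id
      mem_baseSet_at := hmem
      coordChange := fun i j b g => g + (κ j b - κ i b)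
      coordChange_self := fun i b _ g => by simp
      continuousOn_coordChange := fun i j => by
        rintro ⟨b, g⟩ hb
        have h1 : ∀ᶠ p in 𝓝 (b, g), p.2 + (κ j p.1 - κ i p.1) = g + (κ j b - κ i b) := by
          have h2 : ∀ᶠ p : ℂ × G in 𝓝 (b, g), p.2 = g :=
            continuousAt_snd.eventually_mem ((isOpen_discrete {g}).mem_nhds (mem_singleton g))
          filter_upwards [h2, continuousAt_fst.eventually (h i j b hb.1)] with p hp1 hp2
          rw [hp1, hp2]
        exact (continuousAt_const.congr (h1.mono fun p hp => hp.symm)).continuousWithinAt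
      coordChange_comp := fun i j k b _ g => by abel }
  have hcov : IsCoveringMap Z.proj := by
    refine IsCoveringMap.mk _ (fun _ => G) (fun i => Z.localTriv i) fun b => ?_
    exact hmem b
  obtain ⟨s, ⟨-, hs⟩, -⟩ := hcov.existsUnique_continuousMap_lifts (ContinuousMap.id ℂ) (0 : ℂ)
    (⟨0, (0 : G)⟩ : Z.TotalSpace) rfl
  have hs' : ∀ b, (s b).1 = b := fun b => congrFun hs b
  have hsec : ∀ b, ∃ g : G, s b = (⟨b, g⟩ : Z.TotalSpace) := fun b => by
    have := hs' b
    revert this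
    rcases s b with ⟨x, g⟩
    rintro rfl
    exact ⟨g, rfl⟩
  choose c hc using hsec
  refine ⟨fun b => κ b b - c b, fun i b hb => ?_⟩
  have h1 : ContinuousAt (fun x => Z.localTriv i (s x)) b := by
    refine ContinuousAt.comp (f := s) ((Z.localTriv i).continuousAt ?_) s.continuous.continuousAt
    rw [Z.mem_localTriv_source, hs']
    exact hb
  have h2 : ∀ᶠ x in 𝓝 b, (Z.localTriv i (s x)).2 = (Z.localTriv i (s b)).2 :=
    (continuousAt_snd.comp h1).eventually_mem
      (isOpen_discrete {(Z.localTriv i (s b)).2} |>.mem_nhds rfl)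
  filter_upwards [h2] with x hx
  rw [hc, hc] at hx
  have hx' : c x + (κ i x - κ x x) = c b + (κ i b - κ b b) := hx
  have : κ x x - c x - κ i x = -(c x + (κ i x - κ x x)) := by abel
  rw [this, hx']
  abel

/-- An additive function of intervals that has primitives locally has a global primitive. -/
theorem eq_sub_of_local {G : Type*} [AddCommGroup G] {a b : ℝ} {I : ℝ → ℝ → G} {f : ℝ → G}
    (hI : ∀ x ∈ uIcc a b, ∀ y ∈ uIcc a b, ∀ z ∈ uIcc a b, I x y + I y z = I x z)
    (h : ∀ t ∈ uIcc a b, ∃ W ∈ 𝓝 t, ∀ x ∈ W ∩ uIcc a b, ∀ y ∈ W ∩ uIcc a b, uIcc x y ⊆ W →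
      I x y = f y - f x) : I a b = f b - f a := by
  have hc : IsLocallyConstant (fun t : uIcc a b => I a t - f t) := by
    rw [IsLocallyConstant.iff_eventually_eq]
    rintro ⟨t, ht⟩
    obtain ⟨W, hW, hWI⟩ := h t ht
    obtain ⟨ε, hε, hb⟩ := Metric.mem_nhds_iff.1 hW
    have : ∀ᶠ y : uIcc a b in 𝓝 ⟨t, ht⟩, (y : ℝ) ∈ Metric.ball t ε :=
      continuous_subtype_val.continuousAt.eventually_mem (Metric.ball_mem_nhds t hε)
    filter_upwards [this] with y hy
    have e := hWI t ⟨hb (Metric.mem_ball_self hε), ht⟩ y ⟨hb hy, y.2⟩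
      (((convex_ball t ε).ordConnected.uIcc_subset (Metric.mem_ball_self hε) hy).trans hb)
    change I a y - f y = I a t - f t
    rw [← hI a left_mem_uIcc t ht y y.2, e]
    abel
  have : PreconnectedSpace (uIcc a b) := Subtype.preconnectedSpace isPreconnected_uIcc
  have := hc.apply_eq_of_preconnectedSpace ⟨a, left_mem_uIcc⟩ ⟨b, right_mem_uIcc⟩
  have h0 : I a a = 0 := by simpa using hI a left_mem_uIcc a left_mem_uIcc a left_mem_uIcc
  simp only [h0] at this
  have e : I a b = (I a b - f b) + f b := by abel
  rw [e, ← this]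
  abel

/-- Potentials of a periodic family of tangent vectors are periodic up to a constant. -/
theorem exists_period {E : Type*} [NormedAddCommGroup E] [NormedSpace ℝ E] {K : Set E} {x₀ τ : E}
    (hK : StarConvex ℝ x₀ K) {D : E → Tan M} (hD : ContinuousOn D K)
    (hne : ∀ w ∈ K, vec (D w) ≠ 0) (hτK : ∀ w ∈ K, w + τ ∈ K) (hτ : ∀ w ∈ K, D (w + τ) = D w) :
    ∃ (k : E → ExtChain M) (h : ExtChain M), (∀ (p : ℝ → E) (a b : ℝ), ContinuousOn p (uIcc a b) →
      MapsTo p (uIcc a b) K → cls (dirArc (fun t => D (p t)) a b) = k (p b) - k (p a)) ∧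
      ∀ w ∈ K, k (w + τ) = k w + h := by
  obtain ⟨k, hk⟩ := exists_potential hK hD hne
  refine ⟨k, k (x₀ + τ) - k x₀, hk, fun w hw => ?_⟩
  have hseg : MapsTo (fun r : ℝ => x₀ + r • (w - x₀)) (uIcc 0 1) K := by
    intro r hr
    rw [uIcc_of_le zero_le_one] at hr
    have := hK hw (sub_nonneg.2 hr.2) hr.1 (by ring)
    convert this using 1
    module
  have h1 := hk (fun r => x₀ + r • (w - x₀)) 0 1 (by fun_prop) hseg
  have h2 := hk (fun r => x₀ + r • (w - x₀) + τ) 0 1 (by fun_prop) fun r hr => hτK _ (hseg hr)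
  rw [dirArc_congr fun r hr => hτ _ (hseg hr), h1] at h2
  simp only [one_smul, zero_smul, add_zero, add_sub_cancel] at h2
  have : k (w + τ) = (k (w + τ) - k (x₀ + τ)) + k (x₀ + τ) := by abel
  rw [this, ← h2]
  abel

/-- The period of the exponential. -/
def period : ℂ := 2 * Real.pi * Complex.I

theorem exp_add_period (ζ : ℂ) : Complex.exp (ζ + period) = Complex.exp ζ :=
  Complex.exp_periodic ζ

variable (M) in
/-- The class of the fibre over a point. -/
def fibreClass (x : M) : ExtChain M := cls (fibreLoop (tan x 1))

/-- The curves of tangent vectors that run around the origin of a tangent plane once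
counterclockwise in the sense of a linear map that preserves the orientation have the class of
the fibre. -/
theorem cls_rotation (x : M) {A : ℂ →L[ℝ] ℂ} (hA : 0 < LinearMap.det (A : ℂ →ₗ[ℝ] ℂ)) :
    cls (dirArc (fun t => tan x (A (Complex.exp ((t : ℂ) * period)))) 0 1) = fibreClass M x := by
  have hA1 : A 1 ≠ 0 := det_ne_zero_iff_injective hA.ne' one_ne_zero
  have hne : ∀ (s : ℝ) (z : ℂ), s ∈ 𝕀 → z ≠ 0 →
      (1 - s) • (z * A 1) + s • A z ≠ 0 := by
    intro s z hs hz h0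
    have hAz : A z = z.re • A 1 + z.im • A Complex.I := by
      rw [← map_smul, ← map_smul, ← map_add]
      congr 1
      apply Complex.ext <;> simp
    have hw := wedge_map A 1 Complex.I
    have h1 : wedge 1 Complex.I = 1 := by simp [wedge]
    rw [h1, mul_one] at hw
    have h2 := congrArg (wedge (A 1)) h0
    have h3 : wedge (A 1) ((1 - s) • (z * A 1) + s • A z) =
        z.im * ((1 - s) * Complex.normSq (A 1) + s * wedge (A 1) (A Complex.I)) := by
      rw [hAz]
      simp [wedge, Complex.normSq_apply]
      ring
    have h4 : 0 < (1 - s) * Complex.normSq (A 1) + s * wedge (A 1) (A Complex.I) := by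
      have p1 := Complex.normSq_pos.2 hA1
      rw [hw]
      rcases hs.1.eq_or_lt with rfl | h
      · simpa using p1
      · have := mul_pos h hA
        nlinarith [hs.2]
    rw [h3] at h2
    have hz0 : z.im = 0 := by
      have : wedge (A 1) 0 = 0 := by simp [wedge]
      rw [this] at h2
      exact (mul_eq_zero.1 h2).resolve_right h4.ne'
    have hzr : z = (z.re : ℂ) := Complex.ext rfl (by simp [hz0])
    rw [hAz, hz0, zero_smul, add_zero, hzr] at h0
    have h5 : (1 - s) • ((z.re : ℂ) * A 1) + s • (((z.re : ℂ)).re • A 1) = (z.re : ℂ) * A 1 := by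
      simp only [Complex.ofReal_re, Complex.real_smul]
      push_cast
      ring
    rw [h5] at h0
    rcases mul_eq_zero.1 h0 with h | h
    · exact hz (by rw [hzr, h])
    · exact hA1 h
  have hK : StarConvex ℝ ((0 : ℝ), (0 : ℂ)) (𝕀 ×ˢ (univ : Set ℂ)) :=
    ((convex_Icc 0 1).prod convex_univ).starConvex ⟨by simp, mem_univ _⟩
  obtain ⟨k, h, hk, hp⟩ := exists_period (M := M) (τ := ((0 : ℝ), period)) hK
    (D := fun w => tan x ((1 - w.1) • (Complex.exp w.2 * A 1) + w.1 • A (Complex.exp w.2)))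
    ((continuous_tan x).comp (by fun_prop)).continuousOn
    (fun w hw => hne _ _ hw.1 (Complex.exp_ne_zero _))
    (fun w hw => ⟨by simpa using hw.1, mem_univ _⟩)
    (fun w _ => by simp only [Prod.snd_add, Prod.fst_add, add_zero, exp_add_period])
  have e1 := hk (fun t => (1, (t : ℂ) * period)) 0 1 (by fun_prop)
    (fun t _ => ⟨by simp, mem_univ _⟩)
  have e2 := hk (fun t => (0, -Complex.log (A 1) + (t : ℂ) * period)) 0 1 (by fun_prop)
    (fun t _ => ⟨by simp, mem_univ _⟩)
  have p1 := hp (1, 0) ⟨by simp, mem_univ _⟩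
  have p2 := hp (0, -Complex.log (A 1)) ⟨by simp, mem_univ _⟩
  simp only [Prod.mk_add_mk, add_zero, zero_add] at p1 p2
  simp only [Complex.ofReal_one, one_mul, Complex.ofReal_zero, zero_mul, p1, p2, add_zero,
    sub_self, zero_smul, one_smul, zero_add, sub_zero, add_sub_cancel_left] at e1 e2
  rw [e1, ← e2, fibreClass, fibreLoop]
  congr 1
  refine dirArc_congr fun t _ => ?_
  simp only [tan_fst, vec_tan, mul_one]
  congr 1
  rw [Complex.exp_add, Complex.exp_neg, Complex.exp_log hA1, mul_comm (A 1)⁻¹,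
    inv_mul_cancel_right₀ hA1, period]
  congr 1
  ring

theorem der_comp_symm {e : OpenPartialHomeomorph M ℂ} (he : e ∈ orientedCharts M) {y : ℂ}
    (hy : y ∈ e.target) :
    (der e (e.symm y)).comp (der e.symm y) = ContinuousLinearMap.id ℝ ℂ ∧
      (der e.symm y).comp (der e (e.symm y)) = ContinuousLinearMap.id ℝ ℂ := by
  have h1 := (orientedCharts.contMDiffAt_symm he hy).mdifferentiableAt (by simp)
  have h2 := (orientedCharts.contMDiffAt he (e.map_target hy)).mdifferentiableAt (by simp)
  constructor
  · have h3 := mfderiv_comp y h2 h1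
    refine h3.symm.trans ?_
    refine Eq.trans (Filter.EventuallyEq.mfderiv_eq (f := id) ?_) mfderiv_id
    filter_upwards [e.open_target.mem_nhds hy] with z hz
    exact e.right_inv hz
  · have h1' : MDifferentiableAt 𝓒 𝓒 e.symm (e (e.symm y)) := by rwa [e.right_inv hy]
    have h3 := mfderiv_comp (e.symm y) h1' h2
    rw [e.right_inv hy] at h3
    refine h3.symm.trans ?_
    refine Eq.trans (Filter.EventuallyEq.mfderiv_eq (f := id) ?_) mfderiv_id
    filter_upwards [e.open_source.mem_nhds (e.map_target hy)] with z hz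
    exact e.left_inv hz

theorem det_pos_of_comp_eq_id {A B : ℂ →L[ℝ] ℂ} (h : A.comp B = ContinuousLinearMap.id ℝ ℂ)
    (hA : 0 < LinearMap.det (A : ℂ →ₗ[ℝ] ℂ)) : 0 < LinearMap.det (B : ℂ →ₗ[ℝ] ℂ) := by
  have h2 : LinearMap.det (A : ℂ →ₗ[ℝ] ℂ) * LinearMap.det (B : ℂ →ₗ[ℝ] ℂ) =
      LinearMap.det ((ContinuousLinearMap.id ℝ ℂ : ℂ →L[ℝ] ℂ) : ℂ →ₗ[ℝ] ℂ) := by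
    rw [← h, ← LinearMap.det_comp]
    rfl
  have h3 : LinearMap.det ((ContinuousLinearMap.id ℝ ℂ : ℂ →L[ℝ] ℂ) : ℂ →ₗ[ℝ] ℂ) = 1 :=
    LinearMap.det_id
  rw [h3] at h2
  exact (pos_iff_pos_of_mul_pos (by rw [h2]; exact one_pos)).1 hA

theorem der_symm_det_pos {e : OpenPartialHomeomorph M ℂ} (he : e ∈ orientedCharts M) {y : ℂ}
    (hy : y ∈ e.target) : 0 < LinearMap.det (der e.symm y : ℂ →ₗ[ℝ] ℂ) :=
  det_pos_of_comp_eq_id (der_comp_symm he hy).1 (det_der_pos he (e.map_target hy))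

theorem chartAt_mem_orientedCharts [OrientedAtlas M] (x : M) : chartAt ℂ x ∈ orientedCharts M :=
  ⟨IsManifold.chart_mem_maximalAtlas x, OrientedAtlas.pos _ (chart_mem_atlas ℂ x)⟩

/-- The period of a potential for exponential coordinates is the fibre class. -/
theorem period_eq_fibreClass {O : Set ℂ} {y₀ : ℂ} (hO : StarConvex ℝ y₀ O) {c : ℂ → M}
    {A : ℂ → ℂ →L[ℝ] ℂ} (hA : ∀ y ∈ O, 0 < LinearMap.det (A y : ℂ →ₗ[ℝ] ℂ))
    (hD : ContinuousOn (fun w : ℂ × ℂ => tan (c w.1) (A w.1 (Complex.exp w.2))) (O ×ˢ univ)) :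
    ∃ k : ℂ × ℂ → ExtChain M, (∀ (p : ℝ → ℂ × ℂ) (a b : ℝ), ContinuousOn p (uIcc a b) →
      MapsTo p (uIcc a b) (O ×ˢ univ) →
        cls (dirArc (fun t => tan (c (p t).1) (A (p t).1 (Complex.exp (p t).2))) a b) =
          k (p b) - k (p a)) ∧
      ∀ y ∈ O, ∀ y' ∈ O, fibreClass M (c y) = fibreClass M (c y') ∧
        ∀ ζ, k (y, ζ + period) = k (y, ζ) + fibreClass M (c y') := by
  obtain ⟨k, h, hk, hp⟩ := exists_period (M := M) (x₀ := (y₀, (0 : ℂ))) (τ := ((0 : ℂ), period))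
    (hO.prod (convex_univ.starConvex (mem_univ _))) hD
    (fun w hw => det_ne_zero_iff_injective (hA _ hw.1).ne' (Complex.exp_ne_zero _))
    (fun w hw => ⟨by simpa using hw.1, mem_univ _⟩)
    (fun w _ => by simp only [Prod.snd_add, Prod.fst_add, add_zero, exp_add_period])
  have key : ∀ y ∈ O, h = fibreClass M (c y) := by
    intro y hy
    have e1 := hk (fun t => (y, (t : ℂ) * period)) 0 1 (by fun_prop) (fun t _ => ⟨hy, mem_univ _⟩)
    have p1 := hp (y, 0) ⟨hy, mem_univ _⟩
    simp only [Prod.mk_add_mk, add_zero, zero_add] at p1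
    simp only [Complex.ofReal_one, one_mul, Complex.ofReal_zero, zero_mul, p1,
      add_sub_cancel_left] at e1
    rw [← e1, cls_rotation _ (hA y hy)]
  refine ⟨k, hk, fun y hy y' hy' => ⟨(key y hy).symm.trans (key y' hy'), fun ζ => ?_⟩⟩
  rw [← key y' hy', ← hp (y, ζ) ⟨hy, mem_univ _⟩]
  simp

theorem fibreClass_eq [OrientedAtlas M] [PreconnectedSpace M] (x x' : M) :
    fibreClass M x = fibreClass M x' := by
  have hc : IsLocallyConstant (fibreClass M) := by
    rw [IsLocallyConstant.iff_eventually_eq]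
    intro x
    have he := chartAt_mem_orientedCharts x
    set e := chartAt ℂ x with hedef
    have hx : x ∈ e.source := mem_chart_source ℂ x
    obtain ⟨ε, hε, hb⟩ := Metric.mem_nhds_iff.1 (e.open_target.mem_nhds (e.map_source hx))
    have hD : ContinuousOn (fun w : ℂ × ℂ => tan (e.symm w.1) (der e.symm w.1 (Complex.exp w.2)))
        (Metric.ball (e x) ε ×ˢ univ) := by
      refine continuousOn_push (f := e.symm) (g := fun w : ℂ × ℂ => (tan w.1 (Complex.exp w.2) : Tan ℂ))
        (continuous_tan_model.comp (continuous_fst.prodMk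
          (Complex.continuous_exp.comp continuous_snd))).continuousOn fun w hw => ?_
      exact (orientedCharts.contMDiffAt_symm he (hb hw.1)).of_le (by simp)
    obtain ⟨k, -, hk⟩ := period_eq_fibreClass (M := M) (c := e.symm) (A := fun y => der e.symm y)
      ((convex_ball (e x) ε).starConvex (Metric.mem_ball_self hε))
      (fun y hy => der_symm_det_pos he (hb hy)) hD
    filter_upwards [e.open_source.mem_nhds hx, (e.continuousAt hx).eventually_mem
      (Metric.ball_mem_nhds _ hε)] with y hy hy'
    have := (hk _ hy' _ (Metric.mem_ball_self hε)).1
    rwa [e.left_inv hy, e.left_inv hx] at this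
  exact hc.apply_eq_of_preconnectedSpace x x'

section Pairs

/-- Two curves of tangent vectors over two lifts of a curve in the plane, with opposite
projections to the base. -/
structure LiftPair (π : S → C) (F₁ F₂ : ℂ → S) (p : ℝ → ℂ) (g₁ g₂ : ℝ → Tan S) (s : Set ℝ) :
    Prop where
  cont : ContinuousOn p s
  cont₁ : ContinuousOn g₁ s
  cont₂ : ContinuousOn g₂ s
  base₁ : ∀ t ∈ s, (g₁ t).1 = F₁ (p t)
  base₂ : ∀ t ∈ s, (g₂ t).1 = F₂ (p t)
  ne_zero₁ : ∀ t ∈ s, vec (g₁ t) ≠ 0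
  ne_zero₂ : ∀ t ∈ s, vec (g₂ t) ≠ 0
  push_eq : ∀ t ∈ s, push π (g₁ t) = opp (push π (g₂ t))

theorem LiftPair.mono {F₁ F₂ : ℂ → S} {p : ℝ → ℂ} {g₁ g₂ : ℝ → Tan S} {s t : Set ℝ}
    (h : LiftPair π F₁ F₂ p g₁ g₂ t) (hst : s ⊆ t) : LiftPair π F₁ F₂ p g₁ g₂ s :=
  ⟨h.cont.mono hst, h.cont₁.mono hst, h.cont₂.mono hst, fun r hr => h.base₁ r (hst hr),
    fun r hr => h.base₂ r (hst hr), fun r hr => h.ne_zero₁ r (hst hr),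
    fun r hr => h.ne_zero₂ r (hst hr), fun r hr => h.push_eq r (hst hr)⟩

theorem LiftPair.add {F₁ F₂ : ℂ → S} {p : ℝ → ℂ} {g₁ g₂ : ℝ → Tan S} {a b : ℝ}
    (h : LiftPair π F₁ F₂ p g₁ g₂ (uIcc a b)) : ∀ x ∈ uIcc a b, ∀ y ∈ uIcc a b, ∀ z ∈ uIcc a b,
      (cls (dirArc g₂ x y) - cls (dirArc g₁ x y)) + (cls (dirArc g₂ y z) - cls (dirArc g₁ y z)) =
        cls (dirArc g₂ x z) - cls (dirArc g₁ x z) := by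
  intro x hx y hy z hz
  rw [← cls_dirArc_add ordConnected_uIcc h.cont₂ h.ne_zero₂ hx hy hz,
    ← cls_dirArc_add ordConnected_uIcc h.cont₁ h.ne_zero₁ hx hy hz]
  abel

/-- Lifting of coordinate vectors. -/
def liftCoord (π : S → C) (e : OpenPartialHomeomorph C ℂ) (x : S) : ℂ →L[ℝ] ℂ :=
  (der π x).inverse.comp (der e.symm (e (π x)))

variable (hπ : IsSimpleBranchedCover π K)

include hπ

theorem liftCoord_det_pos {e : OpenPartialHomeomorph C ℂ} (he : e ∈ orientedCharts C) {x : S}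
    (hx : π x ∈ e.source) (hb : π x ∉ branchPoints π) :
    0 < LinearMap.det (liftCoord π e x : ℂ →ₗ[ℝ] ℂ) := by
  obtain ⟨L⟩ := hπ.nonempty_localSection hb
  have h1 : (der π x).comp (der π x).inverse = ContinuousLinearMap.id ℝ ℂ :=
    ContinuousLinearMap.ext fun v => hπ.der_liftVec hb v
  have h2 := det_pos_of_comp_eq_id h1 (L.det_pos x L.mem)
  have h3 := der_symm_det_pos he (e.map_source hx)
  have h4 : LinearMap.det (liftCoord π e x : ℂ →ₗ[ℝ] ℂ) =
      LinearMap.det ((der π x).inverse : ℂ →ₗ[ℝ] ℂ) *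
        LinearMap.det (der e.symm (e (π x)) : ℂ →ₗ[ℝ] ℂ) := by
    rw [← LinearMap.det_comp]
    rfl
  rw [h4]
  exact mul_pos h2 h3

theorem cvec_liftCoord {e : OpenPartialHomeomorph C ℂ} (he : e ∈ orientedCharts C) {x : S}
    (hx : π x ∈ e.source) (hb : π x ∉ branchPoints π) (u : ℂ) :
    cvec e π (tan x (liftCoord π e x u)) = u := by
  have h1 := cvec_liftVec (φ := e) hπ hb (der e.symm (e (π x)) u)
  have h2 := congrArg (fun f : ℂ →L[ℝ] ℂ => f u) (der_comp_symm he (e.map_source hx)).1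
  rw [e.left_inv hx] at h2
  exact h1.trans h2

theorem liftCoord_cvec {e : OpenPartialHomeomorph C ℂ} (he : e ∈ orientedCharts C) {w : Tan S}
    (hx : π w.1 ∈ e.source) (hb : π w.1 ∉ branchPoints π) :
    tan w.1 (liftCoord π e w.1 (cvec e π w)) = w := by
  have h2 := congrArg (fun f : ℂ →L[ℝ] ℂ => f (der π w.1 (vec w)))
    (der_comp_symm he (e.map_source hx)).2
  rw [e.left_inv hx] at h2
  have h3 : liftCoord π e w.1 (cvec e π w) = vec w := by
    refine Eq.trans ?_ (hπ.liftVec_der hb (vec w))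
    exact congrArg (liftVec π w.1) h2
  rw [h3, tan_vec]

theorem push_liftCoord {e : OpenPartialHomeomorph C ℂ} {x : S}
    (hb : π x ∉ branchPoints π) (u : ℂ) :
    push π (tan x (liftCoord π e x u)) = tan (π x) (der e.symm (e (π x)) u) := by
  rw [push, tan_fst, vec_tan]
  exact congrArg (tan (π x)) (hπ.der_liftVec hb _)

theorem continuousOn_liftCoord {e : OpenPartialHomeomorph C ℂ} (he : e ∈ orientedCharts C)
    {Y : Type*} [TopologicalSpace Y] {s : Set Y} {c : Y → S} {u : Y → ℂ} (hc : ContinuousOn c s)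
    (hu : ContinuousOn u s) (hx : ∀ y ∈ s, π (c y) ∈ e.source)
    (hb : ∀ y ∈ s, π (c y) ∉ branchPoints π) :
    ContinuousOn (fun y => tan (c y) (liftCoord π e (c y) (u y))) s := by
  have h1 : ContinuousOn (fun y => e (π (c y))) s := by
    refine e.continuousOn.comp (t := e.source) ?_ hx
    exact hπ.proper.continuous.comp_continuousOn hc
  have h2 : ContinuousOn (fun y => push e.symm (tan (e (π (c y))) (u y) : Tan ℂ)) s :=
    continuousOn_push (continuous_tan_model.comp_continuousOn (h1.prodMk hu)) fun y hy =>
      (orientedCharts.contMDiffAt_symm he (e.map_source (hx y hy))).of_le (by simp)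
  exact continuousOn_liftTan hπ h2 hc (fun y hy => (e.left_inv (hx y hy)).symm) hb

theorem continuousOn_cvec {e : OpenPartialHomeomorph C ℂ} (he : e ∈ orientedCharts C)
    {Y : Type*} [TopologicalSpace Y] {s : Set Y} {g : Y → Tan S} (hg : ContinuousOn g s)
    (hx : ∀ y ∈ s, π (g y).1 ∈ e.source) (hb : ∀ y ∈ s, π (g y).1 ∉ branchPoints π) :
    ContinuousOn (fun y => cvec e π (g y)) s := by
  have h1 := continuousOn_push hg fun y hy => hπ.contMDiffAt (hb y hy)
  have h2 := continuousOn_push (f := e) h1 fun y hy =>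
    (orientedCharts.contMDiffAt he (hx y hy)).of_le (by simp)
  exact continuous_vec_model.comp_continuousOn h2

variable {F : ℂ → C} {F₁ F₂ : ℂ → S} (hF : Continuous F) (hbr : ∀ w, F w ∉ branchPoints π)
  (hF₁ : Continuous F₁) (hF₂ : Continuous F₂) (h₁ : ∀ w, π (F₁ w) = F w) (h₂ : ∀ w, π (F₂ w) = F w)

include hF hbr hF₁ hF₂ h₁ h₂

theorem exists_local_potential [OrientedAtlas S] [OrientedAtlas C] [PreconnectedSpace S] (y₀ : ℂ) :
    ∃ (O : Set ℂ) (κ : ℂ → Tan C → ExtChain S), IsOpen O ∧ y₀ ∈ O ∧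
      (∀ (p : ℝ → ℂ) (g₁ g₂ : ℝ → Tan S) (a b : ℝ), LiftPair π F₁ F₂ p g₁ g₂ (uIcc a b) →
        MapsTo p (uIcc a b) O → cls (dirArc g₂ a b) - cls (dirArc g₁ a b) =
          κ (p b) (push π (g₂ b)) - κ (p a) (push π (g₂ a))) ∧
      ∀ b ∈ O, ∀ V ∈ 𝓝 b, ∀ᶠ b' in 𝓝 b, ∀ w w' : Tan C, w.1 = F b → w'.1 = F b' → vec w ≠ 0 →
        vec w' ≠ 0 → ∃ (p : ℝ → ℂ) (g₁ g₂ : ℝ → Tan S), LiftPair π F₁ F₂ p g₁ g₂ (uIcc 0 1) ∧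
          MapsTo p (uIcc 0 1) V ∧ p 0 = b ∧ p 1 = b' ∧ push π (g₂ 0) = w ∧ push π (g₂ 1) = w' := by
  have he := chartAt_mem_orientedCharts (F y₀)
  set e := chartAt ℂ (F y₀) with hedef
  obtain ⟨ε, hε, hball⟩ := Metric.mem_nhds_iff.1
    (hF.continuousAt.eventually_mem (e.open_source.mem_nhds (mem_chart_source ℂ (F y₀))))
  set O := Metric.ball y₀ ε with hO
  have hOe : ∀ y ∈ O, F y ∈ e.source := fun y hy => hball hy
  have key : ∀ G : ℂ → S, Continuous G → (∀ w, π (G w) = F w) →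
      ContinuousOn (fun w : ℂ × ℂ => tan (G w.1) (liftCoord π e (G w.1) (Complex.exp w.2)))
        (O ×ˢ univ) ∧ ∀ y ∈ O, 0 < LinearMap.det (liftCoord π e (G y) : ℂ →ₗ[ℝ] ℂ) := by
    intro G hG hGF
    refine ⟨continuousOn_liftCoord hπ he (hG.comp continuous_fst).continuousOn
      (Complex.continuous_exp.comp continuous_snd).continuousOn (fun y hy => ?_) (fun y _ => ?_),
      fun y hy => liftCoord_det_pos hπ he ?_ ?_⟩
    · exact (hGF _).symm ▸ hOe _ hy.1
    · exact (hGF _).symm ▸ hbr _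
    · exact (hGF _).symm ▸ hOe _ hy
    · exact (hGF _).symm ▸ hbr _
  obtain ⟨hD₁, hdet₁⟩ := key F₁ hF₁ h₁
  obtain ⟨hD₂, hdet₂⟩ := key F₂ hF₂ h₂
  have hst : StarConvex ℝ y₀ O := (convex_ball y₀ ε).starConvex (Metric.mem_ball_self hε)
  obtain ⟨k₁, hk₁, hp₁⟩ := period_eq_fibreClass hst hdet₁ hD₁
  obtain ⟨k₂, hk₂, hp₂⟩ := period_eq_fibreClass hst hdet₂ hD₂
  let κ₀ : ℂ → ℂ → ExtChain S := fun y ζ => k₂ (y, ζ) - k₁ (y, ζ + Real.pi * Complex.I)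
  have hper : ∀ y ∈ O, Function.Periodic (κ₀ y) period := by
    intro y hy ζ
    have e1 := (hp₁ y hy y hy).2 (ζ + Real.pi * Complex.I)
    have e2 := (hp₂ y hy y hy).2 ζ
    rw [fibreClass_eq (F₁ y) (F₂ y)] at e1
    simp only [κ₀]
    rw [e2, show ζ + period + Real.pi * Complex.I = ζ + Real.pi * Complex.I + period by ring, e1]
    abel
  have hκ₀ : ∀ y ∈ O, ∀ ζ ζ', Complex.exp ζ = Complex.exp ζ' → κ₀ y ζ = κ₀ y ζ' := by
    intro y hy ζ ζ' hζ
    obtain ⟨n, rfl⟩ := Complex.exp_eq_exp_iff_exists_int.1 hζ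
    exact (hper y hy).int_mul n ζ'
  let u : Tan C → ℂ := fun w => der e w.1 (vec w)
  refine ⟨O, fun y w => κ₀ y (Complex.log (u w)), Metric.isOpen_ball, Metric.mem_ball_self hε,
    fun p g₁ g₂ a b hg hpO => ?_, fun b hb V hV => ?_⟩
  · refine eq_sub_of_local (I := fun x y => cls (dirArc g₂ x y) - cls (dirArc g₁ x y))
      (f := fun t => κ₀ (p t) (Complex.log (u (push π (g₂ t))))) hg.add fun t ht => ?_
    have hπ₂ : ∀ r ∈ uIcc a b, π (g₂ r).1 = F (p r) := fun r hr => by rw [hg.base₂ r hr, h₂]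
    have hπ₁ : ∀ r ∈ uIcc a b, π (g₁ r).1 = F (p r) := fun r hr => by rw [hg.base₁ r hr, h₁]
    have hs₂ : ∀ r ∈ uIcc a b, π (g₂ r).1 ∈ e.source := fun r hr => hπ₂ r hr ▸ hOe _ (hpO hr)
    have hs₁ : ∀ r ∈ uIcc a b, π (g₁ r).1 ∈ e.source := fun r hr => hπ₁ r hr ▸ hOe _ (hpO hr)
    have hb₂ : ∀ r ∈ uIcc a b, π (g₂ r).1 ∉ branchPoints π := fun r hr => hπ₂ r hr ▸ hbr _
    have hb₁ : ∀ r ∈ uIcc a b, π (g₁ r).1 ∉ branchPoints π := fun r hr => hπ₁ r hr ▸ hbr _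
    have hu := continuousOn_cvec hπ he hg.cont₂ hs₂ hb₂
    have hu0 : ∀ r ∈ uIcc a b, cvec e π (g₂ r) ≠ 0 := fun r hr =>
      cvec_ne_zero hπ he (hs₂ r hr) (hb₂ r hr) (hg.ne_zero₂ r hr)
    have hu₁ : ∀ r ∈ uIcc a b, cvec e π (g₁ r) = -cvec e π (g₂ r) := by
      intro r hr
      have h := congrArg u (hg.push_eq r hr)
      simp only [u, opp_fst, vec_opp, map_neg] at h
      exact h
    set c := cvec e π (g₂ t) with hc
    have hc0 : c ≠ 0 := hu0 t ht
    have hev : ∀ᶠ r in 𝓝 t, r ∈ uIcc a b → cvec e π (g₂ r) / c ∈ Complex.slitPlane := by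
      have h1 : ContinuousWithinAt (fun r => cvec e π (g₂ r) / c) (uIcc a b) t :=
        (hu t ht).div_const c
      refine eventually_nhdsWithin_iff.1 (h1.eventually_mem
        (Complex.isOpen_slitPlane.mem_nhds ?_))
      change c / c ∈ Complex.slitPlane
      rw [div_self hc0]
      exact Complex.one_mem_slitPlane
    refine ⟨_, hev, fun x hx y hy hxy => ?_⟩
    let ζ : ℝ → ℂ := fun r => Complex.log (cvec e π (g₂ r) / c) + Complex.log c
    have hsub : uIcc x y ⊆ uIcc a b := ordConnected_uIcc.uIcc_subset hx.2 hy.2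
    have hζexp : ∀ r ∈ uIcc x y, Complex.exp (ζ r) = cvec e π (g₂ r) := by
      intro r hr
      rw [Complex.exp_add, Complex.exp_log (div_ne_zero (hu0 r (hsub hr)) hc0),
        Complex.exp_log hc0, div_mul_cancel₀ _ hc0]
    have hζ : ContinuousOn ζ (uIcc x y) :=
      (((hu.mono hsub).div_const c).clog fun r hr => hxy hr (hsub hr)).add continuousOn_const
    have e2 := hk₂ (fun r => (p r, ζ r)) x y ((hg.cont.mono hsub).prodMk hζ)
      fun r hr => ⟨hpO (hsub hr), mem_univ _⟩
    have e1 := hk₁ (fun r => (p r, ζ r + Real.pi * Complex.I)) x y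
      ((hg.cont.mono hsub).prodMk (hζ.add continuousOn_const))
      fun r hr => ⟨hpO (hsub hr), mem_univ _⟩
    rw [dirArc_congr (g := g₂) fun r hr => ?_] at e2
    rw [dirArc_congr (g := g₁) fun r hr => ?_] at e1
    · have ee : ∀ r ∈ uIcc x y, κ₀ (p r) (Complex.log (u (push π (g₂ r)))) = κ₀ (p r) (ζ r) := by
        intro r hr
        refine hκ₀ _ (hpO (hsub hr)) _ _ ?_
        rw [hζexp r hr]
        exact Complex.exp_log (hu0 r (hsub hr))
      rw [ee x left_mem_uIcc, ee y right_mem_uIcc, e1, e2]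
      simp only [κ₀]
      abel
    · simp only []
      rw [Complex.exp_add, Complex.exp_pi_mul_I, mul_neg_one, hζexp r hr, ← hu₁ r (hsub hr),
        ← hg.base₁ r (hsub hr)]
      exact liftCoord_cvec hπ he (hs₁ r (hsub hr)) (hb₁ r (hsub hr))
    · simp only []
      rw [hζexp r hr, ← hg.base₂ r (hsub hr)]
      exact liftCoord_cvec hπ he (hs₂ r (hsub hr)) (hb₂ r (hsub hr))
  · obtain ⟨δ, hδ, hbV⟩ := Metric.mem_nhds_iff.1 (Filter.inter_mem hV (Metric.isOpen_ball.mem_nhds hb))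
    filter_upwards [Metric.ball_mem_nhds b hδ] with b' hb' w w' hw hw' hw0 hw0'
    let p : ℝ → ℂ := fun t => b + (t : ℂ) * (b' - b)
    let ζ : ℝ → ℂ := fun t => Complex.log (u w) + (t : ℂ) * (Complex.log (u w') - Complex.log (u w))
    have hpb : MapsTo p (uIcc 0 1) (V ∩ O) := by
      intro t ht
      rw [uIcc_of_le zero_le_one] at ht
      refine hbV ?_
      have := (convex_ball b δ) (Metric.mem_ball_self hδ) hb' (sub_nonneg.2 ht.2) ht.1 (by ring)
      convert this using 1
      simp only [p, Complex.real_smul]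
      push_cast
      ring
    have hpc : Continuous p := by fun_prop
    have hζc : Continuous ζ := by fun_prop
    have hbO : b' ∈ O := (hbV hb').2
    have hsrc : ∀ G : ℂ → S, (∀ w, π (G w) = F w) → ∀ t ∈ uIcc (0 : ℝ) 1, π (G (p t)) ∈ e.source ∧
        π (G (p t)) ∉ branchPoints π := by
      intro G hG t ht
      rw [hG]
      exact ⟨hOe _ (hpb ht).2, hbr _⟩
    have hend : ∀ (x : ℂ) (v : Tan C), x ∈ O → v.1 = F x → vec v ≠ 0 →
        push π (tan (F₂ x) (liftCoord π e (F₂ x) (Complex.exp (Complex.log (u v))))) = v := by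
      intro x v hx hv hv0
      have hvs : v.1 ∈ e.source := hv ▸ hOe x hx
      rw [push_liftCoord hπ (by rw [h₂]; exact hbr x), h₂, ← hv, Complex.exp_log
        (det_ne_zero_iff_injective (det_der_pos he hvs).ne' hv0)]
      have := congrArg (fun f : ℂ →L[ℝ] ℂ => f (vec v)) (der_comp_symm he (e.map_source hvs)).2
      rw [e.left_inv hvs] at this
      exact congrArg (tan v.1) this
    refine ⟨p, fun t => tan (F₁ (p t)) (liftCoord π e (F₁ (p t))
      (Complex.exp (ζ t + Real.pi * Complex.I))),
      fun t => tan (F₂ (p t)) (liftCoord π e (F₂ (p t)) (Complex.exp (ζ t))), ?_,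
      fun t ht => (hpb ht).1, by simp [p], by simp [p], ?_, ?_⟩
    · refine ⟨hpc.continuousOn, ?_, ?_, fun _ _ => rfl, fun _ _ => rfl, fun t ht => ?_,
        fun t ht => ?_, fun t ht => ?_⟩
      · exact continuousOn_liftCoord hπ he (hF₁.comp hpc).continuousOn
          (by fun_prop) (fun t ht => (hsrc F₁ h₁ t ht).1) (fun t ht => (hsrc F₁ h₁ t ht).2)
      · exact continuousOn_liftCoord hπ he (hF₂.comp hpc).continuousOn
          (by fun_prop) (fun t ht => (hsrc F₂ h₂ t ht).1) (fun t ht => (hsrc F₂ h₂ t ht).2)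
      · exact det_ne_zero_iff_injective (hdet₁ _ (hpb ht).2).ne' (Complex.exp_ne_zero _)
      · exact det_ne_zero_iff_injective (hdet₂ _ (hpb ht).2).ne' (Complex.exp_ne_zero _)
      · rw [push_liftCoord hπ (hsrc F₁ h₁ t ht).2, push_liftCoord hπ (hsrc F₂ h₂ t ht).2, h₁, h₂,
          opp_tan, Complex.exp_add, Complex.exp_pi_mul_I, mul_neg_one, map_neg]
    · have : p 0 = b := by simp [p]
      simp only [this, ζ, Complex.ofReal_zero, zero_mul, add_zero]
      exact hend b w hb hw hw0
    · have : p 1 = b' := by simp [p]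
      simp only [this, ζ, Complex.ofReal_one, one_mul, add_sub_cancel]
      exact hend b' w' hbO hw' hw0'

/-- Over a simply connected region, the classes of pairs of lifts depend on their ends only. -/
theorem exists_pair_potential [OrientedAtlas S] [OrientedAtlas C] [PreconnectedSpace S] :
    ∃ κ : ℂ → Tan C → ExtChain S, ∀ (p : ℝ → ℂ) (g₁ g₂ : ℝ → Tan S) (a b : ℝ),
      LiftPair π F₁ F₂ p g₁ g₂ (uIcc a b) → cls (dirArc g₂ a b) - cls (dirArc g₁ a b) =
        κ (p b) (push π (g₂ b)) - κ (p a) (push π (g₂ a)) := by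
  choose O κ hO hmem hE hC using exists_local_potential hπ hF hbr hF₁ hF₂ h₁ h₂
  have hcmp : ∀ i j, ∀ b ∈ O i ∩ O j, ∀ᶠ b' in 𝓝 b, ∀ w w' : Tan C, w.1 = F b → w'.1 = F b' →
      vec w ≠ 0 → vec w' ≠ 0 → κ j b' w' - κ i b' w' = κ j b w - κ i b w := by
    intro i j b hb
    filter_upwards [hC i b hb.1 _ (((hO i).inter (hO j)).mem_nhds hb)] with b' hb' w w' hw hw' hv hv'
    obtain ⟨p, g₁, g₂, hp, hpO, rfl, rfl, rfl, rfl⟩ := hb' w w' hw hw' hv hv'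
    have e1 := hE i p g₁ g₂ 0 1 hp fun t ht => (hpO ht).1
    have e2 := hE j p g₁ g₂ 0 1 hp fun t ht => (hpO ht).2
    rw [e1] at e2
    have := sub_eq_zero.2 e2
    rw [← sub_eq_zero, ← neg_eq_zero, ← this]
    abel
  let w₀ : ℂ → Tan C := fun b => tan (F b) 1
  have hw₀ : ∀ b, vec (w₀ b) ≠ 0 := fun b => one_ne_zero
  obtain ⟨k, hk⟩ := exists_glue O hO hmem (fun i b => κ i b (w₀ b)) fun i j b hb => by
    filter_upwards [hcmp i j b hb] with b' hb'
    exact hb' _ _ rfl rfl (hw₀ _) (hw₀ _)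
  refine ⟨fun b w => k b + (κ b b w - κ b b (w₀ b)), fun p g₁ g₂ a b hg => ?_⟩
  have hK : ∀ i b w, b ∈ O i → w.1 = F b → vec w ≠ 0 →
      k b + (κ b b w - κ b b (w₀ b)) = κ i b w + (k b - κ i b (w₀ b)) := by
    intro i b w hb hw hv
    have := (hcmp i b b ⟨hb, hmem b⟩).self_of_nhds _ _ rfl hw (hw₀ b) hv
    have e : κ b b w = (κ b b w - κ i b w) + κ i b w := by abel
    rw [e, this]
    abel
  refine eq_sub_of_local (I := fun x y => cls (dirArc g₂ x y) - cls (dirArc g₁ x y))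
    (f := fun t => k (p t) + (κ (p t) (p t) (push π (g₂ t)) - κ (p t) (p t) (w₀ (p t)))) hg.add
    fun t ht => ?_
  set i := p t with hi
  have hev : ∀ᶠ r in 𝓝 t, r ∈ uIcc a b → p r ∈ O i ∧
      k (p r) - κ i (p r) (w₀ (p r)) = k i - κ i i (w₀ i) := by
    refine eventually_nhdsWithin_iff.1 ?_
    exact (hg.cont t ht).eventually
      (Filter.Eventually.and ((hO i).mem_nhds (hmem i)) (hk i i (hmem i)))
  refine ⟨_, hev, fun x hx y hy hxy => ?_⟩
  have hsub : uIcc x y ⊆ uIcc a b := ordConnected_uIcc.uIcc_subset hx.2 hy.2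
  have e := hE i p g₁ g₂ x y (hg.mono hsub) fun r hr => (hxy hr (hsub hr)).1
  have hpush : ∀ r ∈ uIcc a b, (push π (g₂ r)).1 = F (p r) ∧ vec (push π (g₂ r)) ≠ 0 := by
    intro r hr
    have hF' : π (g₂ r).1 = F (p r) := by rw [hg.base₂ r hr, h₂]
    exact ⟨hF', hπ.der_ne_zero (by rw [hF']; exact hbr _) (hg.ne_zero₂ r hr)⟩
  obtain ⟨hx1, hx2⟩ := hx.1 hx.2
  obtain ⟨hy1, hy2⟩ := hy.1 hy.2
  rw [hK i (p x) _ hx1 (hpush x hx.2).1 (hpush x hx.2).2,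
    hK i (p y) _ hy1 (hpush y hy.2).1 (hpush y hy.2).2, hx2, hy2, e]
  abel

end Pairs

/-- The streets between two joints of a horse. -/
inductive HorseStreet.Joins : HorseStreet → HorseJoint → HorseJoint → Prop
  | a2 : Joins .a2 .bot .right
  | b2 : Joins .b2 .bot .left
  | c : Joins .c .bot .top
  | a2' : Joins .a2' .left .top
  | b2' : Joins .b2' .right .top

theorem HorseStreet.Joins.R_eq {q q' : HorseJoint} (h : p.Joins q q') :
    p.R = Icc 0 1 := by
  cases h <;> rfl

theorem exists_disk_potential (hπ : IsSimpleBranchedCover π K) (hφ : φ ∈ orientedCharts C)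
    (hd : φ.target = univ) (hU : Disjoint φ.source (branchPoints π)) {σ : ℂ → S}
    (hσ : Continuous σ) (hs : ∀ y, π (σ y) = φ.symm y) :
    ∃ k : ℂ → ℂ → ExtChain S, ∀ (g : ℝ → Tan S) (a b : ℝ), ContinuousOn g (uIcc a b) →
      (∀ t ∈ uIcc a b, π (g t).1 ∈ φ.source ∧ σ (φ (π (g t).1)) = (g t).1 ∧
        cvec φ π (g t) ∈ Complex.slitPlane) →
      cls (dirArc g a b) =
        k (φ (π (g b).1)) (cvec φ π (g b)) - k (φ (π (g a).1)) (cvec φ π (g a)) := by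
  have hsrc : ∀ y, π (σ y) ∈ φ.source := fun y => hs y ▸ φ.map_target (hd ▸ mem_univ y)
  have hbr : ∀ y, π (σ y) ∉ branchPoints π := fun y hb => hU.ne_of_mem (hsrc y) hb rfl
  have hst : StarConvex ℝ ((0, 1) : ℂ × ℂ) (univ ×ˢ Complex.slitPlane) :=
    (starConvex_univ (0 : ℂ)).prod Complex.starConvex_one_slitPlane
  obtain ⟨k, hk⟩ := exists_potential hst
    (D := fun w : ℂ × ℂ => tan (σ w.1) (liftCoord π φ (σ w.1) w.2))
    (continuousOn_liftCoord hπ hφ (hσ.comp continuous_fst).continuousOn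
      continuous_snd.continuousOn (fun _ _ => hsrc _) fun _ _ => hbr _)
    fun w hw => det_ne_zero_iff_injective (liftCoord_det_pos hπ hφ (hsrc _) (hbr _)).ne'
      (Complex.slitPlane_ne_zero hw.2)
  refine ⟨fun y u => k (y, u), fun g a b hg h => ?_⟩
  have hb : ∀ t ∈ uIcc a b, π (g t).1 ∉ branchPoints π := fun t ht hb =>
    hU.ne_of_mem (h t ht).1 hb rfl
  have h1 : ContinuousOn (fun t => φ (π (g t).1)) (uIcc a b) := by
    refine φ.continuousOn.comp (t := φ.source) ?_ fun t ht => (h t ht).1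
    exact hπ.proper.continuous.comp_continuousOn
      ((FiberBundle.continuous_proj ℂ _).comp_continuousOn hg)
  have h2 := continuousOn_cvec hπ hφ hg (fun t ht => (h t ht).1) hb
  rw [← hk (fun t => (φ (π (g t).1), cvec φ π (g t))) a b (h1.prodMk h2)
    fun t ht => ⟨mem_univ _, (h t ht).2.2⟩]
  refine congrArg cls (dirArc_congr fun t ht => ?_)
  simp only [(h t ht).2.1]
  exact (liftCoord_cvec hπ hφ (h t ht).1 (hb t ht)).symm

variable (N φ J) in
/-- The three sheets over the disk of a horse, with potentials for the classes of curves of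
tangent vectors on them whose directions avoid one ray. -/
structure HorseSheets where
  σ : Fin 3 → ℂ → S
  continuous : ∀ i, Continuous (σ i)
  base : ∀ i y, π (σ i y) = φ.symm y
  joint : ∀ q i, σ i (HorseJoint.pos q) = N.sheet (J q) i
  k : Fin 3 → ℂ → ℂ → ExtChain S
  k_spec : ∀ (i : Fin 3) (g : ℝ → Tan S) (a b : ℝ), ContinuousOn g (uIcc a b) →
      (∀ t ∈ uIcc a b, π (g t).1 ∈ φ.source ∧ σ i (φ (π (g t).1)) = (g t).1 ∧
        cvec φ π (g t) ∈ Complex.slitPlane) →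
      cls (dirArc g a b) =
        k i (φ (π (g b).1)) (cvec φ π (g b)) - k i (φ (π (g a).1)) (cvec φ π (g a))

theorem listT_eq_sub {L : List St} (hL : L.IsChain N.Continues) {V : St → ℝ → ExtChain S}
    (hT : ∀ s ∈ L, N.T s = V s 1 - V s 0)
    (hV : ∀ s ∈ L, ∀ s' ∈ L, N.Continues s s' → V s 1 = V s' 0) {x y : St}
    (hx : L.head? = some x) (hy : L.getLast? = some y) : N.listT L = V y 1 - V x 0 := by
  induction L generalizing x with
  | nil => simp at hx
  | cons s L ih =>
    simp only [List.head?_cons, Option.some.injEq] at hx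
    subst hx
    cases L with
    | nil =>
      simp only [List.getLast?_singleton, Option.some.injEq] at hy
      subst hy
      simpa [listT] using hT s (by simp)
    | cons s' L =>
      rw [List.isChain_cons_cons] at hL
      rw [List.getLast?_cons_cons] at hy
      have := ih hL.2 (fun r hr => hT r (List.mem_cons_of_mem _ hr))
        (fun r hr r' hr' => hV r (List.mem_cons_of_mem _ hr) r' (List.mem_cons_of_mem _ hr'))
        rfl hy
      have e : N.listT (s :: s' :: L) = N.T s + N.listT (s' :: L) := by simp [listT]
      rw [e, this, hT s (by simp), hV s (by simp) s' (by simp) hL.1]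
      abel

namespace IsHorse

variable (h : IsHorse N φ J L)

include h

theorem leg_start {q q' : HorseJoint} (hp : p.Joins q q') :
    N.leg (J q) p.i p.j = (L p).head? := by
  cases hp
  exacts [h.bot_a.1, h.bot_b.1, h.bot_c, h.left_a.1, h.right_b.1]

theorem leg_finish {q q' : HorseJoint} (hp : p.Joins q q') :
    N.leg (J q') p.j p.i = (L p).getLast?.map N.rev := by
  cases hp
  exacts [h.right_a.2, h.left_b.2, h.top_c, h.top_a.2, h.top_b.2]

theorem joint_coord (q : HorseJoint) (i : Fin 3) : φ (π (N.sheet (J q) i)) = q.pos := by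
  rw [N.sheet_base]
  exact h.joint_pos q

theorem source_unbranched {z : C} (hz : z ∈ φ.source) : z ∉ branchPoints π :=
  fun hb => h.unbranched.ne_of_mem hz hb rfl

variable [T2Space S] [T2Space C] (hπ : IsSimpleBranchedCover π K)

include hπ

/-- Curves over a street inside a horse lie on one sheet. -/
theorem lift_along (hp : p.R = Icc 0 1) {σ : ℂ → S} (hσ : Continuous σ)
    (hs : ∀ y, π (σ y) = φ.symm y) {c : St → ℝ → S} (hc : ∀ s, Continuous (c s))
    (hb : ∀ s, ∀ t ∈ 𝕀, π (c s t) = π ((N.street s).src t))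
    (hcc : ∀ s s', N.Continues s s' → c s 1 = c s' 0) {x : St} (hx : (L p).head? = some x)
    (h0 : σ (φ (π (c x 0))) = c x 0) :
    ∀ s ∈ L p, ∀ t ∈ 𝕀, σ (φ (π (c s t))) = c s t := by
  have key : ∀ s ∈ L p, σ (φ (π (c s 0))) = c s 0 →
      ∀ t ∈ 𝕀, σ (φ (π (c s t))) = c s t := by
    intro s hs' h0
    have hsrc : ∀ t ∈ 𝕀, π (c s t) ∈ φ.source := fun t ht => by
      rw [hb s t ht]
      exact h.src_mem hπ hp hs' t ht
    have hcont : ContinuousOn (fun t => φ (π (c s t))) (Icc 0 1) :=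
      φ.continuousOn.comp (hπ.proper.continuous.comp (hc s)).continuousOn hsrc
    have hπσ : ∀ t ∈ 𝕀, π (σ (φ (π (c s t)))) = π (c s t) := fun t ht => by
      rw [hs, φ.left_inv (hsrc t ht)]
    exact hπ.lift_unique isPreconnected_Icc (hσ.comp_continuousOn hcont) (hc s).continuousOn
      hπσ (fun t ht => by rw [hπσ t ht]; exact h.source_unbranched (hsrc t ht)) zero_mem_I h0
  have main : ∀ M : List St, (∀ s ∈ M, s ∈ L p) → M.IsChain N.Continues → ∀ x,
      M.head? = some x → σ (φ (π (c x 0))) = c x 0 →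
      ∀ s ∈ M, ∀ t ∈ 𝕀, σ (φ (π (c s t))) = c s t := by
    intro M
    induction M with
    | nil => simp
    | cons s M ih =>
      intro hM hch x hx h0 r hr
      simp only [List.head?_cons, Option.some.injEq] at hx
      subst hx
      have h1 := key s (hM s (by simp)) h0
      rcases List.mem_cons.1 hr with rfl | hr
      · exact h1
      cases M with
      | nil => simp at hr
      | cons s' M =>
        rw [List.isChain_cons_cons] at hch
        refine ih (fun a ha => hM a (List.mem_cons_of_mem _ ha)) hch.2 s' rfl ?_ r hr
        rw [← hcc s s' hch.1]
        exact h1 1 one_mem_I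
  exact main _ (fun _ hs => hs) (h.chain p) x hx h0

theorem lift_src {q q' : HorseJoint} (hp : p.Joins q q') {σ : ℂ → S}
    (hσ : Continuous σ) (hs : ∀ y, π (σ y) = φ.symm y) (h0 : σ q.pos = N.sheet (J q) p.i) :
    (∀ s ∈ L p, ∀ t ∈ 𝕀,
      σ (φ (π ((N.street s).src t))) = (N.street s).src t) ∧ σ q'.pos = N.sheet (J q') p.i := by
  obtain ⟨x, hx⟩ := h.exists_head p
  obtain ⟨y, hy⟩ := h.exists_last p
  have hl := h.leg_start hp
  have hl' := h.leg_finish hp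
  rw [hx] at hl
  rw [hy, Option.map_some] at hl'
  have H := h.lift_along hπ hp.R_eq hσ hs (c := fun s => (N.street s).src)
    (fun s => (N.street s).src_smooth.continuous) (fun _ _ _ => rfl)
    (fun s s' hc => congrArg (fun w : Tan S => w.1) hc.velocity_src) hx
    (by rw [src_zero hl, h.joint_coord, h0])
  refine ⟨H, ?_⟩
  have := H y (List.mem_of_getLast? hy) 1 one_mem_I
  have e : (N.street y).src 1 = N.sheet (J q') p.i := by
    have := tgt_zero hl'
    rwa [tgt_rev, sub_zero] at this
  simpa only [e, h.joint_coord] using this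

theorem lift_tgt {q q' : HorseJoint} (hp : p.Joins q q') {σ : ℂ → S}
    (hσ : Continuous σ) (hs : ∀ y, π (σ y) = φ.symm y) (h0 : σ q.pos = N.sheet (J q) p.j) :
    (∀ s ∈ L p, ∀ t ∈ 𝕀,
      σ (φ (π ((N.street s).src t))) = (N.street s).tgt t) ∧ σ q'.pos = N.sheet (J q') p.j := by
  obtain ⟨x, hx⟩ := h.exists_head p
  obtain ⟨y, hy⟩ := h.exists_last p
  have hl := h.leg_start hp
  have hl' := h.leg_finish hp
  rw [hx] at hl
  rw [hy, Option.map_some] at hl'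
  have H := h.lift_along hπ hp.R_eq hσ hs (c := fun s => (N.street s).tgt)
    (fun s => (N.street s).tgt_smooth.continuous)
    (fun s t ht => ((N.street s).same_base t ht).symm)
    (fun s s' hc => congrArg (fun w : Tan S => w.1) hc.velocity_tgt) hx
    (by rw [tgt_zero hl, h.joint_coord, h0])
  refine ⟨fun s hs t ht => by rw [(N.street s).same_base t ht]; exact H s hs t ht, ?_⟩
  have := H y (List.mem_of_getLast? hy) 1 one_mem_I
  have e : (N.street y).tgt 1 = N.sheet (J q') p.j := by
    have := src_zero hl'
    rwa [N.src_rev, sub_zero] at this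
  simpa only [e, h.joint_coord] using this

theorem nonempty_sheets : Nonempty (HorseSheets N φ J) := by
  have hbr : ∀ y, φ.symm y ∉ branchPoints π := fun y =>
    h.source_unbranched (φ.map_target (h.disk ▸ mem_univ y))
  have hF : Continuous φ.symm := by
    rw [← continuousOn_univ, ← h.disk]
    exact φ.symm.continuousOn
  have hex : ∀ q i, ∃ G : ℂ → S, Continuous G ∧ (∀ w, π (G w) = φ.symm w) ∧
      G (HorseJoint.pos q) = N.sheet (J q) i := fun q i => by
    refine hπ.exists_lift hF hbr ?_
    rw [N.sheet_base, ← h.joint_pos q, φ.left_inv (h.joint_mem q)]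
    rfl
  have huniq : ∀ G G' : ℂ → S, Continuous G → Continuous G' → (∀ w, π (G w) = φ.symm w) →
      (∀ w, π (G' w) = φ.symm w) → ∀ y, G y = G' y → G = G' := by
    intro G G' hG hG' hs hs' y hy
    refine funext fun w => hπ.lift_unique isPreconnected_univ hG.continuousOn hG'.continuousOn
      (fun w _ => (hs w).trans (hs' w).symm) (fun w _ => ?_) (mem_univ y) hy w (mem_univ w)
    rw [hs]
    exact hbr w
  choose σ hσ hs h0 using hex .bot
  choose k hk using fun i =>
    exists_disk_potential hπ h.chart h.disk h.unbranched (hσ i) (hs i)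
  have r0 := (h.lift_src hπ .a2 (hσ 0) (hs 0) (h0 0)).2
  have r1 := (h.lift_tgt hπ .a2 (hσ 1) (hs 1) (h0 1)).2
  have l1 := (h.lift_src hπ .b2 (hσ 1) (hs 1) (h0 1)).2
  have l2 := (h.lift_tgt hπ .b2 (hσ 2) (hs 2) (h0 2)).2
  have t0 := (h.lift_src hπ .c (hσ 0) (hs 0) (h0 0)).2
  have t2 := (h.lift_tgt hπ .c (hσ 2) (hs 2) (h0 2)).2
  have t1 := (h.lift_tgt hπ .a2' (hσ 1) (hs 1) l1).2
  have r2 : σ 2 (HorseJoint.pos .right) = N.sheet (J .right) 2 := by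
    obtain ⟨G, hG, hGs, hG0⟩ := hex .right 2
    have := (h.lift_tgt hπ .b2' hG hGs hG0).2
    rw [huniq _ _ (hσ 2) hG (hs 2) hGs _ (t2.trans this.symm), hG0]
  have l0 : σ 0 (HorseJoint.pos .left) = N.sheet (J .left) 0 := by
    obtain ⟨G, hG, hGs, hG0⟩ := hex .left 0
    have := (h.lift_src hπ .a2' hG hGs hG0).2
    rw [huniq _ _ (hσ 0) hG (hs 0) hGs _ (t0.trans this.symm), hG0]
  refine ⟨⟨σ, hσ, hs, fun q i => ?_, k, hk⟩⟩
  cases q <;> fin_cases i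
  exacts [h0 0, h0 1, h0 2, r0, r1, r2, l0, l1, l2, t0, t1, t2]

end IsHorse

namespace HorseSheets

variable (Y : HorseSheets N φ J)

/-- The potential at a joint of the pair of lifts of a leg of type `ij`. -/
def E (q : HorseJoint) (i j : Fin 3) : ExtChain S :=
  Y.k j q.pos (N.dirCoord φ (J q) i j) - Y.k i q.pos (N.dirCoord φ (J q) j i)

variable (h : IsHorse N φ J L) (hπ : IsSimpleBranchedCover π K)

include h hπ

theorem cls_dirArc_sheet {i : Fin 3} {g : ℝ → Tan S} {a b : ℝ} (hg : ContinuousOn g (uIcc a b))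
    {p u : ℝ → ℂ} (hp : ∀ t ∈ uIcc a b, (g t).1 = Y.σ i (p t))
    (hu : ∀ t ∈ uIcc a b, cvec φ π (g t) = u t) (hs : ∀ t ∈ uIcc a b, u t ∈ Complex.slitPlane) :
    cls (dirArc g a b) = Y.k i (p b) (u b) - Y.k i (p a) (u a) := by
  have hsrc : ∀ t ∈ uIcc a b, π (g t).1 = φ.symm (p t) := fun t ht => by
    rw [hp t ht, Y.base]
  have hφ : ∀ t ∈ uIcc a b, φ (π (g t).1) = p t := fun t ht => by
    rw [hsrc t ht, φ.right_inv (h.disk ▸ mem_univ _)]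
  rw [Y.k_spec i g a b hg fun t ht => ⟨?_, ?_, ?_⟩, hφ _ left_mem_uIcc, hφ _ right_mem_uIcc,
    hu _ left_mem_uIcc, hu _ right_mem_uIcc]
  · rw [hsrc t ht]
    exact φ.map_target (h.disk ▸ mem_univ _)
  · rw [hφ t ht, hp t ht]
  · rw [hu t ht]
    exact hs t ht

theorem cls_turnArc (q : HorseJoint) (i : Fin 3) {v w : ℂ}
    (hs : ∀ r ∈ 𝕀,
      (1 - r) * der φ (N.pt (J q)) v + r * der φ (N.pt (J q)) w ∈ Complex.slitPlane) :
    cls (turnArc (N.sheet (J q) i) (liftVec π (N.sheet (J q) i) v)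
      (liftVec π (N.sheet (J q) i) w)) =
      Y.k i q.pos (der φ (N.pt (J q)) w) - Y.k i q.pos (der φ (N.pt (J q)) v) := by
  have hx := N.sheet_unbranched (J q) i
  have hlin : ∀ r : ℝ, cvec φ π (tan (N.sheet (J q) i) ((1 - r) * liftVec π (N.sheet (J q) i) v +
      r * liftVec π (N.sheet (J q) i) w)) =
      (1 - r) * der φ (N.pt (J q)) v + r * der φ (N.pt (J q)) w := by
    intro r
    have e1 : ∀ (c : ℝ) (z : ℂ), (c : ℂ) * z = c • z := fun c z => (Complex.real_smul).symm
    have e2 : (1 : ℂ) - r = ((1 - r : ℝ) : ℂ) := by push_cast; rfl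
    rw [e2, e1, e1, e1, e1, ← liftVec_smul, ← liftVec_smul, ← liftVec_add,
      cvec_liftVec hπ hx, N.sheet_base, map_add, map_smul, map_smul]
    rfl
  have h01 : ∀ r ∈ uIcc (0 : ℝ) 1, r ∈ 𝕀 := fun _ => mem_uIcc_zero_one.1
  have := Y.cls_dirArc_sheet h hπ (i := i) (a := 0) (b := 1)
    (g := fun r : ℝ => tan (N.sheet (J q) i) ((1 - r) * liftVec π (N.sheet (J q) i) v +
      r * liftVec π (N.sheet (J q) i) w)) (continuous_turn _ _ _).continuousOn
    (p := fun _ => q.pos)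
    (u := fun r => (1 - r) * der φ (N.pt (J q)) v + r * der φ (N.pt (J q)) w)
    (fun r _ => (Y.joint q i).symm) (fun r _ => hlin r) fun r hr => hs r (h01 r hr)
  rw [turnArc, this]
  simp

end HorseSheets

theorem convex_comb_pos {r x y : ℝ} (hr : r ∈ 𝕀) (hx : 0 < x) (hy : 0 < y) :
    0 < (1 - r) * x + r * y :=
  convex_Ioi (0 : ℝ) hx hy (sub_nonneg.2 hr.2) hr.1 (by ring)

namespace HorseSheets

variable (Y : HorseSheets N φ J) (h : IsHorse N φ J L) (hπ : IsSimpleBranchedCover π K)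

include h hπ

theorem turn_bot : N.turn (J .bot) 0 1 2 = Y.E .bot 0 2 - Y.E .bot 0 1 - Y.E .bot 1 2 := by
  obtain ⟨x, hx, ex⟩ := h.dirCoord_a hπ .bot
  obtain ⟨y, hy, ey⟩ := h.dirCoord_b hπ .bot
  obtain ⟨w, hw, ew⟩ := h.dirCoord_c_bot hπ
  have hd : ∀ i j, der φ (N.pt (J .bot)) (N.dir (J .bot) i j) = N.dirCoord φ (J .bot) i j :=
    fun _ _ => rfl
  rw [turn, ← N.dir_swap _ 0 2, ← N.dir_swap _ 0 1, ← N.dir_swap _ 1 2,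
    Y.cls_turnArc h hπ _ _ fun r hr => ?_, Y.cls_turnArc h hπ _ _ fun r hr => ?_,
    Y.cls_turnArc h hπ _ _ fun r hr => ?_]
  · simp only [hd, E]
    abel
  · rw [hd, hd, ey, ew, Complex.mem_slitPlane_iff]
    right
    simp
    linarith [convex_comb_pos hr hy (mul_pos hw two_pos)]
  · rw [hd, hd, ex, dirCoord_swap, ey, Complex.mem_slitPlane_iff]
    left
    simp
    linarith [convex_comb_pos hr hx hy]
  · rw [hd, hd, dirCoord_swap, ew, dirCoord_swap, ex, Complex.mem_slitPlane_iff]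
    right
    simp
    linarith [convex_comb_pos hr (mul_pos hw two_pos) hx]

theorem turn_top : N.turn (J .top) 0 2 1 = Y.E .top 0 1 + Y.E .top 1 2 - Y.E .top 0 2 := by
  obtain ⟨x, hx, ex⟩ := h.dirCoord_a hπ .top
  obtain ⟨y, hy, ey⟩ := h.dirCoord_b hπ .top
  obtain ⟨w, hw, ew⟩ := h.dirCoord_c_top hπ
  have hd : ∀ i j, der φ (N.pt (J .top)) (N.dir (J .top) i j) = N.dirCoord φ (J .top) i j :=
    fun _ _ => rfl
  rw [turn, ← N.dir_swap _ 0 1, ← N.dir_swap _ 0 2, ← N.dir_swap _ 2 1,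
    Y.cls_turnArc h hπ _ _ fun r hr => ?_, Y.cls_turnArc h hπ _ _ fun r hr => ?_,
    Y.cls_turnArc h hπ _ _ fun r hr => ?_]
  · simp only [hd, E]
    abel
  · rw [hd, hd, dirCoord_swap, ey, ex, Complex.mem_slitPlane_iff]
    left
    simp
    linarith [convex_comb_pos hr hy hx]
  · rw [hd, hd, ew, ey, Complex.mem_slitPlane_iff]
    right
    simp
    linarith [convex_comb_pos hr (mul_pos hw two_pos) hy]
  · rw [hd, hd, dirCoord_swap, ex, dirCoord_swap, ew, Complex.mem_slitPlane_iff]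
    right
    simp
    linarith [convex_comb_pos hr hx (mul_pos hw two_pos)]

variable [T2Space S] [T2Space C]

theorem src_eq {q q' : HorseJoint} (hp : p.Joins q q') : ∀ s ∈ L p,
    ∀ t ∈ 𝕀, (N.street s).src t = Y.σ p.i (φ (π ((N.street s).src t))) :=
  fun s hs t ht =>
    ((h.lift_src hπ hp (Y.continuous _) (Y.base _) (Y.joint _ _)).1 s hs t ht).symm

theorem tgt_eq {q q' : HorseJoint} (hp : p.Joins q q') : ∀ s ∈ L p,
    ∀ t ∈ 𝕀, (N.street s).tgt t = Y.σ p.j (φ (π ((N.street s).src t))) :=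
  fun s hs t ht =>
    ((h.lift_tgt hπ hp (Y.continuous _) (Y.base _) (Y.joint _ _)).1 s hs t ht).symm

theorem cvec_mem_slitPlane (hs : s ∈ L p) {t : ℝ}
    (ht : t ∈ 𝕀) (hU : π ((N.street s).src t) ∈ φ.source) :
    cvec φ π (velocity (N.street s).tgt t) ∈ Complex.slitPlane ∧
      cvec φ π (opp (velocity (N.street s).src t)) ∈ Complex.slitPlane := by
  obtain ⟨c, hc, e⟩ := h.exists_cvec hπ (Or.inl hs) ht hU
  have := (mul_ne_zero hc p.d_im_pos.ne')
  rw [cvec_opp, Street.cvec_tgt hπ h.chart _ ht hU, e]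
  constructor <;> rw [Complex.mem_slitPlane_iff] <;> right <;> simpa using this

theorem listT_joins {q q' : HorseJoint} (hp : p.Joins q q') :
    N.listT (L p) = Y.E q' p.i p.j - Y.E q p.i p.j := by
  obtain ⟨x, hx⟩ := h.exists_head p
  obtain ⟨y, hy⟩ := h.exists_last p
  have hl := h.leg_start hp
  have hl' := h.leg_finish hp
  rw [hx] at hl
  rw [hy, Option.map_some] at hl'
  let V : St → ℝ → ExtChain S := fun s t =>
    Y.k p.j (φ (π ((N.street s).tgt t))) (cvec φ π (velocity (N.street s).tgt t)) -
      Y.k p.i (φ (π ((N.street s).src t))) (cvec φ π (opp (velocity (N.street s).src t)))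
  have hT : ∀ s ∈ L p, N.T s = V s 1 - V s 0 := by
    intro s hs
    have h01 : ∀ r ∈ uIcc (0 : ℝ) 1, r ∈ 𝕀 := fun _ => mem_uIcc_zero_one.1
    have hU := h.src_mem hπ hp.R_eq hs
    have e1 := Y.k_spec p.j (velocity (N.street s).tgt) 0 1
      (N.street s).continuous_velocity_tgt.continuousOn fun t ht => ⟨?_, ?_,
        (cvec_mem_slitPlane h hπ hs (h01 t ht) (hU t (h01 t ht))).1⟩
    · have e2 := Y.k_spec p.i (fun t => opp (velocity (N.street s).src t)) 0 1
        (N.street s).continuous_opp_velocity_src.continuousOn fun t ht => ⟨hU t (h01 t ht),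
          (Y.src_eq h hπ hp s hs t (h01 t ht)).symm,
          (cvec_mem_slitPlane h hπ hs (h01 t ht) (hU t (h01 t ht))).2⟩
      rw [T, Street.transport, e1, e2]
      simp only [V, opp_fst]
      simp only [velocity_fst]
      abel
    · simp only [velocity_fst]
      rw [← (N.street s).same_base t (h01 t ht)]
      exact hU t (h01 t ht)
    · simp only [velocity_fst]
      rw [← (N.street s).same_base t (h01 t ht)]
      exact (Y.tgt_eq h hπ hp s hs t (h01 t ht)).symm
  rw [listT_eq_sub (h.chain p) hT (fun s _ s' _ hc => ?_) hx hy]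
  · have e0 : V x 0 = Y.E q p.i p.j := by
      simp only [V, E]
      rw [N.leg_tgt _ _ _ _ hl, N.leg_src _ _ _ _ hl, opp_tan, ← liftVec_neg, ← N.dir_swap,
        src_zero hl, tgt_zero hl, h.joint_coord, h.joint_coord,
        cvec_liftVec hπ (N.sheet_unbranched _ _), cvec_liftVec hπ (N.sheet_unbranched _ _),
        N.sheet_base _ p.i, N.sheet_base _ p.j]
      rfl
    have e1 : V y 1 = Y.E q' p.i p.j := by
      have a1 := N.velocity_src_rev y 0
      have a2 := N.velocity_tgt_rev y 0
      rw [N.leg_src _ _ _ _ hl', sub_zero] at a1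
      rw [N.leg_tgt _ _ _ _ hl', sub_zero] at a2
      have b1 : velocity (N.street y).tgt 1 = tan (N.sheet (J q') p.j)
          (liftVec π (N.sheet (J q') p.j) (N.dir (J q') p.i p.j)) := by
        rw [← opp_opp (velocity (N.street y).tgt 1), ← a1, opp_tan, ← liftVec_neg, ← N.dir_swap]
      have c1 : (N.street y).src 1 = N.sheet (J q') p.i :=
        congrArg (fun w : Tan S => w.1) a2.symm
      have c2 : (N.street y).tgt 1 = N.sheet (J q') p.j :=
        congrArg (fun w : Tan S => w.1) b1
      simp only [V, E]
      rw [b1, ← a2, c1, c2, h.joint_coord, h.joint_coord,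
        cvec_liftVec hπ (N.sheet_unbranched _ _), cvec_liftVec hπ (N.sheet_unbranched _ _),
        N.sheet_base _ p.i, N.sheet_base _ p.j]
      rfl
    rw [e0, e1]
  · have a1 := hc.velocity_tgt
    have a2 := hc.velocity_src
    have c1 := congrArg (fun w : Tan S => w.1) a1
    have c2 := congrArg (fun w : Tan S => w.1) a2
    simp only [velocity_fst] at c1 c2
    simp only [V, a1, a2, c1, c2]

end HorseSheets

theorem z_eq [T2Space S] [T2Space C] (hπ : IsSimpleBranchedCover π K) {m : ℕ} (H : Herd N m)
    (hl : l ∈ Icc 1 m) (Y : HorseSheets N (H.chart l) (H.joint l)) :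
    Herd.z N H l = Y.E .top 0 1 + Y.E .top 1 2 - Y.E .bot 0 1 - Y.E .bot 1 2 +
      (H.ch .a (l - 1) + H.ch .b (l - 1) + H.ch .a' (m - l) + H.ch .b' (m - l)) := by
  have h := H.horse l hl
  have e := Y.listT_joins h hπ .c
  simp only [HorseStreet.i, HorseStreet.j] at e
  rw [Herd.z, Y.turn_bot h hπ, Y.turn_top h hπ, e]
  abel

theorem exists_continuousOn_inverse {X Y : Type*} [TopologicalSpace X] [TopologicalSpace Y]
    [T2Space Y] [Nonempty X] {D : X → Y} {A : Set X} (hA : IsCompact A) (hD : ContinuousOn D A)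
    (hi : InjOn D A) : ∃ e : Y → X, ContinuousOn e (D '' A) ∧ (∀ z ∈ D '' A, e z ∈ A ∧ D (e z) = z) := by
  classical
  have := isCompact_iff_compactSpace.1 hA
  have hemb : Topology.IsClosedEmbedding (A.domRestrict D) :=
    (continuousOn_iff_continuous_domRestrict.1 hD).isClosedEmbedding (injOn_iff_injective.1 hi)
  have hex : ∀ z ∈ D '' A, ∃ w ∈ A, D w = z := fun z hz => hz
  choose! e he using hex
  refine ⟨e, ?_, he⟩
  rw [continuousOn_iff_continuous_domRestrict]
  have h1 : Continuous fun z : D '' A => (⟨e z, (he z z.2).1⟩ : A) := by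
    rw [hemb.isInducing.continuous_iff]
    refine continuous_subtype_val.congr fun z => ?_
    exact (he z z.2).2.symm
  exact continuous_subtype_val.comp h1

/-- A potential for the classes of pairs of lifts, to two sections over a region of the base, of
curves of tangent vectors. -/
def PairPotential (π : S → C) (B : Set C) (s₁ s₂ : C → S) (κ : Tan C → ExtChain S) : Prop :=
  ∀ (g₁ g₂ : ℝ → Tan S) (a b : ℝ), ContinuousOn g₁ (uIcc a b) → ContinuousOn g₂ (uIcc a b) →
    (∀ t ∈ uIcc a b, vec (g₁ t) ≠ 0 ∧ vec (g₂ t) ≠ 0 ∧ π (g₂ t).1 ∈ B ∧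
      push π (g₁ t) = opp (push π (g₂ t))) →
    (g₁ a).1 = s₁ (π (g₂ a).1) → (g₂ a).1 = s₂ (π (g₂ a).1) →
    (g₁ b).1 = s₁ (π (g₂ b).1) ∧ (g₂ b).1 = s₂ (π (g₂ b).1) ∧
      cls (dirArc g₂ a b) - cls (dirArc g₁ a b) = κ (push π (g₂ b)) - κ (push π (g₂ a))

theorem exists_pairPotential [OrientedAtlas S] [OrientedAtlas C] [PreconnectedSpace S] [T2Space S]
    [T2Space C] (hπ : IsSimpleBranchedCover π K) {D : ℂ → C}
    (hD : ContinuousOn D (Metric.closedBall 0 1)) (hi : InjOn D (Metric.closedBall 0 1))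
    (hb : MapsTo D (Metric.closedBall 0 1) (branchPoints π)ᶜ) {x₁ x₂ : S} (hx : π x₁ = π x₂)
    (hx₁ : π x₂ ∈ D '' Metric.closedBall 0 1) :
    ∃ s₁ s₂ κ, PairPotential π (D '' Metric.closedBall 0 1) s₁ s₂ κ ∧ s₁ (π x₂) = x₁ ∧
      s₂ (π x₂) = x₂ := by
  let ρ : ℂ → ℂ := fun w => (max 1 ‖w‖)⁻¹ • w
  have hpos : ∀ w : ℂ, 0 < max 1 ‖w‖ := fun w => lt_max_of_lt_left one_pos
  have hρc : Continuous ρ := by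
    refine Continuous.smul (Continuous.inv₀ (by fun_prop) fun w => (hpos w).ne') continuous_id
  have hρ : ∀ w, ρ w ∈ Metric.closedBall (0 : ℂ) 1 := by
    intro w
    rw [mem_closedBall_zero_iff, norm_smul, norm_inv, Real.norm_of_nonneg (hpos w).le,
      inv_mul_le_iff₀ (hpos w), mul_one]
    exact le_max_right _ _
  have hρ' : ∀ w ∈ Metric.closedBall (0 : ℂ) 1, ρ w = w := by
    intro w hw
    rw [mem_closedBall_zero_iff] at hw
    simp [ρ, max_eq_left hw]
  obtain ⟨e, hec, he⟩ := exists_continuousOn_inverse (isCompact_closedBall (0 : ℂ) 1) hD hi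
  set F : ℂ → C := fun w => D (ρ w) with hF
  have hFc : Continuous F := hD.comp_continuous hρc hρ
  have hbr : ∀ w, F w ∉ branchPoints π := fun w => hb (hρ w)
  have hFe : ∀ z ∈ D '' Metric.closedBall 0 1, F (e z) = z := fun z hz => by
    rw [hF]
    simp only [hρ' _ (he z hz).1, (he z hz).2]
  obtain ⟨F₁, hF₁, h₁, h₁'⟩ := hπ.exists_lift hFc hbr (w₀ := e (π x₂)) (x₀ := x₁)
    (by rw [hFe _ hx₁, hx])
  obtain ⟨F₂, hF₂, h₂, h₂'⟩ := hπ.exists_lift hFc hbr (w₀ := e (π x₂)) (x₀ := x₂)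
    (by rw [hFe _ hx₁])
  obtain ⟨κ, hκ⟩ := exists_pair_potential hπ hFc hbr hF₁ hF₂ h₁ h₂
  refine ⟨F₁ ∘ e, F₂ ∘ e, fun w => κ (e w.1) w, fun g₁ g₂ a b hg₁ hg₂ h ha₁ ha₂ => ?_, h₁', h₂'⟩
  have hproj : ∀ g : ℝ → Tan S, ContinuousOn g (uIcc a b) →
      ContinuousOn (fun t => (g t).1) (uIcc a b) := fun g hg =>
    (FiberBundle.continuous_proj ℂ _).comp_continuousOn hg
  have hπg : ContinuousOn (fun t => π (g₂ t).1) (uIcc a b) :=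
    hπ.proper.continuous.comp_continuousOn (hproj g₂ hg₂)
  have hpc : ContinuousOn (fun t => e (π (g₂ t).1)) (uIcc a b) :=
    hec.comp hπg fun t ht => (h t ht).2.2.1
  have h12 : ∀ t ∈ uIcc a b, π (g₁ t).1 = π (g₂ t).1 := fun t ht =>
    congrArg (fun w : Tan C => w.1) (h t ht).2.2.2
  have hbr' : ∀ t ∈ uIcc a b, π (g₂ t).1 ∉ branchPoints π := fun t ht =>
    hFe _ (h t ht).2.2.1 ▸ hbr _
  have hb₁ : ∀ t ∈ uIcc a b, (g₁ t).1 = F₁ (e (π (g₂ t).1)) :=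
    hπ.lift_unique isPreconnected_uIcc (hproj g₁ hg₁) (hF₁.comp_continuousOn hpc)
      (fun t ht => by rw [h₁, hFe _ (h t ht).2.2.1, h12 t ht])
      (fun t ht => by rw [h12 t ht]; exact hbr' t ht) left_mem_uIcc ha₁
  have hb₂ : ∀ t ∈ uIcc a b, (g₂ t).1 = F₂ (e (π (g₂ t).1)) :=
    hπ.lift_unique isPreconnected_uIcc (hproj g₂ hg₂) (hF₂.comp_continuousOn hpc)
      (fun t ht => by rw [h₂, hFe _ (h t ht).2.2.1]) hbr' left_mem_uIcc ha₂
  refine ⟨hb₁ b right_mem_uIcc, hb₂ b right_mem_uIcc, ?_⟩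
  exact hκ (fun t => e (π (g₂ t).1)) g₁ g₂ a b ⟨hpc, hg₁, hg₂, hb₁, hb₂, fun t ht => (h t ht).1,
    fun t ht => (h t ht).2.1, fun t ht => (h t ht).2.2.2⟩

section Moves

variable {B : Set C} {s₁ s₂ : C → S} {κ : Tan C → ExtChain S}

theorem push_liftVec (hπ : IsSimpleBranchedCover π K) {x : S} (hb : π x ∉ branchPoints π) (v : ℂ) :
    push π (tan x (liftVec π x v)) = tan (π x) v := by
  rw [push, tan_fst, vec_tan]
  exact congrArg (tan (π x)) (hπ.der_liftVec hb v)

theorem Street.push_src [OrientedAtlas C] (hπ : IsSimpleBranchedCover π K) (p : Street π) {t : ℝ}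
    (ht : t ∈ 𝕀) : push π (velocity p.src t) = push π (velocity p.tgt t) := by
  have he := chartAt_mem_orientedCharts (π (p.src t))
  have hU := mem_chart_source ℂ (π (p.src t))
  have h1 := p.cvec_tgt hπ he ht hU
  have hb := p.same_base t ht
  have key : ∀ v : ℂ, der (chartAt ℂ (π (p.src t))) (π (p.src t)) v = 0 → v = 0 := fun v hv =>
    by_contra fun h => det_ne_zero_iff_injective (det_der_pos he hU).ne' h hv
  have h2 : der π (p.tgt t) (vec (velocity p.tgt t)) = der π (p.src t) (vec (velocity p.src t)) := by
    refine sub_eq_zero.1 (key _ ?_)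
    rw [map_sub, sub_eq_zero]
    refine Eq.trans ?_ h1
    rw [hb]
    rfl
  rw [push, push, velocity_fst, velocity_fst, h2, hb]

variable (N s₁ s₂) in
/-- The sections `s₁`, `s₂` are the sheets `i`, `j` at the joint `v`. -/
def OnSheets (v : Jt) (i j : Fin 3) : Prop :=
  N.sheet v i = s₁ (N.pt v) ∧ N.sheet v j = s₂ (N.pt v)

namespace PairPotential

variable (hP : PairPotential π B s₁ s₂ κ) (hπ : IsSimpleBranchedCover π K)

include hP hπ

theorem street [OrientedAtlas C]
    (hB : ∀ t ∈ 𝕀, π ((N.street s).src t) ∈ B)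
    (h₁ : (N.street s).src 0 = s₁ (π ((N.street s).src 0)))
    (h₂ : (N.street s).tgt 0 = s₂ (π ((N.street s).src 0))) :
    (N.street s).src 1 = s₁ (π ((N.street s).src 1)) ∧
      (N.street s).tgt 1 = s₂ (π ((N.street s).src 1)) ∧
      N.T s = κ (push π (velocity (N.street s).tgt 1)) -
        κ (push π (velocity (N.street s).tgt 0)) := by
  set p := N.street s
  have h01 : ∀ r ∈ uIcc (0 : ℝ) 1, r ∈ 𝕀 := fun _ => mem_uIcc_zero_one.1
  have e0 := p.same_base 0 zero_mem_I
  have e1 := p.same_base 1 one_mem_I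
  have := hP (fun t => opp (velocity p.src t)) (velocity p.tgt) 0 1
    p.continuous_opp_velocity_src.continuousOn p.continuous_velocity_tgt.continuousOn
    (fun t ht => ⟨p.opp_src_regular t (h01 t ht), p.tgt_regular t (h01 t ht), ?_, ?_⟩) ?_ ?_
  · simp only [opp_fst, velocity_fst] at this
    rw [← e1] at this
    exact this
  · rw [velocity_fst, ← p.same_base t (h01 t ht)]
    exact hB t (h01 t ht)
  · rw [push_opp, p.push_src hπ (h01 t ht)]
  · simp only [opp_fst, velocity_fst]
    rw [← e0]
    exact h₁
  · simp only [velocity_fst]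
    rw [← e0]
    exact h₂

theorem list [OrientedAtlas C] {M : List St} (hM : M.IsChain N.Continues)
    (hB : ∀ s ∈ M, ∀ t ∈ 𝕀, π ((N.street s).src t) ∈ B) {x y : St}
    (hx : M.head? = some x) (hy : M.getLast? = some y)
    (h₁ : (N.street x).src 0 = s₁ (π ((N.street x).src 0)))
    (h₂ : (N.street x).tgt 0 = s₂ (π ((N.street x).src 0))) :
    (N.street y).src 1 = s₁ (π ((N.street y).src 1)) ∧
      (N.street y).tgt 1 = s₂ (π ((N.street y).src 1)) ∧
      N.listT M = κ (push π (velocity (N.street y).tgt 1)) -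
        κ (push π (velocity (N.street x).tgt 0)) := by
  induction M generalizing x with
  | nil => simp at hx
  | cons s M ih =>
    simp only [List.head?_cons, Option.some.injEq] at hx
    subst hx
    have h := hP.street hπ (hB s (by simp)) h₁ h₂
    cases M with
    | nil =>
      simp only [List.getLast?_singleton, Option.some.injEq] at hy
      subst hy
      simpa [listT] using h
    | cons s' M =>
      rw [List.isChain_cons_cons] at hM
      rw [List.getLast?_cons_cons] at hy
      have a1 := hM.1.velocity_tgt
      have c1 : (N.street s).tgt 1 = (N.street s').tgt 0 := congrArg (fun w : Tan S => w.1) a1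
      have c2 : (N.street s).src 1 = (N.street s').src 0 :=
        congrArg (fun w : Tan S => w.1) hM.1.velocity_src
      have := ih hM.2 (fun r hr => hB r (List.mem_cons_of_mem _ hr)) rfl hy
        (c2 ▸ h.1) (by rw [← c1, ← c2]; exact h.2.1)
      refine ⟨this.1, this.2.1, ?_⟩
      have e : N.listT (s :: s' :: M) = N.T s + N.listT (s' :: M) := by simp [listT]
      rw [e, this.2.2, h.2.2, a1]
      abel

theorem listT_joints [OrientedAtlas C] {M : List St} (hM : M.IsChain N.Continues)
    (hB : ∀ s ∈ M, ∀ t ∈ 𝕀, π ((N.street s).src t) ∈ B) {x y : St}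
    (hx : M.head? = some x) (hy : M.getLast? = some y) {v v' : Jt} {i j : Fin 3}
    (hv : N.leg v i j = some x) (hv' : N.leg v' j i = some (N.rev y))
    (h : OnSheets N s₁ s₂ v i j) : OnSheets N s₁ s₂ v' i j ∧
      N.listT M = κ (tan (N.pt v') (N.dir v' i j)) - κ (tan (N.pt v) (N.dir v i j)) := by
  have b0 := N.base_leg hv
  have H := hP.list hπ hM hB hx hy (by rw [b0, src_zero hv, h.1]) (by rw [b0, tgt_zero hv, h.2])
  have a0 := N.leg_tgt _ _ _ _ hv
  have c1 : (N.street y).src 1 = N.sheet v' i := by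
    have := tgt_zero hv'
    rwa [tgt_rev, sub_zero] at this
  have c2 : (N.street y).tgt 1 = N.sheet v' j := by
    have := src_zero hv'
    rwa [N.src_rev, sub_zero] at this
  have a1 : velocity (N.street y).tgt 1 =
      tan (N.sheet v' j) (liftVec π (N.sheet v' j) (N.dir v' i j)) := by
    have := N.velocity_src_rev y 0
    rw [N.leg_src _ _ _ _ hv', sub_zero] at this
    rw [← opp_opp (velocity (N.street y).tgt 1), ← this, opp_tan, ← liftVec_neg, ← N.dir_swap]
  have hb : π (N.sheet v' i) = N.pt v' := N.sheet_base v' i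
  rw [c1, hb, c2, a1, a0, push_liftVec hπ (N.sheet_unbranched _ _),
    push_liftVec hπ (N.sheet_unbranched _ _), N.sheet_base v' j, N.sheet_base v j] at H
  exact ⟨⟨H.1, H.2.1⟩, H.2.2⟩

theorem move (h : IsHorse N φ J L) (Y : HorseSheets N φ J) {q q' : HorseJoint} {i j : Fin 3}
    (hB : ∀ y ∈ segment ℝ q.pos q'.pos, φ.symm y ∈ B)
    (hu : ∀ t ∈ 𝕀,
      ((1 - t) * N.dirCoord φ (J q) i j + t * N.dirCoord φ (J q') i j : ℂ).im ≠ 0)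
    (ho : OnSheets N s₁ s₂ (J q) i j) : OnSheets N s₁ s₂ (J q') i j ∧
      Y.E q' i j - Y.E q i j =
        κ (tan (N.pt (J q')) (N.dir (J q') i j)) - κ (tan (N.pt (J q)) (N.dir (J q) i j)) := by
  have h01 : ∀ r ∈ uIcc (0 : ℝ) 1, r ∈ 𝕀 := fun _ => mem_uIcc_zero_one.1
  let p : ℝ → ℂ := fun t => (1 - t) * q.pos + t * q'.pos
  let u : ℝ → ℂ := fun t => (1 - t) * N.dirCoord φ (J q) i j + t * N.dirCoord φ (J q') i j
  have hsrc : ∀ k t, π (Y.σ k (p t)) ∈ φ.source := fun k t =>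
    Y.base k (p t) ▸ φ.map_target (h.disk ▸ mem_univ _)
  have hbr : ∀ k t, π (Y.σ k (p t)) ∉ branchPoints π := fun k t => h.source_unbranched (hsrc k t)
  have hpc : Continuous p := by fun_prop
  have huc : Continuous u := by fun_prop
  let g : Fin 3 → (ℝ → ℂ) → ℝ → Tan S := fun k w t =>
    tan (Y.σ k (p t)) (liftCoord π φ (Y.σ k (p t)) (w t))
  have hg : ∀ k w, Continuous w → ContinuousOn (g k w) (uIcc 0 1) := fun k w hw =>
    continuousOn_liftCoord hπ h.chart ((Y.continuous k).comp hpc).continuousOn hw.continuousOn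
      (fun t _ => hsrc k t) fun t _ => hbr k t
  have hcv : ∀ k w t, cvec φ π (g k w t) = w t := fun k w t =>
    cvec_liftCoord hπ h.chart (hsrc k t) (hbr k t) _
  have hne : ∀ k w t, w t ≠ 0 → vec (g k w t) ≠ 0 := fun k w t hw =>
    det_ne_zero_iff_injective (liftCoord_det_pos hπ h.chart (hsrc k t) (hbr k t)).ne' hw
  have hu0 : ∀ t ∈ uIcc (0 : ℝ) 1, (u t).im ≠ 0 := fun t ht => hu t (h01 t ht)
  have hu1 : ∀ t ∈ uIcc (0 : ℝ) 1, u t ≠ 0 := fun t ht e => hu0 t ht (by rw [e, Complex.zero_im])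
  have p0 : p 0 = q.pos := by simp [p]
  have p1 : p 1 = q'.pos := by simp [p]
  have hpt : ∀ t, π (Y.σ j (p t)) = φ.symm (p t) := fun t => Y.base j _
  have hq : ∀ r, φ.symm (HorseJoint.pos r) = N.pt (J r) := fun r => by
    rw [← h.joint_pos r, φ.left_inv (h.joint_mem r)]
  have hpush : ∀ k w t, push π (g k w t) = tan (φ.symm (p t)) (der φ.symm (p t) (w t)) := by
    intro k w t
    rw [push_liftCoord hπ (hbr k t), Y.base, φ.right_inv (h.disk ▸ mem_univ _)]
  have hend : ∀ r w t, p t = HorseJoint.pos r → w t = N.dirCoord φ (J r) i j →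
      push π (g j w t) = tan (N.pt (J r)) (N.dir (J r) i j) := by
    intro r w t hp hw
    rw [hpush, hp, hw, hq]
    have := congrArg (fun f : ℂ →L[ℝ] ℂ => f (N.dir (J r) i j))
      (der_comp_symm h.chart (y := HorseJoint.pos r) (h.disk ▸ mem_univ _)).2
    rw [hq] at this
    exact congrArg (tan (N.pt (J r))) this
  have H := hP (g i fun t => -u t) (g j u) 0 1 (hg _ _ huc.neg) (hg _ _ huc)
    (fun t ht => ⟨hne i (fun t => -u t) t (neg_ne_zero.2 (hu1 t ht)), hne _ _ _ (hu1 t ht), ?_, ?_⟩) ?_ ?_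
  · have e1 := Y.cls_dirArc_sheet h hπ (hg i (fun t => -u t) huc.neg) (p := p)
      (u := fun t => -u t) (fun t _ => rfl) (fun t _ => hcv i (fun t => -u t) t) fun t ht => by
        rw [Complex.mem_slitPlane_iff]
        exact Or.inr (by simpa using hu0 t ht)
    have e2 := Y.cls_dirArc_sheet h hπ (hg j u huc) (p := p) (u := u) (fun t _ => rfl)
      (fun t _ => hcv _ _ _) fun t ht => by
        rw [Complex.mem_slitPlane_iff]
        exact Or.inr (hu0 t ht)
    have u0 : u 0 = N.dirCoord φ (J q) i j := by simp [u]
    have u1 : u 1 = N.dirCoord φ (J q') i j := by simp [u]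
    rw [e1, e2, hend q u 0 p0 u0, hend q' u 1 p1 u1] at H
    simp only [u0, u1, p0, p1, ← dirCoord_swap] at H
    obtain ⟨H1, H2, H3⟩ := H
    refine ⟨⟨?_, ?_⟩, ?_⟩
    · rw [← Y.joint, ← hq, ← p1, ← hpt]
      exact H1
    · rw [← Y.joint, ← hq, ← p1, ← hpt]
      exact H2
    · rw [← H3, HorseSheets.E, HorseSheets.E]
      abel
  · change π (Y.σ j (p t)) ∈ B
    rw [hpt]
    refine hB _ ⟨1 - t, t, sub_nonneg.2 (h01 t ht).2, (h01 t ht).1, by ring, ?_⟩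
    simp [p]
  · rw [hpush i (fun t => -u t), hpush, opp_tan, map_neg]
  · change Y.σ i (p 0) = s₁ (π (Y.σ j (p 0)))
    rw [hpt, p0, hq, Y.joint, ho.1]
  · change Y.σ j (p 0) = s₂ (π (Y.σ j (p 0)))
    rw [hpt, p0, hq, Y.joint, ho.2]

end PairPotential

end Moves

section Constancy

variable {φ φ' : OpenPartialHomeomorph C ℂ} {J J' : HorseJoint → Jt} {L L' : HorseStreet → List St}

variable [OrientedAtlas S] [OrientedAtlas C] [PreconnectedSpace S] [T2Space S] [T2Space C]
  (hπ : IsSimpleBranchedCover π K)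

include hπ

theorem IsHorse.symm_mem_listTrace (h : IsHorse N φ J L) {y : ℂ} (hy : y ∈ p.fig) :
    φ.symm y ∈ N.listTrace (L p) := by
  rw [← h.fig p] at hy
  obtain ⟨z, ⟨hz, hz'⟩, rfl⟩ := hy
  rwa [φ.left_inv hz']

/-- The disk between two consecutive horses, with the joints `bot'`, `q'` of the second horse and
`q`, `top` of the first one on its boundary. -/
theorem listT_sub_listT (h : IsHorse N φ J L) (h' : IsHorse N φ' J' L') (Y : HorseSheets N φ J)
    (Y' : HorseSheets N φ' J') {D : ℂ → C} (hD : ContinuousOn D (Metric.closedBall 0 1))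
    (hi : InjOn D (Metric.closedBall 0 1))
    (hb : MapsTo D (Metric.closedBall 0 1) (branchPoints π)ᶜ) {i j : Fin 3} {q q' : HorseJoint}
    {p p' r r' : HorseStreet}
    (hs : D '' Metric.sphere 0 1 = N.listTrace (L p) ∪ N.listTrace (L r) ∪
      N.listTrace (L' p') ∪ N.listTrace (L r'))
    (hp : p.fig = segment ℝ q.pos HorseJoint.top.pos)
    (hp' : p'.fig = segment ℝ HorseJoint.bot.pos q'.pos)
    (hu : ∃ d : ℂ, d.im ≠ 0 ∧ (∀ q, ∃ c : ℝ, 0 < c ∧ N.dirCoord φ (J q) i j = c * d) ∧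
      ∀ q, ∃ c : ℝ, 0 < c ∧ N.dirCoord φ' (J' q) i j = c * d)
    (hr₀ : N.leg (J .top) i j = (L r).head?) (hr₁ : N.leg (J' q') j i = (L r).getLast?.map N.rev)
    (hr₀' : N.leg (J q) i j = (L r').head?)
    (hr₁' : N.leg (J' .bot) j i = (L r').getLast?.map N.rev) :
    N.listT (L r') - N.listT (L r) =
      (Y.E .top i j - Y.E q i j) - (Y'.E q' i j - Y'.E .bot i j) := by
  have hB : D '' Metric.sphere 0 1 ⊆ D '' Metric.closedBall 0 1 :=
    image_mono Metric.sphere_subset_closedBall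
  rw [hs] at hB
  obtain ⟨d, hd, hud, hud'⟩ := hu
  have him : ∀ {u u' : ℂ}, (∃ c : ℝ, 0 < c ∧ u = c * d) → (∃ c : ℝ, 0 < c ∧ u' = c * d) →
      ∀ t ∈ 𝕀, ((1 - t) * u + t * u' : ℂ).im ≠ 0 := by
    rintro _ _ ⟨c, hc, rfl⟩ ⟨c', hc', rfl⟩ t ht
    have e : ((1 - t) * (c * d) + t * (c' * d) : ℂ) = (((1 - t) * c + t * c' : ℝ) : ℂ) * d := by
      push_cast
      ring
    rw [e, Complex.im_ofReal_mul]
    exact mul_ne_zero (convex_comb_pos ht hc hc').ne' hd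
  obtain ⟨x, hx⟩ := h.exists_head r
  obtain ⟨y, hy⟩ := h.exists_last r
  obtain ⟨x', hx'⟩ := h.exists_head r'
  obtain ⟨y', hy'⟩ := h.exists_last r'
  rw [hx] at hr₀
  rw [hx'] at hr₀'
  rw [hy, Option.map_some] at hr₁
  rw [hy', Option.map_some] at hr₁'
  have hmem : ∀ {M : List St} {s : St}, s ∈ M → ∀ t ∈ 𝕀,
      π ((N.street s).src t) ∈ N.listTrace M := fun hs t ht => ⟨_, hs, N.mem_trace ht⟩
  have hptq : N.pt (J q) ∈ D '' Metric.closedBall 0 1 := by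
    rw [← N.base_leg hr₀']
    exact hB (Or.inr (hmem (List.mem_of_head? hx') 0 zero_mem_I))
  obtain ⟨s₁, s₂, κ, hP, e₁, e₂⟩ := exists_pairPotential hπ hD hi hb
    (x₁ := N.sheet (J q) i) (x₂ := N.sheet (J q) j)
    ((N.sheet_base _ _).trans (N.sheet_base _ _).symm) (by rw [N.sheet_base]; exact hptq)
  rw [N.sheet_base] at e₁ e₂
  have o : OnSheets N s₁ s₂ (J q) i j := ⟨e₁.symm, e₂.symm⟩
  obtain ⟨o₁, k₁⟩ := hP.listT_joints hπ (h.chain r')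
    (fun s hs t ht => hB (Or.inr (hmem hs t ht))) hx' hy' hr₀' hr₁' o
  obtain ⟨o₂, k₂⟩ := hP.move hπ h' Y' (q := .bot) (q' := q')
    (fun y hy => hB (Or.inl (Or.inr (h'.symm_mem_listTrace hπ (hp' ▸ hy)))))
    (him (hud' _) (hud' _)) o₁
  obtain ⟨o₃, k₃⟩ := hP.move hπ h Y (q := q) (q' := .top)
    (fun y hy => hB (Or.inl (Or.inl (Or.inl (h.symm_mem_listTrace hπ (hp ▸ hy))))))
    (him (hud _) (hud _)) o
  obtain ⟨-, k₄⟩ := hP.listT_joints hπ (h.chain r)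
    (fun s hs t ht => hB (Or.inl (Or.inl (Or.inr (hmem hs t ht))))) hx hy hr₀ hr₁ o₃
  rw [k₁, k₂, k₃, k₄]
  abel

theorem Herd.z_succ {m : ℕ} (H : Herd N m) (h1 : 1 ≤ l) (hl : l < m) :
    Herd.z N H l = Herd.z N H (l + 1) := by
  have hl₀ : l ∈ Icc 1 m := ⟨h1, hl.le⟩
  have hl₁ : l + 1 ∈ Icc 1 m := ⟨by omega, hl⟩
  have h := H.horse l hl₀
  have h' := H.horse (l + 1) hl₁
  obtain ⟨Y⟩ := h.nonempty_sheets hπ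
  obtain ⟨Y'⟩ := h'.nonempty_sheets hπ
  obtain ⟨ga, gb, ga', gb'⟩ := H.glue l h1 hl
  obtain ⟨F, G, ⟨hF, hFi, hFb, hFs⟩, ⟨hG, hGi, hGb, hGs⟩, -⟩ := H.noHoles l h1 hl
  have da : ∃ d : ℂ, d.im ≠ 0 ∧
      (∀ q, ∃ c : ℝ, 0 < c ∧ N.dirCoord (H.chart l) (H.joint l q) 0 1 = c * d) ∧
      ∀ q, ∃ c : ℝ, 0 < c ∧ N.dirCoord (H.chart (l + 1)) (H.joint (l + 1) q) 0 1 = c * d :=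
    ⟨1 + Complex.I, by simp, h.dirCoord_a hπ, h'.dirCoord_a hπ⟩
  have db : ∃ d : ℂ, d.im ≠ 0 ∧
      (∀ q, ∃ c : ℝ, 0 < c ∧ N.dirCoord (H.chart l) (H.joint l q) 1 2 = c * d) ∧
      ∀ q, ∃ c : ℝ, 0 < c ∧ N.dirCoord (H.chart (l + 1)) (H.joint (l + 1) q) 1 2 = c * d :=
    ⟨-1 + Complex.I, by simp, h.dirCoord_b hπ, h'.dirCoord_b hπ⟩
  have eb := listT_sub_listT hπ h h' Y Y' hF hFi hFb (q := .left) (q' := .right) (p := .a2')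
    (p' := .a2) (r := .b1') (r' := .b3) hFs rfl rfl db h.top_b.1 (gb' ▸ h'.right_b.2) h.left_b.1
    (gb ▸ h'.bot_b.2)
  have ea := listT_sub_listT hπ h h' Y Y' hG hGi hGb (q := .right) (q' := .left) (p := .b2')
    (p' := .b2) (r := .a1') (r' := .a3) hGs rfl rfl da h.top_a.1 (ga' ▸ h'.left_a.2) h.right_a.1
    (ga ▸ h'.bot_a.2)
  have ta := Y.listT_joins h hπ .a2
  have tb := Y.listT_joins h hπ .b2
  have ta' := Y'.listT_joins h' hπ .a2'
  have tb' := Y'.listT_joins h' hπ .b2'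
  simp only [HorseStreet.i, HorseStreet.j] at ta tb ta' tb'
  have ca := H.ch_succ .a (l - 1)
  have cb := H.ch_succ .b (l - 1)
  have ca' := H.ch_succ .a' (m - (l + 1))
  have cb' := H.ch_succ .b' (m - (l + 1))
  simp only [Arm.level, Arm.outer, Arm.inner, show l - 1 + 1 = l by omega,
    show m - (l + 1) + 1 = m - l by omega, show m - (m - l) = l by omega,
    show m - (m - (l + 1)) = l + 1 by omega] at ca cb ca' cb'
  rw [z_eq hπ H hl₀ Y, z_eq hπ H hl₁ Y', Nat.add_sub_cancel, ca, cb, ca', cb', ga, gb, ta, tb, ta',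
    tb', eq_add_of_sub_eq ea, eq_add_of_sub_eq eb]
  abel

theorem Herd.z_eq_last {m : ℕ} (H : Herd N m) : ∀ l ∈ Icc 1 m, Herd.z N H l = Herd.z N H m := by
  rintro l ⟨h1, hl⟩
  refine Nat.decreasingInduction' (P := fun k => Herd.z N H k = Herd.z N H m)
    (fun k hk hlk ih => ?_) hl rfl
  rw [Herd.z_succ hπ H (h1.trans hlk) hk, ih]

end Constancy

theorem contDiffAt_glue {g h : ℝ → ℂ} {t₀ : ℝ} (hg : ContDiffAt ℝ 1 g t₀) (hh : ContDiffAt ℝ 1 h t₀)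
    (h0 : g t₀ = h t₀) (h1 : deriv g t₀ = deriv h t₀) :
    ContDiffAt ℝ 1 (fun t => if t < t₀ then g t else h t) t₀ := by
  have hg' := hg.eventually (by simp)
  have hh' := hh.eventually (by simp)
  obtain ⟨ε, hε, hball⟩ := Metric.eventually_nhds_iff_ball.1 (hg'.and hh')
  set B := Metric.ball t₀ ε with hB
  have hd : ∀ t ∈ B, HasDerivAt g (deriv g t) t ∧ HasDerivAt h (deriv h t) t := fun t ht =>
    ⟨((hball t ht).1.differentiableAt one_ne_zero).hasDerivAt,
      ((hball t ht).2.differentiableAt one_ne_zero).hasDerivAt⟩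
  have hder : ∀ t ∈ B, HasDerivAt (fun t => if t < t₀ then g t else h t)
      (if t < t₀ then deriv g t else deriv h t) t := by
    intro t ht
    rcases lt_trichotomy t t₀ with hlt | rfl | hgt
    · rw [if_pos hlt]
      refine (hd t ht).1.congr_of_eventuallyEq ?_
      filter_upwards [Iio_mem_nhds hlt] with r hr using if_pos hr
    · rw [if_neg (lt_irrefl _), ← hasDerivWithinAt_univ, ← Iic_union_Ici (a := t)]
      refine HasDerivWithinAt.union ?_ ?_
      · refine (h1 ▸ (hd t ht).1.hasDerivWithinAt).congr (fun r hr => ?_) ?_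
        · rcases lt_or_eq_of_le (mem_Iic.1 hr) with hr | rfl
          · exact if_pos hr
          · rw [if_neg (lt_irrefl _), h0]
        · rw [if_neg (lt_irrefl _), h0]
      · refine (hd t ht).2.hasDerivWithinAt.congr (fun r hr => if_neg (not_lt.2 hr)) ?_
        exact if_neg (lt_irrefl _)
    · rw [if_neg (not_lt.2 hgt.le)]
      refine (hd t ht).2.congr_of_eventuallyEq ?_
      filter_upwards [Ioi_mem_nhds hgt] with r hr using if_neg (not_lt.2 (le_of_lt hr))
  have hcont : ∀ f : ℝ → ℂ, (∀ t ∈ B, ContDiffAt ℝ 1 f t) → ContinuousOn (deriv f) B := by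
    intro f hf
    have : ContDiffOn ℝ 1 f B := fun t ht => (hf t ht).contDiffWithinAt
    exact this.continuousOn_deriv_of_isOpen Metric.isOpen_ball le_rfl
  have hc : ContinuousOn (fun t => if t < t₀ then deriv g t else deriv h t) B := by
    refine ContinuousOn.if (p := fun t => t < t₀) ?_ ?_ ?_
    · rintro a ⟨-, ha⟩
      have : a = t₀ := by
        have := frontier_lt_subset_eq continuous_id continuous_const ha
        exact this
      rw [this, h1]
    · exact (hcont g fun t ht => (hball t ht).1).mono inter_subset_left
    · exact (hcont h fun t ht => (hball t ht).2).mono inter_subset_left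
  have : ContDiffOn ℝ 1 (fun t => if t < t₀ then g t else h t) B := by
    rw [show (1 : WithTop ℕ∞) = 0 + 1 by rfl, contDiffOn_succ_iff_deriv_of_isOpen Metric.isOpen_ball]
    refine ⟨fun t ht => (hder t ht).differentiableAt.differentiableWithinAt, by simp, ?_⟩
    rw [contDiffOn_zero]
    exact hc.congr fun t ht => (hder t ht).deriv
  exact this.contDiffAt (Metric.isOpen_ball.mem_nhds (Metric.mem_ball_self hε))

theorem contMDiffAt_glue {g h : ℝ → M} {t₀ : ℝ} (hg : ContMDiff 𝓡 𝓒 1 g)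
    (hh : ContMDiff 𝓡 𝓒 1 h) (hv : velocity g t₀ = velocity h t₀) :
    ContMDiffAt 𝓡 𝓒 1 (fun t => if t < t₀ then g t else h t) t₀ ∧
      velocity (fun t => if t < t₀ then g t else h t) t₀ = velocity h t₀ := by
  have h0 : g t₀ = h t₀ := congrArg (fun w : Tan M => w.1) hv
  set k : ℝ → M := fun t => if t < t₀ then g t else h t with hk
  have hk0 : k t₀ = h t₀ := if_neg (lt_irrefl _)
  set e := chartAt ℂ (h t₀)
  have hes : h t₀ ∈ e.source := mem_chart_source ℂ _
  have hem : ContMDiffAt 𝓒 𝓒 1 e (h t₀) :=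
    (contMDiffOn_chart (I := 𝓒) (n := 1)).contMDiffAt (e.open_source.mem_nhds hes)
  have hcd : ∀ f : ℝ → M, ContMDiff 𝓡 𝓒 1 f → f t₀ = h t₀ →
      ContDiffAt ℝ 1 (fun t => e (f t)) t₀ ∧
        deriv (fun t => e (f t)) t₀ = vec (push e (velocity f t₀)) := by
    intro f hf h1
    rw [← h1] at hem
    have h2 : ContMDiffAt 𝓡 𝓒 1 (fun t => e (f t)) t₀ := hem.comp t₀ (hf t₀)
    refine ⟨contMDiffAt_iff_contDiffAt.1 h2, ?_⟩
    rw [← velocity_push (hem.mdifferentiableAt one_ne_zero) ((hf t₀).mdifferentiableAt one_ne_zero)]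
    exact (hasDerivAt_of_velocity (h2.mdifferentiableAt one_ne_zero)).deriv
  have hkc : ContinuousAt k t₀ := by
    rw [continuousAt_iff_continuous_left'_right']
    constructor
    · refine ContinuousWithinAt.congr ?_ (f := g) (fun r hr => if_pos hr) (hk0.trans h0.symm)
      exact hg.continuous.continuousWithinAt
    · refine ContinuousWithinAt.congr ?_ (f := h) (fun r hr => if_neg (not_lt.2 (le_of_lt hr))) hk0
      exact hh.continuous.continuousWithinAt
  have hkm : ContMDiffAt 𝓡 𝓒 1 k t₀ := by
    rw [contMDiffAt_iff_target]
    refine ⟨hkc, ?_⟩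
    rw [contMDiffAt_iff_contDiffAt, hk0]
    obtain ⟨a, a'⟩ := hcd g hg h0
    obtain ⟨b, b'⟩ := hcd h hh rfl
    refine (contDiffAt_glue a b (by simp only [h0]) (by rw [a', b', hv])).congr_of_eventuallyEq ?_
    refine Filter.Eventually.of_forall fun t => ?_
    simp only [Function.comp, hk, mfld_simps]
    split_ifs <;> rfl
  refine ⟨hkm, ?_⟩
  have hu : UniqueMDiffWithinAt 𝓡 (Ici t₀) t₀ :=
    (uniqueDiffOn_Ici t₀ t₀ self_mem_Ici).uniqueMDiffWithinAt
  have h3 := mfderivWithin_eq_mfderiv hu (hkm.mdifferentiableAt one_ne_zero)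
  have h4 := mfderivWithin_eq_mfderiv hu ((hh t₀).mdifferentiableAt one_ne_zero)
  have h5 : mfderivWithin 𝓡 𝓒 k (Ici t₀) t₀ =
      mfderivWithin 𝓡 𝓒 h (Ici t₀) t₀ :=
    mfderivWithin_congr (fun r hr => if_neg (not_lt.2 hr)) hk0
  have h6 : (mfderiv 𝓡 𝓒 k t₀ : ℝ →L[ℝ] ℂ) = mfderiv 𝓡 𝓒 h t₀ :=
    h3.symm.trans (h5.trans h4)
  have h7 := congrArg (fun A : ℝ →L[ℝ] ℂ => tan (h t₀) (A 1)) h6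
  refine Eq.trans ?_ h7
  rw [velocity, hk0]
  rfl

section Cycle

variable {g : ℤ → ℝ → M}

/-- The curve that runs through a sequence of curves, each of them parametrised by `[0,1]`. -/
def concat (g : ℤ → ℝ → M) (t : ℝ) : M := g ⌊t⌋ (t - ⌊t⌋)

theorem velocity_translate {γ : ℝ → M} (hγ : ContMDiff 𝓡 𝓒 1 γ) (c t : ℝ) :
    velocity (fun r => γ (r - c)) t = velocity γ (t - c) := by
  have := velocity_comp (h := fun r => r - c) ((hγ _).mdifferentiableAt one_ne_zero)
    ((hasDerivAt_id t).sub_const c)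
  rw [this, one_smul]
  rfl

theorem contMDiff_translate {γ : ℝ → M} (hγ : ContMDiff 𝓡 𝓒 1 γ) (c : ℝ) :
    ContMDiff 𝓡 𝓒 1 (fun r => γ (r - c)) :=
  hγ.comp (ContDiff.contMDiff (by fun_prop))

theorem concat_smooth (hg : ∀ k, ContMDiff 𝓡 𝓒 1 (g k))
    (hv : ∀ k, velocity (g k) 1 = velocity (g (k + 1)) 0) (t : ℝ) :
    ContMDiffAt 𝓡 𝓒 1 (concat g) t ∧
      velocity (concat g) t = velocity (g ⌊t⌋) (t - ⌊t⌋) := by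
  set k := ⌊t⌋ with hk
  rcases (Int.floor_le t).lt_or_eq with h | h
  · have he : concat g =ᶠ[𝓝 t] fun r => g k (r - k) := by
      filter_upwards [Ioo_mem_nhds h (Int.lt_floor_add_one t)] with r hr
      have : ⌊r⌋ = k := Int.floor_eq_iff.2 ⟨hr.1.le, hr.2⟩
      rw [concat, this]
    refine ⟨((contMDiff_translate (hg k) k) t).congr_of_eventuallyEq he, ?_⟩
    rw [velocity_congr he, velocity_translate (hg k)]
  · have he : concat g =ᶠ[𝓝 t] fun r => if r < t then g (k - 1) (r - ((k - 1 : ℤ) : ℝ))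
        else g k (r - k) := by
      filter_upwards [Ioo_mem_nhds (sub_one_lt t) (lt_add_one t)] with r hr
      split_ifs with hrt
      · have : ⌊r⌋ = k - 1 := Int.floor_eq_iff.2 ⟨by push_cast; linarith [hr.1], by
          push_cast; linarith⟩
        rw [concat, this]
      · have : ⌊r⌋ = k := Int.floor_eq_iff.2 ⟨by linarith [not_lt.1 hrt], by linarith [hr.2]⟩
        rw [concat, this]
    have hv' := hv (k - 1)
    rw [sub_add_cancel] at hv'
    obtain ⟨h1, h2⟩ := contMDiffAt_glue (contMDiff_translate (hg (k - 1)) ((k - 1 : ℤ) : ℝ))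
      (contMDiff_translate (hg k) k) (t₀ := t) (by
        rw [velocity_translate (hg _), velocity_translate (hg _), ← h,
          show (k : ℝ) - ((k - 1 : ℤ) : ℝ) = 1 by push_cast; ring, sub_self]
        exact hv')
    refine ⟨h1.congr_of_eventuallyEq he, ?_⟩
    rw [velocity_congr he, h2, velocity_translate (hg k)]

theorem concat_velocity_end (hg : ∀ k, ContMDiff 𝓡 𝓒 1 (g k))
    (hv : ∀ k, velocity (g k) 1 = velocity (g (k + 1)) 0) (k : ℤ) {t : ℝ} (ht : t ∈ 𝕀) :
    velocity (concat g) (t + k) = velocity (g k) t := by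
  rw [(concat_smooth hg hv _).2]
  rcases ht.2.lt_or_eq with h | rfl
  · have : ⌊t + k⌋ = k := Int.floor_eq_iff.2 ⟨by linarith [ht.1], by linarith⟩
    rw [this, add_sub_cancel_right]
  · have : ⌊(1 : ℝ) + k⌋ = k + 1 := by rw [add_comm, ← Int.cast_one, ← Int.cast_add, Int.floor_intCast]
    rw [this, hv, show (1 : ℝ) + k - ((k + 1 : ℤ) : ℝ) = 0 by push_cast; ring]

theorem concat_periodic {n : ℕ} (hper : ∀ k, g (k + n) = g k) (t : ℝ) :
    concat g (t + n) = concat g t := by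
  have : ⌊t + n⌋ = ⌊t⌋ + n := Int.floor_add_natCast t n
  rw [concat, this, hper, concat]
  congr 1
  push_cast
  ring

/-- The closed curve that runs through `n` curves. -/
theorem exists_loop_concat {n : ℕ} (hn : 0 < n) (hper : ∀ k, g (k + n) = g k)
    (hg : ∀ k, ContMDiff 𝓡 𝓒 1 (g k))
    (hreg : ∀ k, ∀ t ∈ 𝕀, vec (velocity (g k) t) ≠ 0)
    (hv : ∀ k, velocity (g k) 1 = velocity (g (k + 1)) 0) :
    ∃ β : Loop M, (∀ t, β.curve t = concat g (n * t)) ∧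
      (∀ t, vec (velocity β.curve t) = (n : ℝ) • vec (velocity (concat g) (n * t))) ∧
      β.framing = ∑ k ∈ Finset.range n, cls (dirArc (velocity (g k)) 0 1) := by
  have hn' : (0 : ℝ) < n := Nat.cast_pos.2 hn
  have hsm : ContMDiff 𝓡 𝓒 1 (concat g) := fun t => (concat_smooth hg hv t).1
  have hne : ∀ t, vec (velocity (concat g) t) ≠ 0 := fun t => by
    rw [(concat_smooth hg hv t).2]
    exact hreg _ _ ⟨sub_nonneg.2 (Int.floor_le t), by linarith [Int.lt_floor_add_one t]⟩
  have hvel : ∀ t, velocity (fun r => concat g (n * r)) t =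
      tan (concat g (n * t)) ((n : ℝ) • vec (velocity (concat g) (n * t))) := fun t =>
    velocity_comp ((hsm _).mdifferentiableAt one_ne_zero)
      (by simpa using (hasDerivAt_id t).const_mul (n : ℝ))
  let β : Loop M :=
    { curve := fun r => concat g (n * r)
      smooth := hsm.comp (ContDiff.contMDiff (by fun_prop))
      periodic := fun t => by rw [mul_add, mul_one, concat_periodic hper]
      regular := fun t => by
        rw [hvel, vec_tan]
        exact smul_ne_zero hn'.ne' (hne _) }
  refine ⟨β, fun _ => rfl, fun t => by rw [hvel, vec_tan], ?_⟩
  have hcv : Continuous (velocity (concat g)) := by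
    rw [← continuousOn_univ]
    exact continuousOn_velocity fun t _ => hsm t
  obtain ⟨k, hk⟩ := exists_potential (M := M) (E := ℝ × ℝ) (K := univ ×ˢ Ioi 0) (x₀ := (0, 1))
    ((convex_univ.prod (convex_Ioi 0)).starConvex ⟨mem_univ _, one_pos⟩)
    (D := fun w => tan (velocity (concat g) w.1).1 (w.2 • vec (velocity (concat g) w.1)))
    (continuousOn_smul (hcv.comp continuous_fst).continuousOn continuous_snd.continuousOn)
    fun w hw => smul_ne_zero (ne_of_gt hw.2) (hne _)
  have hpiece : ∀ i : ℕ, cls (dirArc (velocity (g i)) 0 1) = k ((i + 1 : ℕ), 1) - k (i, 1) := by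
    intro i
    rw [dirArc_congr (g := fun t => tan (velocity (concat g) (t + i)).1
      ((1 : ℝ) • vec (velocity (concat g) (t + i))))]
    · rw [hk (fun t => (t + i, 1)) 0 1 (by fun_prop) fun t _ => ⟨mem_univ _, mem_Ioi.2 one_pos⟩]
      congr 3
      · push_cast; ring
      · ring
    · intro t ht
      rw [uIcc_of_le zero_le_one] at ht
      rw [one_smul, tan_vec]
      exact (concat_velocity_end hg hv (i : ℤ) ht).symm
  have hsum : ∑ i ∈ Finset.range n, cls (dirArc (velocity (g i)) 0 1) = k (n, 1) - k (0, 1) := by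
    rw [Finset.sum_congr rfl fun i _ => hpiece i,
      Finset.sum_range_sub (fun i : ℕ => k ((i : ℝ), 1)), Nat.cast_zero]
  have hscale : ∀ c : ℝ, cls (dirArc (fun s => tan (velocity (concat g) c).1
      (s • vec (velocity (concat g) c))) 1 n) = k (c, n) - k (c, 1) := by
    intro c
    refine hk (fun s => (c, s)) 1 n (by fun_prop) fun t ht => ⟨mem_univ _, ?_⟩
    rcases le_total (1 : ℝ) n with h | h
    · rw [uIcc_of_le h] at ht
      exact lt_of_lt_of_le one_pos ht.1
    · rw [uIcc_of_ge h] at ht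
      exact lt_of_lt_of_le hn' ht.1
  have hend : velocity (concat g) n = velocity (concat g) 0 := by
    have h1 := concat_velocity_end hg hv (n : ℤ) (left_mem_Icc.2 zero_le_one)
    have h2 := concat_velocity_end hg hv 0 (left_mem_Icc.2 zero_le_one)
    have h3 := hper 0
    simp only [zero_add, Int.cast_natCast, Int.cast_zero] at h1 h2 h3
    rw [h1, h2, h3]
  have e1 := hscale n
  rw [hend, hscale 0] at e1
  have e2 : β.framing = k (n, n) - k (0, n) := by
    rw [Loop.framing, dirArc_congr (g := fun t => tan (velocity (concat g) (n * t)).1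
      ((n : ℝ) • vec (velocity (concat g) (n * t)))) fun t _ => hvel t,
      hk (fun t => (n * t, n)) 0 1 (by fun_prop) fun t _ => ⟨mem_univ _, hn'⟩]
    simp
  rw [e2, hsum, ← sub_eq_zero]
  rw [← sub_eq_zero] at e1
  rw [← neg_eq_zero, ← e1]
  abel

/-- The closed curve that runs through a cyclic list of distinct curves; `θ p t` is the parameter at
which it runs through the point `t` of the curve `p`. -/
theorem exists_loop {ι : Type*} {f : ι → ℝ → M} (hf : ∀ p, ContMDiff 𝓡 𝓒 1 (f p))
    {P : List ι} (hP : P ≠ []) (hnd : P.Nodup)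
    (hreg : ∀ p ∈ P, ∀ t ∈ 𝕀, vec (velocity (f p) t) ≠ 0)
    (hch : (P ++ [P.head hP]).IsChain fun p p' => velocity (f p) 1 = velocity (f p') 0) :
    ∃ (β : Loop M) (θ : ι → ℝ → ℝ),
      (∀ p ∈ P, ∀ t ∈ Ico (0 : ℝ) 1, θ p t ∈ Ico (0 : ℝ) 1 ∧ β.curve (θ p t) = f p t ∧
        ∃ c : ℝ, 0 < c ∧ vec (velocity β.curve (θ p t)) = c • vec (velocity (f p) t)) ∧
      (∀ r ∈ Ico (0 : ℝ) 1, ∃ p ∈ P, ∃ t ∈ Ico (0 : ℝ) 1, θ p t = r) ∧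
      (∀ p ∈ P, ∀ p' ∈ P, ∀ t ∈ Ico (0 : ℝ) 1, ∀ t' ∈ Ico (0 : ℝ) 1, θ p t = θ p' t' →
        p = p' ∧ t = t') ∧
      β.framing = (P.map fun p => cls (dirArc (velocity (f p)) 0 1)).sum := by
  classical
  set n := P.length with hn
  have hn0 : 0 < n := List.length_pos_iff.2 hP
  have hn' : (0 : ℝ) < n := Nat.cast_pos.2 hn0
  have hidx : ∀ k : ℤ, (k % n).toNat < n := fun k => by
    have h1 := Int.emod_nonneg k (by omega : (n : ℤ) ≠ 0)
    have h2 := Int.emod_lt_of_pos k (by omega : (0 : ℤ) < n)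
    omega
  let g : ℤ → ℝ → M := fun k => f (P[(k % n).toNat]'(hidx k))
  have hgn : ∀ i : ℕ, ∀ hi : i < n, g i = f P[i] := by
    intro i hi
    simp only [g]
    congr 2
    rw [Int.emod_eq_of_lt (by omega) (by omega)]
    simp
  have hper : ∀ k, g (k + n) = g k := by
    intro k
    simp only [g, Int.add_emod_right]
  have hmem : ∀ k, ∃ p ∈ P, g k = f p := fun k => ⟨_, List.getElem_mem _, rfl⟩
  have hv₀ : ∀ i : ℕ, i < n → velocity (g i) 1 = velocity (g (i + 1 : ℕ)) 0 := by
    intro i hi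
    have hlen : (P ++ [P.head hP]).length = n + 1 := by simp [hn]
    have := List.isChain_iff_getElem.1 hch i (by omega)
    rw [List.getElem_append_left (by omega)] at this
    rw [hgn i hi, this]
    rcases Nat.lt_or_ge (i + 1) n with h | h
    · rw [List.getElem_append_left (by omega), hgn (i + 1) h]
    · rw [List.getElem_append_right (by omega)]
      have e : g ((i + 1 : ℕ) : ℤ) = f (P.head hP) := by
        have e1 : ((i + 1 : ℕ) : ℤ) = 0 + n := by omega
        rw [e1, hper, ← Nat.cast_zero, hgn 0 hn0, List.head_eq_getElem]
      rw [e]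
      simp
  have hv : ∀ k, velocity (g k) 1 = velocity (g (k + 1)) 0 := by
    intro k
    have h1 := Int.emod_nonneg k (by omega : (n : ℤ) ≠ 0)
    have e1 : g k = g ((k % n).toNat : ℕ) := by
      simp only [g, Int.toNat_of_nonneg h1, Int.emod_emod]
    have e2 : g (k + 1) = g (((k % n).toNat + 1 : ℕ) : ℤ) := by
      simp only [g, Nat.cast_add, Int.toNat_of_nonneg h1, Nat.cast_one, Int.emod_add_emod]
    rw [e1, e2]
    exact hv₀ _ (hidx k)
  obtain ⟨β, hβ, hβv, hβf⟩ := exists_loop_concat hn0 hper (fun k => hf _)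
    (fun k t ht => by
      obtain ⟨p, hp, e⟩ := hmem k
      rw [e]
      exact hreg p hp t ht) hv
  have hcv : ∀ p ∈ P, ∀ t ∈ Ico (0 : ℝ) 1,
      velocity (concat g) (n * ((P.idxOf p + t) / n)) = velocity (f p) t := by
    intro p hp t ht
    rw [mul_div_cancel₀ _ hn'.ne', add_comm]
    have := concat_velocity_end (g := g) (fun k => hf _) hv (P.idxOf p) (Ico_subset_Icc_self ht)
    rw [hgn _ (List.idxOf_lt_length_of_mem hp), List.getElem_idxOf] at this
    exact this
  refine ⟨β, fun p t => (P.idxOf p + t) / n, fun p hp t ht => ⟨?_, ?_, n, hn', ?_⟩, fun r hr => ?_,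
    fun p hp p' hp' t ht t' ht' he => ?_, ?_⟩
  · have h1 : (P.idxOf p : ℝ) + 1 ≤ n := by
      exact_mod_cast List.idxOf_lt_length_of_mem hp
    exact ⟨div_nonneg (add_nonneg (Nat.cast_nonneg _) ht.1) hn'.le,
      (div_lt_one hn').2 (by linarith [ht.2])⟩
  · rw [hβ]
    exact congrArg (fun w : Tan M => w.1) (hcv p hp t ht)
  · rw [hβv, hcv p hp t ht]
  · set i := ⌊n * r⌋₊ with hi
    have h0 : 0 ≤ n * r := mul_nonneg hn'.le hr.1
    have h1 := Nat.floor_le h0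
    have h2 := Nat.lt_floor_add_one (n * r)
    have hin : i < n := by
      rw [hi, Nat.floor_lt h0]
      exact (mul_lt_iff_lt_one_right hn').2 hr.2
    refine ⟨P[i], List.getElem_mem _, n * r - i, ⟨by linarith, by linarith⟩, ?_⟩
    simp only []
    rw [hnd.idxOf_getElem, add_sub_cancel, mul_div_cancel_left₀ _ hn'.ne']
  · simp only [div_left_inj' hn'.ne'] at he
    have h1 : P.idxOf p = P.idxOf p' := by
      rcases lt_trichotomy (P.idxOf p) (P.idxOf p') with h | h | h
      · have : (P.idxOf p : ℝ) + 1 ≤ P.idxOf p' := by exact_mod_cast h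
        linarith [ht.2, ht'.1]
      · exact h
      · have : (P.idxOf p' : ℝ) + 1 ≤ P.idxOf p := by exact_mod_cast h
        linarith [ht'.2, ht.1]
    refine ⟨(List.idxOf_inj hp).1 h1, ?_⟩
    rw [h1] at he
    linarith
  · rw [hβf, ← Fin.sum_univ_fun_getElem, Finset.sum_range]
    exact Finset.sum_congr rfl fun i _ => by rw [hgn i i.2]

end Cycle

namespace Arm

/-- The arm of the same type that comes from the opposite side. -/
def op : Arm → Arm
  | a => .a' | b => .b' | a' => .a | b' => .b

/-- The sheet of the sources of the streets on an arm. -/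
def i : Arm → Fin 3
  | a => 0 | b => 1 | a' => 1 | b' => 2

/-- The sheet of the targets of the streets on an arm. -/
def j : Arm → Fin 3
  | a => 1 | b => 2 | a' => 0 | b' => 1

/-- The joint of the last horse that an arm reaches first. -/
def tip : Arm → HorseJoint
  | a | b => .bot | a' | b' => .top

theorem op_op (x : Arm) : x.op.op = x := by cases x <;> rfl

theorem op_ne (x : Arm) : x.op ≠ x := by cases x <;> simp [op]

theorem op_i (x : Arm) : x.op.i = x.j := by cases x <;> rfl

theorem op_j (x : Arm) : x.op.j = x.i := by cases x <;> rfl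

end Arm

namespace Herd

variable {m : ℕ} (H : Herd N m)

/-- The streets of an arm up to the last horse. -/
def arm (x : Arm) : List St := (List.range (2 * x.num m m + 1)).flatMap (H.block x)

theorem mem_arm {x : Arm} : s ∈ H.arm x ↔ ∃ b < 2 * x.num m m + 1, s ∈ H.block x b := by
  simp [arm]

/-- The street, in some orientation, belongs to an arm. -/
def OnArm (s : St) : Prop := ∃ x, N.On (H.arm x) s

variable (hm : 1 ≤ m)

include hm

theorem num_last_lt (x : Arm) : 2 * x.num m m + 1 ≤ 2 * m - 1 := by
  have := x.num_lt (m := m) (l := m) ⟨hm, le_rfl⟩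
  omega

theorem mem_line_of_mem_arm {x : Arm} (h : s ∈ H.arm x) : s ∈ H.line x := by
  obtain ⟨b, hb, hs⟩ := H.mem_arm.1 h
  exact H.mem_line.2 ⟨b, hb.trans_le (num_last_lt hm x), hs⟩

theorem arm_chain (x : Arm) : (H.arm x).IsChain N.Continues := by
  have := num_last_lt hm x
  exact isChain_flatMap_range _ _ (fun _ hb => H.block_ne_nil x (by omega))
    (fun _ hb => H.block_chain x (by omega))
    fun _ hb _ _ hs hs' => H.block_continues x (by omega) hs hs'

theorem arm_head (x : Arm) : ∃ s, (H.arm x).head? = some s ∧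
    N.cap s = some (H.source x.index) := by
  rw [arm, head?_flatMap_range _ _ (H.block_ne_nil x (by omega))]
  exact H.block_head x

theorem arm_last (x : Arm) : ∃ s, (H.arm x).getLast? = some s ∧
    N.leg (H.joint m x.tip) x.j x.i = some (N.rev s) := by
  have hl : m ∈ Icc 1 m := ⟨hm, le_rfl⟩
  have h := H.horse m hl
  have := num_last_lt hm x
  rw [arm, getLast?_flatMap_range _ _ (H.block_ne_nil x (by omega)), block_even, x.level_num hl]
  cases x
  · obtain ⟨s, hs⟩ := h.exists_last .a1
    have := h.bot_a.2
    rw [hs] at this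
    exact ⟨s, hs, this⟩
  · obtain ⟨s, hs⟩ := h.exists_last .b1
    have := h.bot_b.2
    rw [hs] at this
    exact ⟨s, hs, this⟩
  · obtain ⟨s, hs⟩ := h.exists_head .a1'
    refine ⟨N.rev s, by simp [Arm.orient, getLast?_revList, Arm.outer, hs], ?_⟩
    rw [N.rev_rev]
    exact h.top_a.1.trans hs
  · obtain ⟨s, hs⟩ := h.exists_head .b1'
    refine ⟨N.rev s, by simp [Arm.orient, getLast?_revList, Arm.outer, hs], ?_⟩
    rw [N.rev_rev]
    exact h.top_b.1.trans hs

theorem arm_nodup (x : Arm) : (H.arm x).Nodup := by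
  refine nodup_of_chain continues_left_unique (H.arm_chain hm x) fun s t hs hc => ?_
  obtain ⟨s', hs', hcap⟩ := H.arm_head hm x
  rw [hs] at hs'
  obtain rfl := Option.some.inj hs'
  rw [hc.cap_eq_none] at hcap
  exact absurd hcap (by simp)

theorem arm_pred {x : Arm} (hs : s ∈ H.arm x) :
    N.cap s = some (H.source x.index) ∧ (H.arm x).head? = some s ∨
      ∃ v i j, N.leg v i j = some s := by
  rcases head_or_pred (H.arm_chain hm x) s hs with h | ⟨s₀, -, v, i, j, -, h⟩
  · obtain ⟨s', hs', hcap⟩ := H.arm_head hm x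
    rw [h] at hs'
    obtain rfl := Option.some.inj hs'
    exact Or.inl ⟨hcap, h⟩
  · exact Or.inr ⟨v, i, j, h⟩

theorem arm_succ {x : Arm} (hs : s ∈ H.arm x) : ∃ v i j, N.leg v i j = some (N.rev s) := by
  rcases last_or_succ (H.arm_chain hm x) s hs with h | ⟨s₀, -, v, i, j, h, -⟩
  · obtain ⟨s', hs', hl⟩ := H.arm_last hm x
    rw [h] at hs'
    obtain rfl := Option.some.inj hs'
    exact ⟨_, _, _, hl⟩
  · exact ⟨v, j, i, h⟩

variable (hS : N.SixWayStreets)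

include hS

theorem OnArm.twoWay (hs : H.OnArm s) : N.TwoWay s := by
  obtain ⟨x, hs | hs⟩ := hs
  · exact H.line_twoWay hS x s (H.mem_line_of_mem_arm hm hs)
  · exact N.twoWay_rev.1 (H.line_twoWay hS x _ (H.mem_line_of_mem_arm hm hs))

variable [T2Space C] (hπ : IsSimpleBranchedCover π K)

include hπ

omit hm in
theorem exists_joint_of_twoWay {i j i' j' : Fin 3}
    (hleg : N.leg v i j = some s) (hleg' : N.leg v i' j' = some s') (ht : N.TwoWay s)
    (ht' : N.TwoWay s') (hn : ¬ ((i' = i ∧ j' = j) ∨ (i' = j ∧ j' = i))) :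
    ∃ k ∈ Icc 1 m, ∃ q, v = H.joint k q := by
  have hmem := H.cover s ht (N.mem_trace zero_mem_I)
  rw [N.base_leg hleg] at hmem
  simp only [mem_iUnion] at hmem
  obtain ⟨k, hk, hv⟩ := hmem
  have h := H.horse k hk
  obtain ⟨p, hp⟩ := h.exists_on hπ hleg ht hv
  obtain ⟨p', hp'⟩ := h.exists_on hπ hleg' ht' hv
  obtain ⟨q, hq⟩ := h.exists_joint hπ hleg hleg' hp hp' hv hn
  exact H.exists_eq_joint hS hπ hk hleg hp ht hv hq

theorem street_c_notMem_line (hk : k ∈ Icc 1 m) (hs : N.On (H.street k .c) s)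
    (x : Arm) : s ∉ H.line x := by
  have h := H.horse k hk
  have key : ∀ L : List St, L.IsChain N.Continues → (∀ y, L.head? = some y → N.TwoWay y ∧
      ∃ q i j, N.leg (H.joint k q) i j = some y ∧ ((i = 2 ∧ j = 0 ∧ q = .top) ∨
        (i = 0 ∧ j = 2 ∧ q = .bot))) → ∀ s ∈ L, s ∉ H.line x := by
    intro L hL hhead
    have : ∀ n (hn : n < L.length), L[n] ∉ H.line x := by
      intro n
      induction n with
      | zero =>
        intro hn hmem
        obtain ⟨ht, q, i, j, hleg, hij⟩ := hhead L[0]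
          (by rw [List.head?_eq_getElem?, List.getElem?_eq_getElem hn])
        rcases head_or_pred (H.line_chain x) _ hmem with hx | ⟨s₀, hs₀, v, i', j', h1, h2⟩
        · obtain ⟨s', hs', hcap⟩ := H.line_head hm x
          rw [hx] at hs'
          rw [← Option.some.inj hs', N.leg_cap _ _ _ _ hleg] at hcap
          exact absurd hcap (by simp)
        · obtain ⟨rfl, rfl, rfl⟩ := N.leg_unique _ _ _ _ _ _ _ hleg h2
          have ht₀ := N.twoWay_rev.2 (H.line_twoWay hS x s₀ hs₀)
          have := h.twoWay_third hπ (by tauto) h1 ht₀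
          rcases hij with ⟨rfl, rfl, rfl⟩ | ⟨rfl, rfl, rfl⟩ <;> simp at this
      | succ n ih =>
        intro hn hmem
        have hc := (List.isChain_iff_getElem.1 hL) n hn
        rcases head_or_pred (H.line_chain x) _ hmem with hx | ⟨s₀, hs₀, hc₀⟩
        · exact H.line_no_pred hm x _ _ hx hc
        · rw [hc₀.left_unique hc] at hs₀
          exact ih (by omega) hs₀
    intro s hs
    obtain ⟨n, hn, rfl⟩ := List.getElem_of_mem hs
    exact this n hn
  rcases hs with hs | hs
  · refine key _ (h.chain .c) (fun y hy => ⟨h.twoWay_c y (List.mem_of_head? hy), .bot, 0, 2,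
      h.bot_c.trans hy, by simp⟩) s hs
  · refine key _ (chain_revList (h.chain .c)) (fun y hy => ?_) s (mem_revList.2 hs)
    refine ⟨N.twoWay_rev.1 (h.twoWay_c _ (mem_revList.1 (List.mem_of_head? hy))), .top, 2, 0, ?_,
      by simp⟩
    rw [h.top_c, ← head?_revList, hy]

theorem OnArm.not_on_c (hs : H.OnArm s) (hk : k ∈ Icc 1 m) :
    ¬ N.On (H.street k .c) s := by
  intro hc
  obtain ⟨x, hs | hs⟩ := hs
  · exact H.street_c_notMem_line hm hS hπ hk hc x (H.mem_line_of_mem_arm hm hs)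
  · exact H.street_c_notMem_line hm hS hπ hk (N.on_rev.2 hc) x (H.mem_line_of_mem_arm hm hs)

theorem OnArm.block_lt (hs : H.OnArm s) {x : Arm} {b : ℕ} (hb : b < 2 * m - 1)
    (h : N.On (H.block x b) s) : b < 2 * x.num m m + 1 := by
  have key : ∀ y, s ∈ H.arm y ∨ N.rev s ∈ H.arm y → b < 2 * x.num m m + 1 := by
    intro y hy
    have : ∃ b' < 2 * y.num m m + 1, N.On (H.block y b') s := by
      rcases hy with hy | hy <;> obtain ⟨b', hb', h'⟩ := H.mem_arm.1 hy
      exacts [⟨b', hb', Or.inl h'⟩, ⟨b', hb', Or.inr h'⟩]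
    obtain ⟨b', hb', h'⟩ := this
    obtain ⟨rfl, rfl⟩ := H.block_unique hS hπ hm hb (hb'.trans_le (num_last_lt hm y)) h h'
    exact hb'
  obtain ⟨y, hy⟩ := hs
  exact key y hy

theorem OnArm.outer (hs : H.OnArm s) (hk : k ∈ Icc 1 m) {x : Arm}
    (hx : x.num m m = 0) (h : N.On (H.street k x.outer) s) : x.num m k = 0 := by
  have := hs.block_lt H hm hS hπ (outer_num_lt hk x) ((H.on_outer_iff hk x).2 h)
  omega

theorem OnArm.inner (hs : H.OnArm s) (hk : k ∈ Icc 1 m) {x : Arm}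
    (hx : x.num m m = 0) : ¬ N.On (H.street k x.inner) s := by
  intro h
  have ha := H.active_of_twoWay hS hπ hk h (hs.twoWay H hm hS)
  have := hs.block_lt H hm hS hπ (inner_num_lt hk ha) ((H.on_inner_iff hk x).2 h)
  omega

/-- The legs at the joints of the horses that belong to arms. -/
theorem OnArm.leg (hs : H.OnArm s) (hk : k ∈ Icc 1 m) {q : HorseJoint}
    {i j : Fin 3} (hleg : N.leg (H.joint k q) i j = some s) :
    (q = .bot ∧ (i = 1 ∧ j = 0 ∨ i = 2 ∧ j = 1 ∨ k < m ∧ (i = 0 ∧ j = 1 ∨ i = 1 ∧ j = 2))) ∨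
    (q = .right ∧ (i = 0 ∧ j = 1 ∨ i = 1 ∧ j = 0)) ∨
    (q = .left ∧ (i = 1 ∧ j = 2 ∨ i = 2 ∧ j = 1)) ∨
    (q = .top ∧ k = m ∧ (i = 0 ∧ j = 1 ∨ i = 1 ∧ j = 2)) := by
  have h := H.horse k hk
  have ht := hs.twoWay H hm hS
  have hk1 := hk.1
  have hk2 := hk.2
  have hact : ∀ {p}, N.On (H.street k p) s → p.Active m k := fun hp =>
    H.active_of_twoWay hS hπ hk hp ht
  have hA' : (Arm.a').num m m = 0 := by simp [Arm.num]
  have hB' : (Arm.b').num m m = 0 := by simp [Arm.num]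
  have a2' := hs.inner H hm hS hπ hk hA'
  have b2' := hs.inner H hm hS hπ hk hB'
  have a1' : ∀ k ∈ Icc 1 m, N.On (H.street k .a1') s → k = m := fun k hk hp => by
    have := hs.outer H hm hS hπ hk hA' hp
    simp only [Arm.num] at this
    have := hk.2
    omega
  have b1' : ∀ k ∈ Icc 1 m, N.On (H.street k .b1') s → k = m := fun k hk hp => by
    have := hs.outer H hm hS hπ hk hB' hp
    simp only [Arm.num] at this
    have := hk.2
    omega
  have a3' : ¬ N.On (H.street k .a3') s := fun hp => by
    have h1 : 1 < k := hact hp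
    have hg := (H.glue (k - 1) (by omega) (by omega)).2.2.1
    rw [show k - 1 + 1 = k by omega] at hg
    have := a1' (k - 1) ⟨by omega, by omega⟩ (hg ▸ hp)
    omega
  have b3' : ¬ N.On (H.street k .b3') s := fun hp => by
    have h1 : 1 < k := hact hp
    have hg := (H.glue (k - 1) (by omega) (by omega)).2.2.2
    rw [show k - 1 + 1 = k by omega] at hg
    have := b1' (k - 1) ⟨by omega, by omega⟩ (hg ▸ hp)
    omega
  have hhead : ∀ {p}, N.leg (H.joint k q) i j = (H.street k p).head? → N.On (H.street k p) s :=
    fun e => Or.inl (List.mem_of_head? (e.symm.trans hleg))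
  have hlast : ∀ {p}, N.leg (H.joint k q) i j = (H.street k p).getLast?.map N.rev →
      N.On (H.street k p) s := fun {p} e => by
    rw [hleg] at e
    obtain ⟨r, hr, e⟩ := Option.map_eq_some_iff.1 e.symm
    exact Or.inr (by rw [← e, N.rev_rev]; exact List.mem_of_getLast? hr)
  have hne := leg_ne hleg
  fin_cases i <;> fin_cases j <;> simp only [Fin.zero_eta, Fin.mk_one, Fin.reduceFinMk] at *
  · exact absurd rfl hne
  · have := hhead (h.legs_a q).1
    cases q
    · exact Or.inl ⟨rfl, Or.inr (Or.inr ⟨hact this, by simp⟩)⟩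
    · simp
    · exact (a2' this).elim
    · exact Or.inr (Or.inr (Or.inr ⟨rfl, a1' k hk this, by simp⟩))
  · rcases h.twoWay_third hπ (by simp) hleg ht with ⟨rfl, -⟩ | ⟨rfl, h0, -⟩
    · exact (hs.not_on_c H hm hS hπ hk (hhead h.bot_c)).elim
    · exact absurd h0 (by decide)
  · have := hlast (h.legs_a q).2
    cases q
    · simp
    · simp
    · exact (a3' this).elim
    · exact (a2' this).elim
  · exact absurd rfl hne
  · have := hhead (h.legs_b q).1
    cases q
    · exact Or.inl ⟨rfl, Or.inr (Or.inr ⟨hact this, by simp⟩)⟩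
    · exact (b2' this).elim
    · simp
    · exact Or.inr (Or.inr (Or.inr ⟨rfl, b1' k hk this, by simp⟩))
  · rcases h.twoWay_third hπ (by simp) hleg ht with ⟨rfl, h0, -⟩ | ⟨rfl, -⟩
    · exact absurd h0 (by decide)
    · exact (hs.not_on_c H hm hS hπ hk (hlast h.top_c)).elim
  · have := hlast (h.legs_b q).2
    cases q
    · simp
    · exact (b3' this).elim
    · simp
    · exact (b2' this).elim
  · exact absurd rfl hne

end Herd

section Network

variable (N)

namespace SpectralNetwork

theorem strand_rev (s : St) (t : ℝ) : N.strand (N.rev s) (1 - t) = (N.strand s t).swap := by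
  have h1 := N.src_rev s (1 - t)
  have h2 := N.tgt_rev s (1 - t)
  rw [sub_sub_cancel] at h1 h2
  unfold strand
  rw [N.rev_rev]
  rcases le_or_gt t 0 with h | h
  · rw [if_neg (by linarith), if_pos (by linarith), if_pos h]
    cases N.cap s
    · simp [h1, h2]
    · simp only [Option.elim, Prod.swap]
      congr 2 <;> ring_nf
  · rw [if_neg h.not_ge]
    rcases le_or_gt 1 t with h' | h'
    · rw [if_pos (by linarith), if_pos h']
      cases N.cap (N.rev s)
      · simp [h1, h2]
      · simp only [Option.elim, Prod.swap]
        congr 2 <;> ring_nf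
    · rw [if_neg (by linarith), if_neg (by linarith), if_neg (by linarith)]
      simp [h1, h2]

theorem cap_point (σ : Cap π) {t : ℝ} (h0 : t ≠ 0) (h : t ∈ Icc (-1 : ℝ) 1) :
    π (σ.path (-t)) = π (σ.path t) ∧ σ.path (-t) ≠ σ.path t ∧
      π (σ.path t) ∉ branchPoints π := by
  refine ⟨?_, fun e => ?_, ?_⟩
  · rcases le_total 0 t with h' | h'
    · exact σ.symmetric t ⟨h', h.2⟩
    · have := σ.symmetric (-t) ⟨by linarith, by linarith [h.1]⟩
      rw [neg_neg] at this
      exact this.symm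
  · have := σ.injective ⟨by linarith [h.2], by linarith [h.1]⟩ h e
    exact h0 (by linarith)
  · rcases lt_or_gt_of_ne h0 with h' | h'
    · have := σ.symmetric (-t) ⟨by linarith, by linarith [h.1]⟩
      rw [neg_neg] at this
      rw [this]
      exact σ.unbranched _ ⟨by linarith, by linarith [h.1]⟩
    · exact σ.unbranched _ ⟨h', h.2⟩

theorem strand_spec {t : ℝ} (ht : t ∈ N.params s) :
    π (N.strand s t).1 = π (N.strand s t).2 ∧ (N.strand s t).1 ≠ (N.strand s t).2 ∧
      π (N.strand s t).2 ∉ branchPoints π := by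
  unfold strand
  rcases ht with ⟨h0, h1⟩ | ⟨hc, h0, h1⟩ | ⟨hc, h0, h1⟩
  · rw [if_neg h0.not_ge, if_neg h1.not_ge]
    have hI : t ∈ 𝕀 := ⟨h0.le, h1.le⟩
    refine ⟨(N.street s).same_base t hI, (N.street s).distinct t hI, ?_⟩
    rw [← (N.street s).same_base t hI]
    exact (N.street s).unbranched t hI
  · obtain ⟨σ, hσ⟩ := Option.ne_none_iff_exists'.1 hc
    rw [if_pos h1, hσ]
    exact cap_point σ (by linarith) ⟨by linarith, by linarith⟩
  · obtain ⟨σ, hσ⟩ := Option.ne_none_iff_exists'.1 hc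
    rw [if_neg (by linarith), if_pos h0, hσ]
    have := cap_point σ (t := -(2 - t)) (by linarith) ⟨by linarith, by linarith⟩
    rwa [neg_neg] at this

/-- A target curve of a street (`n = 0`), or one half of the cap at its start (`n = -1`) or at
its end (`n = 1`), parametrised by the unit interval. -/
def run (s : St) (n : ℤ) : ℝ → S :=
  if n = 0 then (N.street s).tgt else
    if n < 0 then (N.cap s).elim (N.street s).tgt Cap.path
    else (N.cap (N.rev s)).elim (N.street s).tgt fun σ t => σ.path (t - 1)

/-- The condition under which `run s n` has its meaning. -/
def IsRun (s : St) (n : ℤ) : Prop :=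
  n = 0 ∨ n = -1 ∧ N.cap s ≠ none ∨ n = 1 ∧ N.cap (N.rev s) ≠ none

theorem run_zero (s : St) : N.run s 0 = (N.street s).tgt := if_pos rfl

variable {N}

theorem run_neg_one {σ : Cap π} (h : N.cap s = some σ) : N.run s (-1) = σ.path := by
  simp [run, h]

theorem run_one {σ : Cap π} (h : N.cap (N.rev s) = some σ) :
    N.run s 1 = fun t => σ.path (t - 1) := by
  simp [run, h]

theorem contMDiff_run (s : St) (n : ℤ) : ContMDiff 𝓡 𝓒 1 (N.run s n) := by
  unfold run
  split_ifs
  · exact (N.street s).tgt_smooth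
  · cases N.cap s
    exacts [(N.street s).tgt_smooth, Cap.smooth _]
  · cases N.cap (N.rev s)
    exacts [(N.street s).tgt_smooth, contMDiff_translate (Cap.smooth _) 1]

theorem run_regular {n : ℤ} (h : N.IsRun s n) {t : ℝ} (ht : t ∈ 𝕀) :
    vec (velocity (N.run s n) t) ≠ 0 := by
  rcases h with rfl | ⟨rfl, hc⟩ | ⟨rfl, hc⟩
  · rw [run_zero]
    exact (N.street s).tgt_regular t ht
  · obtain ⟨σ, hσ⟩ := Option.ne_none_iff_exists'.1 hc
    rw [run_neg_one hσ]
    exact σ.regular t ⟨by linarith [ht.1], ht.2⟩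
  · obtain ⟨σ, hσ⟩ := Option.ne_none_iff_exists'.1 hc
    rw [run_one hσ, velocity_translate σ.smooth]
    exact σ.regular _ ⟨by linarith [ht.1], by linarith [ht.2]⟩

theorem run_cases {n : ℤ} (h : N.IsRun s n) {t : ℝ} (ht : t ∈ Ico (0 : ℝ) 1) :
    (t + n ∈ N.params s ∧ N.run s n t = (N.strand s (t + n)).2) ∨
    (n = 0 ∧ t = 0 ∧ N.cap s = none ∧ N.run s n t = (N.street s).tgt 0) ∨
    (n = -1 ∧ t = 0 ∧ ∃ σ, N.cap s = some σ ∧ N.run s n t = σ.path 0) := by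
  obtain ⟨h0, h1⟩ := ht
  rcases h with rfl | ⟨rfl, hc⟩ | ⟨rfl, hc⟩
  · rw [run_zero, Int.cast_zero, add_zero]
    rcases h0.eq_or_lt with rfl | h0
    · rcases hc : N.cap s with _ | σ
      · exact Or.inr (Or.inl (by simp))
      · refine Or.inl ⟨Or.inr (Or.inl ⟨by simp [hc], by norm_num, le_rfl⟩), ?_⟩
        simp only [strand, le_refl, if_true, hc, Option.elim]
        have := congrArg (fun w : Tan S => w.1) (N.cap_tgt s σ hc)
        simp only [velocity_fst] at this
        rw [← this, add_zero]
    · refine Or.inl ⟨Or.inl ⟨h0, h1⟩, ?_⟩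
      rw [strand, if_neg h0.not_ge, if_neg h1.not_ge]
  · obtain ⟨σ, hσ⟩ := Option.ne_none_iff_exists'.1 hc
    rw [run_neg_one hσ]
    push_cast
    rcases h0.eq_or_lt with rfl | h0
    · exact Or.inr (Or.inr (by simp [hσ]))
    · refine Or.inl ⟨Or.inr (Or.inl ⟨hc, by linarith, by linarith⟩), ?_⟩
      rw [strand, if_pos (by linarith), hσ]
      simp
  · obtain ⟨σ, hσ⟩ := Option.ne_none_iff_exists'.1 hc
    rw [run_one hσ]
    push_cast
    refine Or.inl ⟨Or.inr (Or.inr ⟨hc, by linarith, by linarith⟩), ?_⟩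
    rw [strand, if_neg (by linarith), if_pos (by linarith), hσ]
    simp only [Option.elim]
    congr 1
    ring

variable (hN : N.Lawful)
include hN

/-- Runs of two-way streets meet only where they start together at a joint. -/
theorem run_eq (hs : N.TwoWay s) (hs' : N.TwoWay s')
    (hl : N.cap s = none → ∃ v i j, N.leg v i j = some s)
    (hl' : N.cap s' = none → ∃ v i j, N.leg v i j = some s') {n n' : ℤ} (hn : N.IsRun s n)
    (hn' : N.IsRun s' n') {t t' : ℝ} (ht : t ∈ Ico (0 : ℝ) 1) (ht' : t' ∈ Ico (0 : ℝ) 1)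
    (h : N.run s n t = N.run s' n' t') : (s = s' ∧ n = n' ∧ t = t') ∨
      ((n = 0 ∧ t = 0) ∧ (n' = 0 ∧ t' = 0) ∧ ∃ v i i' j, i ≠ i' ∧ N.leg v i j = some s ∧
        N.leg v i' j = some s') := by
  have joint : ∀ {s s' : St} {n : ℤ} {t : ℝ}, (N.cap s' = none → ∃ v i j, N.leg v i j = some s') →
      t + n ∈ N.params s → N.cap s' = none → (N.strand s (t + n)).2 ≠ (N.street s').tgt 0 := by
    intro s s' n t hl' hp hc e
    obtain ⟨v, i, j, hleg⟩ := hl' hc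
    rw [tgt_zero hleg] at e
    have := hN.embedded.2.1 s v _ hp (by
      rw [(N.strand_spec hp).1, e, N.sheet_base v j]; rfl)
    exact this.le_bot ⟨Or.inr rfl, ⟨j, e.symm⟩⟩
  have cap : ∀ σ : Cap π, ∀ {s : St} {n : ℤ} {t : ℝ}, t + n ∈ N.params s →
      (N.strand s (t + n)).2 ≠ σ.path 0 := by
    intro σ s n t hp e
    exact (N.strand_spec hp).2.2 ⟨_, σ.ramified, by rw [e]⟩
  have jc : ∀ σ : Cap π, ∀ {s : St}, (N.street s).tgt 0 ≠ σ.path 0 := by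
    intro σ s e
    refine (N.street s).unbranched 0 zero_mem_I ⟨_, σ.ramified, ?_⟩
    rw [(N.street s).same_base 0 zero_mem_I, e]
  rcases run_cases hn ht with ⟨hp, e⟩ | ⟨rfl, rfl, hc, e⟩ | ⟨rfl, rfl, σ, hσ, e⟩ <;>
  rcases run_cases hn' ht' with ⟨hp', e'⟩ | ⟨rfl, rfl, hc', e'⟩ | ⟨rfl, rfl, σ', hσ', e'⟩ <;>
  rw [e, e'] at h
  · have hb := N.strand_spec hp
    rcases hN.embedded.1 s s' _ hp _ hp' (by rw [hb.1, (N.strand_spec hp').1, h]) with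
      ⟨rfl, ht0⟩ | ⟨rfl, ht0⟩ | hd
    · refine Or.inl ⟨rfl, ?_⟩
      have h1 := ht.1; have h2 := ht.2; have h3 := ht'.1; have h4 := ht'.2
      have : n = n' := by
        have a : (n : ℝ) < n' + 1 := by linarith
        have b : (n' : ℝ) < n + 1 := by linarith
        norm_cast at a b
        omega
      subst this
      exact ⟨rfl, by linarith⟩
    · rw [ht0, strand_rev] at h
      exact absurd h.symm hb.2.1
    · exact absurd (Or.inr h) (disjoint_left.1 hd (Or.inr rfl))
  · exact absurd h (joint hl' hp hc')
  · exact absurd h (cap σ' hp)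
  · exact absurd h.symm (joint hl hp' hc)
  · obtain ⟨v, i, j, hv⟩ := hl hc
    obtain ⟨v', i', j', hv'⟩ := hl' hc'
    rw [tgt_zero hv, tgt_zero hv'] at h
    have hpt : N.pt v = N.pt v' := by
      rw [pt, pt, ← N.sheet_base v j, ← N.sheet_base v' j', h]
    rcases hN.embedded.2.2 v v' hpt with rfl | hd
    · obtain rfl := N.sheet_injective v h
      by_cases hi : i = i'
      · subst hi
        rw [hv] at hv'
        exact Or.inl ⟨Option.some.inj hv', rfl, rfl⟩
      · exact Or.inr ⟨⟨rfl, rfl⟩, ⟨rfl, rfl⟩, v, i, i', j, hi, hv, hv'⟩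
    · exact absurd h (disjoint_range_iff.1 hd _ _)
  · exact absurd h (jc σ')
  · exact absurd h.symm (cap σ hp')
  · exact absurd h.symm (jc σ)
  · exact Or.inl ⟨hN.branchRule.1 s s' σ σ' hσ hσ'
      (by rw [Cap.branchPoint, Cap.branchPoint, h]) hs hs', rfl, rfl⟩

/-- A run of a street meets a joint only where it starts there. -/
theorem run_eq_sheet (hl : N.cap s = none → ∃ v i j, N.leg v i j = some s) {n : ℤ}
    (hn : N.IsRun s n) {t : ℝ} (ht : t ∈ Ico (0 : ℝ) 1) {j : Fin 3}
    (h : N.run s n t = N.sheet v j) : n = 0 ∧ t = 0 ∧ ∃ i, N.leg v i j = some s := by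
  rcases run_cases hn ht with ⟨hp, e⟩ | ⟨rfl, rfl, hc, e⟩ | ⟨rfl, rfl, σ, hσ, e⟩ <;> rw [e] at h
  · have := hN.embedded.2.1 s v _ hp (by
      rw [(N.strand_spec hp).1, h, N.sheet_base v j]; rfl)
    exact absurd ⟨j, h.symm⟩ (disjoint_left.1 this (Or.inr rfl))
  · obtain ⟨v', i, j', hv⟩ := hl hc
    rw [tgt_zero hv] at h
    have hpt : N.pt v = N.pt v' := by
      rw [pt, pt, ← N.sheet_base v j, ← N.sheet_base v' j', h]
    rcases hN.embedded.2.2 v v' hpt with rfl | hd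
    · obtain rfl := N.sheet_injective v h
      exact ⟨rfl, rfl, i, hv⟩
    · exact absurd h.symm (disjoint_range_iff.1 hd _ _)
  · exact absurd ⟨_, σ.ramified, by rw [h]⟩ (sheet_unbranched N v j)

omit hN in
/-- The base point of a run of a street is a branch point or belongs to the street. -/
theorem run_mem_trace {n : ℤ} (hn : N.IsRun s n) {t : ℝ} (ht : t ∈ Ico (0 : ℝ) 1)
    (hb : π (N.run s n t) ∉ branchPoints π) : π (N.run s n t) ∈ N.trace s := by
  rcases run_cases hn ht with ⟨hp, e⟩ | ⟨rfl, rfl, hc, e⟩ | ⟨rfl, rfl, σ, hσ, e⟩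
  · exact Or.inr ⟨_, hp, by rw [e]; exact (N.strand_spec hp).1⟩
  · rw [e, ← (N.street s).same_base 0 zero_mem_I]
    exact N.mem_trace zero_mem_I
  · exact absurd ⟨_, σ.ramified, by rw [e]⟩ hb

end SpectralNetwork

end Network

/-- A smooth increasing function with prescribed derivatives at the ends of an interval. -/
theorem exists_spline {c₀ c₁ : ℝ} (h₀ : 0 < c₀) (h₁ : 0 < c₁) : ∃ y y' : ℝ → ℝ,
    ContDiff ℝ 1 y ∧ (∀ t, HasDerivAt y (y' t) t) ∧ y 0 = -1 ∧ y 1 = 1 ∧ y' 0 = c₀ ∧ y' 1 = c₁ ∧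
      ∀ t ∈ 𝕀, 0 < y' t := by
  obtain ⟨k, hk⟩ := exists_nat_gt (c₀ + c₁)
  have hk' : (0 : ℝ) < k + 1 := by positivity
  set c : ℝ := (2 * (k + 3) - c₀ - c₁) / (k + 1) with hc
  have hcpos : 0 < c := div_pos (by linarith) hk'
  refine ⟨fun t => -1 + c * t + (c₀ - c) * (1 - (1 - t) ^ (k + 3)) / (k + 3) +
    (c₁ - c) * t ^ (k + 3) / (k + 3), fun t => c + (c₀ - c) * (1 - t) ^ (k + 2) +
    (c₁ - c) * t ^ (k + 2), by fun_prop, fun t => ?_, by simp, ?_, by simp, by simp,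
    fun t ht => ?_⟩
  · have h1 := ((((hasDerivAt_id t).const_sub 1).pow (k + 3)).const_sub 1).const_mul (c₀ - c)
    have h2 := ((hasDerivAt_id t).pow (k + 3)).const_mul (c₁ - c)
    have h3 := ((((hasDerivAt_id t).const_mul c).const_add (-1)).add
      (h1.div_const (k + 3 : ℝ))).add (h2.div_const (k + 3 : ℝ))
    refine h3.congr_deriv ?_
    simp only [id]
    push_cast
    field_simp
  · simp only [sub_self, one_pow]
    rw [zero_pow (by omega), hc]
    field_simp
    ring
  · have e1 : (1 - t) ^ (k + 2) ≤ 1 - t :=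
      pow_le_of_le_one (by linarith [ht.2]) (by linarith [ht.1]) (by omega)
    have e2 : t ^ (k + 2) ≤ t := pow_le_of_le_one ht.1 ht.2 (by omega)
    have e3 : 0 ≤ (1 - t) ^ (k + 2) := pow_nonneg (by linarith [ht.2]) _
    have e4 : 0 ≤ t ^ (k + 2) := pow_nonneg ht.1 _
    have e5 : 0 < (1 - t) ^ (k + 2) ∨ 0 < t ^ (k + 2) := by
      rcases ht.1.eq_or_lt with rfl | h
      · left; norm_num
      · right; positivity
    have := mul_nonneg hcpos.le (show (0 : ℝ) ≤ 1 - (1 - t) ^ (k + 2) - t ^ (k + 2) by linarith)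
    rcases e5 with e5 | e5
    · nlinarith [mul_pos h₀ e5, mul_nonneg h₁.le e4]
    · nlinarith [mul_pos h₁ e5, mul_nonneg h₀.le e3]

namespace Arm

/-- The side to which a bridge bends at first. -/
def eps : Arm → ℝ
  | a | a' => 1 | b | b' => -1

/-- Whether an arm runs up or down. -/
def sgn : Arm → ℝ
  | a | b => 1 | a' | b' => -1

end Arm

/-- The points of an S-shaped curve from the bottom to the top of a horse, by height. -/
def bridgePt (ε y : ℝ) : ℂ := (ε * (y * (y ^ 2 - 1) / 2) : ℝ) + y * Complex.I

/-- The tangent vectors of this curve. -/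
def bridgeDir (ε y : ℝ) : ℂ := (ε * ((3 * y ^ 2 - 1) / 2) : ℝ) + Complex.I

theorem hasDerivAt_bridgePt (ε : ℝ) {y : ℝ → ℝ} {y' t : ℝ} (h : HasDerivAt y y' t) :
    HasDerivAt (fun t => bridgePt ε (y t)) (y' * bridgeDir ε (y t)) t := by
  have h1 : HasDerivAt (fun t => ε * (y t * (y t ^ 2 - 1) / 2))
      (ε * ((3 * y t ^ 2 - 1) / 2) * y') t := by
    refine (((h.mul ((h.pow 2).sub_const 1)).div_const 2).const_mul ε).congr_deriv ?_
    simp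
    ring
  refine (h1.ofReal_comp.add (h.ofReal_comp.mul_const Complex.I)).congr_deriv ?_
  rw [bridgeDir]
  push_cast
  ring

theorem bridgePt_im (ε y : ℝ) : (bridgePt ε y).im = y := by
  simp only [bridgePt, Complex.add_im, Complex.ofReal_im, Complex.mul_im, Complex.ofReal_re,
    Complex.I_im, Complex.I_re]
  ring

theorem bridgePt_re (ε y : ℝ) : (bridgePt ε y).re = ε * (y * (y ^ 2 - 1) / 2) := by
  simp only [bridgePt, Complex.add_re, Complex.mul_re, Complex.ofReal_im, Complex.ofReal_re,
    Complex.I_im, Complex.I_re]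
  ring

theorem bridgeDir_im (ε y : ℝ) : (bridgeDir ε y).im = 1 := by
  simp only [bridgeDir, Complex.add_im, Complex.ofReal_im, Complex.I_im, zero_add]

section Horse

variable (N φ J) in
/-- The parametrisation by height of a curve that continues an arm through a horse. -/
structure Bridge (x : Arm) where
  y : ℝ → ℝ
  y' : ℝ → ℝ
  smooth : ContDiff ℝ 1 y
  deriv : ∀ t, HasDerivAt y (y' t) t
  y_zero : y 0 = -x.sgn
  y_one : y 1 = x.sgn
  pos : ∀ t ∈ 𝕀, 0 < x.sgn * y' t
  start : N.dirCoord φ (J x.tip) x.i x.j = y' 0 * (x.eps + Complex.I)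
  finish : N.dirCoord φ (J x.op.tip) x.i x.j = y' 1 * (x.eps + Complex.I)

variable (h : IsHorse N φ J L) (hπ : IsSimpleBranchedCover π K)

include h hπ in
theorem IsHorse.nonempty_bridge (x : Arm) : Nonempty (Bridge N φ J x) := by
  have key : ∀ q, ∃ c : ℝ, 0 < c ∧
      N.dirCoord φ (J q) x.i x.j = ((x.sgn * c : ℝ) : ℂ) * (x.eps + Complex.I) := by
    intro q
    obtain ⟨c, hc, ha⟩ := h.dirCoord_a hπ q
    obtain ⟨d, hd, hb⟩ := h.dirCoord_b hπ q
    cases x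
    · exact ⟨c, hc, by simp [Arm.i, Arm.j, Arm.sgn, Arm.eps, ha]⟩
    · exact ⟨d, hd, by simp [Arm.i, Arm.j, Arm.sgn, Arm.eps, hb]⟩
    · refine ⟨c, hc, ?_⟩
      rw [Arm.i, Arm.j, N.dirCoord_swap, ha]
      simp [Arm.sgn, Arm.eps]
    · refine ⟨d, hd, ?_⟩
      rw [Arm.i, Arm.j, N.dirCoord_swap, hb]
      simp [Arm.sgn, Arm.eps]
  obtain ⟨c₀, h₀, e₀⟩ := key x.tip
  obtain ⟨c₁, h₁, e₁⟩ := key x.op.tip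
  obtain ⟨y, y', hy, hd, y0, y1, d0, d1, hp⟩ := exists_spline h₀ h₁
  have hs : x.sgn * x.sgn = 1 := by cases x <;> simp [Arm.sgn]
  exact ⟨⟨fun t => x.sgn * y t, fun t => x.sgn * y' t, contDiff_const.mul hy,
    fun t => (hd t).const_mul _, by rw [y0]; ring, by rw [y1]; ring,
    fun t ht => by rw [← mul_assoc, hs, one_mul]; exact hp t ht, by rw [e₀, d0], by rw [e₁, d1]⟩⟩

omit [IsManifold 𝓒 ∞ C] in
theorem Bridge.sgn_mul_strictMonoOn {x : Arm} (B : Bridge N φ J x) :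
    StrictMonoOn (fun t => x.sgn * B.y t) (Icc 0 1) := by
  refine strictMonoOn_of_deriv_pos (convex_Icc 0 1)
    (continuousOn_const.mul B.smooth.continuous.continuousOn) fun t ht => ?_
  rw [((B.deriv t).const_mul x.sgn).deriv]
  exact B.pos t (interior_subset ht)

theorem Bridge.injOn {x : Arm} (B : Bridge N φ J x) : InjOn B.y (Icc 0 1) :=
  fun t ht t' ht' e => B.sgn_mul_strictMonoOn.injOn ht ht' (by simp only [e])

theorem Bridge.mem_Ioo {x : Arm} (B : Bridge N φ J x) {t : ℝ} (ht : t ∈ Ioo (0 : ℝ) 1) :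
    B.y t ∈ Ioo (-1 : ℝ) 1 := by
  have h0 := B.sgn_mul_strictMonoOn zero_mem_I ⟨ht.1.le, ht.2.le⟩ ht.1
  have h1 := B.sgn_mul_strictMonoOn ⟨ht.1.le, ht.2.le⟩ one_mem_I ht.2
  simp only [B.y_zero, B.y_one] at h0 h1
  cases x <;> simp only [Arm.sgn] at h0 h1 <;> constructor <;> linarith

theorem Bridge.exists_zero {x : Arm} (B : Bridge N φ J x) : ∃ t ∈ Ioo (0 : ℝ) 1, B.y t = 0 := by
  have hc : ContinuousOn (fun t => x.sgn * B.y t) (Icc 0 1) :=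
    continuousOn_const.mul B.smooth.continuous.continuousOn
  have := intermediate_value_Ioo zero_le_one hc
  simp only [B.y_zero, B.y_one] at this
  have hs : x.sgn * x.sgn = 1 := by cases x <;> simp [Arm.sgn]
  rw [mul_neg, hs] at this
  obtain ⟨t, ht, e⟩ := this (show (0 : ℝ) ∈ Ioo (-1) 1 by norm_num)
  refine ⟨t, ht, (mul_eq_zero.1 e).resolve_left fun h0 => ?_⟩
  rw [h0, zero_mul] at hs
  exact zero_ne_one hs

/-- The bridge on the sheet of the targets of the arm. -/
def Bridge.curve {x : Arm} (B : Bridge N φ J x) (Y : HorseSheets N φ J) (t : ℝ) : S :=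
  Y.σ x.j (bridgePt x.eps (B.y t))

theorem Bridge.pt_zero {x : Arm} (B : Bridge N φ J x) :
    bridgePt x.eps (B.y 0) = x.tip.pos ∧ bridgeDir x.eps (B.y 0) = x.eps + Complex.I := by
  rw [B.y_zero]
  cases x <;> simp [bridgePt, bridgeDir, Arm.sgn, Arm.tip, Arm.eps, HorseJoint.pos] <;> norm_num

theorem Bridge.pt_one {x : Arm} (B : Bridge N φ J x) :
    bridgePt x.eps (B.y 1) = x.op.tip.pos ∧ bridgeDir x.eps (B.y 1) = x.eps + Complex.I := by
  rw [B.y_one]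
  cases x <;> simp [bridgePt, bridgeDir, Arm.sgn, Arm.tip, Arm.op, Arm.eps, HorseJoint.pos] <;>
    norm_num

variable (Y : HorseSheets N φ J)

include h

theorem HorseSheets.mem_source (i : Fin 3) (w : ℂ) : π (Y.σ i w) ∈ φ.source := by
  rw [Y.base]
  exact φ.map_target (h.disk ▸ mem_univ w)

theorem HorseSheets.coord (i : Fin 3) (w : ℂ) : φ (π (Y.σ i w)) = w := by
  rw [Y.base]
  exact φ.right_inv (h.disk ▸ mem_univ w)

include hπ

theorem HorseSheets.σ_inj [T2Space S] {i j : Fin 3} {w w' : ℂ} (e : Y.σ i w = Y.σ j w') :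
    w = w' ∧ i = j := by
  have hw : w = w' := by rw [← Y.coord h i w, e, Y.coord h]
  subst hw
  refine ⟨rfl, N.sheet_injective (J .bot) ?_⟩
  rw [← Y.joint, ← Y.joint]
  exact hπ.lift_unique isPreconnected_univ (Y.continuous i).continuousOn
    (Y.continuous j).continuousOn (fun y _ => by rw [Y.base, Y.base])
    (fun y _ => h.source_unbranched (Y.mem_source h i y)) (mem_univ w) e _ (mem_univ _)

/-- The velocity of a curve on a sheet over the disk of a horse. -/
theorem HorseSheets.velocity_comp (i : Fin 3) {w : ℝ → ℂ} (hw : ContDiff ℝ 1 w) {w' : ℂ} {t : ℝ}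
    (hd : HasDerivAt w w' t) : ContMDiffAt 𝓡 𝓒 1 (fun t => Y.σ i (w t)) t ∧
      velocity (fun t => Y.σ i (w t)) t =
        tan (Y.σ i (w t)) (liftCoord π φ (Y.σ i (w t)) w') := by
  have hF : ContMDiffAt 𝓒 𝓒 1 φ.symm (w t) :=
    (orientedCharts.contMDiffAt_symm h.chart (h.disk ▸ mem_univ (w t))).of_le (by simp)
  obtain ⟨hs, hp⟩ := hπ.lift_smooth (Y.continuous i) (Y.base i) (w := w t)
    (by rw [← Y.base i]; exact h.source_unbranched (Y.mem_source h i _)) hF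
  have hwm : ContMDiffAt 𝓡 𝓒 1 w t := hw.contMDiff t
  refine ⟨hs.comp t hwm, ?_⟩
  have hwd := hwm.mdifferentiableAt one_ne_zero
  rw [velocity_push (hs.mdifferentiableAt one_ne_zero) hwd]
  have : velocity w t = tan (w t) w' := by
    rw [← (hasDerivAt_of_velocity hwd).unique hd]
    exact (tan_vec _).symm
  rw [this, hp, liftTan, liftCoord, Y.coord h]
  rfl

namespace Bridge

variable {x : Arm} (B : Bridge N φ J x)

theorem velocity_curve (t : ℝ) : ContMDiffAt 𝓡 𝓒 1 (B.curve Y) t ∧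
    velocity (B.curve Y) t = tan (B.curve Y t)
      (liftCoord π φ (B.curve Y t) (B.y' t * bridgeDir x.eps (B.y t))) := by
  refine Y.velocity_comp h hπ x.j ?_ (hasDerivAt_bridgePt x.eps (B.deriv t))
  have := B.smooth
  unfold bridgePt
  exact (Complex.ofRealCLM.contDiff.comp (contDiff_const.mul (by fun_prop))).add
    ((Complex.ofRealCLM.contDiff.comp B.smooth).mul contDiff_const)

theorem contMDiff_curve : ContMDiff 𝓡 𝓒 1 (B.curve Y) :=
  fun t => (B.velocity_curve h hπ Y t).1

theorem cvec_curve (t : ℝ) :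
    cvec φ π (velocity (B.curve Y) t) = B.y' t * bridgeDir x.eps (B.y t) := by
  rw [(B.velocity_curve h hπ Y t).2]
  exact cvec_liftCoord hπ h.chart (Y.mem_source h _ _)
    (h.source_unbranched (Y.mem_source h _ _)) _

omit h hπ in
theorem y'_ne_zero {t : ℝ} (ht : t ∈ 𝕀) : B.y' t ≠ 0 := fun e => by
  have := B.pos t ht
  rw [e, mul_zero] at this
  exact this.false

theorem cvec_im {t : ℝ} (ht : t ∈ 𝕀) :
    (cvec φ π (velocity (B.curve Y) t)).im ≠ 0 := by
  rw [B.cvec_curve h hπ Y, Complex.im_ofReal_mul, bridgeDir_im, mul_one]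
  exact B.y'_ne_zero ht

theorem regular {t : ℝ} (ht : t ∈ 𝕀) : vec (velocity (B.curve Y) t) ≠ 0 := fun e => by
  refine B.cvec_im h hπ Y ht ?_
  simp [cvec, e]

omit hπ in
theorem liftCoord_dirCoord (q : HorseJoint) (i j k : Fin 3) :
    liftCoord π φ (N.sheet (J q) k) (N.dirCoord φ (J q) i j) =
      liftVec π (N.sheet (J q) k) (N.dir (J q) i j) := by
  have hq : φ (π (N.sheet (J q) k)) = q.pos := h.joint_coord q k
  have hp : φ.symm q.pos = N.pt (J q) := by
    rw [← h.joint_pos q, φ.left_inv (h.joint_mem q)]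
  have := (der_comp_symm h.chart (y := q.pos) (h.disk ▸ mem_univ _)).2
  rw [hp] at this
  rw [liftCoord, hq, dirCoord, ContinuousLinearMap.comp_apply]
  exact congrArg _ (congrArg (fun A : ℂ →L[ℝ] ℂ => A (N.dir (J q) i j)) this)

theorem velocity_zero : velocity (B.curve Y) 0 = tan (N.sheet (J x.tip) x.j)
    (liftVec π (N.sheet (J x.tip) x.j) (N.dir (J x.tip) x.i x.j)) := by
  have : B.curve Y 0 = N.sheet (J x.tip) x.j := by rw [curve, B.pt_zero.1, Y.joint]
  rw [(B.velocity_curve h hπ Y 0).2, this, B.pt_zero.2, ← B.start, liftCoord_dirCoord h]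

theorem velocity_one : velocity (B.curve Y) 1 = tan (N.sheet (J x.op.tip) x.j)
    (liftVec π (N.sheet (J x.op.tip) x.j) (N.dir (J x.op.tip) x.i x.j)) := by
  have : B.curve Y 1 = N.sheet (J x.op.tip) x.j := by rw [curve, B.pt_one.1, Y.joint]
  rw [(B.velocity_curve h hπ Y 1).2, this, B.pt_one.2, ← B.finish, liftCoord_dirCoord h]

theorem cls_curve : cls (dirArc (velocity (B.curve Y)) 0 1) =
    Y.k x.j x.op.tip.pos (N.dirCoord φ (J x.op.tip) x.i x.j) -
      Y.k x.j x.tip.pos (N.dirCoord φ (J x.tip) x.i x.j) := by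
  have := Y.cls_dirArc_sheet h hπ (i := x.j) (a := 0) (b := 1)
    (continuousOn_velocity fun t _ => B.contMDiff_curve h hπ Y t)
    (p := fun t => bridgePt x.eps (B.y t)) (fun t _ => rfl)
    (fun t _ => B.cvec_curve h hπ Y t) (fun t ht => Or.inr ?_)
  · rw [this, B.pt_zero.1, B.pt_one.1, B.pt_zero.2, B.pt_one.2, ← B.start, ← B.finish]
  · rw [uIcc_of_le zero_le_one] at ht
    rw [← B.cvec_curve h hπ Y]
    exact B.cvec_im h hπ Y ht

end Bridge

end Horse

/-- The pieces of the loops of a herd. -/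
inductive Piece (St : Type*)
  | run (s : St) (n : ℤ)
  | bridge (x : Arm)

namespace Herd

variable {m : ℕ} (H : Herd N m)

/-- The data from which the loops of a herd are made: sheets and bridges over the last horse, and
the streets at the caps. -/
structure LoopData where
  sheets : HorseSheets N (H.chart m) (H.joint m)
  bridge : ∀ x, Bridge N (H.chart m) (H.joint m) x
  first : Arm → St
  head_arm : ∀ x, (H.arm x).head? = some (first x)
  cap_first : ∀ x, N.cap (first x) = some (H.source x.index)

theorem nonempty_loopData [T2Space S] [T2Space C] (hπ : IsSimpleBranchedCover π K) (hm : 1 ≤ m) :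
    Nonempty H.LoopData := by
  have h := H.horse m ⟨hm, le_rfl⟩
  choose f hf hc using H.arm_head hm
  exact ⟨⟨(h.nonempty_sheets hπ).some, fun x => (h.nonempty_bridge hπ x).some, f, hf, hc⟩⟩

variable {H} (D : H.LoopData)

namespace LoopData

/-- The curves of the pieces. -/
def curve : Piece St → ℝ → S
  | .run s n => N.run s n
  | .bridge x => (D.bridge x).curve D.sheets

/-- Half of a loop: up an arm, across the bridge, and down the opposite arm to its cap. -/
def half (x : Arm) : List (Piece St) :=
  (H.arm x).map (Piece.run · 0) ++ .bridge x :: ((N.revList (H.arm x.op)).map (Piece.run · 0) ++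
    [.run (N.rev (D.first x.op)) 1, .run (D.first x.op) (-1)])

/-- A closed loop through two opposite arms. -/
def loop (x : Arm) : List (Piece St) := D.half x ++ D.half x.op

theorem first_mem (x : Arm) : D.first x ∈ H.arm x := List.mem_of_mem_head? (D.head_arm x)

theorem mem_half {x : Arm} {p : Piece St} : p ∈ D.half x ↔ (∃ s ∈ H.arm x, p = .run s 0) ∨
    p = .bridge x ∨ (∃ s, N.rev s ∈ H.arm x.op ∧ p = .run s 0) ∨
    p = .run (N.rev (D.first x.op)) 1 ∨ p = .run (D.first x.op) (-1) := by
  simp only [half, List.mem_append, List.mem_map, List.mem_cons, mem_revList, List.not_mem_nil,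
    or_false]
  simp only [eq_comm (a := p)]

theorem mem_loop {x : Arm} {p : Piece St} (hp : p ∈ D.loop x) : (∃ y, (y = x ∨ y = x.op) ∧
    p = .bridge y) ∨ ∃ s n y, (y = x ∨ y = x.op) ∧ N.On (H.arm y) s ∧ N.IsRun s n ∧
      p = .run s n := by
  obtain ⟨y, hy, hp⟩ : ∃ y, (y = x ∨ y = x.op) ∧ p ∈ D.half y := by
    rcases List.mem_append.1 hp with hp | hp
    exacts [⟨x, Or.inl rfl, hp⟩, ⟨x.op, Or.inr rfl, hp⟩]
  have hy' : y.op = x ∨ y.op = x.op := by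
    rcases hy with rfl | rfl
    exacts [Or.inr rfl, Or.inl x.op_op]
  rcases (D.mem_half).1 hp with ⟨s, hs, rfl⟩ | rfl | ⟨s, hs, rfl⟩ | rfl | rfl
  · exact Or.inr ⟨s, 0, y, hy, Or.inl hs, Or.inl rfl, rfl⟩
  · exact Or.inl ⟨y, hy, rfl⟩
  · exact Or.inr ⟨s, 0, y.op, hy', Or.inr hs, Or.inl rfl, rfl⟩
  · refine Or.inr ⟨_, _, y.op, hy', N.on_rev.2 (Or.inl (D.first_mem _)),
      Or.inr (Or.inr ⟨rfl, ?_⟩), rfl⟩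
    rw [N.rev_rev, D.cap_first]
    simp
  · refine Or.inr ⟨_, _, y.op, hy', Or.inl (D.first_mem _), Or.inr (Or.inl ⟨rfl, ?_⟩), rfl⟩
    rw [D.cap_first]
    simp

theorem bridge_mem (x : Arm) : .bridge x ∈ D.half x := D.mem_half.2 (Or.inr (Or.inl rfl))

theorem run_mem {x : Arm} (h : s ∈ H.arm x) : .run s 0 ∈ D.half x :=
  D.mem_half.2 (Or.inl ⟨s, h, rfl⟩)

theorem run_rev_mem {x : Arm} (h : N.rev s ∈ H.arm x) : .run s 0 ∈ D.half x.op :=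
  D.mem_half.2 (Or.inr (Or.inr (Or.inl ⟨s, by rwa [Arm.op_op], rfl⟩)))

variable (hm : 1 ≤ m)

include hm

theorem half_chain (h : IsHorse N (H.chart m) (H.joint m) (H.street m))
    (hπ : IsSimpleBranchedCover π K) (x : Arm) :
    (D.half x ++ [Piece.run (D.first x.op) 0]).IsChain fun p p' =>
      velocity (D.curve p) 1 = velocity (D.curve p') 0 := by
  have hc : ∀ {L : List St}, L.IsChain N.Continues →
      (L.map (Piece.run · 0)).IsChain fun p p' =>
        velocity (D.curve p) 1 = velocity (D.curve p') 0 := by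
    intro L hL
    rw [List.isChain_map]
    refine hL.imp fun s s' hs => ?_
    simp only [curve, run_zero]
    exact hs.velocity_tgt
  obtain ⟨s, hs, hleg⟩ := H.arm_last hm x
  obtain ⟨s', hs', hleg'⟩ := H.arm_last hm x.op
  have hcap := D.cap_first x.op
  have hcap' : N.cap (N.rev (N.rev (D.first x.op))) = some (H.source x.op.index) := by
    rw [N.rev_rev, hcap]
  have v1 : velocity (N.run (N.rev (D.first x.op)) 1) = fun t =>
      velocity (H.source x.op.index).path (t - 1) := by
    rw [run_one hcap']
    exact funext fun t => velocity_translate (Cap.smooth _) 1 t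
  have e1 : velocity (N.street s).tgt 1 = velocity ((D.bridge x).curve D.sheets) 0 := by
    have := velocity_tgt_one hleg
    rw [N.rev_rev] at this
    rw [this, Bridge.velocity_zero h hπ]
  have e2 : velocity ((D.bridge x).curve D.sheets) 1 = velocity (N.street (N.rev s')).tgt 0 := by
    rw [N.leg_tgt _ _ _ _ hleg', Bridge.velocity_one h hπ, Arm.op_i, Arm.op_j]
  have e3 : velocity (N.street (N.rev (D.first x.op))).tgt 1 =
      velocity (N.run (N.rev (D.first x.op)) 1) 0 := by
    simp only [v1, velocity_tgt_rev, sub_self, zero_sub]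
    exact (N.cap_src _ _ hcap).symm
  have e4 : velocity (N.run (N.rev (D.first x.op)) 1) 1 =
      velocity (N.run (D.first x.op) (-1)) 0 := by
    simp only [v1, run_neg_one hcap, sub_self]
  have e5 : velocity (N.run (D.first x.op) (-1)) 1 = velocity (N.street (D.first x.op)).tgt 0 := by
    rw [run_neg_one hcap]
    exact N.cap_tgt _ _ hcap
  have hr : (N.revList (H.arm x.op)).head? = some (N.rev s') := by rw [head?_revList, hs']; rfl
  have hr' : (N.revList (H.arm x.op)).getLast? = some (N.rev (D.first x.op)) := by
    rw [getLast?_revList, D.head_arm]; rfl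
  rw [half, List.append_assoc, List.cons_append, List.isChain_append]
  refine ⟨hc (H.arm_chain hm x), ?_, ?_⟩
  · rw [List.isChain_cons, List.append_assoc]
    refine ⟨?_, ?_⟩
    · rw [List.head?_append, List.head?_map, hr]
      simpa [curve, run_zero] using e2
    · rw [List.isChain_append]
      refine ⟨hc (chain_revList (H.arm_chain hm x.op)), by simp [curve, run_zero, e4, e5], ?_⟩
      rw [List.getLast?_map, hr']
      simpa [curve, run_zero] using e3
  · rw [List.getLast?_map, hs]
    simpa [curve, run_zero] using e1

theorem loop_head (x : Arm) : ∃ l, D.loop x = .run (D.first x) 0 :: l := by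
  have := D.head_arm x
  rcases e : H.arm x with _ | ⟨s, l⟩
  · simp [e] at this
  · rw [e] at this
    simp only [List.head?_cons, Option.some.injEq] at this
    subst this
    rw [loop, half, e]
    exact ⟨_, rfl⟩

theorem loop_chain (h : IsHorse N (H.chart m) (H.joint m) (H.street m))
    (hπ : IsSimpleBranchedCover π K) (x : Arm) (hP : D.loop x ≠ []) :
    (D.loop x ++ [(D.loop x).head hP]).IsChain fun p p' =>
      velocity (D.curve p) 1 = velocity (D.curve p') 0 := by
  obtain ⟨l, hl⟩ := D.loop_head hm x
  have hx : (D.loop x).head hP = .run (D.first x) 0 := by simp [hl]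
  obtain ⟨l', hl'⟩ : ∃ l', D.half x.op = .run (D.first x.op) 0 :: l' := by
    have := D.head_arm x.op
    rcases e : H.arm x.op with _ | ⟨s, l⟩
    · simp [e] at this
    · rw [e] at this
      simp only [List.head?_cons, Option.some.injEq] at this
      subst this
      rw [half, e]
      exact ⟨_, rfl⟩
  have h1 := D.half_chain hm h hπ x
  have h2 := D.half_chain hm h hπ x.op
  rw [Arm.op_op] at h2
  rw [hx, loop, List.append_assoc, List.isChain_append]
  rw [List.isChain_append] at h1
  refine ⟨h1.1, h2, fun p hp p' hp' => h1.2.2 p hp p' ?_⟩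
  rw [hl'] at hp'
  simpa using hp'

variable [T2Space C] (hS : N.SixWayStreets) (hπ : IsSimpleBranchedCover π K)

include hS hπ

theorem arm_disjoint {x y : Arm} (hs : s ∈ H.arm x) :
    (s ∈ H.arm y → x = y) ∧ N.rev s ∉ H.arm y :=
  ⟨fun h => H.arm_eq_of_mem_line hm (H.mem_line_of_mem_arm hm hs) (H.mem_line_of_mem_arm hm h),
    fun h => H.rev_notMem_line hS hπ hm y x s (H.mem_line_of_mem_arm hm hs)
      (H.mem_line_of_mem_arm hm h)⟩

theorem eq_of_on {x y : Arm} (hx : N.On (H.arm x) s) (hy : N.On (H.arm y) s) : x = y := by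
  rcases hx with hx | hx <;> rcases hy with hy | hy
  · exact (arm_disjoint hm hS hπ hx).1 hy
  · exact absurd hy (arm_disjoint hm hS hπ hx).2
  · exact absurd hx (arm_disjoint hm hS hπ hy).2
  · exact (arm_disjoint hm hS hπ hx).1 hy

theorem loop_nodup (x : Arm) : (D.loop x).Nodup := by
  have inj : Function.Injective (fun s : St => Piece.run s 0) := fun s s' h => by simpa using h
  have hr : ∀ y, (N.revList (H.arm y)).Nodup := fun y => by
    rw [revList, List.nodup_reverse]
    exact (H.arm_nodup hm y).map fun s s' h => by rw [← N.rev_rev s, h, N.rev_rev]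
  have half_nodup : ∀ y, (D.half y).Nodup := by
    intro y
    rw [half, List.nodup_append', List.nodup_cons, List.nodup_append']
    refine ⟨(H.arm_nodup hm y).map inj, ⟨by simp, (hr _).map inj, by simp, ?_⟩, ?_⟩
    · intro p hp hp'
      simp only [List.mem_map] at hp
      obtain ⟨s, -, rfl⟩ := hp
      simp at hp'
    · intro p hp hp'
      simp only [List.mem_map] at hp
      obtain ⟨s, hs, rfl⟩ := hp
      simp [mem_revList, (arm_disjoint hm hS hπ hs).2] at hp'
  rw [loop, List.nodup_append']
  refine ⟨half_nodup x, half_nodup x.op, fun p hp hp' => ?_⟩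
  have hne := x.op_ne
  rcases D.mem_half.1 hp with ⟨s, hs, rfl⟩ | rfl | ⟨s, hs, rfl⟩ | rfl | rfl <;>
  rcases D.mem_half.1 hp' with ⟨s', hs', e⟩ | e | ⟨s', hs', e⟩ | e | e <;> simp at e
  · subst e
    exact hne ((arm_disjoint hm hS hπ hs).1 hs').symm
  · subst e
    rw [Arm.op_op] at hs'
    exact (arm_disjoint hm hS hπ hs).2 hs'
  · exact hne e.symm
  · subst e
    have := (arm_disjoint (y := x.op) hm hS hπ hs').2
    exact this hs
  · subst e
    rw [Arm.op_op] at hs'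
    exact hne ((arm_disjoint hm hS hπ hs).1 hs')
  · have := N.rev_rev (D.first x.op)
    rw [e, N.rev_rev, Arm.op_op] at this
    exact hne.symm ((arm_disjoint (y := x.op) hm hS hπ (D.first_mem x)).1
      (this ▸ D.first_mem x.op))
  · rw [Arm.op_op] at e
    exact hne.symm ((arm_disjoint (y := x.op) hm hS hπ (D.first_mem x)).1
      (e ▸ D.first_mem x.op))

end LoopData

end Herd

/-- The streets other than `c` in the coordinate of a horse stay outside of a square or on its
upper sides. -/
theorem HorseStreet.fig_bound {m : ℕ} (hc : p ≠ .c) (ha : p.Active m m) {w : ℂ}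
    (hw : w ∈ p.fig) : 1 ≤ |w.im| ∨ |w.re| = 1 - w.im := by
  obtain ⟨r, hr, rfl⟩ := mem_fig.1 hw
  cases p <;> simp [base, d, R, HorseStreet.Active] at hr ha hc ⊢
  · left; rw [abs_of_nonpos (by linarith)]; linarith
  · left; rw [abs_of_nonpos (by linarith)]; linarith
  · left; rw [abs_of_nonneg (by linarith)]; linarith
  · right; rw [abs_of_nonpos (by linarith)]; ring
  · right; rw [abs_of_nonpos (by linarith)]; ring
  · left; rw [abs_of_nonneg (by linarith)]; linarith
  · right; rw [abs_of_nonneg (by linarith)]; ring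
  · right; rw [abs_of_nonneg (by linarith)]; ring

theorem bridgePt_bound {x : Arm} {y : ℝ} (hy : y ∈ Ioo (-1 : ℝ) 1) :
    ¬ (1 ≤ |(bridgePt x.eps y).im| ∨ |(bridgePt x.eps y).re| = 1 - (bridgePt x.eps y).im) := by
  rw [bridgePt_im, bridgePt_re, abs_mul, show |x.eps| = 1 by cases x <;> simp [Arm.eps], one_mul]
  obtain ⟨h1, h2⟩ := hy
  rintro (h | h)
  · exact absurd (abs_lt.2 ⟨h1, h2⟩) h.not_gt
  · have : |y * (y ^ 2 - 1) / 2| < 1 - y := by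
      rw [abs_lt]
      constructor <;> nlinarith [mul_pos (sub_pos.2 h2) (show 0 < 1 + y by linarith)]
    linarith

theorem SpectralNetwork.trace_rev_subset (s : St) : N.trace s ⊆ N.trace (N.rev s) := by
  rintro z (⟨t, ht, rfl⟩ | ⟨t, ht, rfl⟩)
  · refine Or.inl ⟨1 - t, one_sub_mem ht, ?_⟩
    simp only
    rw [N.src_rev, sub_sub_cancel, (N.street s).same_base t ht]
  · refine Or.inr ⟨1 - t, ?_, ?_⟩
    · rcases ht with ⟨h0, h1⟩ | ⟨hc, h0, h1⟩ | ⟨hc, h0, h1⟩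
      · exact Or.inl ⟨by linarith, by linarith⟩
      · exact Or.inr (Or.inr ⟨by rwa [N.rev_rev], by linarith, by linarith⟩)
      · exact Or.inr (Or.inl ⟨hc, by linarith, by linarith⟩)
    · simp only
      rw [strand_rev]
      exact (N.strand_spec ht).1.symm

theorem IsHorse.mem_fig {φ : OpenPartialHomeomorph C ℂ} {J : HorseJoint → Jt}
    {L : HorseStreet → List St} (h : IsHorse N φ J L)
    (hs : N.On (L p) s) {z : C} (hz : z ∈ N.trace s) (hU : z ∈ φ.source) : φ z ∈ p.fig := by
  rw [← h.fig p]
  rcases hs with hs | hs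
  exacts [⟨z, ⟨⟨s, hs, hz⟩, hU⟩, rfl⟩, ⟨z, ⟨⟨_, hs, N.trace_rev_subset s hz⟩, hU⟩, rfl⟩]

namespace Herd.LoopData

variable {m : ℕ} {H : Herd N m} (D : H.LoopData)

/-- The common points of the two loops of a herd: the pieces of the loops through `b` and through
`a` on which they lie, with the parameters. -/
inductive Meet : Piece St → ℝ → Piece St → ℝ → Prop
  | bot {k : ℕ} {r s : St} (hk : k ∈ Icc 1 m) (hlt : k < m)
      (hr : N.leg (H.joint k .bot) 2 1 = some r) (hs : N.leg (H.joint k .bot) 0 1 = some s) :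
      Meet (.run r 0) 0 (.run s 0) 0
  | last {r : St} (hr : N.leg (H.joint m .bot) 2 1 = some r) : Meet (.run r 0) 0 (.bridge .a) 0
  | top {s : St} (hs : N.leg (H.joint m .top) 0 1 = some s) : Meet (.bridge .b') 0 (.run s 0) 0
  | mid {t t' : ℝ} (ht : t ∈ Ioo (0 : ℝ) 1) (ht' : t' ∈ Ioo (0 : ℝ) 1)
      (h : (D.bridge .b').y t = 0) (h' : (D.bridge .a).y t' = 0) :
      Meet (.bridge .b') t (.bridge .a) t'

theorem curve_bridge_zero (x : Arm) :
    D.curve (.bridge x) 0 = N.sheet (H.joint m x.tip) x.j := by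
  rw [curve, Bridge.curve, (D.bridge x).pt_zero.1, D.sheets.joint]

variable [T2Space S] [T2Space C] (hm : 1 ≤ m) (hπ : IsSimpleBranchedCover π K) (hN : N.Lawful)

include hm hπ in
theorem bridge_meet_bridge {x x' : Arm} {t t' : ℝ} (ht : t ∈ Ico (0 : ℝ) 1)
    (ht' : t' ∈ Ico (0 : ℝ) 1) (e : D.curve (.bridge x) t = D.curve (.bridge x') t') :
    (x = x' ∧ t = t') ∨ D.Meet (.bridge x) t (.bridge x') t' ∨
      D.Meet (.bridge x') t' (.bridge x) t := by
  have h := H.horse m ⟨hm, le_rfl⟩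
  obtain ⟨hw, hj⟩ := D.sheets.σ_inj h hπ e
  have hy : (D.bridge x).y t = (D.bridge x').y t' := by
    simpa [bridgePt_im] using congrArg Complex.im hw
  by_cases hx : x = x'
  · subst hx
    exact Or.inl ⟨rfl, (D.bridge x).injOn ⟨ht.1, ht.2.le⟩ ⟨ht'.1, ht'.2.le⟩ hy⟩
  have hre := congrArg Complex.re hw
  rw [bridgePt_re, bridgePt_re, ← hy] at hre
  set y := (D.bridge x).y t with hydef
  have hlt : ∀ {z : Arm} {r : ℝ}, r ∈ Ico (0 : ℝ) 1 → (D.bridge z).y r = -z.sgn ∨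
      (r ∈ Ioo (0 : ℝ) 1 ∧ (D.bridge z).y r ∈ Ioo (-1 : ℝ) 1) := by
    intro z r hr
    rcases hr.1.eq_or_lt with rfl | h0
    · exact Or.inl (D.bridge z).y_zero
    · exact Or.inr ⟨⟨h0, hr.2⟩, (D.bridge z).mem_Ioo ⟨h0, hr.2⟩⟩
  have h1 := hlt (z := x) ht
  have h2 := hlt (z := x') ht'
  rw [← hy] at h2
  rw [← hydef] at h1
  have mid : x.sgn = -x'.sgn → x.eps = -x'.eps → y = 0 ∧ t ∈ Ioo (0 : ℝ) 1 ∧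
      t' ∈ Ioo (0 : ℝ) 1 := by
    intro hs he
    have hs' : x'.sgn = 1 ∨ x'.sgn = -1 := by cases x' <;> simp [Arm.sgn]
    have he' : x'.eps = 1 ∨ x'.eps = -1 := by cases x' <;> simp [Arm.eps]
    have hI : t ∈ Ioo (0 : ℝ) 1 ∧ t' ∈ Ioo (0 : ℝ) 1 ∧ y ∈ Ioo (-1 : ℝ) 1 := by
      rcases h1 with h1 | ⟨h1, hy1⟩ <;> rcases h2 with h2 | ⟨h2, hy2⟩
      · rcases hs' with h | h <;> rw [h] at hs h2 <;> rw [hs] at h1 <;> linarith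
      · rcases hs' with h | h <;> rw [h] at hs <;> rw [hs] at h1 <;> rw [h1] at hy2 <;>
          simp at hy2
      · rcases hs' with h | h <;> rw [h] at h2 <;> rw [h2] at hy1 <;> simp at hy1
      · exact ⟨h1, h2, hy1⟩
    refine ⟨?_, hI.1, hI.2.1⟩
    have hz : y * (y ^ 2 - 1) = 0 := by
      rw [he] at hre
      rcases he' with h | h <;> rw [h] at hre <;> linarith
    rcases mul_eq_zero.1 hz with h | h
    · exact h
    · nlinarith [mul_pos (sub_pos.2 hI.2.2.1) (sub_pos.2 hI.2.2.2)]
  right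
  cases x <;> cases x' <;> simp only [Arm.j, reduceCtorEq, not_true_eq_false] at hj hx <;>
    first
    | exact absurd hj (by decide)
    | skip
  · obtain ⟨h0, ha, hb⟩ := mid (by simp [Arm.sgn]) (by simp [Arm.eps])
    exact Or.inr (Meet.mid hb ha (hy ▸ h0) h0)
  · obtain ⟨h0, ha, hb⟩ := mid (by simp [Arm.sgn]) (by simp [Arm.eps])
    exact Or.inl (Meet.mid ha hb h0 (hy ▸ h0))

include hm hπ hN

theorem end_cases (hs : H.OnArm s) (hc : N.cap s = none) :
    ∃ v i j, N.leg v i j = some s := by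
  obtain ⟨x, hs | hs⟩ := hs
  · rcases H.arm_pred hm hs with ⟨h, -⟩ | h
    · rw [hc] at h
      cases h
    · exact h
  · have := H.arm_succ hm hs
    rwa [N.rev_rev] at this

theorem bridge_meet_run {x : Arm} {n : ℤ} {t t' : ℝ} (hs : H.OnArm s)
    (hn : N.IsRun s n) (ht : t ∈ Ico (0 : ℝ) 1) (ht' : t' ∈ Ico (0 : ℝ) 1)
    (e : D.curve (.bridge x) t = N.run s n t') :
    D.Meet (.bridge x) t (.run s n) t' ∨ D.Meet (.run s n) t' (.bridge x) t := by
  have hl : m ∈ Icc 1 m := ⟨hm, le_rfl⟩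
  have h := H.horse m hl
  rcases ht.1.eq_or_lt with rfl | h0
  · rw [curve_bridge_zero] at e
    obtain ⟨rfl, rfl, i, hleg⟩ := run_eq_sheet hN (end_cases hm hπ hN hs) hn ht' e.symm
    have := hs.leg H hm hN.sixWayStreets hπ hl hleg
    cases x <;> simp [Arm.tip, Arm.j] at this hleg
    · subst this
      exact Or.inr (Meet.last hleg)
    · subst this
      exact Or.inl (Meet.top hleg)
  · exfalso
    have hz : π (N.run s n t') ∈ (H.chart m).source := e ▸ D.sheets.mem_source h _ _
    have htr := run_mem_trace hn ht' (h.source_unbranched hz)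
    have htw := hs.twoWay H hm hN.sixWayStreets
    obtain ⟨p, hp⟩ := h.twoWay_horse s htw ⟨_, htr, hz⟩
    have hc : p ≠ .c := by
      rintro rfl
      exact hs.not_on_c H hm hN.sixWayStreets hπ hl hp
    have hfig := h.mem_fig hp htr hz
    rw [← e, curve, Bridge.curve, D.sheets.coord h] at hfig
    exact bridgePt_bound ((D.bridge x).mem_Ioo ⟨h0, ht.2⟩)
      (HorseStreet.fig_bound hc (H.active_of_twoWay hN.sixWayStreets hπ hl hp htw) hfig)

theorem run_meet_run (hs : H.OnArm s) (hs' : H.OnArm s') {n n' : ℤ}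
    (hn : N.IsRun s n) (hn' : N.IsRun s' n') {t t' : ℝ} (ht : t ∈ Ico (0 : ℝ) 1)
    (ht' : t' ∈ Ico (0 : ℝ) 1) (e : N.run s n t = N.run s' n' t') :
    (Piece.run s n = .run s' n' ∧ t = t') ∨ D.Meet (.run s n) t (.run s' n') t' ∨
      D.Meet (.run s' n') t' (.run s n) t := by
  have hS := hN.sixWayStreets
  rcases run_eq hN (hs.twoWay H hm hS) (hs'.twoWay H hm hS) (end_cases hm hπ hN hs)
    (end_cases hm hπ hN hs') hn hn' ht ht' e with
    ⟨rfl, rfl, rfl⟩ | ⟨⟨rfl, rfl⟩, ⟨rfl, rfl⟩, v, i, i', j, hi, hleg, hleg'⟩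
  · exact Or.inl ⟨rfl, rfl⟩
  right
  obtain ⟨k, hk, q, rfl⟩ := H.exists_joint_of_twoWay hS hπ hleg hleg' (hs.twoWay H hm hS)
    (hs'.twoWay H hm hS) (by
      rintro (⟨h, -⟩ | ⟨h, h'⟩)
      · exact hi h.symm
      · exact leg_ne hleg h'.symm)
  have h1 := hs.leg H hm hS hπ hk hleg
  have h2 := hs'.leg H hm hS hπ hk hleg'
  have key : q = .bot ∧ k < m ∧ j = 1 ∧ (i = 2 ∧ i' = 0 ∨ i = 0 ∧ i' = 2) := by
    cases q <;> simp at h1 h2 <;> fin_cases j <;> simp at h1 h2 ⊢ <;> omega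
  obtain ⟨rfl, hlt, rfl, ⟨rfl, rfl⟩ | ⟨rfl, rfl⟩⟩ := key
  exacts [Or.inl (Meet.bot hk hlt hleg hleg'), Or.inr (Meet.bot hk hlt hleg' hleg)]

/-- The loops of a herd meet each other at the expected points, and nowhere else. -/
theorem meet {x x' : Arm} {p p' : Piece St} (hp : p ∈ D.loop x) (hp' : p' ∈ D.loop x') {t t' : ℝ}
    (ht : t ∈ Ico (0 : ℝ) 1) (ht' : t' ∈ Ico (0 : ℝ) 1) (e : D.curve p t = D.curve p' t') :
    (p = p' ∧ t = t') ∨ D.Meet p t p' t' ∨ D.Meet p' t' p t := by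
  rcases D.mem_loop hp with ⟨y, -, rfl⟩ | ⟨s, n, y, -, hs, hn, rfl⟩ <;>
  rcases D.mem_loop hp' with ⟨y', -, rfl⟩ | ⟨s', n', y', -, hs', hn', rfl⟩
  · rcases D.bridge_meet_bridge hm hπ ht ht' e with ⟨rfl, h⟩ | h
    exacts [Or.inl ⟨rfl, h⟩, Or.inr h]
  · exact Or.inr (D.bridge_meet_run hm hπ hN ⟨_, hs'⟩ hn' ht ht' e)
  · exact Or.inr (D.bridge_meet_run hm hπ hN ⟨_, hs⟩ hn ht' ht e.symm).symm
  · exact D.run_meet_run hm hπ hN ⟨_, hs⟩ ⟨_, hs'⟩ hn hn' ht ht' e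

end Herd.LoopData

section Loops

theorem Loop.homology_mem (β : Loop M) : β.homology ∈ H1 M := by
  refine ⟨arc β.curve 0 1, ?_, rfl⟩
  have hc := β.smooth.continuous
  have h : Continuous (fun r : unitInterval => β.curve (0 + r * (1 - 0))) := by fun_prop
  rw [SetLike.mem_coe, AddMonoidHom.mem_ker, arc, dif_pos h, bdry1, FreeAbelianGroup.lift_apply_of]
  have := β.periodic 0
  simp only [ContinuousMap.coe_mk, sub_zero, mul_one, zero_add] at this ⊢
  rw [Icc.coe_one, Icc.coe_zero, this, sub_self]

variable {β β' : Loop M} {T : Type*} [Fintype T] {u u' : T → ℝ} (hu : ∀ i, u i ∈ Ico (0 : ℝ) 1)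
  (hu' : ∀ i, u' i ∈ Ico (0 : ℝ) 1) (hi : Function.Injective u)
  (h : ∀ r ∈ Ico (0 : ℝ) 1, ∀ r' ∈ Ico (0 : ℝ) 1,
    β.curve r = β'.curve r' ↔ ∃ i, r = u i ∧ r' = u' i)
  (hw : ∀ i, wedge (vec (velocity β.curve (u i))) (vec (velocity β'.curve (u' i))) ≠ 0)

include hu hu' hi h hw

theorem hasIntersection_of_enum {n : ℤ} (hn : n = ∑ i, if 0 < wedge
      (vec (velocity β.curve (u i))) (vec (velocity β'.curve (u' i))) then (1 : ℤ) else -1) :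
    HasIntersection β.homology β'.homology n := by
  have hr : meetings (fun _ : Fin 1 => β) (fun _ : Fin 1 => β') =
      range fun i => (((0 : Fin 1), u i), ((0 : Fin 1), u' i)) := by
    ext ⟨⟨a, r⟩, ⟨b, r'⟩⟩
    obtain rfl := Subsingleton.elim a 0
    obtain rfl := Subsingleton.elim b 0
    simp only [meetings, mem_ofPred_eq, mem_range, Prod.mk.injEq, true_and]
    constructor
    · rintro ⟨h1, h2, e⟩
      obtain ⟨i, rfl, rfl⟩ := (h r h1 r' h2).1 e
      exact ⟨i, rfl, rfl⟩
    · rintro ⟨i, rfl, rfl⟩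
      exact ⟨hu i, hu' i, (h _ (hu i) _ (hu' i)).2 ⟨i, rfl, rfl⟩⟩
  refine ⟨1, 1, fun _ => β, fun _ => β', by simp, by simp, by rw [hr]; exact finite_range _, ?_, ?_⟩
  · rw [hr]
    rintro _ ⟨i, rfl⟩
    exact hw i
  · rw [hr, finsum_mem_range, finsum_eq_sum_of_fintype, hn]
    intro i j e
    simp only [Prod.mk.injEq, true_and] at e
    exact hi e.1

theorem isTildeLift_of_enum (hβ : InjOn β.curve (Ico 0 1)) (hβ' : InjOn β'.curve (Ico 0 1))
    {w : Tan M} (hv : vec w ≠ 0) : IsTildeLift (β.homology + β'.homology)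
      (β.framing + β'.framing + (2 + Fintype.card T) • cls (fibreLoop w)) := by
  have hr : crossings ![β, β'] = range fun i => (((0 : Fin 2), u i), ((1 : Fin 2), u' i)) := by
    ext ⟨⟨a, r⟩, ⟨b, r'⟩⟩
    simp only [crossings, mem_ofPred_eq, mem_range, Prod.mk.injEq]
    constructor
    · rintro ⟨h1, h2, hab, e⟩
      fin_cases a <;> fin_cases b <;> simp at hab e ⊢
      · exact absurd (hβ h1 h2 e) hab.ne
      · obtain ⟨i, rfl, rfl⟩ := (h r h1 r' h2).1 e
        exact ⟨i, rfl, rfl⟩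
      · exact absurd (hβ' h1 h2 e) hab.ne
    · rintro ⟨i, ⟨rfl, rfl⟩, rfl, rfl⟩
      exact ⟨hu i, hu' i, Or.inl (by simp), (h _ (hu i) _ (hu' i)).2 ⟨i, rfl, rfl⟩⟩
  have hinj : Function.Injective fun i => (((0 : Fin 2), u i), ((1 : Fin 2), u' i)) := by
    intro i j e
    simp only [Prod.mk.injEq, true_and] at e
    exact hi e.1
  refine ⟨2, ![β, β'], by rw [hr]; exact finite_range _, ?_, by simp, w, hv, ?_⟩
  · rw [hr]
    rintro _ ⟨i, rfl⟩
    exact hw i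
  · rw [hr, ← Nat.card_coe_set_eq, Nat.card_range_of_injective hinj, Nat.card_eq_fintype_card]
    simp

end Loops

namespace Herd

variable {m : ℕ} (H : Herd N m)

theorem mem_block_of_leg_bot (hk : k ∈ Icc 1 m) {r : St}
    (h : N.leg (H.joint k .bot) 2 1 = some r) : N.rev r ∈ H.block .b (2 * (k - 1)) := by
  rw [(H.horse k hk).bot_b.2, Option.map_eq_some_iff] at h
  obtain ⟨r, hr, rfl⟩ := h
  rw [N.rev_rev, block_even, Arm.level, Nat.sub_add_cancel hk.1]
  exact List.mem_of_getLast? hr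

theorem mem_arm_of_leg_bot (hk : k ∈ Icc 1 m) {r : St}
    (h : N.leg (H.joint k .bot) 2 1 = some r) : N.rev r ∈ H.arm .b :=
  H.mem_arm.2 ⟨_, by have := hk.1; have := hk.2; simp only [Arm.num]; omega,
    H.mem_block_of_leg_bot hk h⟩

theorem mem_arm_of_leg_bot_up (hk : k ∈ Icc 1 m) (hlt : k < m)
    (h : N.leg (H.joint k .bot) 0 1 = some s) : s ∈ H.arm .a := by
  rw [(H.horse k hk).bot_a.1] at h
  refine H.mem_arm.2 ⟨2 * (k - 1) + 1, by simp only [Arm.num]; have := hk.1; omega, ?_⟩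
  rw [block_odd, Arm.level, Nat.sub_add_cancel hk.1]
  exact List.mem_of_head? h

theorem mem_arm_of_leg_top (hm : 1 ≤ m) (h : N.leg (H.joint m .top) 0 1 = some s) :
    N.rev s ∈ H.arm .a' := by
  rw [(H.horse m ⟨hm, le_rfl⟩).top_a.1] at h
  refine H.mem_arm.2 ⟨0, by omega, ?_⟩
  rw [show 0 = 2 * 0 from rfl, block_even, Arm.level, Nat.sub_zero]
  exact mem_revList.2 (by rw [N.rev_rev]; exact List.mem_of_head? h)

namespace LoopData

variable {H} (D : H.LoopData)

theorem Meet.mem (hm : 1 ≤ m) {p p' : Piece St} {t t' : ℝ} (h : D.Meet p t p' t') :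
    p ∈ D.loop .b ∧ p' ∈ D.loop .a := by
  have l : ∀ {x p}, p ∈ D.half x → p ∈ D.loop x := List.mem_append_left _
  have r : ∀ {x p}, p ∈ D.half (Arm.op x) → p ∈ D.loop x := List.mem_append_right _
  cases h with
  | bot hk hlt hr hs => exact ⟨r (D.run_rev_mem (H.mem_arm_of_leg_bot hk hr)),
      l (D.run_mem (H.mem_arm_of_leg_bot_up hk hlt hs))⟩
  | last hr => exact ⟨r (D.run_rev_mem (H.mem_arm_of_leg_bot ⟨hm, le_rfl⟩ hr)), l (D.bridge_mem _)⟩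
  | top hs => exact ⟨r (D.bridge_mem _), l (D.run_rev_mem (H.mem_arm_of_leg_top hm hs))⟩
  | mid => exact ⟨r (D.bridge_mem _), l (D.bridge_mem _)⟩

theorem Meet.mem_Ico {p p' : Piece St} {t t' : ℝ} (h : D.Meet p t p' t') :
    t ∈ Ico (0 : ℝ) 1 ∧ t' ∈ Ico (0 : ℝ) 1 := by
  cases h with
  | mid ht ht' => exact ⟨⟨ht.1.le, ht.2⟩, ⟨ht'.1.le, ht'.2⟩⟩
  | _ => norm_num

theorem Meet.curve_eq {p p' : Piece St} {t t' : ℝ} (h : D.Meet p t p' t') :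
    D.curve p t = D.curve p' t' := by
  cases h with
  | bot hk hlt hr hs => simp only [curve, run_zero, tgt_zero hr, tgt_zero hs]
  | last hr => rw [curve_bridge_zero, curve, run_zero, tgt_zero hr]; rfl
  | top hs => rw [curve_bridge_zero, curve, run_zero, tgt_zero hs]; rfl
  | mid ht ht' h h' =>
    rw [curve, curve, Bridge.curve, Bridge.curve, h, h']
    simp [bridgePt, Arm.j]

variable [T2Space S] [T2Space C] (hm : 1 ≤ m) (hπ : IsSimpleBranchedCover π K) (hN : N.Lawful)

include hπ

theorem wedge_legs_pos (hk : k ∈ Icc 1 m) (q : HorseJoint) :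
    0 < wedge (liftVec π (N.sheet (H.joint k q) 1) (N.dir (H.joint k q) 2 1))
      (liftVec π (N.sheet (H.joint k q) 1) (N.dir (H.joint k q) 0 1)) := by
  have h := H.horse k hk
  have hq : π (N.sheet (H.joint k q) 1) ∈ (H.chart k).source := by
    rw [N.sheet_base]
    exact h.joint_mem q
  rw [← Bridge.liftCoord_dirCoord h, ← Bridge.liftCoord_dirCoord h, wedge_map, N.dirCoord_swap _ _ 1 2,
    wedge_neg_left, wedge_swap, neg_neg]
  exact mul_pos (liftCoord_det_pos hπ h.chart hq (sheet_unbranched N _ _))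
    (N.dirCoord_cyclic h.chart (h.joint_mem q)).2.2

include hm

theorem Meet.wedge {p p' : Piece St} {t t' : ℝ} (hM : D.Meet p t p' t') :
    (t = 0 → 0 < wedge (vec (velocity (D.curve p) t)) (vec (velocity (D.curve p') t'))) ∧
    (t ≠ 0 → wedge (vec (velocity (D.curve p) t)) (vec (velocity (D.curve p') t')) < 0) := by
  have hl : m ∈ Icc 1 m := ⟨hm, le_rfl⟩
  have h := H.horse m hl
  cases hM with
  | bot hk hlt hr hs =>
    simp only [curve, run_zero, N.leg_tgt _ _ _ _ hr, N.leg_tgt _ _ _ _ hs, vec_tan]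
    exact ⟨fun _ => wedge_legs_pos hπ hk _, fun h => absurd rfl h⟩
  | last hr =>
    simp only [curve, run_zero, N.leg_tgt _ _ _ _ hr, Bridge.velocity_zero h hπ, vec_tan]
    exact ⟨fun _ => wedge_legs_pos hπ hl _, fun h => absurd rfl h⟩
  | top hs =>
    simp only [curve, run_zero, N.leg_tgt _ _ _ _ hs, Bridge.velocity_zero h hπ, vec_tan]
    exact ⟨fun _ => wedge_legs_pos hπ hl _, fun h => absurd rfl h⟩
  | mid ht ht' e e' =>
    refine ⟨fun h0 => absurd h0 ht.1.ne', fun _ => ?_⟩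
    have hc := (Meet.mid ht ht' e e' : D.Meet _ _ _ _).curve_eq
    simp only [curve] at hc ⊢
    rw [((D.bridge .b').velocity_curve h hπ D.sheets t).2,
      ((D.bridge .a).velocity_curve h hπ D.sheets t').2, hc, vec_tan, vec_tan, wedge_map, e, e']
    have hz := D.sheets.mem_source h (Arm.j .a) (bridgePt (Arm.eps .a) ((D.bridge .a).y t'))
    refine mul_neg_of_pos_of_neg (liftCoord_det_pos hπ h.chart hz (h.source_unbranched hz)) ?_
    have h1 := (D.bridge .b').pos t ⟨ht.1.le, ht.2.le⟩
    have h2 := (D.bridge .a).pos t' ⟨ht'.1.le, ht'.2.le⟩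
    have : HerdNetwork.wedge (bridgeDir (Arm.eps .b') 0) (bridgeDir (Arm.eps .a) 0) = 1 := by
      have hre : ∀ ε, (bridgeDir ε 0).re = -ε / 2 := fun ε => by
        simp only [bridgeDir, Complex.add_re, Complex.ofReal_re, Complex.I_re]
        ring
      rw [HerdNetwork.wedge, Complex.mul_im, Complex.conj_re, Complex.conj_im, bridgeDir_im,
        bridgeDir_im, hre, hre]
      norm_num [Arm.eps]
    rw [← Complex.real_smul, ← Complex.real_smul, wedge_smul_left, wedge_smul_right, this]
    simp only [Arm.sgn] at h1 h2
    nlinarith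

include hN

theorem exists_enum : ∃ e : Option (Option (Fin m)) → (Piece St × ℝ) × (Piece St × ℝ),
    Function.Injective (fun i => (e i).1) ∧
    (∀ i, D.Meet (e i).1.1 (e i).1.2 (e i).2.1 (e i).2.2) ∧
    (∀ p t p' t', D.Meet p t p' t' → ∃ i, e i = ((p, t), (p', t'))) ∧
    (e none).1.2 ≠ 0 ∧ ∀ i, (e (some i)).1.2 = 0 := by
  have hl : m ∈ Icc 1 m := ⟨hm, le_rfl⟩
  have hr : ∀ k, ∃ r, k ∈ Icc 1 m → N.leg (H.joint k .bot) 2 1 = some r := by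
    intro k
    by_cases hk : k ∈ Icc 1 m
    · obtain ⟨r, hr⟩ := (H.horse k hk).exists_last .b1
      exact ⟨N.rev r, fun _ => by rw [(H.horse k hk).bot_b.2, hr]; rfl⟩
    · exact ⟨D.first .a, fun h => absurd h hk⟩
  have hu : ∀ k, ∃ s, k ∈ Icc 1 m → N.leg (H.joint k .bot) 0 1 = some s := by
    intro k
    by_cases hk : k ∈ Icc 1 m
    · obtain ⟨s, hs⟩ := (H.horse k hk).exists_head .a2
      exact ⟨s, fun _ => by rw [(H.horse k hk).bot_a.1, hs]⟩
    · exact ⟨D.first .a, fun h => absurd h hk⟩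
  choose r hr using hr
  choose u hu using hu
  obtain ⟨s, hs⟩ := (H.horse m hl).exists_head .a1'
  rw [← (H.horse m hl).top_a.1] at hs
  obtain ⟨t, ht, ht0⟩ := (D.bridge .b').exists_zero
  obtain ⟨t', ht', ht0'⟩ := (D.bridge .a).exists_zero
  have hk : ∀ k : Fin m, (k : ℕ) + 1 ∈ Icc 1 m := fun k => ⟨by omega, k.2⟩
  refine ⟨fun i => i.elim ((.bridge .b', t), (.bridge .a, t')) fun i => i.elim
    ((.bridge .b', 0), (.run s 0, 0)) fun k => ((.run (r (k + 1)) 0, 0),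
      if (k : ℕ) + 1 < m then (.run (u (k + 1)) 0, 0) else (.bridge .a, 0)),
    ?_, ?_, ?_, ht.1.ne', ?_⟩
  · rintro (_ | _ | k) (_ | _ | k') e <;> simp [ht.1.ne, ht.1.ne'] at e ⊢
    have h1 := H.mem_block_of_leg_bot (hk k) (hr _ (hk k))
    have h2 := H.mem_block_of_leg_bot (hk k') (hr _ (hk k'))
    rw [← e] at h2
    have := H.block_eq_of_mem hm (by omega) (by omega) h1 h2
    exact Fin.ext (by omega)
  · rintro (_ | _ | k)
    · exact Meet.mid ht ht' ht0 ht0'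
    · exact Meet.top hs
    · simp only [Option.elim]
      split_ifs with hlt
      · exact Meet.bot (hk k) hlt (hr _ (hk k)) (hu _ (hk k))
      · refine Meet.last ?_
        have e : (k : ℕ) + 1 = m := by omega
        have := hr _ (hk k)
        rw [e] at this ⊢
        exact this
  · intro p t₁ p' t₁' hM
    cases hM with
    | @bot k r' s' hk' hlt hr' hs' =>
      refine ⟨some (some ⟨k - 1, by have := hk'.1; omega⟩), ?_⟩
      have e1 := (hr k hk').symm.trans hr'
      have e2 := (hu k hk').symm.trans hs'
      simp only [Option.some.injEq] at e1 e2
      simp only [Option.elim, Nat.sub_add_cancel hk'.1, if_pos hlt, e1, e2]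
    | last hr' =>
      refine ⟨some (some ⟨m - 1, by omega⟩), ?_⟩
      have e1 := (hr m hl).symm.trans hr'
      simp only [Option.some.injEq] at e1
      simp only [Option.elim, Nat.sub_add_cancel hm, lt_irrefl, if_false, e1]
    | top hs' =>
      refine ⟨some none, ?_⟩
      have e1 := hs.symm.trans hs'
      simp only [Option.some.injEq] at e1
      simp only [Option.elim, e1]
    | mid h1 h2 h3 h4 =>
      refine ⟨none, ?_⟩
      have e1 := (D.bridge .b').injOn ⟨ht.1.le, ht.2.le⟩ ⟨h1.1.le, h1.2.le⟩ (ht0.trans h3.symm)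
      have e2 := (D.bridge .a).injOn ⟨ht'.1.le, ht'.2.le⟩ ⟨h2.1.le, h2.2.le⟩ (ht0'.trans h4.symm)
      simp only [Option.elim, e1, e2]
  · rintro (_ | k) <;> rfl

omit hπ hN in
/-- The two loops of a herd have no pieces in common. -/
theorem disjoint_loops (hS : N.SixWayStreets) (hπ : IsSimpleBranchedCover π K) {p : Piece St}
    (hp : p ∈ D.loop .b) : p ∉ D.loop .a := by
  have hxy : ∀ {y y' : Arm}, y = .b ∨ y = Arm.op .b → y' = .a ∨ y' = Arm.op .a → y ≠ y' := by
    rintro _ _ (rfl | rfl) (rfl | rfl) <;> simp [Arm.op]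
  intro hp'
  rcases D.mem_loop hp with ⟨y, hy, rfl⟩ | ⟨s, n, y, hy, hs, hn, rfl⟩ <;>
  rcases D.mem_loop hp' with ⟨y', hy', e⟩ | ⟨s', n', y', hy', hs', hn', e⟩ <;> cases e
  · exact hxy hy hy' rfl
  · exact hxy hy hy' (eq_of_on hm hS hπ hs hs')

end LoopData

end Herd

theorem SpectralNetwork.T_eq_add (s : St) : N.T s = cls (dirArc (velocity (N.street s).tgt) 0 1) +
    cls (dirArc (velocity (N.street (N.rev s)).tgt) 0 1) := by
  have hc := (N.street s).continuous_opp_velocity_src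
  have hr := (N.street s).opp_src_regular
  have h1 : velocity (N.street (N.rev s)).tgt =
      fun t => (fun r => opp (velocity (N.street s).src r)) (1 - t) :=
    funext fun t => N.velocity_tgt_rev s t
  have h2 := cls_dirArc_symm (f := fun r => opp (velocity (N.street s).src r)) (a := 0) (b := 1)
    hc.continuousOn (by rwa [uIcc_of_le zero_le_one])
  have h3 := cls_dirArc_comp (h := fun t => 1 - t) (a := 0) (b := 1) ordConnected_Icc
    hc.continuousOn hr (by fun_prop)
    (by rw [uIcc_of_le zero_le_one]; exact fun t ht => one_sub_mem ht)
  rw [sub_self, sub_zero, h2] at h3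
  rw [h1, h3, T, Street.transport, sub_eq_add_neg]

theorem Cap.simpleton_eq (σ : Cap π) : σ.simpleton =
    cls (dirArc (velocity fun t => σ.path (t - 1)) 0 1) + cls (dirArc (velocity σ.path) 0 1) := by
  have hc : ContinuousOn (velocity σ.path) (Icc (-1) 1) :=
    continuousOn_velocity fun t _ => σ.smooth t
  have h1 : (velocity fun t => σ.path (t - 1)) = fun t => velocity σ.path (t - 1) :=
    funext fun t => velocity_translate σ.smooth 1 t
  rw [h1, cls_dirArc_comp ordConnected_Icc hc σ.regular (by fun_prop), sub_self, zero_sub,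
    cls_dirArc_add ordConnected_Icc hc σ.regular (by norm_num) (by norm_num) (by norm_num),
    simpleton]
  rw [uIcc_of_le zero_le_one]
  exact fun t ht => ⟨by linarith [ht.1], by linarith [ht.2]⟩

namespace Herd

variable {m : ℕ} {H : Herd N m}

theorem listT_arm (x : Arm) :
    H.ch x (x.num m m) = (H.source x.index).simpleton + N.listT (H.arm x) := by
  have : ∀ n, ∑ b ∈ Finset.range n, N.listT (H.block x b) =
      N.listT ((List.range n).flatMap (H.block x)) := by
    intro n
    induction n with
    | zero => rfl
    | succ n ih =>
      rw [Finset.sum_range_succ, ih, flatMap_range_succ, listT, listT, listT, List.map_append,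
        List.sum_append]
  rw [ch, this, arm]

namespace LoopData

variable (D : H.LoopData)

/-- The class of the framing lift of a piece. -/
def framing (p : Piece St) : ExtChain S := cls (dirArc (velocity (D.curve p)) 0 1)

theorem sum_half (x : Arm) : ((D.half x).map D.framing).sum =
    ((H.arm x).map fun s => D.framing (.run s 0)).sum + D.framing (.bridge x) +
      (((H.arm x.op).map fun s => D.framing (.run (N.rev s) 0)).sum +
        (H.source x.op.index).simpleton) := by
  have hcap := D.cap_first x.op
  have h1 : D.framing (.run (N.rev (D.first x.op)) 1) + D.framing (.run (D.first x.op) (-1)) =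
      (H.source x.op.index).simpleton := by
    rw [Cap.simpleton_eq, framing, framing, curve, curve, run_neg_one hcap,
      run_one (σ := H.source x.op.index) (by rw [N.rev_rev, hcap])]
  rw [half, revList]
  simp only [List.map_append, List.map_map, List.map_cons, List.map_nil, List.sum_append,
    List.sum_cons, List.sum_nil, List.map_reverse, List.sum_reverse, add_zero, h1]
  simp only [Function.comp_def]
  abel

theorem sum_arm (x : Arm) : ((H.arm x).map fun s => D.framing (.run s 0)).sum +
    ((H.arm x).map fun s => D.framing (.run (N.rev s) 0)).sum = N.listT (H.arm x) := by
  rw [← List.sum_map_add, listT]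
  refine congrArg List.sum (List.map_congr_left fun s _ => ?_)
  simp only [framing, curve, run_zero]
  exact (N.T_eq_add s).symm

theorem sum_loops [T2Space S] [T2Space C] (hm : 1 ≤ m) (hπ : IsSimpleBranchedCover π K) :
    ((D.loop .a).map D.framing).sum + ((D.loop .b).map D.framing).sum = Herd.z N H m := by
  have hl : m ∈ Icc 1 m := ⟨hm, le_rfl⟩
  have h := H.horse m hl
  have hb : ∀ x, D.framing (.bridge x) = _ := fun x => (D.bridge x).cls_curve h hπ D.sheets
  rw [z_eq hπ H hl D.sheets]
  have ha := listT_arm (H := H) .a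
  have hb' := listT_arm (H := H) .b
  have hc := listT_arm (H := H) .a'
  have hd := listT_arm (H := H) .b'
  simp only [Arm.num] at ha hb' hc hd
  rw [ha, hb', hc, hd, ← D.sum_arm, ← D.sum_arm, ← D.sum_arm, ← D.sum_arm]
  simp only [loop, List.map_append, List.sum_append, sum_half, hb, Arm.op, Arm.i, Arm.j, Arm.tip,
    HorseSheets.E]
  abel

end LoopData

/-- The total charge at the street `c` of a horse is the lift of a sum of two homology classes with
intersection number `m`. -/
theorem exists_classes [OrientedAtlas S] [T2Space S] [T2Space C] (H : Herd N m) (hm : 1 ≤ m)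
    (hπ : IsSimpleBranchedCover π K) (hN : N.Lawful) :
    ∃ γ γ' : H1 S, HasIntersection (γ : ChainMod S) (γ' : ChainMod S) (m : ℤ) ∧
      ∃ g : ExtChain S, IsTildeLift ((γ + γ' : H1 S) : ChainMod S) g ∧
        (-1) ^ m * X Z g = X Z (Herd.z N H m) := by
  obtain ⟨D⟩ := H.nonempty_loopData hπ hm
  have h := H.horse m ⟨hm, le_rfl⟩
  have hS := hN.sixWayStreets
  have hf : ∀ p, ContMDiff 𝓡 𝓒 1 (D.curve p) := by
    rintro (⟨s, n⟩ | x)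
    exacts [contMDiff_run s n, (D.bridge x).contMDiff_curve h hπ D.sheets]
  have hreg : ∀ x, ∀ p ∈ D.loop x, ∀ t ∈ 𝕀, vec (velocity (D.curve p) t) ≠ 0 := by
    intro x p hp t ht
    rcases D.mem_loop hp with ⟨y, -, rfl⟩ | ⟨s, n, y, -, -, hn, rfl⟩
    exacts [(D.bridge y).regular h hπ D.sheets ht, run_regular hn ht]
  have hne : ∀ x, D.loop x ≠ [] := fun x => by
    obtain ⟨l, hl⟩ := D.loop_head hm x
    simp [hl]
  have hloop := fun x => exists_loop hf (hne x) (D.loop_nodup hm hS hπ x) (hreg x)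
    (D.loop_chain hm h hπ x (hne x))
  choose β θ hθ hsurj hinj hfr using hloop
  have hself : ∀ x, (x = .a ∨ x = .b) → InjOn (β x).curve (Ico 0 1) := by
    intro x hx r hr r' hr' e
    obtain ⟨p, hp, t, ht, rfl⟩ := hsurj x r hr
    obtain ⟨p', hp', t', ht', rfl⟩ := hsurj x r' hr'
    rw [(hθ x p hp t ht).2.1, (hθ x p' hp' t' ht').2.1] at e
    have hdis : ∀ {q q' : Piece St}, q ∈ D.loop x → q' ∈ D.loop x → q ∈ D.loop .b →
        q' ∉ D.loop .a := by
      rintro q q' hq hq' hb ha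
      rcases hx with rfl | rfl
      exacts [D.disjoint_loops hm hS hπ hb hq, D.disjoint_loops hm hS hπ hq' ha]
    rcases D.meet hm hπ hN hp hp' ht ht' e with ⟨rfl, rfl⟩ | hM | hM
    · rfl
    · exact absurd (hM.mem D hm).2 (hdis hp hp' (hM.mem D hm).1)
    · exact absurd (hM.mem D hm).2 (hdis hp' hp (hM.mem D hm).1)
  obtain ⟨e, he, hM, hex, h0, h1⟩ := D.exists_enum hm hπ hN
  have hI := fun i => (hM i).mem_Ico
  have hmem := fun i => (hM i).mem D hm
  set u : Option (Option (Fin m)) → ℝ := fun i => θ .b (e i).1.1 (e i).1.2 with hu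
  set u' : Option (Option (Fin m)) → ℝ := fun i => θ .a (e i).2.1 (e i).2.2 with hu'
  have fb := fun i => hθ .b _ (hmem i).1 _ (hI i).1
  have fa := fun i => hθ .a _ (hmem i).2 _ (hI i).2
  have hui : Function.Injective u := by
    intro i j hij
    obtain ⟨h2, h3⟩ := hinj .b _ (hmem i).1 _ (hmem j).1 _ (hI i).1 _ (hI j).1 hij
    exact he (Prod.ext h2 h3)
  have hiff : ∀ r ∈ Ico (0 : ℝ) 1, ∀ r' ∈ Ico (0 : ℝ) 1,
      (β .b).curve r = (β .a).curve r' ↔ ∃ i, r = u i ∧ r' = u' i := by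
    intro r hr r' hr'
    constructor
    · intro E
      obtain ⟨p, hp, t, ht, rfl⟩ := hsurj .b r hr
      obtain ⟨p', hp', t', ht', rfl⟩ := hsurj .a r' hr'
      rw [(hθ .b p hp t ht).2.1, (hθ .a p' hp' t' ht').2.1] at E
      rcases D.meet hm hπ hN hp hp' ht ht' E with ⟨rfl, rfl⟩ | hM' | hM'
      · exact absurd hp' (D.disjoint_loops hm hS hπ hp)
      · obtain ⟨i, hi⟩ := hex _ _ _ _ hM'
        exact ⟨i, by simp only [hu, hi], by simp only [hu', hi]⟩
      · exact absurd (hM'.mem D hm).2 (D.disjoint_loops hm hS hπ hp)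
    · rintro ⟨i, rfl, rfl⟩
      rw [(fb i).2.1, (fa i).2.1]
      exact (hM i).curve_eq
  have hwedge : ∀ i, ∃ c : ℝ, 0 < c ∧
      wedge (vec (velocity (β .b).curve (u i))) (vec (velocity (β .a).curve (u' i))) =
        c * wedge (vec (velocity (D.curve (e i).1.1) (e i).1.2))
          (vec (velocity (D.curve (e i).2.1) (e i).2.2)) := by
    intro i
    obtain ⟨-, -, c, hc, h2⟩ := fb i
    obtain ⟨-, -, d, hd, h3⟩ := fa i
    exact ⟨c * d, mul_pos hc hd, by rw [h2, h3, wedge_smul_left, wedge_smul_right, mul_assoc]⟩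
  have hpos : ∀ i, 0 < wedge (vec (velocity (β .b).curve (u (some i))))
      (vec (velocity (β .a).curve (u' (some i)))) := by
    intro i
    obtain ⟨c, hc, h2⟩ := hwedge (some i)
    rw [h2]
    exact mul_pos hc (((hM (some i)).wedge D hm hπ).1 (h1 i))
  have hneg : wedge (vec (velocity (β .b).curve (u none)))
      (vec (velocity (β .a).curve (u' none))) < 0 := by
    obtain ⟨c, hc, h2⟩ := hwedge none
    rw [h2]
    exact mul_neg_of_pos_of_neg hc (((hM none).wedge D hm hπ).2 h0)
  have hw : ∀ i, wedge (vec (velocity (β .b).curve (u i)))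
      (vec (velocity (β .a).curve (u' i))) ≠ 0 := by
    rintro (_ | i)
    exacts [hneg.ne, (hpos i).ne']
  have hreg' := (β .b).regular 0
  refine ⟨⟨_, (β .b).homology_mem⟩, ⟨_, (β .a).homology_mem⟩,
    hasIntersection_of_enum (fun i => (fb i).1) (fun i => (fa i).1) hui hiff hw ?_, _,
    isTildeLift_of_enum (fun i => (fb i).1) (fun i => (fa i).1) hui hiff hw
      (hself .b (Or.inr rfl)) (hself .a (Or.inl rfl)) hreg', ?_⟩
  · rw [Fintype.sum_option, if_neg hneg.not_gt, Finset.sum_congr rfl fun i _ => if_pos (hpos i)]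
    simp
  · have hz : (β .b).framing + (β .a).framing = Herd.z N H m := by
      rw [hfr, hfr, add_comm]
      exact D.sum_loops hm hπ
    rw [X_add, X_nsmul_fibre Z hreg', hz]
    have hcard : 2 + Fintype.card (Option (Option (Fin m))) = m + 2 * 2 := by
      simp
      omega
    rw [hcard, pow_add, pow_mul]
    have key : ∀ (R : Type _) [CommRing R], (-1 : R) ^ m * (-1) ^ m = 1 := fun R _ => by
      rw [← mul_pow]
      norm_num
    linear_combination (X Z (Herd.z N H m)) * key (Series S)

end Herd

theorem SpectralNetwork.factor_mem (s : St) : SeriesIn Z (extH1 S) (N.factor s) := by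
  refine (seriesIn_one (extH1 S).zero_mem).add
    ((N.gen_mem s 0 zero_mem_I).mul (N.gen_mem (N.rev s) 1 one_mem_I) fun a ha b hb => ?_)
  have h1 := N.velocity_src_rev s 1
  have h2 := N.velocity_tgt_rev s 1
  rw [sub_self] at h1 h2
  rw [Street.solitonCharges, h1, h2, opp_opp] at hb
  exact charges_add_mem_extH1 ha hb

theorem Herd.exists_on {m : ℕ} (H : Herd N m) (hs : N.TwoWay s) :
    ∃ l ∈ Icc 1 m, ∃ p, N.On (H.street l p) s := by
  have hmem := H.cover s hs (N.mem_trace zero_mem_I)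
  simp only [mem_iUnion] at hmem
  obtain ⟨l, hl, hv⟩ := hmem
  obtain ⟨p, hp⟩ := (H.horse l hl).twoWay_horse s hs ⟨_, N.mem_trace zero_mem_I, hv⟩
  exact ⟨l, hl, p, hp⟩

end HerdNetwork

end

open HerdNetwork in
theorem proposition3p1 {S C : Type*}
    [TopologicalSpace S] [ChartedSpace ℂ S] [IsManifold 𝓘(ℝ, ℂ) ∞ S] [OrientedAtlas S]
    [T2Space S] [ConnectedSpace S]
    [TopologicalSpace C] [ChartedSpace ℂ C] [IsManifold 𝓘(ℝ, ℂ) ∞ C] [OrientedAtlas C]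
    [T2Space C]
    (π : S → C) (K : ℕ) (hπ : IsSimpleBranchedCover π K)
    (Z : ExtChain S →+ ℝ) {St Jt : Type*}
    (N : SpectralNetwork π Z St Jt) (hN : N.Lawful)
    (m : ℕ) (hm : 1 ≤ m) (H : Herd N m) :
    ∃ P : Series S, SeriesIn Z (extH1 S) P ∧
      (∃ γ γ' : H1 S, HasIntersection (γ : ChainMod S) (γ' : ChainMod S) (m : ℤ) ∧
        ∃ g : ExtChain S, IsTildeLift ((γ + γ' : H1 S) : ChainMod S) g ∧
          P = 1 + ((-1) ^ m * X Z g) * P ^ ((m - 1) ^ 2)) ∧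
      (∀ l ∈ Icc 1 m, ∀ p : HorseStreet, ∀ s ∈ H.street l p, ∀ t ∈ Icc (0 : ℝ) 1,
        N.Q s t = P ^ p.exponent m l) ∧
      (∀ s, N.TwoWay s → ∃ n : ℕ, ∀ t ∈ Icc (0 : ℝ) 1, N.Q s t = P ^ n) := by

  obtain ⟨hpow, hq⟩ := H.q_eq_pow hπ hN.sixWay hN.sixWayStreets hN.branchRule hm (H.z_eq_last hπ)
  have hfac : ∀ l ∈ Icc 1 m, ∀ p, ∀ s ∈ H.street l p, N.factor s = H.q m .c ^ p.exponent m l :=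
    fun l hl p s hs => by
      rw [(H.q_spec hπ hN.sixWay hN.sixWayStreets hl p).1 s hs, hq l hl p]
  refine ⟨H.q m .c, ?_, ?_, fun l hl p s hs t ht => ?_, fun s hs => ?_⟩
  · obtain ⟨s, hs⟩ := (H.horse m ⟨hm, le_rfl⟩).exists_head .c
    rw [← (H.q_spec hπ hN.sixWay hN.sixWayStreets ⟨hm, le_rfl⟩ .c).1 s (List.mem_of_head? hs)]
    exact N.factor_mem s
  · obtain ⟨γ, γ', hI, g, hg, hX⟩ := H.exists_classes hm hπ hN
    exact ⟨γ, γ', hI, g, hg, by rw [hX]; exact hpow⟩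
  · rw [N.Q_eq_factor s ht, hfac l hl p s hs]
  · obtain ⟨l, hl, p, hp⟩ := H.exists_on hs
    refine ⟨p.exponent m l, fun t ht => ?_⟩
    rw [N.Q_eq_factor s ht]
    rcases hp with hp | hp
    · exact hfac l hl p s hp
    · rw [← N.factor_rev, hfac l hl p _ hp]
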